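/- Let $\mathcal H$ be a separable complex Hilbert space, $a\in\mathbb R$, and let $V:(a,\infty)\to\mathcal B(\mathcal H)$ be weakly measurable with $V(x)=V(x)^*$ for a.e. $x$ and $\|V(\cdot)\|_{\mathcal B(\mathcal H)}\in L^1((a,c);dx)$ for all $c>a$ (so that $a$ is a regular endpoint). Put $\tau u=-u''+Vu$ and let $\mathcal D_{\max}$ be the set of $u\in W^{2,1}_{\rm loc}((a,\infty);dx;\mathcal H)$ with $u,\tau u\in L^2((a,\infty);dx;\mathcal H)$. Assume that $\tau$ is of limit-point type at $\infty$, i.e., $\lim_{x\to\infty}[(u(x),v'(x))_{\mathcal H}-(u'(x),v(x))_{\mathcal H}]=0$ for all $u,v\in\mathcal D_{\max}$. Let $\alpha=\alpha^*\in\mathcal B(\mathcal H)$ and let $H_{+,\alpha}$ be the operator $u\mapsto\tau u$ in $L^2((a,\infty);dx;\mathcal H)$ with domain $\{u\in\mathcal D_{\max}\mid \sin(\alpha)u'(a)+\cos(\alpha)u(a)=0\}$. For $z\in\mathbb C$ let $\theta_\alpha(z,\cdot,a)$, $\phi_\alpha(z,\cdot,a)$ be the $\mathcal B(\mathcal H)$-valued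 solutions of $\tau Y=zY$ with $\theta_\alpha(z,a,a)=\phi_\alpha'(z,a,a)=\cos(\alpha)$ and $\theta_\alpha'(z,a,a)=-\phi_\alpha(z,a,a)=\sin(\alpha)$. For $z\in\mathbb C\setminus\mathbb R$ let $m_{+,\alpha}(z)\in\mathcal B(\mathcal H)$ be the Weyl–Titchmarsh operator: $m_{+,\alpha}(z)f=g$ if and only if $\theta_\alpha(z,\cdot,a)f+\phi_\alpha(z,\cdot,a)g\in L^2((a,\infty);dx;\mathcal H)$. Let $d\rho_{+,\alpha}$ be the nonnegative $\mathcal B(\mathcal H)$-valued measure (strongly countably additive, defined on bounded Borel sets) in the Nevanlinna representation $$m_{+,\alpha}(z)=c_{+,\alpha}+\int_{\mathbb R}d\rho_{+,\alpha}(\lambda)\Big[\frac1{\lambda-z}-\frac{\lambda}{1+\lambda^2}\Big],\qquad z\in\mathbb C\setminus\mathbb R,$$ with $c_{+,\alpha}=c_{+,\alpha}^*\in\mathcal B(\mathcal H)$ and $\int_{\mathbb R}(1+\lambda^2)^{-1}d(e,\rho_{+,\alpha}(\lambda)e)_{\mathcal H}<\infty$ for all $e\in\mathcal H$. Let $L^2(\mathbb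 R;d\rho_{+,\alpha};\mathcal H)$ be the Hilbert space obtained by completing the $\mathcal H$-valued step functions of bounded support with respect to $(f,g)\mapsto\int_{\mathbb R}(f(\lambda),d\rho_{+,\alpha}(\lambda)g(\lambda))_{\mathcal H}$. A scalar measure $\nu$ on $\mathbb R$ is called a control measure of $d\rho_{+,\alpha}$ if, for all bounded Borel sets $B$, $\nu(B)=0$ if and only if $\rho_{+,\alpha}(B)=0$. Then all these objects exist, $H_{+,\alpha}$ is self-adjoint, and the following hold. (i) There is a unitary operator $U_{+,\alpha}$ from $L^2((a,\infty);dx;\mathcal H)$ onto $L^2(\mathbb R;d\rho_{+,\alpha};\mathcal H)$ given by $$(U_{+,\alpha}h)(\lambda)=\mathop{\rm l.i.m.}_{b\uparrow\infty}\int_a^b dx\,\phi_\alpha(\lambda,x,a)^*h(x)$$ (limit in $L^2(\mathbb R;d\rho_{+,\alpha};\mathcal H)$), and for every continuous $F:\mathbb R\to\mathbb C$, $$U_{+,\alpha}F(H_{+,\alpha})U_{+,\alpha}^{-1}=M_F,$$ where $F(H_{+,\alpha})$ is defined by the spectral theorem and $M_F$ is the maximally defined operator of multiplication by $F$ in $L^2(\mathbb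 R;d\rho_{+,\alpha};\mathcal H)$. (ii) For every continuous $F:\mathbb R\to\mathbb C$ and every control measure $\nu$ of $d\rho_{+,\alpha}$, $$\sigma(F(H_{+,\alpha}))=\{z\in\mathbb C\mid \nu(\{\lambda\in\mathbb R\mid |F(\lambda)-z|<\varepsilon\})>0\text{ for all }\varepsilon>0\},$$ the essential range of $F$ with respect to $\rho_{+,\alpha}$. (iii) $\sigma(H_{+,\alpha})=\operatorname{supp}(d\rho_{+,\alpha})$. (iv) The multiplicity of the spectrum of $H_{+,\alpha}$ (the least number of vectors that generate $L^2((a,\infty);dx;\mathcal H)$ under the spectral projections of $H_{+,\alpha}$) is at most $\dim(\mathcal H)\in\mathbb N_0\cup\{\infty\}$. -/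

import Mathlib

open MeasureTheory Filter Topology Set
open scoped InnerProductSpace ENNReal

universe u

noncomputable section

/-! ### Operator-valued measures on the line -/

/-- A locally bounded, nonnegative, strongly countably additive measure with values in the bounded
operators of `H`, defined on the bounded Borel subsets of `ℝ`. On all other sets
the function `toFun` takes the conventional value `0`. -/
structure OperatorMeasure (H : Type u) [NormedAddCommGroup H] [InnerProductSpace ℂ H] where
  toFun : Set ℝ → H →L[ℂ] H
  empty' : toFun ∅ = 0
  isPositive' : ∀ B, MeasurableSet B → Bornology.IsBounded B → (toFun B).IsPositive
  hasSum' : ∀ B : ℕ → Set ℝ, (∀ i, MeasurableSet (B i)) → Pairwise (Function.onFun Disjoint B) →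
    Bornology.IsBounded (⋃ i, B i) → ∀ x : H, HasSum (fun i => toFun (B i) x) (toFun (⋃ i, B i) x)
  eq_zero' : ∀ B, ¬ (MeasurableSet B ∧ Bornology.IsBounded B) → toFun B = 0

namespace OperatorMeasure

variable {H : Type u} [NormedAddCommGroup H] [InnerProductSpace ℂ H]

instance : CoeFun (OperatorMeasure H) (fun _ => Set ℝ → H →L[ℂ] H) := ⟨toFun⟩

instance : Inhabited (OperatorMeasure H) :=
  ⟨{ toFun := fun _ => 0
     empty' := rfl
     isPositive' := fun _ _ _ => ContinuousLinearMap.isPositive_zero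
     hasSum' := fun _ _ _ _ _ => by simp
     eq_zero' := fun _ _ => rfl }⟩

theorem isPositive (ρ : OperatorMeasure H) (B : Set ℝ) : (ρ B).IsPositive := by
  by_cases h : MeasurableSet B ∧ Bornology.IsBounded B
  · exact ρ.isPositive' B h.1 h.2
  · rw [ρ.eq_zero' B h]; exact ContinuousLinearMap.isPositive_zero

theorem union (ρ : OperatorMeasure H) {A B : Set ℝ} (hA : MeasurableSet A) (hB : MeasurableSet B)
    (hAB : Disjoint A B) (hb : Bornology.IsBounded (A ∪ B)) : ρ (A ∪ B) = ρ A + ρ B := by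
  ext x
  have h := ρ.hasSum' (fun i => if i = 0 then A else if i = 1 then B else ∅)
    (fun i => by split_ifs <;> simp [hA, hB])
    (by
      intro i j hij
      change Disjoint (if i = 0 then A else if i = 1 then B else ∅)
        (if j = 0 then A else if j = 1 then B else ∅)
      split_ifs <;>
        first
        | exact hAB
        | exact hAB.symm
        | exact disjoint_bot_left (α := Set ℝ)
        | exact disjoint_bot_right (α := Set ℝ)
        | (exfalso; omega))
  have hU : (⋃ i : ℕ, (if i = 0 then A else if i = 1 then B else ∅)) = A ∪ B := by
    ext y
    simp only [mem_iUnion, mem_union]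
    constructor
    · rintro ⟨i, hi⟩
      split_ifs at hi
      · exact Or.inl hi
      · exact Or.inr hi
      · exact absurd hi (by simp)
    · rintro (hy | hy)
      · exact ⟨0, by simpa using hy⟩
      · exact ⟨1, by simpa using hy⟩
  rw [hU] at h
  refine (h hb x).unique ?_
  rw [_root_.add_apply]
  have := hasSum_sum_of_ne_finset_zero (L := .unconditional ℕ) (s := Finset.range 2)
    (f := fun i : ℕ => ρ (if i = 0 then A else if i = 1 then B else ∅) x) (by
      intro i hi
      have h0 : i ≠ 0 := by rintro rfl; simp at hi
      have h1 : i ≠ 1 := by rintro rfl; simp at hi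
      simp [h0, h1, ρ.empty'])
  simpa [Finset.sum_range_succ] using this

/-- The scalar measure `B ↦ (e, ρ(B) e)`, extended from bounded to all Borel sets. -/
def scalarMeasure (ρ : OperatorMeasure H) (e : H) : Measure ℝ :=
  Measure.ofMeasurable
    (fun B _ => ∑' k : ℤ, ENNReal.ofReal (⟪e, ρ (B ∩ Ioc (k : ℝ) (k + 1)) e⟫_ℂ).re)
    (by simp [ρ.empty'])
    (by
      intro B hB hd
      rw [ENNReal.tsum_comm]
      refine tsum_congr fun k => ?_
      have h := ρ.hasSum' (fun i => B i ∩ Ioc (k : ℝ) (k + 1))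
        (fun i => (hB i).inter measurableSet_Ioc)
        (fun i j hij => (hd hij).mono inter_subset_left inter_subset_left)
        ((Metric.isBounded_Ioc (k : ℝ) (k + 1)).subset
          (iUnion_subset fun i => inter_subset_right)) e
      rw [← iUnion_inter] at h
      have h2 := Complex.hasSum_re (h.mapL (innerSL ℂ e))
      simp only [innerSL_apply_apply] at h2
      rw [← h2.tsum_eq, ENNReal.ofReal_tsum_of_nonneg _ h2.summable]
      intro i
      exact (ρ.isPositive _).re_inner_nonneg_right e)

/-- A control measure: a scalar measure with the same (bounded) null sets as `ρ`. -/
def IsControlMeasure (ρ : OperatorMeasure H) (ν : Measure ℝ) : Prop :=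
  ∀ B : Set ℝ, MeasurableSet B → Bornology.IsBounded B → (ν B = 0 ↔ ρ B = 0)

/-- The topological support of `dρ`. -/
def support (ρ : OperatorMeasure H) : Set ℝ :=
  {l | ∀ ε > 0, ρ (Ioo (l - ε) (l + ε)) ≠ 0}

end OperatorMeasure

/-! ### The Hilbert space `L²(ℝ; dρ; H)` -/

/-- `H`-valued Borel step functions on `ℝ` that vanish outside a bounded set. -/
def boundedStep (H : Type u) [NormedAddCommGroup H] [InnerProductSpace ℂ H] :
    Submodule ℂ (SimpleFunc ℝ H) where
  carrier := {f | Bornology.IsBounded (Function.support f)}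
  add_mem' := fun {f g} hf hg => by
    have hf' : Bornology.IsBounded (Function.support f) := hf
    exact (hf'.union hg).subset (Function.support_add f g)
  zero_mem' := by simp
  smul_mem' := fun c f hf => by
    have hf' : Bornology.IsBounded (Function.support f) := hf
    exact hf'.subset (Function.support_const_smul_subset c f)

namespace OperatorMeasure

variable {H : Type u} [NormedAddCommGroup H] [InnerProductSpace ℂ H]

/-- The sesquilinear form `(f, g) ↦ ∫ (f(λ), dρ(λ) g(λ))` on step functions: the sum over all pairs
of values `p = (ξ, η)` of `(ξ, ρ({f = ξ, g = η}) η)`. -/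
def form (ρ : OperatorMeasure H) (f g : SimpleFunc ℝ H) : ℂ :=
  ∑ p ∈ (f.pair g).range, ⟪p.1, ρ (f.pair g ⁻¹' {p}) p.2⟫_ℂ

theorem biUnion_fin {Y : Type*} (ρ : OperatorMeasure H) (t : SimpleFunc ℝ Y) (s : Finset Y)
    (hb : ∀ y ∈ s, Bornology.IsBounded (t ⁻¹' {y})) :
    Bornology.IsBounded (t ⁻¹' (s : Set Y)) ∧
      ρ (t ⁻¹' (s : Set Y)) = ∑ y ∈ s, ρ (t ⁻¹' {y}) := by
  classical
  induction s using Finset.induction_on with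
  | empty => simp [ρ.empty']
  | insert y s hy ih =>
    obtain ⟨h1, h2⟩ := ih fun z hz => hb z (Finset.mem_insert_of_mem hz)
    have h3 := hb y (Finset.mem_insert_self y s)
    have hb' := h3.union h1
    have he : t ⁻¹' ((insert y s : Finset Y) : Set Y) = t ⁻¹' {y} ∪ t ⁻¹' (s : Set Y) := by
      rw [Finset.coe_insert, insert_eq, preimage_union]
    rw [he, ρ.union (t.measurableSet_preimage _) (t.measurableSet_preimage _) _ hb',
      Finset.sum_insert hy, h2]
    · exact ⟨hb', rfl⟩
    · exact Disjoint.preimage _ (by simpa using hy)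

theorem form_map {Y : Type*} (ρ : OperatorMeasure H) (t : SimpleFunc ℝ Y) (f g : Y → H)
    (hb : ∀ y, f y ≠ 0 → g y ≠ 0 → Bornology.IsBounded (t ⁻¹' {y})) :
    ρ.form (t.map f) (t.map g) = ∑ y ∈ t.range, ⟪f y, ρ (t ⁻¹' {y}) (g y)⟫_ℂ := by
  classical
  have hp : (t.map f).pair (t.map g) = t.map (fun y => (f y, g y)) := by
    ext x <;> rfl
  rw [form, hp, SimpleFunc.range_map]
  refine Finset.sum_image' _ fun y _ => ?_
  by_cases h : f y ≠ 0 ∧ g y ≠ 0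
  · rw [SimpleFunc.map_preimage_singleton, (ρ.biUnion_fin t _ _).2, _root_.sum_apply,
      inner_sum]
    · refine Finset.sum_congr (by ext; simp) fun z hz => ?_
      have hz2 := (Finset.mem_filter.1 hz).2
      simp only [Prod.mk.injEq] at hz2
      rw [hz2.1, hz2.2]
    · intro z hz
      have hz2 : f z = f y ∧ g z = g y := by
        simp only [Finset.mem_filter, Prod.mk.injEq] at hz
        exact hz.2
      exact hb z (by rw [hz2.1]; exact h.1) (by rw [hz2.2]; exact h.2)
  · have h' : ∀ z : Y, f z = f y → g z = g y → ∀ A : H →L[ℂ] H, ⟪f z, A (g z)⟫_ℂ = 0 := by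
      intro z h1 h2 A
      rw [h1, h2]
      by_cases h3 : f y = 0
      · simp [h3]
      · have h4 : g y = 0 := by by_contra h4; exact h ⟨h3, h4⟩
        simp [h4]
    rw [Finset.sum_eq_zero]
    · exact h' y rfl rfl _
    · intro z hz
      have hz2 := (Finset.mem_filter.1 hz).2
      simp only [Prod.mk.injEq] at hz2
      exact h' z hz2.1 hz2.2 _

/-- The space of bounded-support step functions, carrying the semi-inner product given by `ρ`. -/
def Step (_ρ : OperatorMeasure H) : Type u := boundedStep H

instance (ρ : OperatorMeasure H) : AddCommGroup ρ.Step :=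
  inferInstanceAs (AddCommGroup (boundedStep H))

instance (ρ : OperatorMeasure H) : Module ℂ ρ.Step :=
  inferInstanceAs (Module ℂ (boundedStep H))

theorem bounded_of_ne {Y : Type*} {f : SimpleFunc ℝ H} (hf : f ∈ boundedStep H)
    (t : SimpleFunc ℝ Y) (F : Y → H) (h : f = t.map F) (y : Y) (hy : F y ≠ 0) :
    Bornology.IsBounded (t ⁻¹' {y}) := by
  have hf' : Bornology.IsBounded (Function.support f) := hf
  refine hf'.subset ?_
  intro x hx
  rw [Function.mem_support, h, SimpleFunc.map_apply, show t x = y from hx]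
  exact hy

theorem form_conj (ρ : OperatorMeasure H) (f g : boundedStep H) :
    (starRingEnd ℂ) (ρ.form g f) = ρ.form f g := by
  have h1 : (f : SimpleFunc ℝ H) = ((f : SimpleFunc ℝ H).pair (g : SimpleFunc ℝ H)).map Prod.fst :=
    rfl
  have h2 : (g : SimpleFunc ℝ H) = ((f : SimpleFunc ℝ H).pair (g : SimpleFunc ℝ H)).map Prod.snd :=
    rfl
  have e1 := ρ.form_map ((f : SimpleFunc ℝ H).pair (g : SimpleFunc ℝ H)) Prod.snd Prod.fst
    (fun y hy _ => bounded_of_ne g.2 _ _ h2 y hy)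
  rw [← h1, ← h2] at e1
  rw [e1, form, map_sum]
  refine Finset.sum_congr rfl fun p _ => ?_
  rw [inner_conj_symm, (ρ.isPositive _).isSymmetric.apply_clm]

theorem form_self_nonneg (ρ : OperatorMeasure H) (f : boundedStep H) :
    0 ≤ (ρ.form f f).re := by
  have e1 := ρ.form_map (f : SimpleFunc ℝ H) id id
    (fun y hy _ => bounded_of_ne f.2 _ _ rfl y hy)
  change ρ.form f f = _ at e1
  rw [e1, Complex.re_sum]
  exact Finset.sum_nonneg fun y _ => (ρ.isPositive _).re_inner_nonneg_right y

theorem form_add (ρ : OperatorMeasure H) (f g h : boundedStep H) :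
    ρ.form ((f + g : boundedStep H) : SimpleFunc ℝ H) h = ρ.form f h + ρ.form g h := by
  let t : SimpleFunc ℝ (H × H × H) := (f : SimpleFunc ℝ H).pair ((g : SimpleFunc ℝ H).pair h)
  have hh : ∀ y : H × H × H, y.2.2 ≠ 0 → Bornology.IsBounded (t ⁻¹' {y}) :=
    fun y hy => bounded_of_ne h.2 t (fun y => y.2.2) rfl y hy
  have e1 := ρ.form_map t (fun y => y.1 + y.2.1) (fun y => y.2.2) (fun y _ hy => hh y hy)
  have e2 := ρ.form_map t (fun y => y.1) (fun y => y.2.2) (fun y _ hy => hh y hy)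
  have e3 := ρ.form_map t (fun y => y.2.1) (fun y => y.2.2) (fun y _ hy => hh y hy)
  change ρ.form ((f + g : boundedStep H) : SimpleFunc ℝ H) h = _ at e1
  change ρ.form f h = _ at e2
  change ρ.form g h = _ at e3
  rw [e1, e2, e3, ← Finset.sum_add_distrib]
  exact Finset.sum_congr rfl fun y _ => inner_add_left _ _ _

theorem form_smul (ρ : OperatorMeasure H) (f h : boundedStep H) (c : ℂ) :
    ρ.form ((c • f : boundedStep H) : SimpleFunc ℝ H) h = (starRingEnd ℂ) c * ρ.form f h := by
  let t : SimpleFunc ℝ (H × H) := (f : SimpleFunc ℝ H).pair h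
  have hh : ∀ y : H × H, y.2 ≠ 0 → Bornology.IsBounded (t ⁻¹' {y}) :=
    fun y hy => bounded_of_ne h.2 t (fun y => y.2) rfl y hy
  have e1 := ρ.form_map t (fun y => c • y.1) (fun y => y.2) (fun y _ hy => hh y hy)
  have e2 := ρ.form_map t (fun y => y.1) (fun y => y.2) (fun y _ hy => hh y hy)
  change ρ.form ((c • f : boundedStep H) : SimpleFunc ℝ H) h = _ at e1
  change ρ.form f h = _ at e2
  rw [e1, e2, Finset.mul_sum]
  exact Finset.sum_congr rfl fun y _ => inner_smul_left _ _ _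

/-- The semi-inner product `(f, g) = ∫ (f(λ), dρ(λ) g(λ))` on step functions. -/
instance preCore (ρ : OperatorMeasure H) : PreInnerProductSpace.Core ℂ ρ.Step where
  inner f g := ρ.form (f : boundedStep H).1 (g : boundedStep H).1
  conj_inner_symm f g := ρ.form_conj f g
  re_inner_nonneg f := ρ.form_self_nonneg f
  add_left f g h := ρ.form_add f g h
  smul_left f h c := ρ.form_smul f h c

instance (ρ : OperatorMeasure H) : SeminormedAddCommGroup ρ.Step :=
  InnerProductSpace.Core.toSeminormedAddCommGroup (𝕜 := ℂ)

instance (ρ : OperatorMeasure H) : InnerProductSpace ℂ ρ.Step := .ofCore _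

/-- The Hilbert space `L²(ℝ; dρ; H)`: the (Hausdorff) completion of the step functions with respect
to the semi-inner product `∫ (f(λ), dρ(λ) g(λ))`. -/
abbrev L2 (ρ : OperatorMeasure H) : Type u := UniformSpace.Completion ρ.Step

/-- Multiplication of step functions by the indicator function of `A`. -/
def indicatorStep (ρ : OperatorMeasure H) (A : Set ℝ) : ρ.Step →ₗ[ℂ] ρ.Step where
  toFun f := (⟨(f : boundedStep H).1.restrict A, by
    by_cases hA : MeasurableSet A
    · have hf : Bornology.IsBounded (Function.support (f : boundedStep H).1) :=
        (f : boundedStep H).2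
      refine hf.subset ?_
      rw [SimpleFunc.coe_restrict _ hA, Set.support_indicator]
      exact inter_subset_right
    · rw [SimpleFunc.restrict_of_not_measurable hA]
      exact (boundedStep H).zero_mem⟩ : boundedStep H)
  map_add' f g := by
    apply Subtype.ext
    change ((f : boundedStep H).1 + (g : boundedStep H).1).restrict A =
      (f : boundedStep H).1.restrict A + (g : boundedStep H).1.restrict A
    by_cases hA : MeasurableSet A
    · ext x
      simp only [SimpleFunc.coe_restrict _ hA, SimpleFunc.coe_add, Pi.add_apply,
        Set.indicator_add']
    · simp [SimpleFunc.restrict_of_not_measurable hA]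
  map_smul' c f := by
    apply Subtype.ext
    change (c • (f : boundedStep H).1).restrict A = c • (f : boundedStep H).1.restrict A
    by_cases hA : MeasurableSet A
    · ext x
      simp only [SimpleFunc.coe_restrict _ hA, SimpleFunc.coe_smul, Pi.smul_apply]
      by_cases hx : x ∈ A <;> simp [hx]
    · simp [SimpleFunc.restrict_of_not_measurable hA]

theorem norm_indicatorStep_le (ρ : OperatorMeasure H) (A : Set ℝ) (f : ρ.Step) :
    ‖ρ.indicatorStep A f‖ ≤ 1 * ‖f‖ := by
  classical
  rw [one_mul]
  change √(ρ.form ((f : boundedStep H).1.restrict A) ((f : boundedStep H).1.restrict A)).re ≤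
    √(ρ.form (f : boundedStep H).1 (f : boundedStep H).1).re
  refine Real.sqrt_le_sqrt ?_
  by_cases hA : MeasurableSet A
  · let t : SimpleFunc ℝ (H × Bool) := (f : boundedStep H).1.pair
      (SimpleFunc.piecewise A hA (SimpleFunc.const ℝ true) (SimpleFunc.const ℝ false))
    let F : H × Bool → H := fun y => if y.2 then y.1 else 0
    have hF : (f : boundedStep H).1.restrict A = t.map F := by
      ext x
      rw [SimpleFunc.restrict_apply _ hA]
      by_cases hx : x ∈ A <;> simp [t, F, hx]
    have hb : ∀ y : H × Bool, y.1 ≠ 0 → Bornology.IsBounded (t ⁻¹' {y}) :=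
      fun y hy => bounded_of_ne (f : boundedStep H).2 t Prod.fst rfl y hy
    have hb' : ∀ y : H × Bool, F y ≠ 0 → Bornology.IsBounded (t ⁻¹' {y}) := by
      intro y hy
      refine hb y fun h => hy ?_
      simp [F, h]
    have e1 := ρ.form_map t F F (fun y _ hy => hb' y hy)
    have e2 := ρ.form_map t Prod.fst Prod.fst (fun y _ hy => hb y hy)
    change ρ.form (f : boundedStep H).1 (f : boundedStep H).1 = _ at e2
    rw [hF, e1, e2, Complex.re_sum, Complex.re_sum]
    refine Finset.sum_le_sum fun y _ => ?_
    have hp := (ρ.isPositive (t ⁻¹' {y})).re_inner_nonneg_right y.1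
    by_cases hy : y.2
    · simp [F, hy]
    · simpa [F, hy] using hp
  · rw [SimpleFunc.restrict_of_not_measurable hA]
    have : ρ.form 0 0 = 0 := by
      refine Finset.sum_eq_zero fun p hp => ?_
      obtain ⟨x, rfl⟩ := SimpleFunc.mem_range.1 hp
      simp
    rw [this]
    exact ρ.form_self_nonneg f

/-- Multiplication by the indicator function of a Borel set `A`, as a bounded operator in
`L²(ℝ; dρ; H)`. -/
def indicator (ρ : OperatorMeasure H) (A : Set ℝ) : ρ.L2 →L[ℂ] ρ.L2 :=
  ((ρ.indicatorStep A).mkContinuous 1 (ρ.norm_indicatorStep_le A)).completion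

/-- The step function `χ_{(l, r]} ξ`. -/
def stepFun (ρ : OperatorMeasure H) (l r : ℝ) (ξ : H) : ρ.Step :=
  (⟨(SimpleFunc.const ℝ ξ).restrict (Ioc l r), by
    change Bornology.IsBounded (Function.support ((SimpleFunc.const ℝ ξ).restrict (Ioc l r)))
    rw [SimpleFunc.coe_restrict _ measurableSet_Ioc, Set.support_indicator]
    exact (Metric.isBounded_Ioc l r).subset inter_subset_left⟩ : boundedStep H)

/-- The element `χ_{(l, r]} ξ` of `L²(ℝ; dρ; H)`. -/
def step (ρ : OperatorMeasure H) (l r : ℝ) (ξ : H) : ρ.L2 :=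
  ((ρ.stepFun l r ξ : ρ.Step) : UniformSpace.Completion ρ.Step)

end OperatorMeasure

/-- A finite subdivision `l = η₀ < η₁ < ⋯ < ηₙ = r` with intermediate points
`η'ⱼ ∈ [ηⱼ, ηⱼ₊₁]`. -/
structure TaggedPartition (l r : ℝ) where
  n : ℕ
  pt : ℕ → ℝ
  tag : ℕ → ℝ
  pt_zero : pt 0 = l
  pt_last : pt n = r
  pt_lt : ∀ j < n, pt j < pt (j + 1)
  tag_mem : ∀ j < n, tag j ∈ Icc (pt j) (pt (j + 1))

/-- The norm (mesh) of a subdivision. -/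
def TaggedPartition.mesh {l r : ℝ} (P : TaggedPartition l r) : ℝ :=
  ⨆ j : Fin P.n, (P.pt (j + 1) - P.pt j)

/-- The filter of subdivisions of `[l, r]` whose mesh tends to `0`. -/
def meshToZero (l r : ℝ) : Filter (TaggedPartition l r) :=
  comap TaggedPartition.mesh (𝓝 0)

namespace OperatorMeasure

variable {H : Type u} [NormedAddCommGroup H] [InnerProductSpace ℂ H]

/-- The element `k` of `L²(ℝ; dρ; H)` is (the class of) the function `v : ℝ → H`: on every bounded
interval `(l, r]` it is the `L²(ℝ; dρ; H)`-limit of the step functions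
`∑ⱼ χ_{(ηⱼ, ηⱼ₊₁]} v(η'ⱼ)` as the mesh of the subdivision tends to zero. -/
def IsClassOf (ρ : OperatorMeasure H) (v : ℝ → H) (k : ρ.L2) : Prop :=
  ∀ l r : ℝ, l < r → Tendsto
    (fun P : TaggedPartition l r =>
      ∑ j ∈ Finset.range P.n, ρ.step (P.pt j) (P.pt (j + 1)) (v (P.tag j)))
    (meshToZero l r) (𝓝 (ρ.indicator (Ioc l r) k))

/-- The graph of multiplication by a continuous function `F` in `L²(ℝ; dρ; H)`: the pairs `(k, g)`
with `g = F k`, which means that on every bounded interval `(l, r]` the function `χ_{(l, r]} g` is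
the limit of `∑ⱼ F(η'ⱼ) χ_{(ηⱼ, ηⱼ₊₁]} k` as the mesh of the subdivision tends to zero. -/
def mulGraph (ρ : OperatorMeasure H) (F : ℝ → ℂ) : Submodule ℂ (ρ.L2 × ρ.L2) where
  carrier := {p | ∀ l r : ℝ, l < r → Tendsto
    (fun P : TaggedPartition l r =>
      ∑ j ∈ Finset.range P.n, F (P.tag j) • ρ.indicator (Ioc (P.pt j) (P.pt (j + 1))) p.1)
    (meshToZero l r) (𝓝 (ρ.indicator (Ioc l r) p.2))}
  add_mem' := fun {p q} hp hq l r hlr => by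
    simpa only [Prod.fst_add, Prod.snd_add, map_add, smul_add, Finset.sum_add_distrib] using
      (hp l r hlr).add (hq l r hlr)
  zero_mem' := fun l r _ => by simpa using tendsto_const_nhds
  smul_mem' := fun c p hp l r hlr => by
    have h := (hp l r hlr).const_smul c
    simp only [Finset.smul_sum] at h
    simpa only [Prod.smul_fst, Prod.smul_snd, map_smul, smul_comm c] using h

/-- The maximally defined operator `M_F` of multiplication by the continuous function `F` in
`L²(ℝ; dρ; H)`; its domain consists of all `k` for which there is a `g` with `g = F k`. -/
def mulOperator (ρ : OperatorMeasure H) (F : ℝ → ℂ) : ρ.L2 →ₗ.[ℂ] ρ.L2 :=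
  (ρ.mulGraph F).toLinearPMap

end OperatorMeasure

/-- The essential range of `F` with respect to the scalar measure `ν`. -/
def essentialRange (ν : Measure ℝ) (F : ℝ → ℂ) : Set ℂ :=
  {z | ∀ ε > 0, 0 < ν {l | ‖F l - z‖ < ε}}

/-! ### Unbounded self-adjoint operators: spectrum, spectral measure, functions, multiplicity -/

/-- A projection-valued measure on the Borel sets of `ℝ`, with the conventional value `0` on sets
that are not Borel. -/
structure ProjectionMeasure (K : Type u) [NormedAddCommGroup K] [InnerProductSpace ℂ K]
    [CompleteSpace K] where
  toFun : Set ℝ → K →L[ℂ] K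
  univ' : toFun univ = 1
  isStarProjection' : ∀ B, IsStarProjection (toFun B)
  hasSum' : ∀ B : ℕ → Set ℝ, (∀ i, MeasurableSet (B i)) → Pairwise (Function.onFun Disjoint B) →
    ∀ x : K, HasSum (fun i => toFun (B i) x) (toFun (⋃ i, B i) x)
  eq_zero' : ∀ B, ¬ MeasurableSet B → toFun B = 0

section Unbounded

variable {K : Type u} [NormedAddCommGroup K] [InnerProductSpace ℂ K]

/-- The spectrum of a (partially defined) linear operator `T`: the set of `z` for which
`T - z` is not a bijection from the domain of `T` onto `K` with bounded inverse. -/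
def operatorSpectrum (T : K →ₗ.[ℂ] K) : Set ℂ :=
  {z | ¬ ∃ R : K →L[ℂ] K,
    (∀ w : K, ∃ hw : R w ∈ T.domain, T ⟨R w, hw⟩ - z • R w = w) ∧
    (∀ f : T.domain, R (T f - z • (f : K)) = f)}

variable [CompleteSpace K]

namespace ProjectionMeasure

instance : CoeFun (ProjectionMeasure K) (fun _ => Set ℝ → K →L[ℂ] K) := ⟨toFun⟩

theorem re_inner_nonneg (E : ProjectionMeasure K) (B : Set ℝ) (f : K) :
    0 ≤ (⟪f, E B f⟫_ℂ).re :=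
  ((ContinuousLinearMap.nonneg_iff_isPositive _).1
    (E.isStarProjection' B).nonneg).re_inner_nonneg_right f

theorem empty (E : ProjectionMeasure K) : E ∅ = 0 := by
  ext x
  have h := E.hasSum' (fun _ => ∅) (fun _ => MeasurableSet.empty)
    (fun _ _ _ => disjoint_bot_left (α := Set ℝ)) x
  exact (summable_const_iff _).1 h.summable

/-- The scalar measure `B ↦ (f, E(B) f) = ‖E(B) f‖²`. -/
def scalarMeasure (E : ProjectionMeasure K) (f : K) : Measure ℝ :=
  Measure.ofMeasurable (fun B _ => ENNReal.ofReal (⟪f, E B f⟫_ℂ).re)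
    (by simp [E.empty])
    (by
      intro B hB hd
      have h2 := Complex.hasSum_re ((E.hasSum' B hB hd f).mapL (innerSL ℂ f))
      simp only [innerSL_apply_apply] at h2
      rw [← h2.tsum_eq, ENNReal.ofReal_tsum_of_nonneg _ h2.summable]
      intro i
      exact E.re_inner_nonneg _ f)

/-- `A = ∫ F dE`: the domain of `A` is `{f | ∫ |F|² d(f, E f) < ∞}`, and
`(f, A f) = ∫ F d(f, E f)` for all `f` in the domain (which by polarization determines `A`). -/
def IsIntegral (E : ProjectionMeasure K) (F : ℝ → ℂ) (A : K →ₗ.[ℂ] K) : Prop :=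
  (∀ f : K, f ∈ A.domain ↔ ∫⁻ l, ‖F l‖ₑ ^ 2 ∂(E.scalarMeasure f) < ∞) ∧
    ∀ f : A.domain, ⟪(f : K), A f⟫_ℂ = ∫ l, F l ∂(E.scalarMeasure (f : K))

/-- `E` is the spectral measure of `T`, that is, `T = ∫ λ dE(λ)`. -/
def IsSpectralMeasureOf (E : ProjectionMeasure K) (T : K →ₗ.[ℂ] K) : Prop :=
  E.IsIntegral (fun l => (l : ℂ)) T

end ProjectionMeasure

/-- `A = F(T)`, that is, `A = ∫ F dE_T` with the spectral measure `E_T` of `T`. -/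
def IsFunctionOf (T : K →ₗ.[ℂ] K) (F : ℝ → ℂ) (A : K →ₗ.[ℂ] K) : Prop :=
  ∃ E : ProjectionMeasure K, E.IsSpectralMeasureOf T ∧ E.IsIntegral F A

open Classical in
/-- The operator `F(T)` for self-adjoint `T`. -/
def functionOf (T : K →ₗ.[ℂ] K) (F : ℝ → ℂ) : K →ₗ.[ℂ] K :=
  if h : ∃ A, IsFunctionOf T F A then h.choose else ⊥

/-- The spectral multiplicity of a self-adjoint operator: the least number of vectors that generate
the whole space under its spectral projections. -/
def spectralMultiplicity (T : K →ₗ.[ℂ] K) : ℕ∞ :=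
  ⨅ (E : ProjectionMeasure K) (_ : E.IsSpectralMeasureOf T) (S : Set K)
    (_ : (Submodule.span ℂ {g | ∃ B : Set ℝ, MeasurableSet B ∧ ∃ f ∈ S, g = E B f}).topologicalClosure
      = ⊤), S.encard

end Unbounded

/-! ### Schrödinger operators on the half-line `(a, ∞)` -/

section Schrodinger

variable {H : Type u} [NormedAddCommGroup H] [InnerProductSpace ℂ H]

/-- `L²((a, ∞); dx; H)`. -/
abbrev HalfLineL2 (H : Type u) [NormedAddCommGroup H] (a : ℝ) : Type u :=
  Lp H 2 (volume.restrict (Ioi a))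

/-- `u` lies in `W^{2,1}_loc((a, ∞); dx; H)`, with first derivative `u'` and second
derivative `u''`. -/
structure IsW21Loc (a : ℝ) (u u' u'' : ℝ → H) : Prop where
  hasDerivAt : ∀ x ∈ Ioi a, HasDerivAt u (u' x) x
  locallyIntegrable : LocallyIntegrableOn u'' (Ioi a)
  integral_eq : ∀ x ∈ Ioi a, ∀ y ∈ Ioi a, u' y - u' x = ∫ t in x..y, u'' t

/-- The differential expression `τ u = -u'' + V u`. -/
def tau (V : ℝ → H →L[ℂ] H) (u u'' : ℝ → H) (x : ℝ) : H := -u'' x + V x (u x)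

/-- `u` (with derivatives `u'`, `u''`) lies in the domain of the maximal operator. -/
def IsInMaxDomain (V : ℝ → H →L[ℂ] H) (a : ℝ) (u u' u'' : ℝ → H) : Prop :=
  IsW21Loc a u u' u'' ∧ MemLp u 2 (volume.restrict (Ioi a)) ∧
    MemLp (tau V u u'') 2 (volume.restrict (Ioi a))

/-- `τ` is of limit-point type at `∞`: the Wronskians
`W(u, v)(x) = (u(x), v'(x)) - (u'(x), v(x))` vanish at `∞` on the maximal domain. -/
def IsLimitPointAtTop (V : ℝ → H →L[ℂ] H) (a : ℝ) : Prop :=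
  ∀ u u' u'' v v' v'' : ℝ → H, IsInMaxDomain V a u u' u'' → IsInMaxDomain V a v v' v'' →
    Tendsto (fun x => ⟪u x, v' x⟫_ℂ - ⟪u' x, v x⟫_ℂ) atTop (𝓝 0)

/-- `Y` is the operator-valued solution on `(a, ∞)` of `τ Y = z Y` with initial data
`Y(a) = Y₀`, `Y'(a) = Y₁` (in the strong sense). -/
def IsOperatorSolution (V : ℝ → H →L[ℂ] H) (a : ℝ) (z : ℂ) (Y₀ Y₁ : H →L[ℂ] H)
    (Y : ℝ → H →L[ℂ] H) : Prop :=
  ∀ h : H, ∃ u' u'' : ℝ → H, IsW21Loc a (fun x => Y x h) u' u'' ∧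
    (∀ᵐ x ∂(volume.restrict (Ioi a)), tau V (fun x => Y x h) u'' x = z • Y x h) ∧
    Y a h = Y₀ h ∧ Tendsto (fun x => Y x h) (𝓝[>] a) (𝓝 (Y₀ h)) ∧
    Tendsto u' (𝓝[>] a) (𝓝 (Y₁ h))

open Classical in
/-- The operator-valued solution of `τ Y = z Y` with initial data `Y(a) = Y₀`, `Y'(a) = Y₁`. -/
def operatorSolution (V : ℝ → H →L[ℂ] H) (a : ℝ) (z : ℂ) (Y₀ Y₁ : H →L[ℂ] H) : ℝ → H →L[ℂ] H :=
  if h : ∃ Y, IsOperatorSolution V a z Y₀ Y₁ Y then h.choose else 0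

/-- `m` has the Nevanlinna representation
`m(z) = c + ∫ [(λ - z)⁻¹ - λ (1 + λ²)⁻¹] dρ(λ)` on `ℂ \ ℝ`, with `c` self-adjoint and
`∫ (1 + λ²)⁻¹ d(e, ρ(λ) e) < ∞`; the integral is understood through quadratic forms. -/
def IsNevanlinnaMeasure [CompleteSpace H] (m : ℂ → H →L[ℂ] H) (ρ : OperatorMeasure H) : Prop :=
  ∃ c : H →L[ℂ] H, IsSelfAdjoint c ∧ ∀ e : H,
    (∫⁻ l, ENNReal.ofReal (1 / (1 + l ^ 2)) ∂(ρ.scalarMeasure e) < ∞) ∧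
    ∀ z : ℂ, z.im ≠ 0 → ⟪e, m z e⟫_ℂ = ⟪e, c e⟫_ℂ +
      ∫ l : ℝ, (1 / ((l : ℂ) - z) - (l : ℂ) / (1 + (l : ℂ) ^ 2)) ∂(ρ.scalarMeasure e)

variable [CompleteSpace H]

/-- The operator `sin α` for bounded self-adjoint `α`. -/
def opSin (α : H →L[ℂ] H) : H →L[ℂ] H := cfc Real.sin α

/-- The operator `cos α` for bounded self-adjoint `α`. -/
def opCos (α : H →L[ℂ] H) : H →L[ℂ] H := cfc Real.cos α

/-- The graph of `H_{+,α}`: all pairs `(f, τ f)` with `f` in the maximal domain that satisfy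
`sin(α) f'(a) + cos(α) f(a) = 0`. -/
def halfLineGraph (V : ℝ → H →L[ℂ] H) (a : ℝ) (α : H →L[ℂ] H) :
    Submodule ℂ (HalfLineL2 H a × HalfLineL2 H a) where
  carrier := {p | ∃ (u u' u'' : ℝ → H) (u₀ u₁ : H), IsW21Loc a u u' u'' ∧
    p.1 =ᵐ[volume.restrict (Ioi a)] u ∧ p.2 =ᵐ[volume.restrict (Ioi a)] tau V u u'' ∧
    Tendsto u (𝓝[>] a) (𝓝 u₀) ∧ Tendsto u' (𝓝[>] a) (𝓝 u₁) ∧ opSin α u₁ + opCos α u₀ = 0}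
  add_mem' := by
    rintro p q ⟨u, u', u'', u₀, u₁, h1, h2, h3, h4, h5, h6⟩ ⟨v, v', v'', v₀, v₁, k1, k2, k3, k4, k5, k6⟩
    refine ⟨u + v, u' + v', u'' + v'', u₀ + v₀, u₁ + v₁, ⟨?_, ?_, ?_⟩, ?_, ?_, h4.add k4, h5.add k5,
      ?_⟩
    · exact fun x hx => (h1.hasDerivAt x hx).add (k1.hasDerivAt x hx)
    · exact h1.locallyIntegrable.add k1.locallyIntegrable
    · intro x hx y hy
      have hs : uIcc x y ⊆ Ioi a := (convex_Ioi a).ordConnected.uIcc_subset hx hy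
      have i1 := (h1.locallyIntegrable.integrableOn_compact_subset hs isCompact_uIcc).intervalIntegrable
      have i2 := (k1.locallyIntegrable.integrableOn_compact_subset hs isCompact_uIcc).intervalIntegrable
      have e := intervalIntegral.integral_add i1 i2
      simp only [Pi.add_apply]
      rw [e, ← h1.integral_eq x hx y hy, ← k1.integral_eq x hx y hy]
      abel
    · filter_upwards [Lp.coeFn_add p.1 q.1, h2, k2] with x hx hx1 hx2
      rw [Prod.fst_add, hx, Pi.add_apply, Pi.add_apply, hx1, hx2]
    · filter_upwards [Lp.coeFn_add p.2 q.2, h3, k3] with x hx hx1 hx2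
      rw [Prod.snd_add, hx, Pi.add_apply, hx1, hx2]
      simp only [tau, Pi.add_apply, map_add]
      abel
    · rw [map_add, map_add, add_add_add_comm, h6, k6, add_zero]
  zero_mem' := by
    refine ⟨0, 0, 0, 0, 0, ⟨?_, ?_, ?_⟩, ?_, ?_, ?_, ?_, ?_⟩
    · exact fun x _ => hasDerivAt_const x 0
    · exact (integrable_zero ℝ H volume).locallyIntegrable.locallyIntegrableOn _
    · intro x _ y _
      simp
    · exact Lp.coeFn_zero _ _ _
    · filter_upwards [Lp.coeFn_zero H 2 (volume.restrict (Ioi a))] with x hx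
      rw [Prod.snd_zero, hx]
      simp [tau]
    · exact tendsto_const_nhds
    · exact tendsto_const_nhds
    · simp
  smul_mem' := by
    rintro c p ⟨u, u', u'', u₀, u₁, h1, h2, h3, h4, h5, h6⟩
    refine ⟨c • u, c • u', c • u'', c • u₀, c • u₁, ⟨?_, ?_, ?_⟩, ?_, ?_, h4.const_smul c,
      h5.const_smul c, ?_⟩
    · exact fun x hx => (h1.hasDerivAt x hx).const_smul c
    · exact h1.locallyIntegrable.smul c
    · intro x hx y hy
      simp only [Pi.smul_apply]
      rw [intervalIntegral.integral_smul, ← h1.integral_eq x hx y hy, smul_sub]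
    · filter_upwards [Lp.coeFn_smul c p.1, h2] with x hx hx1
      rw [Prod.smul_fst, hx, Pi.smul_apply, Pi.smul_apply, hx1]
    · filter_upwards [Lp.coeFn_smul c p.2, h3] with x hx hx1
      rw [Prod.smul_snd, hx, Pi.smul_apply, hx1]
      simp only [tau, Pi.smul_apply, map_smul, smul_add, smul_neg]
    · rw [map_smul, map_smul, ← smul_add, h6, smul_zero]

/-- The half-line Schrödinger operator `H_{+,α}` in `L²((a, ∞); dx; H)`: the restriction of the
maximal operator to the functions with `sin(α) f'(a) + cos(α) f(a) = 0`. -/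
def halfLineOperator (V : ℝ → H →L[ℂ] H) (a : ℝ) (α : H →L[ℂ] H) :
    HalfLineL2 H a →ₗ.[ℂ] HalfLineL2 H a :=
  (halfLineGraph V a α).toLinearPMap

/-- The solution `φ_α(z, ·, a)`, with `φ_α(z, a, a) = -sin α` and `φ_α'(z, a, a) = cos α`. -/
def phiSol (V : ℝ → H →L[ℂ] H) (a : ℝ) (α : H →L[ℂ] H) (z : ℂ) : ℝ → H →L[ℂ] H :=
  operatorSolution V a z (-opSin α) (opCos α)

/-- The solution `θ_α(z, ·, a)`, with `θ_α(z, a, a) = cos α` and `θ_α'(z, a, a) = sin α`. -/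
def thetaSol (V : ℝ → H →L[ℂ] H) (a : ℝ) (α : H →L[ℂ] H) (z : ℂ) : ℝ → H →L[ℂ] H :=
  operatorSolution V a z (opCos α) (opSin α)

/-- `M` is the value at `z` of the Weyl-Titchmarsh function: `M f = g` exactly if the
solution `θ_α(z, ·, a) f + φ_α(z, ·, a) g` of `τ y = z y` is square integrable. -/
def IsWeylValue (V : ℝ → H →L[ℂ] H) (a : ℝ) (α : H →L[ℂ] H) (z : ℂ) (M : H →L[ℂ] H) : Prop :=
  ∀ f g : H, MemLp (fun x => thetaSol V a α z x f + phiSol V a α z x g) 2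
    (volume.restrict (Ioi a)) ↔ M f = g

open Classical in
/-- The Weyl-Titchmarsh function `m_{+,α}` on `ℂ \ ℝ`. -/
def weylM (V : ℝ → H →L[ℂ] H) (a : ℝ) (α : H →L[ℂ] H) (z : ℂ) : H →L[ℂ] H :=
  if h : ∃ M, IsWeylValue V a α z M then h.choose else 0

open Classical in
/-- The operator-valued spectral measure `dρ_{+,α}`, the measure in the Nevanlinna representation of
`m_{+,α}`. -/
def spectralRho (V : ℝ → H →L[ℂ] H) (a : ℝ) (α : H →L[ℂ] H) : OperatorMeasure H :=
  if h : ∃ ρ, IsNevanlinnaMeasure (weylM V a α) ρ then h.choose else default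

/-- The truncated generalized Fourier transform
`λ ↦ ∫_a^b φ_α(λ, x, a)^* h(x) dx`. -/
def truncTransform (V : ℝ → H →L[ℂ] H) (a : ℝ) (α : H →L[ℂ] H) (b : ℝ) (h : ℝ → H) (l : ℝ) : H :=
  ∫ x in Ioc a b, ContinuousLinearMap.adjoint (phiSol V a α (l : ℂ) x) (h x)

end Schrodinger

end

/-!
# Spectral theory of half-line Schrödinger operators with operator-valued potentials

The argument works with linear relations (graphs) in a Hilbert space instead of partially defined
operators. It rests on four ideas.

**The boundary triple.** For `f` in the maximal domain put `p = cos α f(a) + sin α f'(a)` and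
`q = cos α f'(a) - sin α f(a)`. The quadruples `(f, τ f, p, q)` form a boundary triple
(`isBoundaryTriple_boundaryGraph`). Green's identity is the Lagrange identity together with the
limit-point hypothesis; maximality follows by testing with compactly supported functions of the
domain, and surjectivity of `(p, q)` by cutting off solutions. The kernel `p = 0` is the graph of
`H_{+,α}` (`kerGraph_boundaryGraph`), which is therefore self-adjoint, and the Weyl function of the
triple is `m_{+,α}`.

**The spectral theorem.** The resolvent of a self-adjoint graph at `i` is a bounded normal operator;
its continuous functional calculus and the Riesz-Markov theorem give the projection-valued measure
`E` of the graph (`IsSelfAdjointGraph.exists_projectionMeasure`).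

**The spectral measure.** Let `Γ : 𝓗 → L²(dx)` be the map that sends the boundary value `p = ξ` to
the square integrable solution of `τ f = i f`. Put `G(B) = ∫_B (λ - i) dE(λ) Γ`. Then
`ρ(B) = G(B)* G(B)` represents `m_{+,α}` in the Nevanlinna form
(`IsBoundaryTriple.isNevanlinnaMeasure`), and by Stieltjes inversion it is the only measure that
does (`IsNevanlinnaMeasure.unique`). By construction `χ_B ξ ↦ G(B) ξ` extends to an isometry `W` of
`L²(dρ)` into `L²(dx)` which intertwines multiplication operators with integrals over `E`
(`exists_gammaIsometry`).

**The eigenfunction expansion.** Write `ĥ(λ) = ∫ φ_α(λ, x)* h(x) dx` for `h` of compact support.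
For `λ` in a short interval `I` the vector `y = E(I) g` nearly satisfies `τ y = λ y` and has boundary
value `p = 0`; by Gronwall's inequality it is close to `φ_α(λ, ·) q` on compact intervals, where `q`
is its second boundary value. Hence `⟪y, h⟫` is close to `⟪q, ĥ(λ)⟫` (`isTransform_truncTransform`),
and by duality `‖E(I) h - G(I) ĥ(λ)‖` is at most a constant times the length of `I`
(`norm_apply_sub_gammaInt_le`). For a subdivision of a bounded interval the errors on the individual
parts are mutually orthogonal, so the error of the Riemann sum `∑ G(Iⱼ) ĥ(λⱼ)` tends to zero with
the mesh (`ProjectionMeasure.tendsto_sum_of_norm_le_length`). This gives `W ĥ = h`: the isometry `W`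
is onto, and its inverse is the transform (`exists_gammaUnitary`).

The spectrum of `F(H_{+,α})` is the essential range of `F` with respect to `E`
(`ProjectionMeasure.operatorSpectrum_op`), and since `W` is onto, `E` and `ρ` have the same null
sets (`gammaMeasure_eq_zero_iff`). The range of `Γ` generates `L²(dx)` under `E`, so the image of a
basis of `𝓗` bounds the multiplicity by `dim 𝓗` (`spectralMultiplicity_idOp_le`).
-/

noncomputable section

/-! ### Linear isometries from Gram matrices -/

/-- Two families of vectors with the same Gram matrix, the first of which is total, are related by
a linear isometry. -/
theorem exists_linearIsometry_of_inner_eq {ι A K : Type*} [NormedAddCommGroup A]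
    [InnerProductSpace ℂ A] [NormedAddCommGroup K] [InnerProductSpace ℂ K] [CompleteSpace K]
    (x : ι → A) (y : ι → K) (h : ∀ i j, ⟪x i, x j⟫_ℂ = ⟪y i, y j⟫_ℂ)
    (hd : (Submodule.span ℂ (range x)).topologicalClosure = ⊤) :
    ∃ V : A →ₗᵢ[ℂ] K, ∀ i, V (x i) = y i := by
  classical
  let e : (ι →₀ ℂ) →ₗ[ℂ] A := Finsupp.linearCombination ℂ x
  let f : (ι →₀ ℂ) →ₗ[ℂ] K := Finsupp.linearCombination ℂ y
  have hn : ∀ c, ‖f c‖ = ‖e c‖ := by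
    intro c
    have h1 : ⟪f c, f c⟫_ℂ = ⟪e c, e c⟫_ℂ := by
      simp only [e, f, Finsupp.linearCombination_apply, Finsupp.sum, sum_inner, inner_sum,
        inner_smul_left, inner_smul_right, h]
    rw [inner_self_eq_norm_sq_to_K, inner_self_eq_norm_sq_to_K] at h1
    have h2 : ‖f c‖ ^ 2 = ‖e c‖ ^ 2 := by exact_mod_cast h1
    exact (sq_eq_sq₀ (norm_nonneg _) (norm_nonneg _)).1 h2
  have hde : DenseRange e := by
    rw [DenseRange, ← LinearMap.coe_range, Finsupp.range_linearCombination, dense_iff_closure_eq,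
      ← Submodule.topologicalClosure_coe, hd, Submodule.top_coe]
  let V : A →L[ℂ] K := f.extendOfNorm e
  have hV : ∀ c, V (e c) = f c := fun c =>
    LinearMap.extendOfNorm_eq hde ⟨1, fun c => by rw [hn, one_mul]⟩ c
  refine ⟨⟨V.toLinearMap, fun a => ?_⟩, fun i => ?_⟩
  · change ‖V a‖ = ‖a‖
    refine hde.induction_on (p := fun a => ‖V a‖ = ‖a‖) a ?_ fun c => ?_
    · exact isClosed_eq (by fun_prop) (by fun_prop)
    · rw [hV, hn]
  · have := hV (Finsupp.single i 1)
    simpa [e, f] using this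

/-! ### Integration with respect to a projection-valued measure -/

namespace ProjectionMeasure

variable {K : Type u} [NormedAddCommGroup K] [InnerProductSpace ℂ K] [CompleteSpace K]
  (E : ProjectionMeasure K)

theorem isSymm (B : Set ℝ) (f g : K) : ⟪E B f, g⟫_ℂ = ⟪f, E B g⟫_ℂ := by
  have h := (E.isStarProjection' B).isSelfAdjoint
  rw [ContinuousLinearMap.isSelfAdjoint_iff'] at h
  rw [← ContinuousLinearMap.adjoint_inner_right, h]

theorem idem (B : Set ℝ) (f : K) : E B (E B f) = E B f :=
  DFunLike.congr_fun (E.isStarProjection' B).isIdempotentElem f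

theorem inner_self (B : Set ℝ) (f : K) : ⟪f, E B f⟫_ℂ = (‖E B f‖ ^ 2 : ℝ) := by
  rw [← E.idem, ← E.isSymm, E.idem, inner_self_eq_norm_sq_to_K]
  norm_cast

theorem norm_apply_le (B : Set ℝ) (f : K) : ‖E B f‖ ≤ ‖f‖ := by
  have h := E.inner_self B f
  have h2 : ‖⟪f, E B f⟫_ℂ‖ ≤ ‖f‖ * ‖E B f‖ := norm_inner_le_norm _ _
  rw [h, Complex.norm_real, Real.norm_of_nonneg (by positivity)] at h2
  by_cases h0 : ‖E B f‖ = 0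
  · rw [h0]; positivity
  · have : 0 < ‖E B f‖ := lt_of_le_of_ne (norm_nonneg _) (Ne.symm h0)
    nlinarith

theorem scalarMeasure_apply (f : K) {B : Set ℝ} (hB : MeasurableSet B) :
    E.scalarMeasure f B = ENNReal.ofReal (‖E B f‖ ^ 2) := by
  rw [scalarMeasure, Measure.ofMeasurable_apply _ hB, E.inner_self, Complex.ofReal_re]

theorem scalarMeasure_univ (f : K) : E.scalarMeasure f univ = ENNReal.ofReal (‖f‖ ^ 2) := by
  rw [E.scalarMeasure_apply f MeasurableSet.univ, E.univ']
  rfl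

instance (f : K) : IsFiniteMeasure (E.scalarMeasure f) :=
  ⟨by rw [E.scalarMeasure_univ]; exact ENNReal.ofReal_lt_top⟩

theorem real_scalarMeasure (f : K) {B : Set ℝ} (hB : MeasurableSet B) :
    (E.scalarMeasure f).real B = ‖E B f‖ ^ 2 := by
  rw [Measure.real, E.scalarMeasure_apply f hB, ENNReal.toReal_ofReal (by positivity)]

theorem union {A B : Set ℝ} (hA : MeasurableSet A) (hB : MeasurableSet B) (h : Disjoint A B) :
    E (A ∪ B) = E A + E B := by
  refine ContinuousLinearMap.coe_injective ((ext_inner_map _ _).1 fun x => ?_)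
  have h1 := measureReal_union (μ := E.scalarMeasure x) h hB
  rw [E.real_scalarMeasure _ (hA.union hB), E.real_scalarMeasure _ hA,
    E.real_scalarMeasure _ hB] at h1
  simp only [ContinuousLinearMap.coe_coe, add_apply, inner_add_left]
  rw [E.isSymm, E.isSymm, E.isSymm, E.inner_self, E.inner_self, E.inner_self, h1]
  push_cast; ring

/-- The range of `E(B)` is orthogonal to the range of `E(A)`: as `E(A ∪ B) = E(A) + E(B)` is a
contraction, `g = E(B) f` satisfies `‖E(A) g + g‖ ≤ ‖g‖`. -/
theorem apply_of_disjoint {A B : Set ℝ} (hA : MeasurableSet A) (hB : MeasurableSet B)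
    (h : Disjoint A B) (f : K) : E A (E B f) = 0 := by
  have h1 := E.inner_self (A ∪ B) (E B f)
  have h2 := E.norm_apply_le (A ∪ B) (E B f)
  rw [E.union hA hB h, add_apply, inner_add_right, E.idem, E.inner_self A] at h1
  replace h1 := congrArg Complex.re h1
  rw [Complex.add_re, Complex.ofReal_re, Complex.ofReal_re] at h1
  have h6 : (⟪E B f, E B f⟫_ℂ).re = ‖E B f‖ ^ 2 := (inner_self_eq_norm_sq (𝕜 := ℂ) _)
  rw [h6] at h1
  rw [E.union hA hB h, add_apply, E.idem] at h2
  have h3 : ‖E A (E B f)‖ ^ 2 + ‖E B f‖ ^ 2 = ‖E A (E B f) + E B f‖ ^ 2 := h1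
  have h4 : ‖E A (E B f)‖ ^ 2 ≤ 0 := by
    nlinarith [norm_nonneg (E A (E B f) + E B f), norm_nonneg (E B f)]
  have h5 : ‖E A (E B f)‖ = 0 := by nlinarith [norm_nonneg (E A (E B f)), sq_nonneg ‖E A (E B f)‖]
  exact norm_eq_zero.1 h5

theorem apply_apply {A B : Set ℝ} (hA : MeasurableSet A) (hB : MeasurableSet B) (f : K) :
    E A (E B f) = E (A ∩ B) f := by
  have h1 : E A = E (A ∩ B) + E (A \ B) := by
    rw [← E.union (hA.inter hB) (hA.diff hB) disjoint_sdiff_inter.symm, inter_union_sdiff]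
  have h2 : E B = E (A ∩ B) + E (B \ A) := by
    rw [← E.union (hA.inter hB) (hB.diff hA)
      (Set.disjoint_left.2 fun x hx hx' => hx'.2 hx.1), inter_comm, inter_union_sdiff]
  rw [h1, add_apply, E.apply_of_disjoint (hA.diff hB) hB disjoint_sdiff_left, add_zero, h2,
    add_apply, map_add, E.idem, E.apply_of_disjoint (hA.inter hB) (hB.diff hA)
      (Set.disjoint_left.2 fun x hx hx' => hx'.2 hx.1), add_zero]

theorem inner_apply_apply {A B : Set ℝ} (hA : MeasurableSet A) (hB : MeasurableSet B) (f : K) :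
    ⟪E A f, E B f⟫_ℂ = ((E.scalarMeasure f).real (A ∩ B) : ℂ) := by
  rw [E.isSymm, E.apply_apply hA hB, E.inner_self, E.real_scalarMeasure _ (hA.inter hB)]

/-- The indicator function of a Borel set as an element of `L²(d(f, E f))`. -/
def indLp (f : K) (B : {B : Set ℝ // MeasurableSet B}) : Lp ℂ 2 (E.scalarMeasure f) :=
  indicatorConstLp 2 B.2 (measure_ne_top _ _) 1

/-- Indicator functions span a dense subspace of `L²(d(f, E f))`. -/
theorem span_indLp (f : K) :
    (Submodule.span ℂ (range (E.indLp f))).topologicalClosure = ⊤ := by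
  rw [eq_top_iff]
  rintro g -
  refine Lp.induction (by simp) (motive := fun g => g ∈
    (Submodule.span ℂ (range (E.indLp f))).topologicalClosure) ?_ ?_ ?_ g
  · intro c s hs hμ
    refine Submodule.le_topologicalClosure _ ?_
    have : (Lp.simpleFunc.indicatorConst 2 hs hμ.ne c : Lp ℂ 2 (E.scalarMeasure f)) =
        c • E.indLp f ⟨s, hs⟩ := by
      rw [Lp.simpleFunc.coe_indicatorConst]
      refine Lp.ext ?_
      filter_upwards [Lp.coeFn_smul c (E.indLp f ⟨s, hs⟩),
        indicatorConstLp_coeFn (p := 2) (hs := hs) (hμs := hμ.ne) (c := c),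
        indicatorConstLp_coeFn (p := 2) (hs := hs) (hμs := hμ.ne) (c := (1 : ℂ))] with x h1 h2 h3
      rw [h1, h2, Pi.smul_apply, indLp, h3]
      by_cases hx : x ∈ s <;> simp [hx]
    rw [this]
    exact Submodule.smul_mem _ _ (Submodule.subset_span ⟨_, rfl⟩)
  · intro f g hf hg _ h1 h2
    exact add_mem h1 h2
  · exact Submodule.isClosed_topologicalClosure _

/-- The assignment `χ_B ↦ E(B) f` extends to an isometry of `L²(d(f, E f))` into `K`, because both
families have the Gram matrix `(f, E(A ∩ B) f)`. -/
theorem exists_isometry (f : K) : ∃ V : Lp ℂ 2 (E.scalarMeasure f) →ₗᵢ[ℂ] K,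
    ∀ B, V (E.indLp f B) = E B f := by
  refine exists_linearIsometry_of_inner_eq (E.indLp f) (fun B => E B f) ?_ (E.span_indLp f)
  rintro ⟨A, hA⟩ ⟨B, hB⟩
  rw [E.inner_apply_apply hA hB, indLp, indLp, L2.inner_indicatorConstLp_indicatorConstLp]
  simp

/-- The isometry of `L²(d(f, E f))` into `K` that sends the indicator function of `B`
to `E(B) f`. -/
def isom (f : K) : Lp ℂ 2 (E.scalarMeasure f) →ₗᵢ[ℂ] K := (E.exists_isometry f).choose

open Classical in
/-- The vector `(∫ F dE) f`, with the conventional value `0` unless `F` is square integrable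
with respect to `d(f, E f)`. -/
def int (F : ℝ → ℂ) (f : K) : K :=
  if h : MemLp F 2 (E.scalarMeasure f) then E.isom f (h.toLp F) else 0

variable {E}

theorem int_def {F : ℝ → ℂ} {f : K} (h : MemLp F 2 (E.scalarMeasure f)) :
    E.int F f = E.isom f (h.toLp F) := dif_pos h

theorem int_indicator (f : K) {B : Set ℝ} (hB : MeasurableSet B) :
    E.int (B.indicator 1) f = E B f := by
  have h : MemLp (B.indicator (1 : ℝ → ℂ)) 2 (E.scalarMeasure f) :=
    (memLp_const (1 : ℂ)).indicator hB
  rw [int_def h]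
  exact (E.exists_isometry f).choose_spec ⟨B, hB⟩

theorem int_add {F G : ℝ → ℂ} {f : K} (hF : MemLp F 2 (E.scalarMeasure f))
    (hG : MemLp G 2 (E.scalarMeasure f)) : E.int (F + G) f = E.int F f + E.int G f := by
  rw [int_def hF, int_def hG, int_def (hF.add hG), ← map_add]; rfl

theorem int_smul {F : ℝ → ℂ} {f : K} (c : ℂ) (hF : MemLp F 2 (E.scalarMeasure f)) :
    E.int (c • F) f = c • E.int F f := by
  rw [int_def hF, int_def (hF.const_smul c), ← map_smul]; rfl

theorem int_sub {F G : ℝ → ℂ} {f : K} (hF : MemLp F 2 (E.scalarMeasure f))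
    (hG : MemLp G 2 (E.scalarMeasure f)) : E.int (F - G) f = E.int F f - E.int G f := by
  rw [int_def hF, int_def hG, int_def (hF.sub hG), ← map_sub]; rfl

theorem inner_int_int {F G : ℝ → ℂ} {f : K} (hF : MemLp F 2 (E.scalarMeasure f))
    (hG : MemLp G 2 (E.scalarMeasure f)) :
    ⟪E.int F f, E.int G f⟫_ℂ = ∫ l, starRingEnd ℂ (F l) * G l ∂(E.scalarMeasure f) := by
  rw [int_def hF, int_def hG, LinearIsometry.inner_map_map, L2.inner_def]
  refine integral_congr_ae ?_
  filter_upwards [hF.coeFn_toLp, hG.coeFn_toLp] with x h1 h2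
  rw [h1, h2, RCLike.inner_apply, mul_comm]

theorem int_one (f : K) : E.int 1 f = f := by
  have := int_indicator (E := E) f MeasurableSet.univ
  rw [indicator_univ, E.univ'] at this
  exact this

theorem inner_int {F : ℝ → ℂ} {f : K} (hF : MemLp F 2 (E.scalarMeasure f)) :
    ⟪f, E.int F f⟫_ℂ = ∫ l, F l ∂(E.scalarMeasure f) := by
  have := inner_int_int (f := f) (E := E) (memLp_const 1) hF
  change ⟪E.int 1 f, _⟫_ℂ = _ at this
  rw [int_one] at this
  simpa using this

theorem enorm_int {F : ℝ → ℂ} {f : K} (hF : MemLp F 2 (E.scalarMeasure f)) :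
    ‖E.int F f‖ₑ = eLpNorm F 2 (E.scalarMeasure f) := by
  rw [int_def hF, LinearIsometry.enorm_map, Lp.enorm_toLp]

end ProjectionMeasure

/-! ### Calculus of the integrals `∫ F dE` -/

theorem sq_eLpNorm_two {X : Type*} [MeasurableSpace X] (μ : Measure X) (F : X → ℂ) :
    eLpNorm F 2 μ ^ 2 = ∫⁻ l, ‖F l‖ₑ ^ 2 ∂μ := by
  have := eLpNorm_nnreal_pow_eq_lintegral (μ := μ) (f := F) (p := 2) (by norm_num)
  simpa using this

theorem memLp_two_iff {X : Type*} [MeasurableSpace X] {μ : Measure X} {F : X → ℂ}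
    (hF : Measurable F) : MemLp F 2 μ ↔ ∫⁻ l, ‖F l‖ₑ ^ 2 ∂μ < ∞ := by
  rw [← sq_eLpNorm_two, MemLp]
  simp [hF.aestronglyMeasurable, lt_top_iff_ne_top]

theorem MeasureTheory.MemLp.add_measure_two {X : Type*} [MeasurableSpace X] {μ ν : Measure X}
    {F : X → ℂ} (hF : Measurable F) (h1 : MemLp F 2 μ) (h2 : MemLp F 2 ν) :
    MemLp F 2 (μ + ν) := by
  rw [memLp_two_iff hF] at *
  rw [lintegral_add_measure]
  exact ENNReal.add_lt_top.2 ⟨h1, h2⟩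

/-- Two maps on functions that are Lipschitz with respect to the `L²(ν)` norm and agree on simple
functions agree on all of `L²(ν)`. -/
theorem eq_of_eq_on_simpleFunc {X Y : Type*} [MeasurableSpace X] [NormedAddCommGroup Y]
    {ν : Measure X} {F : X → ℂ} (hF : MemLp F 2 ν) (L R : (X → ℂ) → Y) (C : ℝ≥0∞) (hC : C ≠ ∞)
    (hL : ∀ s : SimpleFunc X ℂ, MemLp s 2 ν → ‖L F - L s‖ₑ ≤ C * eLpNorm (F - ⇑s) 2 ν)
    (hR : ∀ s : SimpleFunc X ℂ, MemLp s 2 ν → ‖R F - R s‖ₑ ≤ C * eLpNorm (F - ⇑s) 2 ν)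
    (h : ∀ s : SimpleFunc X ℂ, L s = R s) : L F = R F := by
  rw [← sub_eq_zero, ← enorm_eq_zero]
  refine le_antisymm (le_of_forall_gt fun ε hε => ?_) bot_le
  have h2 : (2 * C + 1) ≠ ∞ := by simp [ENNReal.mul_eq_top, hC]
  obtain ⟨s, hs, hm⟩ := hF.exists_simpleFunc_eLpNorm_sub_lt (by norm_num)
    (ENNReal.div_pos hε.ne' h2).ne'
  calc ‖L F - R F‖ₑ = ‖(L F - L s) - (R F - R s)‖ₑ := by rw [h s]; congr 1; abel
    _ ≤ ‖L F - L s‖ₑ + ‖R F - R s‖ₑ := enorm_sub_le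
    _ ≤ C * eLpNorm (F - ⇑s) 2 ν + C * eLpNorm (F - ⇑s) 2 ν := add_le_add (hL s hm) (hR s hm)
    _ = 2 * C * eLpNorm (F - ⇑s) 2 ν := by ring
    _ ≤ (2 * C + 1) * eLpNorm (F - ⇑s) 2 ν := by gcongr; exact le_self_add
    _ < ε := by
      rw [mul_comm]
      exact (ENNReal.lt_div_iff_mul_lt (by simp) (by simp [h2])).1 hs

theorem coe_piecewise_const {X : Type*} [MeasurableSpace X] (c : ℂ) {B : Set X}
    (hB : MeasurableSet B) :
    ⇑(SimpleFunc.piecewise B hB (SimpleFunc.const X c) (SimpleFunc.const X 0)) =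
      B.indicator fun _ => c := by
  ext x
  by_cases hx : x ∈ B <;> simp [hx]

theorem enorm_inner_le {Y : Type*} [NormedAddCommGroup Y] [InnerProductSpace ℂ Y] (x y : Y) :
    ‖⟪x, y⟫_ℂ‖ₑ ≤ ‖x‖ₑ * ‖y‖ₑ := by
  rw [← ofReal_norm, ← ofReal_norm, ← ofReal_norm, ← ENNReal.ofReal_mul (norm_nonneg _)]
  exact ENNReal.ofReal_le_ofReal (norm_inner_le_norm x y)

namespace ProjectionMeasure

variable {K : Type u} [NormedAddCommGroup K] [InnerProductSpace ℂ K] [CompleteSpace K]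
  {E : ProjectionMeasure K}

theorem memLp_of_bounded {F : ℝ → ℂ} (hF : Measurable F) {C : ℝ} (hC : ∀ l, ‖F l‖ ≤ C)
    (f : K) : MemLp F 2 (E.scalarMeasure f) :=
  MemLp.of_bound hF.aestronglyMeasurable C (Eventually.of_forall hC)

theorem memLp_simple (s : SimpleFunc ℝ ℂ) (f : K) : MemLp s 2 (E.scalarMeasure f) :=
  s.memLp_of_isFiniteMeasure 2 _

theorem enorm_int_sub {F G : ℝ → ℂ} {f : K} (hF : MemLp F 2 (E.scalarMeasure f))
    (hG : MemLp G 2 (E.scalarMeasure f)) :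
    ‖E.int F f - E.int G f‖ₑ = eLpNorm (F - G) 2 (E.scalarMeasure f) := by
  rw [← int_sub hF hG, enorm_int (hF.sub hG)]

theorem int_const_indicator (c : ℂ) {B : Set ℝ} (hB : MeasurableSet B) (f : K) :
    E.int (B.indicator fun _ => c) f = c • E B f := by
  have h1 : MemLp (B.indicator (1 : ℝ → ℂ)) 2 (E.scalarMeasure f) :=
    (memLp_const (1 : ℂ)).indicator hB
  rw [← int_indicator f hB, ← int_smul c h1]
  congr 1
  ext x
  by_cases hx : x ∈ B <;> simp [hx]

/-- The integral of a simple function is a linear combination of spectral projections. -/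
theorem exists_int_simple (E : ProjectionMeasure K) (s : SimpleFunc ℝ ℂ) :
    ∃ T ∈ Submodule.span ℂ {T | ∃ B, MeasurableSet B ∧ T = E B}, ∀ f : K, E.int s f = T f := by
  induction s using SimpleFunc.induction with
  | const c hs =>
    refine ⟨c • E _, Submodule.smul_mem _ _ (Submodule.subset_span ⟨_, hs, rfl⟩), fun f => ?_⟩
    rw [smul_apply, ← int_const_indicator c hs f]
    rw [coe_piecewise_const]
  | add _ h1 h2 =>
    obtain ⟨T, hT, h1⟩ := h1
    obtain ⟨S, hS, h2⟩ := h2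
    refine ⟨T + S, add_mem hT hS, fun x => ?_⟩
    rw [SimpleFunc.coe_add, int_add (memLp_simple _ _) (memLp_simple _ _), h1, h2]
    rfl

/-- `E(B) ∫ F dE = ∫ χ_B F dE`; both sides are continuous in `F ∈ L²(d(f, E f))`. -/
theorem apply_int {F : ℝ → ℂ} {f : K} (hF : MemLp F 2 (E.scalarMeasure f)) {B : Set ℝ}
    (hB : MeasurableSet B) : E B (E.int F f) = E.int (B.indicator F) f := by
  refine eq_of_eq_on_simpleFunc hF (fun F => E B (E.int F f)) (fun F => E.int (B.indicator F) f) 1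
    (by simp) ?_ ?_ ?_
  · intro s hs
    rw [one_mul, ← enorm_int_sub hF hs, ← map_sub, enorm_le_iff_norm_le]
    exact E.norm_apply_le _ _
  · intro s hs
    rw [one_mul, enorm_int_sub (hF.indicator hB) (hs.indicator hB), ← indicator_sub']
    exact eLpNorm_indicator_le _
  · intro s
    induction s using SimpleFunc.induction with
    | const c hs =>
      rename_i C
      rw [coe_piecewise_const, indicator_indicator, int_const_indicator c hs,
        int_const_indicator c (hB.inter hs), map_smul, E.apply_apply hB hs]
    | add _ h1 h2 =>
      rename_i s t _
      rw [SimpleFunc.coe_add, int_add (memLp_simple _ _) (memLp_simple _ _), map_add, h1, h2,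
        indicator_add', int_add ((memLp_simple _ _).indicator hB) ((memLp_simple _ _).indicator hB)]

/-- The scalar measure of `(∫ F dE) f` is `|F|² d(f, E f)`. -/
theorem scalarMeasure_int {F : ℝ → ℂ} {f : K}
    (hF : MemLp F 2 (E.scalarMeasure f)) :
    E.scalarMeasure (E.int F f) = (E.scalarMeasure f).withDensity (fun l => ‖F l‖ₑ ^ 2) := by
  ext B hB
  rw [E.scalarMeasure_apply _ hB, apply_int hF hB, withDensity_apply _ hB,
    ENNReal.ofReal_pow (norm_nonneg _), ofReal_norm, enorm_int (hF.indicator hB),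
    sq_eLpNorm_two, ← lintegral_indicator hB]
  refine lintegral_congr fun l => ?_
  by_cases hl : l ∈ B <;> simp [hl]

/-- Additivity of `(∫ F dE) f` in the vector `f`. The integrals at `f`, `g` and `f + g` are defined
through different spaces `L²`; they are compared in `L²` of the sum of the three scalar measures,
where simple functions are dense. -/
theorem int_vec_add {F : ℝ → ℂ} (hFm : Measurable F) {f g : K}
    (hf : MemLp F 2 (E.scalarMeasure f)) (hg : MemLp F 2 (E.scalarMeasure g)) :
    MemLp F 2 (E.scalarMeasure (f + g)) ∧ E.int F (f + g) = E.int F f + E.int F g := by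
  have hle : E.scalarMeasure (f + g) ≤ 2 • (E.scalarMeasure f + E.scalarMeasure g) := by
    refine Measure.le_iff.2 fun B hB => ?_
    rw [E.scalarMeasure_apply _ hB, Measure.smul_apply, Measure.add_apply,
      E.scalarMeasure_apply _ hB, E.scalarMeasure_apply _ hB, ← ENNReal.ofReal_add (by positivity)
      (by positivity), ← ENNReal.ofReal_nsmul]
    refine ENNReal.ofReal_le_ofReal ?_
    rw [map_add]
    have := norm_add_le (E B f) (E B g)
    have := norm_nonneg (E B f + E B g)
    rw [nsmul_eq_mul, Nat.cast_ofNat]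
    nlinarith [sq_nonneg (‖E B f‖ - ‖E B g‖)]
  have hfg : MemLp F 2 (E.scalarMeasure (f + g)) := by
    rw [memLp_two_iff hFm] at *
    refine (lintegral_mono' hle le_rfl).trans_lt ?_
    rw [two_smul, lintegral_add_measure, lintegral_add_measure]
    exact ENNReal.add_lt_top.2 ⟨ENNReal.add_lt_top.2 ⟨hf, hg⟩, ENNReal.add_lt_top.2 ⟨hf, hg⟩⟩
  refine ⟨hfg, ?_⟩
  have h1 : E.scalarMeasure f ≤ E.scalarMeasure f + E.scalarMeasure g + E.scalarMeasure (f + g) := by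
    rw [add_assoc]; exact Measure.le_add_right le_rfl
  have h2 : E.scalarMeasure g ≤ E.scalarMeasure f + E.scalarMeasure g + E.scalarMeasure (f + g) := by
    rw [add_right_comm]; exact Measure.le_add_left le_rfl
  have h3 : E.scalarMeasure (f + g) ≤
      E.scalarMeasure f + E.scalarMeasure g + E.scalarMeasure (f + g) := Measure.le_add_left le_rfl
  refine eq_of_eq_on_simpleFunc ((hf.add_measure_two hFm hg).add_measure_two hFm hfg)
    (fun F => E.int F (f + g)) (fun F => E.int F f + E.int F g) 2 (by simp) ?_ ?_ ?_
  · intro s hs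
    rw [enorm_int_sub hfg (hs.mono_measure h3), two_mul]
    exact (eLpNorm_mono_measure _ h3).trans le_self_add
  · intro s hs
    rw [add_sub_add_comm, two_mul]
    refine (enorm_add_le _ _).trans (add_le_add ?_ ?_)
    · rw [enorm_int_sub hf (hs.mono_measure h1)]
      exact eLpNorm_mono_measure _ h1
    · rw [enorm_int_sub hg (hs.mono_measure h2)]
      exact eLpNorm_mono_measure _ h2
  · intro s
    obtain ⟨T, -, hT⟩ := E.exists_int_simple s
    simp only [hT, map_add]

theorem scalarMeasure_smul (c : ℂ) (f : K) :
    E.scalarMeasure (c • f) = (‖c‖ₑ ^ 2) • E.scalarMeasure f := by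
  ext B hB
  rw [E.scalarMeasure_apply _ hB, Measure.smul_apply, E.scalarMeasure_apply _ hB, map_smul,
    norm_smul, mul_pow, ENNReal.ofReal_mul (by positivity), ENNReal.ofReal_pow (norm_nonneg _),
    ofReal_norm, smul_eq_mul]

theorem int_vec_smul {F : ℝ → ℂ} (hFm : Measurable F) {f : K} (c : ℂ)
    (hf : MemLp F 2 (E.scalarMeasure f)) :
    MemLp F 2 (E.scalarMeasure (c • f)) ∧ E.int F (c • f) = c • E.int F f := by
  have hc : MemLp F 2 (E.scalarMeasure (c • f)) := by
    rw [scalarMeasure_smul]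
    exact hf.smul_measure (by finiteness)
  refine ⟨hc, ?_⟩
  refine eq_of_eq_on_simpleFunc (hf.add_measure_two hFm hc)
    (fun F => E.int F (c • f)) (fun F => c • E.int F f) (‖c‖ₑ + 1) (by finiteness) ?_ ?_ ?_
  · intro s hs
    rw [enorm_int_sub hc hs.right_of_add_measure, add_mul, one_mul]
    exact (eLpNorm_mono_measure _ (Measure.le_add_left le_rfl)).trans le_add_self
  · intro s hs
    rw [← smul_sub, enorm_smul, enorm_int_sub hf hs.left_of_add_measure, add_mul]
    exact (mul_le_mul_right (eLpNorm_mono_measure _ (Measure.le_add_right le_rfl)) _).trans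
      le_self_add
  · intro s
    obtain ⟨T, -, hT⟩ := E.exists_int_simple s
    simp only [hT, map_smul]

/-- Composition of integrals: `∫ G dE ∫ F dE = ∫ G F dE`. -/
theorem int_int {F G : ℝ → ℂ} (hFm : Measurable F) (hGm : Measurable G) {f : K}
    (hF : MemLp F 2 (E.scalarMeasure f)) (hGF : MemLp (G * F) 2 (E.scalarMeasure f)) :
    MemLp G 2 (E.scalarMeasure (E.int F f)) ∧ E.int G (E.int F f) = E.int (G * F) f := by
  have hnorm : ∀ G : ℝ → ℂ, Measurable G → eLpNorm G 2 (E.scalarMeasure (E.int F f)) =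
      eLpNorm (G * F) 2 (E.scalarMeasure f) := by
    intro G hGm
    refine (ENNReal.pow_right_strictMono (two_ne_zero)).injective ?_
    rw [sq_eLpNorm_two, sq_eLpNorm_two,
      scalarMeasure_int hF, lintegral_withDensity_eq_lintegral_mul _ (by fun_prop)
      (by fun_prop)]
    refine lintegral_congr fun l => ?_
    simp only [Pi.mul_apply, enorm_mul, mul_pow]
    ring
  have hG : MemLp G 2 (E.scalarMeasure (E.int F f)) :=
    ⟨hGm.aestronglyMeasurable, by rw [hnorm G hGm]; exact hGF.2⟩
  refine ⟨hG, ?_⟩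
  have hsF : ∀ s : SimpleFunc ℝ ℂ, MemLp (⇑s * F) 2 (E.scalarMeasure f) := fun s =>
    ⟨(s.measurable.mul hFm).aestronglyMeasurable, by
      rw [← hnorm s s.measurable]; exact (memLp_simple s _).2⟩
  refine eq_of_eq_on_simpleFunc hG (fun G => E.int G (E.int F f)) (fun G => E.int (G * F) f) 1
    (by simp) ?_ ?_ ?_
  · intro s hs
    rw [one_mul, enorm_int_sub hG hs]
  · intro s hs
    rw [one_mul, enorm_int_sub hGF (hsF s), ← sub_mul, hnorm _ (hGm.sub s.measurable)]
  · intro s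
    induction s using SimpleFunc.induction with
    | const c hs =>
      rename_i C
      rw [coe_piecewise_const, int_const_indicator c hs, apply_int hF hs,
        ← int_smul _ (hF.indicator hs)]
      congr 1
      ext x
      by_cases hx : x ∈ C <;> simp [hx]
    | add _ h1 h2 =>
      rename_i s t _
      rw [SimpleFunc.coe_add, int_add (memLp_simple _ _) (memLp_simple _ _), h1, h2, add_mul,
        int_add (hsF s) (hsF t)]

/-- The adjoint of `∫ F dE` is the integral of the complex conjugate of `F`. -/
theorem inner_int_right {F : ℝ → ℂ} (hFm : Measurable F) {f g : K}
    (hf : MemLp F 2 (E.scalarMeasure f)) (hg : MemLp F 2 (E.scalarMeasure g)) :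
    ⟪g, E.int F f⟫_ℂ = ⟪E.int (fun l => starRingEnd ℂ (F l)) g, f⟫_ℂ := by
  have hc : ∀ {F : ℝ → ℂ}, MemLp F 2 (E.scalarMeasure g) →
      MemLp (fun l => starRingEnd ℂ (F l)) 2 (E.scalarMeasure g) := fun h => h.star
  refine eq_of_eq_on_simpleFunc (hf.add_measure_two hFm hg)
    (fun F => ⟪g, E.int F f⟫_ℂ) (fun F => ⟪E.int (fun l => starRingEnd ℂ (F l)) g, f⟫_ℂ)
    (‖g‖ₑ + ‖f‖ₑ) (by finiteness) ?_ ?_ ?_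
  · intro s hs
    rw [← inner_sub_right]
    refine (enorm_inner_le _ _).trans ?_
    rw [enorm_int_sub hf hs.left_of_add_measure]
    exact mul_le_mul' le_self_add (eLpNorm_mono_measure _ (Measure.le_add_right le_rfl))
  · intro s hs
    rw [← inner_sub_left]
    refine (enorm_inner_le _ _).trans ?_
    rw [enorm_int_sub (hc hg) (hc hs.right_of_add_measure), mul_comm]
    refine mul_le_mul' le_add_self ?_
    refine le_trans (le_of_eq ?_) (eLpNorm_mono_measure _ (Measure.le_add_left le_rfl))
    refine eLpNorm_congr_norm_ae (Eventually.of_forall fun l => ?_)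
    simp only [Pi.sub_apply, ← map_sub, RCLike.norm_conj]
  · intro s
    induction s using SimpleFunc.induction with
    | const c hs =>
      rename_i C
      have h2 : (fun l => starRingEnd ℂ (C.indicator (fun _ => c) l)) =
          C.indicator fun _ => starRingEnd ℂ c := by
        ext x
        by_cases hx : x ∈ C <;> simp [hx]
      rw [coe_piecewise_const, h2, int_const_indicator c hs, int_const_indicator _ hs,
        inner_smul_left, inner_smul_right, E.isSymm, Complex.conj_conj]
    | add _ h1 h2 =>
      rename_i s t _
      rw [SimpleFunc.coe_add, int_add (memLp_simple _ _) (memLp_simple _ _), inner_add_right, h1,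
        h2, ← inner_add_left, ← int_add (hc (memLp_simple _ _)) (hc (memLp_simple _ _))]
      congr 2
      ext x
      simp

end ProjectionMeasure

/-! ### The operators `∫ F dE` and their spectra -/

namespace ProjectionMeasure

variable {K : Type u} [NormedAddCommGroup K] [InnerProductSpace ℂ K] [CompleteSpace K]
  {E : ProjectionMeasure K}

theorem compl {B : Set ℝ} (hB : MeasurableSet B) (f : K) : E Bᶜ f = f - E B f := by
  have h := E.union hB hB.compl disjoint_compl_right
  rw [union_compl_self, E.univ'] at h
  have := DFunLike.congr_fun h f
  change f = E B f + E Bᶜ f at this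
  rw [eq_sub_iff_add_eq, add_comm]
  exact this.symm

theorem tendsto_apply {B : ℕ → Set ℝ} (hB : ∀ n, MeasurableSet (B n)) (hm : Monotone B)
    (hU : ⋃ n, B n = univ) (f : K) : Tendsto (fun n => E (B n) f) atTop (𝓝 f) := by
  have h1 : Tendsto (fun n => E.scalarMeasure f (B n)ᶜ) atTop (𝓝 0) := by
    have := tendsto_measure_iInter_atTop (μ := E.scalarMeasure f) (s := fun n => (B n)ᶜ)
      (fun n => (hB n).compl.nullMeasurableSet) (fun i j hij => compl_subset_compl.2 (hm hij))
      ⟨0, measure_ne_top _ _⟩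
    rwa [← compl_iUnion, hU, compl_univ, measure_empty] at this
  rw [tendsto_iff_norm_sub_tendsto_zero]
  have h2 : ∀ n, ‖E (B n) f - f‖ = √(E.scalarMeasure f (B n)ᶜ).toReal := by
    intro n
    have := E.real_scalarMeasure f (hB n).compl
    rw [Measure.real, compl (hB n), norm_sub_rev] at this
    rw [this, Real.sqrt_sq (norm_nonneg _)]
  simp_rw [h2]
  have h3 := (ENNReal.tendsto_toReal ENNReal.zero_ne_top).comp h1
  simpa [Function.comp_def] using (Real.continuous_sqrt.tendsto _).comp h3

theorem int_apply_eq {F : ℝ → ℂ} (hFm : Measurable F) {f : K} {B : Set ℝ} (hB : MeasurableSet B)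
    (hF : MemLp (B.indicator F) 2 (E.scalarMeasure f)) :
    MemLp F 2 (E.scalarMeasure (E B f)) ∧ E.int F (E B f) = E.int (B.indicator F) f := by
  have h1 : F * B.indicator 1 = B.indicator F := by
    ext x; by_cases hx : x ∈ B <;> simp [hx]
  have h2 := int_int (E := E) (f := f) (F := B.indicator 1) (G := F)
    (measurable_const.indicator hB) hFm ((memLp_const (1 : ℂ)).indicator hB) (by rwa [h1])
  rwa [int_indicator f hB, h1] at h2

theorem memLp_indicator_of_bounded {F : ℝ → ℂ} (hFm : Measurable F) {f : K} {B : Set ℝ}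
    (hB : MeasurableSet B) {C : ℝ} (hC : ∀ l ∈ B, ‖F l‖ ≤ C) :
    MemLp (B.indicator F) 2 (E.scalarMeasure f) := by
  refine memLp_of_bounded (hFm.indicator hB) (C := max C 0) (fun l => ?_) f
  by_cases hl : l ∈ B
  · rw [indicator_of_mem hl]; exact (hC l hl).trans (le_max_left _ _)
  · rw [indicator_of_notMem hl]; simp

/-- If `|F| ≤ C` on `B`, then `‖∫_B F dE f‖ ≤ C ‖E(B) f‖`. With `F(λ) = λ - t` and a short interval
`B` around `t`, the vector `E(B) f` is an almost-eigenvector. -/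
theorem norm_int_indicator_le {F : ℝ → ℂ} (hFm : Measurable F) (f : K) {B : Set ℝ}
    (hB : MeasurableSet B) {C : ℝ} (hC0 : 0 ≤ C) (hC : ∀ l ∈ B, ‖F l‖ ≤ C) :
    ‖E.int (B.indicator F) f‖ ≤ C * ‖E B f‖ := by
  have hm := memLp_indicator_of_bounded (E := E) hFm (f := f) hB hC
  have h1 : ‖E.int (B.indicator F) f‖ₑ ^ 2 ≤ (ENNReal.ofReal C * ‖E B f‖ₑ) ^ 2 := by
    rw [enorm_int hm, sq_eLpNorm_two, mul_pow, ← ofReal_norm (E B f),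
      ← ENNReal.ofReal_pow (norm_nonneg _), ← E.scalarMeasure_apply f hB,
      ← lintegral_indicator_const hB]
    refine lintegral_mono fun l => ?_
    by_cases hl : l ∈ B
    · rw [indicator_of_mem hl, indicator_of_mem hl]
      gcongr
      rw [← ofReal_norm]
      exact ENNReal.ofReal_le_ofReal (hC l hl)
    · simp [hl]
  rw [← ofReal_norm, ← ofReal_norm, ← ENNReal.ofReal_mul hC0, ← ENNReal.ofReal_pow (by positivity),
    ← ENNReal.ofReal_pow (by positivity), ENNReal.ofReal_le_ofReal_iff (by positivity)] at h1
  exact (sq_le_sq₀ (by positivity) (by positivity)).1 h1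

/-- A vector lies in the domain of `∫ F dE` as soon as the truncated integrals stay bounded, by
monotone convergence. -/
theorem memLp_of_tendsto {F : ℝ → ℂ} (hFm : Measurable F) {f : K} {B : ℕ → Set ℝ}
    (hB : ∀ n, MeasurableSet (B n)) (hm : Monotone B) (hU : ⋃ n, B n = univ) {C : ℝ}
    (hF : ∀ n, MemLp ((B n).indicator F) 2 (E.scalarMeasure f))
    (hC : ∀ n, ‖E.int ((B n).indicator F) f‖ ≤ C) : MemLp F 2 (E.scalarMeasure f) := by
  rw [memLp_two_iff hFm]
  have h1 : ∀ n, ∫⁻ l in B n, ‖F l‖ₑ ^ 2 ∂(E.scalarMeasure f) ≤ ENNReal.ofReal (C ^ 2) := by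
    intro n
    have h2 := enorm_int (hF n)
    rw [← lintegral_indicator (hB n)]
    calc _ = eLpNorm ((B n).indicator F) 2 (E.scalarMeasure f) ^ 2 := by
          rw [sq_eLpNorm_two]
          refine lintegral_congr fun l => ?_
          by_cases hl : l ∈ B n <;> simp [hl]
      _ ≤ _ := by
          rw [← h2, ← ofReal_norm, ← ENNReal.ofReal_pow (norm_nonneg _)]
          refine ENNReal.ofReal_le_ofReal ?_
          have := hC n
          gcongr
  have h3 := setLIntegral_iUnion_of_directed (μ := E.scalarMeasure f) (fun l => ‖F l‖ₑ ^ 2)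
    (directed_of_isDirected_le hm)
  rw [hU, setLIntegral_univ] at h3
  rw [h3]
  exact (iSup_le h1).trans_lt ENNReal.ofReal_lt_top

/-- The operator `∫ F dE` with its maximal domain. -/
def op (E : ProjectionMeasure K) (F : ℝ → ℂ) (hF : Measurable F) : K →ₗ.[ℂ] K where
  domain :=
    { carrier := {f | MemLp F 2 (E.scalarMeasure f)}
      add_mem' := fun h1 h2 => (int_vec_add hF h1 h2).1
      zero_mem' := by
        have h := (int_vec_smul (E := E) (f := (0 : K)) (F := 0) measurable_zero 0 MemLp.zero).1
        change MemLp F 2 (E.scalarMeasure 0)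
        have : E.scalarMeasure 0 = 0 := by
          have := scalarMeasure_smul (E := E) 0 (0 : K)
          simpa using this
        rw [this]
        exact ⟨aestronglyMeasurable_zero_measure _, by simp⟩
      smul_mem' := fun c _ h => (int_vec_smul hF c h).1 }
  toFun :=
    { toFun := fun f => E.int F f
      map_add' := fun f g => (int_vec_add hF f.2 g.2).2
      map_smul' := fun c f => (int_vec_smul hF c f.2).2 }

theorem mem_op_domain {F : ℝ → ℂ} (hF : Measurable F) {f : K} :
    f ∈ (E.op F hF).domain ↔ MemLp F 2 (E.scalarMeasure f) := Iff.rfl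

theorem mem_op_graph {F : ℝ → ℂ} (hF : Measurable F) {f g : K} :
    (f, g) ∈ (E.op F hF).graph ↔ MemLp F 2 (E.scalarMeasure f) ∧ E.int F f = g := by
  rw [LinearPMap.mem_graph_iff]
  constructor
  · rintro ⟨y, rfl, rfl⟩
    exact ⟨y.2, rfl⟩
  · rintro ⟨h1, rfl⟩
    exact ⟨⟨f, h1⟩, rfl, rfl⟩

theorem dense_op_domain {F : ℝ → ℂ} (hF : Measurable F) :
    Dense ((E.op F hF).domain : Set K) := by
  intro f
  have hB : ∀ n : ℕ, MeasurableSet {l | ‖F l‖ ≤ n} := fun n => hF.norm measurableSet_Iic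
  have h1 : Tendsto (fun n : ℕ => E {l | ‖F l‖ ≤ n} f) atTop (𝓝 f) := by
    refine tendsto_apply hB ?_ ?_ f
    · intro m n hmn l hl
      have h : ‖F l‖ ≤ m := hl
      exact h.trans (Nat.cast_le.2 hmn)
    · exact eq_univ_of_forall fun l => mem_iUnion.2 (exists_nat_ge ‖F l‖)
  refine mem_closure_of_tendsto h1 (Eventually.of_forall fun n => ?_)
  exact (int_apply_eq hF (hB n) (memLp_indicator_of_bounded hF (hB n) fun l hl => hl)).1

theorem isIntegral_op {F : ℝ → ℂ} (hF : Measurable F) : E.IsIntegral F (E.op F hF) :=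
  ⟨fun f => by rw [mem_op_domain, memLp_two_iff hF], fun f => inner_int f.2⟩

/-- The operator `∫ F dE` is determined by its domain and its quadratic form. -/
theorem IsIntegral.eq_op {F : ℝ → ℂ} (hF : Measurable F) {A : K →ₗ.[ℂ] K}
    (hA : E.IsIntegral F A) : A = E.op F hF := by
  have hdom : A.domain = (E.op F hF).domain := by
    ext f
    rw [hA.1, mem_op_domain, memLp_two_iff hF]
  let D : A.domain →ₗ[ℂ] K := A.toFun - (E.op F hF).toFun ∘ₗ Submodule.inclusion hdom.le
  have hD : ∀ f : A.domain, ⟪(f : K), D f⟫_ℂ = 0 := by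
    intro f
    change ⟪(f : K), A f - E.int F f⟫_ℂ = 0
    rw [inner_sub_right, hA.2, inner_int, sub_self]
    exact hdom.le f.2
  have hD2 : ∀ f g : A.domain, ⟪(f : K), D g⟫_ℂ = 0 := by
    intro f g
    have h1 := hD (f + g)
    have h2 := hD (f + Complex.I • g)
    simp only [map_add, map_smul, Submodule.coe_add, Submodule.coe_smul, inner_add_left,
      inner_add_right, inner_smul_left, inner_smul_right, hD, Complex.conj_I, zero_add, add_zero,
      mul_zero] at h1 h2
    have h3 : Complex.I * (⟪(f : K), D g⟫_ℂ - ⟪(g : K), D f⟫_ℂ) = 0 := by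
      rw [← h2]; ring
    have h4 := (mul_eq_zero.1 h3).resolve_left Complex.I_ne_zero
    linear_combination (h1 + h4) / 2
  -- the difference `D` has vanishing quadratic form, hence vanishes by polarization and density
  have hd : Dense (A.domain : Set K) := by rw [hdom]; exact dense_op_domain hF
  refine LinearPMap.ext hdom fun f hf hf' => ?_
  have h0 : D ⟨f, hf⟩ = 0 := hd.eq_zero_of_inner_right ℂ fun v hv => hD2 ⟨v, hv⟩ _
  exact sub_eq_zero.1 h0

theorem int_sub_const {F : ℝ → ℂ} {f : K} (hF : MemLp F 2 (E.scalarMeasure f)) (z : ℂ) :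
    E.int (fun l => F l - z) f = E.int F f - z • f := by
  have h := int_sub hF (memLp_const z)
  have h2 : E.int (fun _ => z) f = z • f := by
    have := int_smul (E := E) (f := f) (F := 1) z (memLp_const 1)
    rw [int_one] at this
    rw [← this]
    congr 1
    ext; simp
  rw [h2] at h
  exact h

/-- The bounded operator `∫ F dE` for a bounded Borel function `F`. -/
theorem exists_bounded {F : ℝ → ℂ} (hF : Measurable F) {C : ℝ} (hC0 : 0 ≤ C)
    (hC : ∀ l, ‖F l‖ ≤ C) : ∃ T : K →L[ℂ] K, ∀ f, T f = E.int F f := by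
  have hm : ∀ f, MemLp F 2 (E.scalarMeasure f) := memLp_of_bounded hF hC
  refine ⟨LinearMap.mkContinuous
    { toFun := fun f => E.int F f
      map_add' := fun f g => (int_vec_add hF (hm f) (hm g)).2
      map_smul' := fun c f => (int_vec_smul hF c (hm f)).2 } C fun f => ?_, fun f => rfl⟩
  have := norm_int_indicator_le (E := E) hF f MeasurableSet.univ hC0 fun l _ => hC l
  rw [indicator_univ, E.univ'] at this
  exact this

/-- The spectrum of `∫ F dE` is the essential range of `F` with respect to `E`. -/
theorem operatorSpectrum_op {F : ℝ → ℂ} (hF : Measurable F) :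
    operatorSpectrum (E.op F hF) = {z | ∀ ε > 0, E {l | ‖F l - z‖ < ε} ≠ 0} := by
  ext z
  rw [operatorSpectrum, mem_ofPred_eq, mem_ofPred_eq, ← not_iff_not, not_not]
  push Not
  have hBm : ∀ ε : ℝ, MeasurableSet {l | ‖F l - z‖ < ε} := fun ε =>
    (hF.sub_const z).norm measurableSet_Iio
  constructor
  · rintro ⟨R, -, hR⟩
    refine ⟨1 / (‖R‖ + 1), by positivity, ?_⟩
    set ε := 1 / (‖R‖ + 1) with hε
    ext f
    set y := E {l | ‖F l - z‖ < ε} f with hy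
    have hbd : ∀ l ∈ {l | ‖F l - z‖ < ε}, ‖F l‖ ≤ ε + ‖z‖ := by
      intro l hl
      calc ‖F l‖ = ‖(F l - z) + z‖ := by rw [sub_add_cancel]
        _ ≤ ‖F l - z‖ + ‖z‖ := norm_add_le _ _
        _ ≤ _ := by gcongr; exact (le_of_lt hl)
    have hyd := (int_apply_eq (E := E) hF (hBm ε)
      (memLp_indicator_of_bounded (f := f) hF (hBm ε) hbd)).1
    have h1 := hR ⟨y, hyd⟩
    change R (E.int F y - z • y) = y at h1
    rw [← int_sub_const hyd] at h1
    have h2 : ‖E.int (fun l => F l - z) y‖ ≤ ε * ‖y‖ := by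
      rw [hy, (int_apply_eq (E := E) (hF.sub_const z) (hBm ε) (memLp_indicator_of_bounded
        (f := f) (hF.sub_const z) (hBm ε) fun l hl => le_of_lt hl)).2]
      exact norm_int_indicator_le (hF.sub_const z) f (hBm ε) (by positivity) fun l hl => le_of_lt hl
    have h3 : ‖y‖ ≤ ‖R‖ * (ε * ‖y‖) := by
      conv_lhs => rw [← h1]
      exact (R.le_opNorm _).trans (by gcongr)
    have h4 : ‖R‖ * ε < 1 := by
      rw [hε, mul_one_div, div_lt_one (by positivity)]
      linarith
    have h5 : ‖y‖ = 0 := by nlinarith [norm_nonneg y]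
    exact norm_eq_zero.1 h5
  · rintro ⟨ε, hε, h0⟩
    set B := {l | ‖F l - z‖ < ε} with hB
    -- the resolvent is the integral of the bounded function `(F - z)⁻¹`
    let G : ℝ → ℂ := Bᶜ.indicator fun l => (F l - z)⁻¹
    have hGm : Measurable G := (hF.sub_const z).inv.indicator (hBm ε).compl
    have hGb : ∀ l, ‖G l‖ ≤ 1 / ε := by
      intro l
      by_cases hl : l ∈ Bᶜ
      · have : ε ≤ ‖F l - z‖ := not_lt.1 hl
        simp only [G, indicator_of_mem hl, norm_inv]
        rw [one_div]
        exact inv_anti₀ hε this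
      · simp only [G, indicator_of_notMem hl, norm_zero]; positivity
    obtain ⟨R, hR⟩ := exists_bounded (E := E) hGm (by positivity) hGb
    have hBc : ∀ f, E Bᶜ f = f := fun f => by rw [compl (hBm ε), h0]; simp
    have hmul : (fun l => F l - z) * G = Bᶜ.indicator 1 := by
      ext l
      by_cases hl : l ∈ Bᶜ
      · have h1 : ε ≤ ‖F l - z‖ := not_lt.1 hl
        have h2 : F l - z ≠ 0 := by rw [← norm_pos_iff]; linarith
        simp only [G, Pi.mul_apply, indicator_of_mem hl, Pi.one_apply]
        exact mul_inv_cancel₀ h2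
      · simp only [G, Pi.mul_apply, indicator_of_notMem hl, mul_zero]
    have hGL : ∀ f, MemLp G 2 (E.scalarMeasure f) := memLp_of_bounded hGm hGb
    have hone : ∀ f, MemLp (Bᶜ.indicator (1 : ℝ → ℂ)) 2 (E.scalarMeasure f) := fun f =>
      (memLp_const (1 : ℂ)).indicator (hBm ε).compl
    refine ⟨R, fun w => ?_, fun f => ?_⟩
    · obtain ⟨h1, h2⟩ := int_int (f := w) hGm (hF.sub_const z) (hGL w) (by rw [hmul]; exact hone w)
      rw [hmul, int_indicator w (hBm ε).compl, hBc] at h2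
      have h3 : MemLp F 2 (E.scalarMeasure (R w)) := by
        rw [hR]
        have := h1.add (memLp_const z)
        refine (memLp_congr_ae (Eventually.of_forall fun l => ?_)).1 this
        simp
      refine ⟨h3, ?_⟩
      change E.int F (R w) - z • R w = w
      rw [← int_sub_const h3, hR, h2]
    · have hfd : MemLp F 2 (E.scalarMeasure (f : K)) := f.2
      change R (E.int F f - z • (f : K)) = f
      rw [← int_sub_const hfd, hR, (int_int (hF.sub_const z) hGm (hfd.sub (memLp_const z))
        (by rw [mul_comm, hmul]; exact hone f)).2, mul_comm, hmul, int_indicator _ (hBm ε).compl,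
        hBc]

end ProjectionMeasure

/-! ### Riemann sums -/

namespace TaggedPartition

variable {l r : ℝ} (P : TaggedPartition l r)

theorem pt_mono {i j : ℕ} (hij : i ≤ j) (hj : j ≤ P.n) : P.pt i ≤ P.pt j := by
  induction j, hij using Nat.le_induction with
  | base => exact le_rfl
  | succ k _ ih => exact (ih (by omega)).trans (P.pt_lt k (by omega)).le

theorem sub_le_mesh {j : ℕ} (hj : j < P.n) : P.pt (j + 1) - P.pt j ≤ P.mesh :=
  le_ciSup (f := fun j : Fin P.n => P.pt (j + 1) - P.pt j) (Set.finite_range _).bddAbove ⟨j, hj⟩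

theorem mesh_nonneg : 0 ≤ P.mesh :=
  Real.iSup_nonneg fun j => sub_nonneg.2 (P.pt_lt j j.2).le

theorem left_mem {j : ℕ} (hj : j < P.n) : l ≤ P.pt j := by
  have := P.pt_mono (Nat.zero_le j) hj.le
  rwa [P.pt_zero] at this

theorem right_mem {j : ℕ} (hj : j ≤ P.n) : P.pt j ≤ r := by
  have := P.pt_mono hj le_rfl
  rwa [P.pt_last] at this

theorem abs_sub_tag_le {j : ℕ} (hj : j < P.n) {t : ℝ} (ht : t ∈ Ioc (P.pt j) (P.pt (j + 1))) :
    |t - P.tag j| ≤ P.pt (j + 1) - P.pt j := by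
  have h := P.tag_mem j hj
  rw [abs_le]
  constructor <;> linarith [h.1, h.2, ht.1, ht.2]

theorem tag_mem_Icc {j : ℕ} (hj : j < P.n) : P.tag j ∈ Icc l r :=
  ⟨(P.left_mem hj).trans (P.tag_mem j hj).1, (P.tag_mem j hj).2.trans (P.right_mem hj)⟩

theorem disjoint_Ioc {i j : ℕ} (hi : i < P.n) (hj : j < P.n) (hij : i ≠ j) :
    Disjoint (Ioc (P.pt i) (P.pt (i + 1))) (Ioc (P.pt j) (P.pt (j + 1))) := by
  rcases lt_or_gt_of_ne hij with h | h
  · refine Set.disjoint_left.2 fun x hx hx' => ?_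
    have := P.pt_mono (show i + 1 ≤ j from h) hj.le
    exact absurd (hx.2.trans this) (not_le.2 hx'.1)
  · refine Set.disjoint_left.2 fun x hx hx' => ?_
    have := P.pt_mono (show j + 1 ≤ i from h) hi.le
    exact absurd (hx'.2.trans this) (not_le.2 hx.1)

theorem sum_sub : ∑ j ∈ Finset.range P.n, (P.pt (j + 1) - P.pt j) = r - l := by
  rw [Finset.sum_range_sub, P.pt_zero, P.pt_last]

/-- The subdivision into `n + 1` intervals of equal length. -/
def uniform {l r : ℝ} (hlr : l < r) (n : ℕ) : TaggedPartition l r where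
  n := n + 1
  pt j := l + j * ((r - l) / (n + 1))
  tag j := l + j * ((r - l) / (n + 1))
  pt_zero := by simp
  pt_last := by push_cast; field_simp; ring
  pt_lt j _ := by
    have : 0 < (r - l) / (n + 1) := div_pos (sub_pos.2 hlr) (by positivity)
    push_cast
    nlinarith
  tag_mem j _ := by
    have : 0 < (r - l) / (n + 1) := div_pos (sub_pos.2 hlr) (by positivity)
    constructor
    · exact le_rfl
    · push_cast
      nlinarith

theorem mesh_uniform {l r : ℝ} (hlr : l < r) (n : ℕ) :
    (uniform hlr n).mesh = (r - l) / (n + 1) := by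
  have : Nonempty (Fin (uniform hlr n).n) := ⟨⟨0, Nat.succ_pos n⟩⟩
  have : ∀ j : Fin (uniform hlr n).n, (uniform hlr n).pt (j + 1) - (uniform hlr n).pt j =
      (r - l) / (n + 1) := by
    intro j
    simp only [uniform]
    push_cast
    ring
  rw [mesh, iSup_congr this, ciSup_const]

end TaggedPartition

/-- Subdivisions of arbitrarily small mesh exist, so that limits along `meshToZero` are unique. -/
theorem meshToZero_neBot {l r : ℝ} (hlr : l < r) : (meshToZero l r).NeBot := by
  rw [meshToZero, comap_neBot_iff]
  intro t ht
  have h : Tendsto (fun n : ℕ => (r - l) / ((n : ℝ) + 1)) atTop (𝓝 0) :=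
    tendsto_const_nhds.div_atTop (tendsto_natCast_atTop_atTop.atTop_add tendsto_const_nhds)
  obtain ⟨n, hn⟩ := (h.eventually ht).exists
  exact ⟨TaggedPartition.uniform hlr n, by rwa [TaggedPartition.mesh_uniform]⟩

theorem eventually_mesh_lt (l r : ℝ) {δ : ℝ} (hδ : 0 < δ) :
    ∀ᶠ P : TaggedPartition l r in meshToZero l r, P.mesh < δ :=
  tendsto_comap.eventually (eventually_lt_nhds hδ)

namespace ProjectionMeasure

variable {K : Type u} [NormedAddCommGroup K] [InnerProductSpace ℂ K] [CompleteSpace K]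
  {E : ProjectionMeasure K}

/-- Pythagoras' theorem for vectors localized on the intervals of a subdivision. -/
theorem norm_sum_sq {l r : ℝ} (P : TaggedPartition l r) (e : ℕ → K)
    (he : ∀ j < P.n, E (Ioc (P.pt j) (P.pt (j + 1))) (e j) = e j) :
    ‖∑ j ∈ Finset.range P.n, e j‖ ^ 2 = ∑ j ∈ Finset.range P.n, ‖e j‖ ^ 2 := by
  have h1 : ∀ i ∈ Finset.range P.n, ∀ j ∈ Finset.range P.n, i ≠ j → ⟪e i, e j⟫_ℂ = 0 := by
    intro i hi j hj hij
    rw [Finset.mem_range] at hi hj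
    rw [← he i hi, ← he j hj, E.isSymm, E.apply_of_disjoint measurableSet_Ioc measurableSet_Ioc
      (P.disjoint_Ioc hi hj hij), inner_zero_right]
  rw [← inner_self_eq_norm_sq (𝕜 := ℂ), sum_inner, map_sum]
  refine Finset.sum_congr rfl fun i hi => ?_
  rw [inner_sum, Finset.sum_eq_single i (fun j hj hji => h1 i hi j hj hji.symm)
    (fun h => absurd hi h), inner_self_eq_norm_sq]

theorem sum_Ioc {l r : ℝ} (P : TaggedPartition l r) :
    ∑ j ∈ Finset.range P.n, E (Ioc (P.pt j) (P.pt (j + 1))) = E (Ioc l r) := by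
  have h : ∀ m ≤ P.n, ∑ j ∈ Finset.range m, E (Ioc (P.pt j) (P.pt (j + 1))) =
      E (Ioc l (P.pt m)) := by
    intro m hm
    induction m with
    | zero => simp [P.pt_zero, E.empty]
    | succ k ih =>
      rw [Finset.sum_range_succ, ih (by omega), ← E.union measurableSet_Ioc measurableSet_Ioc
        (Ioc_disjoint_Ioc_of_le le_rfl), Ioc_union_Ioc_eq_Ioc (P.left_mem (by omega))
        (P.pt_lt k (by omega)).le]
  rw [h P.n le_rfl, P.pt_last]

/-- Sums of errors that are localized on the intervals of a subdivision are small as soon as each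
error is small compared with the length of its interval. -/
theorem tendsto_sum_of_norm_le_length {l r C : ℝ} (hlr : l < r) (y : K)
    (e : (P : TaggedPartition l r) → ℕ → K)
    (he : ∀ P : TaggedPartition l r, ∀ j < P.n,
      E (Ioc (P.pt j) (P.pt (j + 1))) (e P j) = e P j)
    (hn : ∀ P : TaggedPartition l r, ∀ j < P.n,
      ‖E (Ioc (P.pt j) (P.pt (j + 1))) y - e P j‖ ≤ C * (P.pt (j + 1) - P.pt j)) :
    Tendsto (fun P : TaggedPartition l r => ∑ j ∈ Finset.range P.n, e P j) (meshToZero l r)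
      (𝓝 (E (Ioc l r) y)) := by
  -- the squared errors sum up to at most `∑ C² |I|² ≤ C² (r - l) mesh`
  have hb : ∀ P : TaggedPartition l r,
      ‖E (Ioc l r) y - ∑ j ∈ Finset.range P.n, e P j‖ ^ 2 ≤ C ^ 2 * (r - l) * P.mesh := by
    intro P
    rw [← sum_Ioc P, sum_apply, ← Finset.sum_sub_distrib,
      norm_sum_sq P _ fun j hj => by rw [map_sub, E.idem, he P j hj]]
    calc _ ≤ ∑ j ∈ Finset.range P.n, C ^ 2 * P.mesh * (P.pt (j + 1) - P.pt j) := by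
          refine Finset.sum_le_sum fun j hj => ?_
          rw [Finset.mem_range] at hj
          have h1 := hn P j hj
          have h2 := P.sub_le_mesh hj
          have h3 := P.pt_lt j hj
          calc _ ≤ (C * (P.pt (j + 1) - P.pt j)) ^ 2 := by gcongr
            _ = C ^ 2 * ((P.pt (j + 1) - P.pt j) * (P.pt (j + 1) - P.pt j)) := by ring
            _ ≤ C ^ 2 * (P.mesh * (P.pt (j + 1) - P.pt j)) := by
              have : 0 ≤ P.pt (j + 1) - P.pt j := by linarith
              gcongr
            _ = _ := by ring
      _ = _ := by rw [← Finset.mul_sum, P.sum_sub]; ring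
  rw [tendsto_iff_norm_sub_tendsto_zero, Metric.tendsto_nhds]
  intro ε hε
  have hD : 0 < C ^ 2 * (r - l) + 1 := by nlinarith [sq_nonneg C, sub_pos.2 hlr]
  filter_upwards [eventually_mesh_lt l r (δ := ε ^ 2 / (C ^ 2 * (r - l) + 1)) (by positivity)]
    with P hP
  have h0 := P.mesh_nonneg
  rw [Real.dist_0_eq_abs, abs_norm, norm_sub_rev]
  refine lt_of_pow_lt_pow_left₀ 2 hε.le ((hb P).trans_lt ?_)
  rw [lt_div_iff₀ hD] at hP
  nlinarith

/-- For continuous `F`, the Riemann sums of `F` on `(l, r]` converge to `∫_{(l, r]} F dE`. -/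
theorem tendsto_riemann {F : ℝ → ℂ} (hF : Continuous F) {l r : ℝ} (k : K) :
    Tendsto (fun P : TaggedPartition l r =>
      ∑ j ∈ Finset.range P.n, F (P.tag j) • E (Ioc (P.pt j) (P.pt (j + 1))) k)
    (meshToZero l r) (𝓝 (E.int ((Ioc l r).indicator F) k)) := by
  have hFm := hF.measurable
  obtain ⟨C, hC⟩ := isCompact_Icc.exists_bound_of_continuousOn (s := Icc l r) hF.continuousOn
  have hm : MemLp ((Ioc l r).indicator F) 2 (E.scalarMeasure k) :=
    memLp_indicator_of_bounded hFm measurableSet_Ioc fun t ht => hC t (Ioc_subset_Icc_self ht)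
  set y := E.int ((Ioc l r).indicator F) k with hy
  have hEy : E (Ioc l r) y = y := by
    rw [hy, apply_int hm measurableSet_Ioc, indicator_indicator, inter_self]
  rw [tendsto_iff_norm_sub_tendsto_zero, Metric.tendsto_nhds]
  intro ε hε
  have huc := isCompact_Icc.uniformContinuousOn_of_continuous (s := Icc l r) hF.continuousOn
  rw [Metric.uniformContinuousOn_iff] at huc
  obtain ⟨δ, hδ, hd⟩ := huc (ε / (‖k‖ + 1)) (by positivity)
  filter_upwards [eventually_mesh_lt l r hδ] with P hP
  rw [Real.dist_0_eq_abs, abs_norm, norm_sub_rev]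
  have hpiece : ∀ j < P.n, E (Ioc (P.pt j) (P.pt (j + 1))) y -
      F (P.tag j) • E (Ioc (P.pt j) (P.pt (j + 1))) k =
      E.int ((Ioc (P.pt j) (P.pt (j + 1))).indicator fun t => F t - F (P.tag j)) k := by
    intro j hj
    have hs : Ioc (P.pt j) (P.pt (j + 1)) ⊆ Ioc l r :=
      Ioc_subset_Ioc (P.left_mem hj) (P.right_mem hj)
    have h1 : MemLp ((Ioc (P.pt j) (P.pt (j + 1))).indicator F) 2 (E.scalarMeasure k) :=
      memLp_indicator_of_bounded hFm measurableSet_Ioc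
        fun t ht => hC t (Ioc_subset_Icc_self (hs ht))
    rw [hy, apply_int hm measurableSet_Ioc, indicator_indicator, inter_eq_left.2 hs,
      ← int_const_indicator _ measurableSet_Ioc,
      ← int_sub h1 ((memLp_const _).indicator measurableSet_Ioc), ← indicator_sub']
    rfl
  have key : ‖y - ∑ j ∈ Finset.range P.n, F (P.tag j) • E (Ioc (P.pt j) (P.pt (j + 1))) k‖ ^ 2 ≤
      (ε / (‖k‖ + 1) * ‖k‖) ^ 2 := by
    conv_lhs => rw [← hEy]
    rw [← sum_Ioc P, sum_apply, ← Finset.sum_sub_distrib,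
      norm_sum_sq P _ fun j hj => by rw [map_sub, E.idem, map_smul, E.idem]]
    calc _ ≤ ∑ j ∈ Finset.range P.n,
          (ε / (‖k‖ + 1)) ^ 2 * ‖E (Ioc (P.pt j) (P.pt (j + 1))) k‖ ^ 2 := by
          refine Finset.sum_le_sum fun j hj => ?_
          rw [Finset.mem_range] at hj
          rw [hpiece j hj, ← mul_pow]
          gcongr
          refine norm_int_indicator_le (hFm.sub_const _) k measurableSet_Ioc (by positivity) ?_
          intro t ht
          have hs : t ∈ Icc l r := ⟨(P.left_mem hj).trans ht.1.le, ht.2.trans (P.right_mem hj)⟩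
          rw [← dist_eq_norm]
          refine (hd t hs _ (P.tag_mem_Icc hj) ?_).le
          rw [Real.dist_eq]
          exact ((P.abs_sub_tag_le hj ht).trans (P.sub_le_mesh hj)).trans_lt hP
      _ = (ε / (‖k‖ + 1)) ^ 2 * ‖E (Ioc l r) k‖ ^ 2 := by
          rw [← Finset.mul_sum, ← sum_Ioc P, sum_apply, norm_sum_sq P _ fun j hj => E.idem _ _]
      _ ≤ _ := by
          rw [mul_pow]
          gcongr
          exact E.norm_apply_le _ _
  refine lt_of_le_of_lt ((sq_le_sq₀ (norm_nonneg _) (by positivity)).1 key) ?_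
  rw [div_mul_eq_mul_div, div_lt_iff₀ (by positivity)]
  nlinarith [norm_nonneg k]

/-- The graph of `∫ F dE` for continuous `F`, in terms of Riemann sums. -/
theorem mem_op_graph_iff_riemann {F : ℝ → ℂ} (hF : Continuous F) {k g : K} :
    (k, g) ∈ (E.op F hF.measurable).graph ↔ ∀ l r : ℝ, l < r →
      Tendsto (fun P : TaggedPartition l r =>
        ∑ j ∈ Finset.range P.n, F (P.tag j) • E (Ioc (P.pt j) (P.pt (j + 1))) k)
      (meshToZero l r) (𝓝 (E (Ioc l r) g)) := by
  rw [mem_op_graph]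
  constructor
  · rintro ⟨h1, rfl⟩ l r hlr
    rw [apply_int h1 measurableSet_Ioc]
    exact tendsto_riemann hF k
  · intro h
    have hFm := hF.measurable
    have hind : ∀ l r : ℝ, l < r → E.int ((Ioc l r).indicator F) k = E (Ioc l r) g := by
      intro l r hlr
      have := meshToZero_neBot hlr
      exact tendsto_nhds_unique (tendsto_riemann hF k) (h l r hlr)
    let B : ℕ → Set ℝ := fun n => Ioc (-(n + 1 : ℝ)) (n + 1)
    have hB : ∀ n, MeasurableSet (B n) := fun n => measurableSet_Ioc
    have hBm : Monotone B := fun m n hmn =>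
      Ioc_subset_Ioc (neg_le_neg (by simpa using hmn)) (by simpa using hmn)
    have hBU : ⋃ n, B n = univ := by
      refine eq_univ_of_forall fun x => mem_iUnion.2 ?_
      obtain ⟨n, hn⟩ := exists_nat_ge |x|
      rw [abs_le] at hn
      exact ⟨n, by constructor <;> linarith [hn.1, hn.2]⟩
    have hlt : ∀ n : ℕ, -(n + 1 : ℝ) < n + 1 := fun n => by
      have : (0 : ℝ) ≤ n := Nat.cast_nonneg n
      linarith
    have hFn : ∀ n, MemLp ((B n).indicator F) 2 (E.scalarMeasure k) := by
      intro n
      obtain ⟨C, hC⟩ := isCompact_Icc.exists_bound_of_continuousOn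
        (s := Icc (-(n + 1 : ℝ)) (n + 1)) hF.continuousOn
      exact memLp_indicator_of_bounded hFm (hB n) fun t ht => hC t (Ioc_subset_Icc_self ht)
    have hmem : MemLp F 2 (E.scalarMeasure k) :=
      memLp_of_tendsto hFm hB hBm hBU (C := ‖g‖) hFn fun n => by
        rw [hind _ _ (hlt n)]; exact E.norm_apply_le _ _
    -- `∫ F dE k` and `g` have the same projections to all bounded intervals
    refine ⟨hmem, tendsto_nhds_unique (tendsto_apply (E := E) hB hBm hBU _) ?_⟩
    have : ∀ n, E (B n) (E.int F k) = E (B n) g := fun n => by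
      rw [apply_int hmem (hB n), hind _ _ (hlt n)]
    simp_rw [this]
    exact tendsto_apply hB hBm hBU g

end ProjectionMeasure

/-! ### The Stieltjes transform -/

/-- The substitution `x = c + y s`, which turns the Poisson kernel into `(1 + s²)⁻¹`. -/
theorem integral_poisson_eq (f : ℝ → ℝ) (c : ℝ) {y : ℝ} (hy : 0 < y) :
    ∫ s : ℝ, f (c + y * s) * (1 + s ^ 2)⁻¹ = ∫ x : ℝ, f x * (y / ((c - x) ^ 2 + y ^ 2)) := by
  have h1 := Measure.integral_comp_mul_left
    (fun t => f (c + t) * (y / ((c - (c + t)) ^ 2 + y ^ 2))) y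
  have h2 := integral_add_left_eq_self (μ := (volume : Measure ℝ))
    (fun t => f t * (y / ((c - t) ^ 2 + y ^ 2))) c
  rw [h2, abs_of_pos (inv_pos.2 hy), smul_eq_mul] at h1
  have h3 : ∀ s : ℝ, f (c + y * s) * (1 + s ^ 2)⁻¹ =
      y * (f (c + y * s) * (y / ((c - (c + y * s)) ^ 2 + y ^ 2))) := by
    intro s
    have : (0 : ℝ) < 1 + s ^ 2 := by positivity
    have h4 : (c - (c + y * s)) ^ 2 + y ^ 2 = y ^ 2 * (1 + s ^ 2) := by ring
    rw [h4]
    field_simp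
  simp_rw [h3]
  rw [integral_const_mul, h1, ← mul_assoc, mul_inv_cancel₀ hy.ne', one_mul]

theorem im_inv_sub (l x : ℝ) {y : ℝ} :
    (1 / ((l : ℂ) - (x + y * Complex.I))).im = y / ((l - x) ^ 2 + y ^ 2) := by
  rw [one_div, Complex.inv_im]
  simp [Complex.normSq_apply]
  ring_nf

theorem integrable_inv_sub {μ : Measure ℝ} [IsFiniteMeasure μ] {z : ℂ} (hz : z.im ≠ 0) :
    Integrable (fun l : ℝ => 1 / ((l : ℂ) - z)) μ := by
  refine Integrable.of_bound (C := 1 / |z.im|) ?_ (Eventually.of_forall fun l => ?_)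
  · refine (Measurable.div measurable_const ?_).aestronglyMeasurable
    exact Complex.measurable_ofReal.sub_const z
  · rw [norm_div, norm_one]
    have h1 : |z.im| ≤ ‖(l : ℂ) - z‖ := by
      have := Complex.abs_im_le_norm ((l : ℂ) - z)
      simpa using this
    exact one_div_le_one_div_of_le (abs_pos.2 hz) h1

/-- Poisson averages of a finite measure recover its integrals of bounded continuous functions. -/
theorem tendsto_integral_poisson (μ : Measure ℝ) [IsFiniteMeasure μ]
    (f : BoundedContinuousFunction ℝ ℝ) :
    Tendsto (fun n : ℕ => ∫ x : ℝ, f x *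
      (∫ l : ℝ, 1 / ((l : ℂ) - (x + (1 / ((n : ℝ) + 2) : ℝ) * Complex.I)) ∂μ).im) atTop
      (𝓝 (Real.pi * ∫ l, f l ∂μ)) := by
  let y : ℕ → ℝ := fun n => 1 / ((n : ℝ) + 2)
  have hy : ∀ n, 0 < y n := fun n => by positivity
  have hy0 : Tendsto y atTop (𝓝 0) :=
    tendsto_const_nhds.div_atTop (tendsto_natCast_atTop_atTop.atTop_add tendsto_const_nhds)
  -- Fubini; the substitution moves the dependence on `n` into the argument of `f`, which makes
  -- dominated convergence applicable
  have hfub : ∀ n, ∫ x : ℝ, f x * (∫ l : ℝ, 1 / ((l : ℂ) - (x + y n * Complex.I)) ∂μ).im =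
      ∫ l, (∫ s : ℝ, f (l + y n * s) * (1 + s ^ 2)⁻¹) ∂μ := by
    intro n
    have h1 : ∀ x : ℝ, (∫ l : ℝ, 1 / ((l : ℂ) - (x + y n * Complex.I)) ∂μ).im =
        ∫ l : ℝ, y n / ((l - x) ^ 2 + y n ^ 2) ∂μ := by
      intro x
      have := integral_im (integrable_inv_sub (μ := μ) (z := x + y n * Complex.I)
        (by simpa using (hy n).ne'))
      rw [← RCLike.im_eq_complex_im, ← this]
      exact integral_congr_ae (Eventually.of_forall fun l => im_inv_sub l x)
    simp_rw [h1, integral_poisson_eq f _ (hy n), ← integral_const_mul]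
    refine integral_integral_swap ?_
    have hc : Continuous (Function.uncurry fun x l : ℝ => f x * (y n / ((l - x) ^ 2 + y n ^ 2))) := by
      refine (f.continuous.comp continuous_fst).mul (Continuous.div continuous_const (by fun_prop) ?_)
      intro p
      have := hy n
      positivity
    refine Integrable.swap (μ := μ) (ν := volume)
      (f := fun p : ℝ × ℝ => f p.2 * (y n / ((p.1 - p.2) ^ 2 + y n ^ 2))) ?_
    have hc2 : AEStronglyMeasurable (fun p : ℝ × ℝ => f p.2 * (y n / ((p.1 - p.2) ^ 2 + y n ^ 2)))
        (μ.prod volume) := (hc.comp continuous_swap).aestronglyMeasurable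
    change Integrable (fun p : ℝ × ℝ => f p.2 * (y n / ((p.1 - p.2) ^ 2 + y n ^ 2))) (μ.prod volume)
    have hpois : ∀ l : ℝ, Integrable (fun x : ℝ => y n / ((l - x) ^ 2 + y n ^ 2)) := by
      intro l
      have h2 := (integrable_inv_one_add_sq.comp_sub_right (l / y n)).comp_mul_left'
        (inv_ne_zero (hy n).ne')
      refine (h2.const_mul (y n)⁻¹).congr (Eventually.of_forall fun x => ?_)
      have := hy n
      have h4 : (0 : ℝ) < 1 + ((y n)⁻¹ * x - l / y n) ^ 2 := by positivity
      have h5 : (0 : ℝ) < (l - x) ^ 2 + y n ^ 2 := by positivity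
      have h6 : 1 + ((y n)⁻¹ * x - l / y n) ^ 2 = ((l - x) ^ 2 + y n ^ 2) / y n ^ 2 := by
        field_simp
        ring
      dsimp only
      rw [h6]
      field_simp
    have hint : ∀ l : ℝ, ∫ x : ℝ, y n / ((l - x) ^ 2 + y n ^ 2) = Real.pi := by
      intro l
      have := integral_poisson_eq (fun _ => 1) l (hy n)
      simp only [one_mul] at this
      rw [← this, integral_univ_inv_one_add_sq]
    have hpos : ∀ l x : ℝ, 0 ≤ y n / ((l - x) ^ 2 + y n ^ 2) := fun l x => by
      have := hy n
      positivity
    rw [integrable_prod_iff hc2]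
    have hsec : ∀ l : ℝ, Integrable (fun x : ℝ => f x * (y n / ((l - x) ^ 2 + y n ^ 2))) := by
      intro l
      exact (hpois l).bdd_mul (c := ‖f‖) f.continuous.aestronglyMeasurable
        (Eventually.of_forall fun x => f.norm_coe_le_norm x)
    refine ⟨Eventually.of_forall hsec, ?_⟩
    refine Integrable.of_bound (C := ‖f‖ * Real.pi) hc2.norm.integral_prod_right'
      (Eventually.of_forall fun l => ?_)
    rw [Real.norm_of_nonneg (integral_nonneg fun _ => norm_nonneg _), ← hint l,
      ← integral_const_mul]
    refine integral_mono (hsec l).norm ((hpois l).const_mul _) fun x => ?_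
    simp only [norm_mul, Real.norm_of_nonneg (hpos l x)]
    exact mul_le_mul_of_nonneg_right (f.norm_coe_le_norm x) (hpos l x)
  have hbound : ∀ (l : ℝ) (n : ℕ) (s : ℝ),
      ‖f (l + y n * s) * (1 + s ^ 2)⁻¹‖ ≤ ‖f‖ * (1 + s ^ 2)⁻¹ := by
    intro l n s
    have : (0 : ℝ) ≤ (1 + s ^ 2)⁻¹ := by positivity
    rw [norm_mul, Real.norm_of_nonneg this]
    gcongr
    exact f.norm_coe_le_norm _
  have hcont : ∀ (l : ℝ) (n : ℕ), Continuous fun s : ℝ => f (l + y n * s) * (1 + s ^ 2)⁻¹ := by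
    intro l n
    refine (f.continuous.comp (by fun_prop)).mul (Continuous.inv₀ (by fun_prop) fun s => ?_)
    positivity
  have hin : ∀ l : ℝ, Tendsto (fun n => ∫ s : ℝ, f (l + y n * s) * (1 + s ^ 2)⁻¹) atTop
      (𝓝 (f l * Real.pi)) := by
    intro l
    rw [← integral_univ_inv_one_add_sq, ← integral_const_mul]
    refine tendsto_integral_of_dominated_convergence (fun s => ‖f‖ * (1 + s ^ 2)⁻¹)
      (fun n => (hcont l n).aestronglyMeasurable) (integrable_inv_one_add_sq.const_mul _)
      (fun n => Eventually.of_forall (hbound l n)) (Eventually.of_forall fun s => ?_)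
    refine Tendsto.mul_const _ ?_
    have h1 : Tendsto (fun n => l + y n * s) atTop (𝓝 l) := by
      simpa using (hy0.mul_const s).const_add l
    exact (f.continuous.tendsto l).comp h1
  change Tendsto (fun n : ℕ => ∫ x : ℝ, f x *
      (∫ l : ℝ, 1 / ((l : ℂ) - (x + y n * Complex.I)) ∂μ).im) atTop _
  simp_rw [hfub]
  rw [mul_comm, ← integral_mul_const]
  refine tendsto_integral_of_dominated_convergence (fun _ => ‖f‖ * Real.pi) (fun n => ?_)
    (integrable_const _) (fun n => Eventually.of_forall fun l => ?_) (Eventually.of_forall hin)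
  · have hc : Continuous fun p : ℝ × ℝ => f (p.1 + y n * p.2) * (1 + p.2 ^ 2)⁻¹ := by
      refine (f.continuous.comp (by fun_prop)).mul (Continuous.inv₀ (by fun_prop) fun s => ?_)
      positivity
    exact (hc.aestronglyMeasurable (μ := μ.prod volume)).integral_prod_right'
  · rw [← integral_univ_inv_one_add_sq, ← integral_const_mul]
    exact norm_integral_le_of_norm_le (integrable_inv_one_add_sq.const_mul _)
      (Eventually.of_forall (hbound l n))

/-- A finite measure is determined by its Stieltjes transform near the real axis. -/
theorem eq_of_stieltjes_eq {μ ν : Measure ℝ} [IsFiniteMeasure μ] [IsFiniteMeasure ν]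
    (h : ∀ z : ℂ, 0 < z.im → z.im < 1 →
      ∫ l : ℝ, 1 / ((l : ℂ) - z) ∂μ = ∫ l : ℝ, 1 / ((l : ℂ) - z) ∂ν) : μ = ν := by
  refine ext_of_forall_integral_eq_of_IsFiniteMeasure fun f => ?_
  have h1 := tendsto_integral_poisson μ f
  have h2 := tendsto_integral_poisson ν f
  have h3 : ∀ (n : ℕ) (x : ℝ),
      ∫ l : ℝ, 1 / ((l : ℂ) - (x + (1 / ((n : ℝ) + 2) : ℝ) * Complex.I)) ∂μ =
      ∫ l : ℝ, 1 / ((l : ℂ) - (x + (1 / ((n : ℝ) + 2) : ℝ) * Complex.I)) ∂ν := by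
    intro n x
    have hn : (0 : ℝ) ≤ n := Nat.cast_nonneg n
    have him : ((x : ℂ) + (1 / ((n : ℝ) + 2) : ℝ) * Complex.I).im = 1 / ((n : ℝ) + 2) := by
      rw [Complex.add_im, Complex.ofReal_im, zero_add, Complex.im_ofReal_mul, Complex.I_im, mul_one]
    refine h _ ?_ ?_
    · rw [him]; positivity
    · rw [him, div_lt_one (by positivity)]; linarith
  simp_rw [h3] at h1
  exact mul_left_cancel₀ Real.pi_ne_zero (tendsto_nhds_unique h1 h2)

/-! ### The spectral theorem -/

/-- A continuous real function regarded as complex-valued. -/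
def ContinuousMap.toComplex {X : Type*} [TopologicalSpace X] (f : C(X, ℝ)) : C(X, ℂ) :=
  ⟨fun x => (f x : ℂ), by fun_prop⟩

theorem star_toComplex {X : Type*} [TopologicalSpace X] (f : C(X, ℝ)) :
    star f.toComplex = f.toComplex := by
  ext x; simp [ContinuousMap.toComplex]

section Spectral

variable {K : Type u} [NormedAddCommGroup K] [InnerProductSpace ℂ K]

/-- Over `ℂ` a bounded operator is determined by its quadratic form. -/
theorem ContinuousLinearMap.ext_inner_self {S T : K →L[ℂ] K}
    (h : ∀ x, ⟪x, S x⟫_ℂ = ⟪x, T x⟫_ℂ) : S = T := by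
  refine ContinuousLinearMap.coe_injective ((ext_inner_map _ _).1 fun x => ?_)
  rw [← inner_conj_symm]
  exact (congrArg (starRingEnd ℂ) (h x)).trans (inner_conj_symm _ _)

variable [CompleteSpace K]

/-- Orthogonal projections whose quadratic forms are given by finite measures form a
projection-valued measure. -/
theorem ProjectionMeasure.exists_of_form (P : Set ℝ → K →L[ℂ] K) (μ : K → Measure ℝ)
    (hfin : ∀ g, IsFiniteMeasure (μ g))
    (h : ∀ B, MeasurableSet B → ∀ g, ⟪g, P B g⟫_ℂ = ((μ g).real B : ℂ))
    (huniv : ∀ g, (μ g).real univ = ‖g‖ ^ 2)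
    (hP : ∀ B, MeasurableSet B → IsStarProjection (P B)) :
    ∃ E : ProjectionMeasure K, (∀ B, MeasurableSet B → E B = P B) ∧
      ∀ g, E.scalarMeasure g = μ g := by
  classical
  have hnorm : ∀ B, MeasurableSet B → ∀ g, ‖P B g‖ ^ 2 = (μ g).real B := by
    intro B hB g
    have hid : P B (P B g) = P B g := DFunLike.congr_fun (hP B hB).isIdempotentElem g
    have hsa := (hP B hB).isSelfAdjoint
    rw [ContinuousLinearMap.isSelfAdjoint_iff'] at hsa
    have h1 : ⟪P B g, P B g⟫_ℂ = ((μ g).real B : ℂ) := by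
      rw [← ContinuousLinearMap.adjoint_inner_right, hsa, hid, h B hB]
    have h2 := congrArg Complex.re h1
    rw [Complex.ofReal_re] at h2
    rw [← h2]
    exact (inner_self_eq_norm_sq (𝕜 := ℂ) _).symm
  let E : ProjectionMeasure K :=
    { toFun := fun B => if MeasurableSet B then P B else 0
      univ' := by
        rw [if_pos MeasurableSet.univ]
        refine ContinuousLinearMap.ext_inner_self fun x => ?_
        rw [h _ MeasurableSet.univ, huniv]
        exact_mod_cast (inner_self_eq_norm_sq_to_K (𝕜 := ℂ) x).symm
      isStarProjection' := fun B => by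
        split_ifs with hB
        · exact hP B hB
        · exact IsStarProjection.zero _
      hasSum' := by
        intro B hB hd x
        have hU : MeasurableSet (⋃ i, B i) := MeasurableSet.iUnion hB
        simp only [hB, hU, if_true]
        have hs : HasSum (fun i => (μ x).real (B i)) ((μ x).real (⋃ i, B i)) := by
          rw [Measure.real, measure_iUnion hd hB]
          have h1 : ∑' i, μ x (B i) ≠ ∞ := by
            rw [← measure_iUnion hd hB]; exact measure_ne_top _ _
          rw [ENNReal.tsum_toReal_eq fun i => measure_ne_top _ _]
          exact (ENNReal.summable_toReal h1).hasSum
        -- strong convergence: the square of the error is the mass of the remaining sets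
        have hdiff : ∀ s : Finset ℕ, ‖∑ i ∈ s, P (B i) x - P (⋃ i, B i) x‖ =
            √((μ x).real (⋃ i, B i) - ∑ i ∈ s, (μ x).real (B i)) := by
          intro s
          have hsm : MeasurableSet (⋃ i ∈ s, B i) :=
            s.measurableSet_biUnion fun i _ => hB i
          have hmb : ∀ y, (μ y).real (⋃ i ∈ s, B i) = ∑ i ∈ s, (μ y).real (B i) := fun y =>
            measureReal_biUnion_finset (fun i _ j _ hij => hd hij) fun i _ => hB i
          have hsub : (⋃ i ∈ s, B i) ⊆ ⋃ i, B i := iUnion₂_subset fun i _ => subset_iUnion B i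
          have hop : P ((⋃ i, B i) \ ⋃ i ∈ s, B i) = P (⋃ i, B i) - ∑ i ∈ s, P (B i) := by
            refine ContinuousLinearMap.ext_inner_self fun y => ?_
            rw [h _ (hU.diff hsm), measureReal_sdiff hsub hsm, hmb, sub_apply,
              sum_apply, inner_sub_right, inner_sum, h _ hU]
            simp only [h _ (hB _)]
            push_cast
            rfl
          have h4 := hnorm _ (hU.diff hsm) x
          rw [measureReal_sdiff hsub hsm, hmb, hop, sub_apply, sum_apply] at h4
          rw [norm_sub_rev, ← h4, Real.sqrt_sq (norm_nonneg _)]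
        change Tendsto (fun s : Finset ℕ => ∑ i ∈ s, P (B i) x) _ _
        rw [tendsto_iff_norm_sub_tendsto_zero]
        simp_rw [hdiff]
        have h5 : Tendsto (fun s : Finset ℕ => (μ x).real (⋃ i, B i) - ∑ i ∈ s, (μ x).real (B i))
            (SummationFilter.unconditional ℕ).filter (𝓝 0) := by
          simpa using hs.const_sub ((μ x).real (⋃ i, B i))
        simpa [Function.comp_def] using (Real.continuous_sqrt.tendsto 0).comp h5
      eq_zero' := fun B hB => if_neg hB }
  have hE : ∀ B, MeasurableSet B → E B = P B := fun B hB => if_pos hB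
  refine ⟨E, hE, fun g => Measure.ext fun B hB => ?_⟩
  rw [E.scalarMeasure_apply g hB, hE B hB, hnorm B hB]
  exact ENNReal.ofReal_toReal (measure_ne_top _ _)

section Compact

open scoped CompactlySupported

variable {X : Type*} [TopologicalSpace X] (Ψ : C(X, ℂ) →⋆ₐ[ℂ] (K →L[ℂ] K))

/-- A `*`-representation of `C(X)` satisfies `(Ψ(f) x, Ψ(h) y) = (x, Ψ(f̄ h) y)`. -/
theorem inner_starAlgHom (f h : C(X, ℂ)) (x y : K) :
    ⟪Ψ f x, Ψ h y⟫_ℂ = ⟪x, Ψ (star f * h) y⟫_ℂ := by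
  rw [map_mul, map_star, ContinuousLinearMap.star_eq_adjoint]
  exact (ContinuousLinearMap.adjoint_inner_right _ _ _).symm

theorem inner_toComplex_symm (f : C(X, ℝ)) (x y : K) :
    ⟪Ψ f.toComplex x, y⟫_ℂ = ⟪x, Ψ f.toComplex y⟫_ℂ := by
  have := inner_starAlgHom Ψ f.toComplex 1 x y
  rwa [map_one, mul_one, star_toComplex] at this

variable [CompactSpace X] [T2Space X] [MeasurableSpace X] [BorelSpace X]

/-- By the Riesz–Markov theorem, the positive functional `f ↦ (g, Ψ(f) g)` is integration with
respect to a finite measure. -/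
theorem exists_measure_of_starAlgHom (g : K) : ∃ μ : Measure X, IsFiniteMeasure μ ∧ μ.Regular ∧
    ∀ f : C(X, ℂ), ⟪g, Ψ f g⟫_ℂ = ∫ x, f x ∂μ := by
  let Λ : C_c(X, ℝ) →ₚ[ℝ] ℝ := PositiveLinearMap.mk₀
    { toFun := fun f => (⟪g, Ψ (f.toContinuousMap.toComplex) g⟫_ℂ).re
      map_add' := fun f h => by
        rw [← Complex.add_re, ← inner_add_right, ← add_apply, ← map_add]
        congr 5
        ext x; simp [ContinuousMap.toComplex]
      map_smul' := fun c f => by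
        have : ((c • f : C_c(X, ℝ)).toContinuousMap.toComplex) =
            (c : ℂ) • f.toContinuousMap.toComplex := by
          ext x; simp [ContinuousMap.toComplex]
        rw [this, map_smul, smul_apply, inner_smul_right, Complex.re_ofReal_mul]
        rfl }
    (by
      intro f hf
      -- positivity: `f = |√f|²`, so that `(g, Ψ(f) g) = ‖Ψ(√f) g‖²`
      let h : C(X, ℝ) := ⟨fun x => √(f x), by fun_prop⟩
      have h1 : f.toContinuousMap.toComplex = star h.toComplex * h.toComplex := by
        ext x
        have h2 : (0 : ℝ) ≤ f x := hf x
        have h3 : ((√(f x) : ℝ) : ℂ) * ((√(f x) : ℝ) : ℂ) = (f x : ℂ) := by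
          rw [← Complex.ofReal_mul, Real.mul_self_sqrt h2]
        simpa [ContinuousMap.toComplex, h] using h3.symm
      change 0 ≤ (⟪g, Ψ (f.toContinuousMap.toComplex) g⟫_ℂ).re
      rw [h1, ← inner_starAlgHom]
      exact inner_self_nonneg (𝕜 := ℂ))
  refine ⟨RealRMK.rieszMeasure Λ, inferInstance, inferInstance, fun f => ?_⟩
  have hreal : ∀ f : C(X, ℝ), ⟪g, Ψ f.toComplex g⟫_ℂ = ∫ x, f x ∂(RealRMK.rieszMeasure Λ) := by
    intro f
    let f' : C_c(X, ℝ) := ⟨f, HasCompactSupport.of_compactSpace _⟩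
    have h1 : ∫ x, f x ∂(RealRMK.rieszMeasure Λ) = (⟪g, Ψ f.toComplex g⟫_ℂ).re :=
      RealRMK.integral_rieszMeasure Λ f'
    rw [h1]
    refine (Complex.conj_eq_iff_re.1 ?_).symm
    rw [inner_conj_symm, inner_toComplex_symm]
  let fr : C(X, ℝ) := ⟨fun x => (f x).re, by fun_prop⟩
  let fi : C(X, ℝ) := ⟨fun x => (f x).im, by fun_prop⟩
  have hf : f = fr.toComplex + Complex.I • fi.toComplex := by
    ext x
    simp only [ContinuousMap.toComplex, fr, fi, ContinuousMap.coe_mk, ContinuousMap.add_apply,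
      ContinuousMap.smul_apply, smul_eq_mul]
    rw [mul_comm]
    exact (Complex.re_add_im _).symm
  have hint : Integrable (fun x => f x) (RealRMK.rieszMeasure Λ) :=
    Integrable.of_bound f.continuous.aestronglyMeasurable ‖f‖
      (Eventually.of_forall fun x => f.norm_coe_le_norm x)
  have h2 := integral_re_add_im hint
  rw [← h2]
  conv_lhs => rw [hf]
  rw [map_add, map_smul, add_apply, smul_apply, inner_add_right, inner_smul_right, hreal, hreal,
    mul_comm]
  rfl

end Compact

end Spectral

section Spectral

variable {K : Type u} [NormedAddCommGroup K] [InnerProductSpace ℂ K] [CompleteSpace K]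

/-- Spectral projections: a representation `Ψ` of `C(X)` extends to indicator functions. For each
vector `g` the map `f ↦ Ψ(f) g` extends to an isometry `V g` of `L²(μ g)`, and `P(B) g = V g χ_B`.
Linearity of `P(B)` and its other properties follow from approximating `χ_B` by continuous
functions, simultaneously in `L²(μ g)` for finitely many `g`. -/
theorem exists_projections_of_starAlgHom {X : Type*} [MetricSpace X] [CompactSpace X]
    [MeasurableSpace X] [BorelSpace X] (Ψ : C(X, ℂ) →⋆ₐ[ℂ] (K →L[ℂ] K)) :
    ∃ (μ : K → Measure X) (P : Set X → K →L[ℂ] K), (∀ g, IsFiniteMeasure (μ g)) ∧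
      (∀ g, ∀ f : C(X, ℂ), ⟪g, Ψ f g⟫_ℂ = ∫ x, f x ∂(μ g)) ∧
      ∀ B, MeasurableSet B → IsStarProjection (P B) ∧
        (∀ g, ⟪g, P B g⟫_ℂ = ((μ g).real B : ℂ)) ∧
        ∀ g, ∀ f : C(X, ℂ), ⟪g, Ψ f (P B g)⟫_ℂ = ∫ x in B, f x ∂(μ g) := by
  classical
  choose μ hfin hreg hμ using fun g => exists_measure_of_starAlgHom Ψ g
  have hdense : ∀ g, (Submodule.span ℂ (range (ContinuousMap.toLp (E := ℂ) 2 (μ g) ℂ)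
      )).topologicalClosure = ⊤ := by
    intro g
    have h1 := ContinuousMap.toLp_denseRange ℂ (μ g) ℂ (p := 2) (by norm_num)
    rw [eq_top_iff]
    intro x _
    exact closure_mono Submodule.subset_span (h1 x)
  have hiso : ∀ g, ∃ V : Lp ℂ 2 (μ g) →ₗᵢ[ℂ] K,
      ∀ f : C(X, ℂ), V (ContinuousMap.toLp (E := ℂ) 2 (μ g) ℂ f) = Ψ f g := by
    intro g
    refine exists_linearIsometry_of_inner_eq _ (fun f => Ψ f g) (fun f h => ?_) (hdense g)
    rw [inner_starAlgHom, hμ, L2.inner_def]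
    refine integral_congr_ae ?_
    filter_upwards [ContinuousMap.coeFn_toLp (p := 2) (𝕜 := ℂ) (μ g) f,
      ContinuousMap.coeFn_toLp (p := 2) (𝕜 := ℂ) (μ g) h] with x h1 h2
    rw [h1, h2, RCLike.inner_apply, mul_comm]
    rfl
  choose V hV using hiso
  let ind : ∀ g : K, ∀ B : {B : Set X // MeasurableSet B}, Lp ℂ 2 (μ g) := fun g B =>
    indicatorConstLp 2 B.2 (measure_ne_top _ _) 1
  -- every `V g χ_B` is approximated, simultaneously for finitely many `g`, by some `Ψ(f) g`
  have happrox : ∀ B : {B : Set X // MeasurableSet B}, ∀ p : Finset K × ℕ, ∃ f : C(X, ℝ),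
      ∀ g ∈ p.1, ‖Ψ f.toComplex g - V g (ind g B)‖ ≤ 1 / ((p.2 : ℝ) + 1) := by
    rintro B ⟨S, n⟩
    have hε : ENNReal.ofReal (1 / ((n : ℝ) + 1)) ≠ 0 := by
      rw [Ne, ENNReal.ofReal_eq_zero, not_le]; positivity
    have hm : MemLp (B.1.indicator fun _ => (1 : ℝ)) 2 (∑ g ∈ S, μ g) :=
      memLp_indicator_const 2 B.2 1 (Or.inr (measure_ne_top _ _))
    obtain ⟨f, hf, -⟩ := hm.exists_boundedContinuous_eLpNorm_sub_le (by norm_num) hε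
    refine ⟨f.toContinuousMap, fun g hg => ?_⟩
    have hle : μ g ≤ ∑ g ∈ S, μ g := Finset.single_le_sum (fun _ _ => Measure.zero_le _) hg
    rw [← hV, ← map_sub, LinearIsometry.norm_map, Lp.norm_def]
    refine ENNReal.toReal_le_of_le_ofReal (by positivity) (le_trans (le_of_eq ?_)
      ((eLpNorm_mono_measure _ hle).trans hf))
    refine eLpNorm_congr_norm_ae ?_
    filter_upwards [Lp.coeFn_sub (ContinuousMap.toLp (E := ℂ) 2 (μ g) ℂ
        f.toContinuousMap.toComplex) (ind g B),
      ContinuousMap.coeFn_toLp (p := 2) (𝕜 := ℂ) (μ g) f.toContinuousMap.toComplex,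
      indicatorConstLp_coeFn (p := 2) (hs := B.2) (hμs := measure_ne_top (μ g) B.1)
        (c := (1 : ℂ))] with x h1 h2 h3
    rw [h1, Pi.sub_apply, h2, h3, Pi.sub_apply, norm_sub_rev]
    by_cases hx : x ∈ B.1
    · rw [indicator_of_mem hx, indicator_of_mem hx, ← Complex.norm_real]
      simp [ContinuousMap.toComplex]
    · rw [indicator_of_notMem hx, indicator_of_notMem hx, ← Complex.norm_real]
      simp [ContinuousMap.toComplex]
  choose fa hfa using happrox
  have hlim : ∀ B g, Tendsto (fun p => Ψ (fa B p).toComplex g) atTop (𝓝 (V g (ind g B))) := by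
    intro B g
    rw [tendsto_iff_norm_sub_tendsto_zero]
    have h0 : Tendsto (fun p : Finset K × ℕ => 1 / ((p.2 : ℝ) + 1)) atTop (𝓝 0) := by
      have := tendsto_one_div_add_atTop_nhds_zero_nat (𝕜 := ℝ)
      rw [← prod_atTop_atTop_eq]
      exact this.comp tendsto_snd
    refine squeeze_zero' (Eventually.of_forall fun _ => norm_nonneg _) ?_ h0
    filter_upwards [eventually_ge_atTop ({g}, 0)] with p hp
    exact hfa B p g (hp.1 (Finset.mem_singleton_self g))
  let T : ∀ _ : {B : Set X // MeasurableSet B}, K →L[ℂ] K := fun B =>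
    LinearMap.mkContinuous
      { toFun := fun g => V g (ind g B)
        map_add' := fun g h => tendsto_nhds_unique (hlim B (g + h)) <| by
          simpa only [map_add] using (hlim B g).add (hlim B h)
        map_smul' := fun c g => tendsto_nhds_unique (hlim B (c • g)) <| by
          simpa only [map_smul, RingHom.id_apply] using (hlim B g).const_smul c } 1 (fun g => by
        have h1 : ‖V g (ind g B)‖ ≤ ‖V g (ind g ⟨univ, MeasurableSet.univ⟩)‖ := by
          rw [LinearIsometry.norm_map, LinearIsometry.norm_map, norm_indicatorConstLp (by norm_num)
            (by norm_num), norm_indicatorConstLp (by norm_num) (by norm_num)]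
          gcongr
          · exact measure_ne_top _ _
          · exact subset_univ _
        have h2 : V g (ind g ⟨univ, MeasurableSet.univ⟩) = g := by
          have h3 : V g (ContinuousMap.toLp (E := ℂ) 2 (μ g) ℂ 1) = g := by
            rw [hV, map_one]
            rfl
          refine Eq.trans ?_ h3
          congr 1
          refine Lp.ext ?_
          filter_upwards [ContinuousMap.coeFn_toLp (p := 2) (𝕜 := ℂ) (μ g) (1 : C(X, ℂ)),
            indicatorConstLp_coeFn (p := 2) (hs := MeasurableSet.univ)
              (hμs := measure_ne_top (μ g) univ) (c := (1 : ℂ))] with x h1 h2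
          rw [h1, h2]
          simp
        rw [one_mul]
        rw [h2] at h1
        exact h1)
  have hT : ∀ B g, T B g = V g (ind g B) := fun _ _ => rfl
  have hsymm : ∀ B g h, ⟪T B g, h⟫_ℂ = ⟪g, T B h⟫_ℂ := by
    intro B g h
    have h1 : Tendsto (fun p => ⟪Ψ (fa B p).toComplex g, h⟫_ℂ) atTop (𝓝 ⟪T B g, h⟫_ℂ) :=
      (hlim B g).inner tendsto_const_nhds
    have h2 : Tendsto (fun p => ⟪g, Ψ (fa B p).toComplex h⟫_ℂ) atTop (𝓝 ⟪g, T B h⟫_ℂ) :=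
      tendsto_const_nhds.inner (hlim B h)
    simp_rw [inner_toComplex_symm] at h1
    exact tendsto_nhds_unique h1 h2
  have hform : ∀ B g, ∀ f : C(X, ℂ), ⟪g, Ψ f (T B g)⟫_ℂ = ∫ x in B.1, f x ∂(μ g) := by
    intro B g f
    have h1 : ⟪g, Ψ f (T B g)⟫_ℂ = ⟪Ψ (star f) g, T B g⟫_ℂ := by
      rw [map_star, ContinuousLinearMap.star_eq_adjoint, ContinuousLinearMap.adjoint_inner_left]
    rw [h1, hT, ← hV, LinearIsometry.inner_map_map, L2.inner_def, ← integral_indicator B.2]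
    refine integral_congr_ae ?_
    filter_upwards [ContinuousMap.coeFn_toLp (p := 2) (𝕜 := ℂ) (μ g) (star f),
      indicatorConstLp_coeFn (p := 2) (hs := B.2) (hμs := measure_ne_top (μ g) B.1)
        (c := (1 : ℂ))] with x h1 h2
    rw [h1, h2, RCLike.inner_apply]
    by_cases hx : x ∈ B.1 <;> simp [hx]
  have hform1 : ∀ B g, ⟪g, T B g⟫_ℂ = ((μ g).real B.1 : ℂ) := by
    intro B g
    have := hform B g 1
    rw [map_one] at this
    exact this.trans (by simp)
  have hself : ∀ B g, ⟪T B g, T B g⟫_ℂ = ((μ g).real B.1 : ℂ) := by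
    intro B g
    rw [hT, LinearIsometry.inner_map_map, L2.inner_indicatorConstLp_indicatorConstLp]
    simp
  refine ⟨μ, fun B => if hB : MeasurableSet B then T ⟨B, hB⟩ else 0, hfin, hμ, fun B hB => ?_⟩
  simp only [dif_pos hB]
  refine ⟨⟨?_, ?_⟩, hform1 ⟨B, hB⟩, hform ⟨B, hB⟩⟩
  · refine ContinuousLinearMap.ext_inner_self fun g => ?_
    change ⟪g, T ⟨B, hB⟩ (T ⟨B, hB⟩ g)⟫_ℂ = _
    rw [← hsymm, hself, hform1]
  · rw [ContinuousLinearMap.isSelfAdjoint_iff']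
    exact (ContinuousLinearMap.eq_adjoint_iff _ _).2 (hsymm ⟨B, hB⟩) |>.symm

/-- Spectral theorem in resolvent form: if `N` is injective and normal with
`N - N* = 2 i N* N`, then `N = ∫ (λ - i)⁻¹ dE(λ)` for a projection-valued measure on `ℝ`. -/
theorem exists_projectionMeasure_of_normal (N : K →L[ℂ] K) (hN : IsStarNormal N)
    (hinj : ∀ f, N f = 0 → f = 0) (hid : N - star N = (2 * Complex.I) • (star N * N)) :
    ∃ E : ProjectionMeasure K, ∀ g,
      ⟪g, N g⟫_ℂ = ∫ l : ℝ, 1 / ((l : ℂ) - Complex.I) ∂(E.scalarMeasure g) := by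
  let X := spectrum ℂ N
  have : CompactSpace X := isCompact_iff_compactSpace.1 (spectrum.isCompact N)
  let Ψ : C(X, ℂ) →⋆ₐ[ℂ] (K →L[ℂ] K) := cfcHom hN
  let ι : C(X, ℂ) := ⟨fun x => (x : ℂ), by fun_prop⟩
  have hι : Ψ ι = N := cfcHom_id hN
  have hX : ∀ x : X, (x : ℂ) - starRingEnd ℂ (x : ℂ) =
      2 * Complex.I * (starRingEnd ℂ (x : ℂ) * x) := by
    intro x
    have h1 : Ψ (ι - star ι) = Ψ ((2 * Complex.I) • (star ι * ι)) := by
      rw [map_sub, map_smul, map_mul, map_star, hι, hid]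
    exact DFunLike.congr_fun (cfcHom_injective hN h1) x
  obtain ⟨μ, P, hfin, hμ, hP⟩ := exists_projections_of_starAlgHom Ψ
  -- `w = (λ - i)⁻¹` means `λ = i + 1 / w`, so `E` is the image under this change of variables of
  -- the spectral measure of `N`; the point `w = 0` is no eigenvalue of `N` and carries no mass
  let φ : X → ℝ := fun x => (Complex.I + 1 / (x : ℂ)).re
  have hφ : Measurable φ := by
    refine Complex.measurable_re.comp (measurable_const.add (measurable_const.div ?_))
    exact measurable_subtype_coe
  let Z : Set X := {x | (x : ℂ) = 0}
  have hZ : MeasurableSet Z := measurable_subtype_coe (measurableSet_singleton (0 : ℂ))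
  have hPZ : P Z = 0 := by
    obtain ⟨-, -, h3⟩ := hP Z hZ
    have h4 : N * P Z = 0 := by
      refine ContinuousLinearMap.ext_inner_self fun g => ?_
      have h5 := h3 g ι
      have h6 : ∫ x in Z, ι x ∂(μ g) = ∫ _ in Z, (0 : ℂ) ∂(μ g) :=
        setIntegral_congr_fun hZ (fun x hx => hx)
      rw [hι, h6] at h5
      rw [zero_apply, inner_zero_right]
      exact h5.trans (by simp)
    ext g
    exact hinj _ (DFunLike.congr_fun h4 g)
  have hZ0 : ∀ g, ∀ᵐ x : X ∂(μ g), (x : ℂ) ≠ 0 := by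
    intro g
    have h5 := (hP Z hZ).2.1 g
    rw [hPZ, zero_apply, inner_zero_right] at h5
    have h6 : (μ g).real Z = 0 := by exact_mod_cast h5.symm
    rw [measureReal_eq_zero_iff] at h6
    exact measure_eq_zero_iff_ae_notMem.1 h6
  obtain ⟨E, -, hE⟩ := ProjectionMeasure.exists_of_form (fun B => P (φ ⁻¹' B))
    (fun g => (μ g).map φ) (fun g => inferInstance)
    (fun B hB g => by
      rw [(hP _ (hφ hB)).2.1, map_measureReal_apply hφ hB])
    (fun g => by
      have h1 := hμ g 1
      rw [map_one] at h1
      rw [map_measureReal_apply hφ MeasurableSet.univ, preimage_univ]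
      have h2 : ⟪g, (1 : K →L[ℂ] K) g⟫_ℂ = ((‖g‖ ^ 2 : ℝ) : ℂ) := by
        exact_mod_cast inner_self_eq_norm_sq_to_K (𝕜 := ℂ) g
      rw [h2] at h1
      have h3 : ∫ x, (1 : C(X, ℂ)) x ∂(μ g) = ((μ g).real univ : ℂ) := by simp
      rw [h3] at h1
      exact_mod_cast h1.symm)
    (fun B hB => (hP _ (hφ hB)).1)
  refine ⟨E, fun g => ?_⟩
  have h1 := hμ g ι
  rw [hι] at h1
  have hm : AEStronglyMeasurable (fun l : ℝ => 1 / ((l : ℂ) - Complex.I)) ((μ g).map φ) :=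
    (measurable_const.div (Complex.measurable_ofReal.sub_const _)).aestronglyMeasurable
  rw [h1, hE, integral_map hφ.aemeasurable hm]
  refine integral_congr_ae ?_
  filter_upwards [hZ0 g] with x hx
  -- on the spectrum `Im (1 / w) = -1`, so that `i + 1 / w` is real
  have h2 : Complex.I + 1 / (x : ℂ) = (φ x : ℂ) := by
    refine (Complex.conj_eq_iff_re.1 ?_).symm
    have hx' : starRingEnd ℂ (x : ℂ) ≠ 0 := by simpa using hx
    have h3 := hX x
    simp only [map_add, Complex.conj_I, map_div₀, map_one]
    field_simp
    linear_combination h3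
  change (x : ℂ) = _
  rw [← h2]
  field_simp
  ring

end Spectral

/-! ### Self-adjoint operators and their spectral measures -/

section Spectral

variable {K : Type u} [NormedAddCommGroup K] [InnerProductSpace ℂ K]

/-- A linear relation that is the graph of a self-adjoint operator: `symm` and `maximal` say that
the relation equals its adjoint, and `single` that it is single-valued (equivalently, that its
domain is dense). -/
structure IsSelfAdjointGraph (T : Submodule ℂ (K × K)) : Prop where
  symm : ∀ p ∈ T, ∀ q ∈ T, ⟪p.1, q.2⟫_ℂ = ⟪p.2, q.1⟫_ℂ
  maximal : ∀ h g : K, (∀ p ∈ T, ⟪h, p.2⟫_ℂ = ⟪g, p.1⟫_ℂ) → (h, g) ∈ T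
  single : ∀ v : K, ((0 : K), v) ∈ T → v = 0

namespace IsSelfAdjointGraph

variable {T : Submodule ℂ (K × K)}

/-- `T - z` is bounded below by `|Im z|`, because `Im (f, (T - z) f) = -Im z ‖f‖²`. -/
theorem norm_le (hT : IsSelfAdjointGraph T) {z : ℂ} {p : K × K} (hp : p ∈ T) :
    |z.im| * ‖p.1‖ ≤ ‖p.2 - z • p.1‖ := by
  have h1 := hT.symm p hp p hp
  have h2 : (⟪p.1, p.2⟫_ℂ).im = 0 := by
    have h3 : starRingEnd ℂ ⟪p.1, p.2⟫_ℂ = ⟪p.1, p.2⟫_ℂ := by rw [inner_conj_symm, h1]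
    exact Complex.conj_eq_iff_im.1 h3
  have h4 : (⟪p.1, p.2 - z • p.1⟫_ℂ).im = -(z.im * ‖p.1‖ ^ 2) := by
    have h5 : ⟪p.1, p.1⟫_ℂ = ((‖p.1‖ ^ 2 : ℝ) : ℂ) := by
      exact_mod_cast inner_self_eq_norm_sq_to_K (𝕜 := ℂ) p.1
    rw [inner_sub_right, inner_smul_right, Complex.sub_im, h2, h5, Complex.im_mul_ofReal]
    ring
  have h6 : |z.im| * ‖p.1‖ ^ 2 ≤ ‖p.1‖ * ‖p.2 - z • p.1‖ := by
    calc |z.im| * ‖p.1‖ ^ 2 = |(⟪p.1, p.2 - z • p.1⟫_ℂ).im| := by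
          rw [h4, abs_neg, abs_mul, abs_of_nonneg (sq_nonneg ‖p.1‖)]
      _ ≤ _ := (Complex.abs_im_le_norm _).trans (norm_inner_le_norm _ _)
  rcases (norm_nonneg p.1).eq_or_lt with h | h
  · rw [← h, mul_zero]; exact norm_nonneg _
  · refine le_of_mul_le_mul_left ?_ h
    linarith

/-- A self-adjoint operator has no non-real eigenvalues. -/
theorem eq_zero (hT : IsSelfAdjointGraph T) {z : ℂ} (hz : z.im ≠ 0) {u : K}
    (h : (u, z • u) ∈ T) : u = 0 := by
  have h1 := hT.norm_le (z := z) h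
  simp only [sub_self, norm_zero] at h1
  have h2 : 0 < |z.im| := abs_pos.2 hz
  exact norm_le_zero_iff.1 (nonpos_of_mul_nonpos_right h1 h2)

theorem isClosed (hT : IsSelfAdjointGraph T) : IsClosed (T : Set (K × K)) := by
  have : (T : Set (K × K)) = ⋂ p : T, {q | ⟪q.1, p.1.2⟫_ℂ = ⟪q.2, p.1.1⟫_ℂ} := by
    ext q
    simp only [mem_iInter]
    exact ⟨fun hq p => hT.symm q hq p.1 p.2, fun h => hT.maximal q.1 q.2 fun p hp => h ⟨p, hp⟩⟩
  rw [this]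
  exact isClosed_iInter fun p => isClosed_eq (by fun_prop) (by fun_prop)

/-- The resolvent of a self-adjoint operator at a non-real point exists: the range of `T - z` is
closed, since `T - z` is bounded below, and dense, since its orthogonal complement consists of
eigenvectors for the conjugate of `z`. -/
theorem exists_resolvent [CompleteSpace K] (hT : IsSelfAdjointGraph T) {z : ℂ}
    (hz : z.im ≠ 0) : ∃ R : K →L[ℂ] K,
    (∀ f, (R f, f + z • R f) ∈ T) ∧ ∀ p ∈ T, R (p.2 - z • p.1) = p.1 := by
  have : CompleteSpace T := hT.isClosed.completeSpace_coe
  let A : T →L[ℂ] K := (ContinuousLinearMap.snd ℂ K K - z • ContinuousLinearMap.fst ℂ K K).comp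
    T.subtypeL
  have hA : ∀ p : T, A p = p.1.2 - z • p.1.1 := fun p => rfl
  have hpos : 0 < |z.im| := abs_pos.2 hz
  have hbound : ∀ p : T, ‖p‖ ≤ (1 + (1 + ‖z‖) / |z.im|) * ‖A p‖ := by
    intro p
    have h1 : ‖p.1.1‖ ≤ ‖A p‖ / |z.im| := by
      rw [le_div_iff₀ hpos, mul_comm]; exact hT.norm_le p.2
    have h2 : ‖p.1.2‖ ≤ ‖A p‖ + ‖z‖ * ‖p.1.1‖ := by
      have : p.1.2 = A p + z • p.1.1 := by rw [hA]; abel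
      calc ‖p.1.2‖ = ‖A p + z • p.1.1‖ := by rw [← this]
        _ ≤ _ := (norm_add_le _ _).trans (by rw [norm_smul])
    have h3 : ‖z‖ * ‖p.1.1‖ ≤ ‖z‖ * (‖A p‖ / |z.im|) := by gcongr
    have h4 : (1 + (1 + ‖z‖) / |z.im|) * ‖A p‖ =
        ‖A p‖ + ‖A p‖ / |z.im| + ‖z‖ * (‖A p‖ / |z.im|) := by ring
    have h5 : 0 ≤ ‖A p‖ / |z.im| := by positivity
    have h6 : 0 ≤ ‖z‖ * (‖A p‖ / |z.im|) := by positivity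
    rw [h4]
    exact max_le (h1.trans (by linarith [norm_nonneg (A p)])) (h2.trans (by linarith))
  have hanti : AntilipschitzWith (Real.toNNReal (1 + (1 + ‖z‖) / |z.im|)) A := by
    refine AddMonoidHomClass.antilipschitz_of_bound A fun p => ?_
    rw [Real.coe_toNNReal _ (by positivity)]
    exact hbound p
  have hclosed : IsClosed (range A) := hanti.isClosed_range A.uniformContinuous
  have hrange : LinearMap.range A.toLinearMap = ⊤ := by
    have hc : IsClosed ((LinearMap.range A.toLinearMap : Submodule ℂ K) : Set K) := by
      rw [LinearMap.coe_range]
      exact hclosed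
    have : CompleteSpace (LinearMap.range A.toLinearMap : Submodule ℂ K) := hc.completeSpace_coe
    rw [← Submodule.orthogonal_eq_bot_iff, Submodule.eq_bot_iff]
    intro h hh
    have h1 : (h, starRingEnd ℂ z • h) ∈ T := by
      refine hT.maximal _ _ fun p hp => ?_
      have h2 : ⟪h, A ⟨p, hp⟩⟫_ℂ = 0 :=
        Submodule.inner_left_of_mem_orthogonal (LinearMap.mem_range_self A.toLinearMap ⟨p, hp⟩) hh
      rw [hA, inner_sub_right, inner_smul_right, sub_eq_zero] at h2
      rw [h2, inner_smul_left, Complex.conj_conj]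
    exact hT.eq_zero (by simpa using hz) h1
  have hker : LinearMap.ker A.toLinearMap = ⊥ := LinearMap.ker_eq_bot.2 hanti.injective
  let e := ContinuousLinearEquiv.ofBijective A hker hrange
  have he : ∀ p, e p = A p := fun p => rfl
  have hinv : ∀ p : T, e.symm (p.1.2 - z • p.1.1) = p := fun p => e.symm_apply_apply p
  refine ⟨((ContinuousLinearMap.fst ℂ K K).comp T.subtypeL).comp (e.symm : K →L[ℂ] T),
    fun f => ?_, fun p hp => ?_⟩
  · have h1 : A (e.symm f) = f := e.apply_symm_apply f
    have h2 : ((e.symm f : T) : K × K).2 = f + z • ((e.symm f : T) : K × K).1 := by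
      rw [hA] at h1
      rw [← sub_eq_iff_eq_add, h1]
    change (((e.symm f : T) : K × K).1, f + z • ((e.symm f : T) : K × K).1) ∈ T
    rw [← h2]
    exact (e.symm f).2
  · change ((e.symm (p.2 - z • p.1) : T) : K × K).1 = p.1
    rw [hinv ⟨p, hp⟩]

end IsSelfAdjointGraph

variable [CompleteSpace K]

namespace ProjectionMeasure

variable {E : ProjectionMeasure K}

theorem measurable_inv_sub (z : ℂ) : Measurable fun l : ℝ => 1 / ((l : ℂ) - z) :=
  measurable_const.div (Complex.measurable_ofReal.sub_const _)

theorem norm_inv_sub_le {z : ℂ} (hz : z.im ≠ 0) (l : ℝ) : ‖1 / ((l : ℂ) - z)‖ ≤ 1 / |z.im| := by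
  rw [norm_div, norm_one]
  have h : |z.im| ≤ ‖(l : ℂ) - z‖ := by
    simpa using Complex.abs_im_le_norm ((l : ℂ) - z)
  exact one_div_le_one_div_of_le (abs_pos.2 hz) h

theorem memLp_inv_sub {z : ℂ} (hz : z.im ≠ 0) (f : K) :
    MemLp (fun l : ℝ => 1 / ((l : ℂ) - z)) 2 (E.scalarMeasure f) :=
  memLp_of_bounded (measurable_inv_sub z) (norm_inv_sub_le hz) f

/-- The self-adjoint operator `∫ λ dE(λ)`. -/
abbrev idOp (E : ProjectionMeasure K) : K →ₗ.[ℂ] K :=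
  E.op (fun l => (l : ℂ)) Complex.measurable_ofReal

/-- The integral of `(λ - z)⁻¹` is the resolvent of `∫ λ dE(λ)` at `z`. -/
theorem inv_sub_mem_graph {z : ℂ} (hz : z.im ≠ 0) (f : K) :
    (E.int (fun l : ℝ => 1 / ((l : ℂ) - z)) f,
      f + z • E.int (fun l : ℝ => 1 / ((l : ℂ) - z)) f) ∈ E.idOp.graph := by
  have h1 := memLp_inv_sub (E := E) hz f
  have h0 : ∀ l : ℝ, (l : ℂ) - z ≠ 0 := fun l h => hz (by
    rw [← sub_eq_zero.1 h]; simp)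
  have h2 : (fun l : ℝ => (l : ℂ)) * (fun l : ℝ => 1 / ((l : ℂ) - z)) =
      1 + z • fun l : ℝ => 1 / ((l : ℂ) - z) := by
    funext l
    simp only [Pi.mul_apply, Pi.add_apply, Pi.one_apply, Pi.smul_apply, smul_eq_mul]
    field_simp [h0 l]
    ring
  have h3 : MemLp (1 : ℝ → ℂ) 2 (E.scalarMeasure f) := memLp_const 1
  have h4 : MemLp (z • fun l : ℝ => 1 / ((l : ℂ) - z)) 2 (E.scalarMeasure f) := h1.const_smul z
  obtain ⟨h5, h6⟩ := int_int (measurable_inv_sub z) Complex.measurable_ofReal h1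
    (by rw [h2]; exact h3.add h4)
  refine (mem_op_graph _).2 ⟨h5, ?_⟩
  rw [h6, h2, int_add h3 h4, int_one, int_smul z h1]

theorem symm_idOp {p q : K × K} (hp : p ∈ E.idOp.graph) (hq : q ∈ E.idOp.graph) :
    ⟪p.1, q.2⟫_ℂ = ⟪p.2, q.1⟫_ℂ := by
  obtain ⟨p1, p2⟩ := p
  obtain ⟨q1, q2⟩ := q
  obtain ⟨hp1, rfl⟩ := (mem_op_graph _).1 hp
  obtain ⟨hq1, rfl⟩ := (mem_op_graph _).1 hq
  have := inner_int_right Complex.measurable_ofReal hq1 hp1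
  simpa only [Complex.conj_ofReal] using this

theorem isSelfAdjointGraph_idOp (E : ProjectionMeasure K) : IsSelfAdjointGraph E.idOp.graph where
  symm _ hp _ hq := symm_idOp hp hq
  single v hv := by
    obtain ⟨-, h⟩ := (mem_op_graph _).1 hv
    have h0 := (E.int_vec_smul Complex.measurable_ofReal (f := 0) 0 (by
      have := ((mem_op_graph (E := E) _).1 hv).1
      exact this)).2
    rw [zero_smul, zero_smul] at h0
    rw [← h, h0]
  maximal h g hhg := by
    -- the resolvent at `i` maps `g - i h` to `h`
    have hz : (Complex.I).im ≠ 0 := by simp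
    have h1 := inv_sub_mem_graph (E := E) hz (g - Complex.I • h)
    set u := E.int (fun l : ℝ => 1 / ((l : ℂ) - Complex.I)) (g - Complex.I • h) with hu
    suffices h2 : h - u = 0 by
      rw [sub_eq_zero] at h2
      rw [← h2] at h1
      simpa using h1
    rw [← inner_self_eq_zero (𝕜 := ℂ)]
    have hz' : (-Complex.I).im ≠ 0 := by simp
    have h3 := inv_sub_mem_graph (E := E) hz' (h - u)
    set w := E.int (fun l : ℝ => 1 / ((l : ℂ) - -Complex.I)) (h - u) with hw
    have h4 := hhg _ h3
    have h5 := symm_idOp h1 h3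
    simp only [inner_add_right, inner_add_left, inner_smul_right, inner_smul_left, inner_sub_left]
      at h4 h5
    simp only [Complex.conj_I] at h4 h5
    rw [inner_sub_left]
    linear_combination h4 - h5

/-- The spectral measure of a self-adjoint operator is unique: the resolvent determines the
Stieltjes transforms of the scalar measures. -/
theorem eq_of_idOp_eq {E F : ProjectionMeasure K} (h : E.idOp = F.idOp) : E = F := by
  have h1 : ∀ f, E.scalarMeasure f = F.scalarMeasure f := by
    intro f
    refine eq_of_stieltjes_eq fun z hz _ => ?_
    have hz' : z.im ≠ 0 := hz.ne'
    rw [← inner_int (memLp_inv_sub hz' f), ← inner_int (memLp_inv_sub hz' f)]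
    congr 1
    have h2 := inv_sub_mem_graph (E := E) hz' f
    have h3 := inv_sub_mem_graph (E := F) hz' f
    rw [← h] at h3
    have h4 := Submodule.sub_mem _ h2 h3
    rw [← sub_eq_zero]
    refine E.isSelfAdjointGraph_idOp.eq_zero hz' ?_
    rw [Prod.mk_sub_mk, add_sub_add_left_eq_sub, ← smul_sub] at h4
    exact h4
  have h2 : ∀ B, E B = F B := by
    intro B
    by_cases hB : MeasurableSet B
    · refine ContinuousLinearMap.ext_inner_self fun f => ?_
      rw [inner_self, inner_self, ← real_scalarMeasure _ _ hB, ← real_scalarMeasure _ _ hB, h1]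
    · rw [E.eq_zero' B hB, F.eq_zero' B hB]
  cases E
  cases F
  congr
  exact funext h2

end ProjectionMeasure

/-- The spectral theorem: a self-adjoint operator is `∫ λ dE(λ)` for some projection-valued
measure `E`. -/
theorem IsSelfAdjointGraph.exists_projectionMeasure {T : Submodule ℂ (K × K)}
    (hT : IsSelfAdjointGraph T) : ∃ E : ProjectionMeasure K, T = E.idOp.graph := by
  have hI : (Complex.I).im ≠ 0 := by simp
  have hI' : (-Complex.I).im ≠ 0 := by simp
  obtain ⟨N, hN1, hN2⟩ := hT.exists_resolvent hI
  obtain ⟨M, hM1, hM2⟩ := hT.exists_resolvent hI'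
  have hadj : star N = M := by
    rw [ContinuousLinearMap.star_eq_adjoint, eq_comm, ContinuousLinearMap.eq_adjoint_iff]
    intro f g
    have h := hT.symm _ (hM1 f) _ (hN1 g)
    simp only [inner_add_right, inner_add_left, inner_smul_right, inner_smul_left, map_neg,
      Complex.conj_I, neg_neg] at h
    linear_combination h
  -- the two forms of the resolvent identity show that the resolvent `N` at `i` commutes with its
  -- adjoint, the resolvent `M` at `-i`
  have hNM : N - M = (2 * Complex.I) • (M * N) := by
    ext f
    have h := hM2 _ (hN1 f)
    simp only [map_sub, map_add, map_smul] at h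
    change N f - M f = (2 * Complex.I) • M (N f)
    nth_rewrite 1 [← h]
    module
  have hMN : N - M = (2 * Complex.I) • (N * M) := by
    ext f
    have h := hN2 _ (hM1 f)
    simp only [map_sub, map_add, map_smul] at h
    change N f - M f = (2 * Complex.I) • N (M f)
    nth_rewrite 1 [← h]
    module
  have hnorm : IsStarNormal N := ⟨by
    rw [hadj]
    exact smul_right_injective _ (r := 2 * Complex.I) (by simp) (hNM.symm.trans hMN)⟩
  have hinj : ∀ f, N f = 0 → f = 0 := by
    intro f hf
    have h := hN1 f
    rw [hf, smul_zero, add_zero] at h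
    exact hT.single f h
  obtain ⟨E, hE⟩ := exists_projectionMeasure_of_normal N hnorm hinj (by rw [hadj, hNM])
  -- the resolvent of `T` at `i` is that of `∫ λ dE(λ)`, so the two operators agree
  have hN : ∀ f, N f = E.int (fun l : ℝ => 1 / ((l : ℂ) - Complex.I)) f := by
    obtain ⟨S, hS⟩ := ProjectionMeasure.exists_bounded (E := E)
      (ProjectionMeasure.measurable_inv_sub Complex.I) (by positivity)
      (ProjectionMeasure.norm_inv_sub_le hI)
    have : N = S := ContinuousLinearMap.ext_inner_self fun g => by
      rw [hE, hS, ProjectionMeasure.inner_int (ProjectionMeasure.memLp_inv_sub hI g)]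
    rw [this]
    exact hS
  have hle : ∀ p ∈ T, p ∈ E.idOp.graph := by
    intro p hp
    have h1 := ProjectionMeasure.inv_sub_mem_graph (E := E) hI (p.2 - Complex.I • p.1)
    rw [← hN, hN2 p hp] at h1
    simpa using h1
  refine ⟨E, le_antisymm hle fun q hq => ?_⟩
  exact hT.maximal q.1 q.2 fun p hp => E.isSelfAdjointGraph_idOp.symm q hq p (hle p hp)

theorem LinearPMap.isSpectralMeasureOf_iff {T : K →ₗ.[ℂ] K} {E : ProjectionMeasure K} :
    E.IsSpectralMeasureOf T ↔ T = E.idOp :=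
  ⟨fun h => ProjectionMeasure.IsIntegral.eq_op _ h,
    fun h => by rw [h]; exact ProjectionMeasure.isIntegral_op _⟩

theorem isFunctionOf_idOp_iff (E : ProjectionMeasure K) {F : ℝ → ℂ} (hF : Measurable F)
    {A : K →ₗ.[ℂ] K} : IsFunctionOf E.idOp F A ↔ A = E.op F hF := by
  constructor
  · rintro ⟨E', h1, h2⟩
    rw [LinearPMap.isSpectralMeasureOf_iff] at h1
    rw [ProjectionMeasure.eq_of_idOp_eq h1]
    exact h2.eq_op hF
  · rintro rfl
    exact ⟨E, LinearPMap.isSpectralMeasureOf_iff.2 rfl, ProjectionMeasure.isIntegral_op hF⟩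

theorem functionOf_idOp (E : ProjectionMeasure K) {F : ℝ → ℂ} (hF : Measurable F) :
    functionOf E.idOp F = E.op F hF := by
  have h : ∃ A, IsFunctionOf E.idOp F A := ⟨_, (isFunctionOf_idOp_iff E hF).2 rfl⟩
  rw [functionOf, dif_pos h]
  exact (isFunctionOf_idOp_iff E hF).1 h.choose_spec

/-- A densely defined operator with self-adjoint graph is self-adjoint. -/
theorem IsSelfAdjointGraph.isSelfAdjoint {T : K →ₗ.[ℂ] K} (hT : IsSelfAdjointGraph T.graph) :
    IsSelfAdjoint T := by
  have hd : Dense (T.domain : Set K) := by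
    rw [Submodule.dense_iff_topologicalClosure_eq_top,
      Submodule.topologicalClosure_eq_top_iff, Submodule.eq_bot_iff]
    intro v hv
    refine hT.single v (hT.maximal _ _ fun p hp => ?_)
    rw [inner_zero_left]
    obtain ⟨x, hx1, hx2⟩ := (LinearPMap.mem_graph_iff T).1 hp
    rw [← hx1]
    exact (Submodule.inner_left_of_mem_orthogonal x.2 hv).symm
  rw [LinearPMap.isSelfAdjoint_def]
  refine LinearPMap.eq_of_eq_graph ?_
  ext q
  rw [LinearPMap.adjoint_graph_eq_graph_adjoint hd, Submodule.mem_adjoint_iff]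
  constructor
  · intro h
    refine hT.maximal q.1 q.2 fun p hp => ?_
    rw [← inner_conj_symm, sub_eq_zero.1 (h p.1 p.2 hp), inner_conj_symm]
  · intro hq p1 p2 hp
    rw [sub_eq_zero]
    exact (hT.symm (p1, p2) hp q hq).symm

end Spectral

/-! ### Boundary triples -/

section Triple

variable {K H : Type u} [NormedAddCommGroup K] [InnerProductSpace ℂ K]
  [NormedAddCommGroup H] [InnerProductSpace ℂ H]

/-- Hellinger-Toeplitz: a map with an everywhere defined formal adjoint is linear and bounded. -/
theorem exists_clm_of_formal_adjoint [CompleteSpace K] [CompleteSpace H] (A : H → K) (B : K → H)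
    (h : ∀ p f, ⟪A p, f⟫_ℂ = ⟪p, B f⟫_ℂ) : ∃ A' : H →L[ℂ] K, ∀ p, A' p = A p := by
  let L : H →ₗ[ℂ] K :=
    { toFun := A
      map_add' := fun p q => ext_inner_right ℂ fun f => by
        rw [inner_add_left, h, h, h, inner_add_left]
      map_smul' := fun c p => ext_inner_right ℂ fun f => by
        rw [RingHom.id_apply, inner_smul_left, h, h, inner_smul_left] }
  have hL : Continuous L := by
    refine L.continuous_of_seq_closed_graph fun s x y hs hy => ?_
    refine ext_inner_right ℂ fun f => ?_
    have h1 : Tendsto (fun n => ⟪L (s n), f⟫_ℂ) atTop (𝓝 ⟪y, f⟫_ℂ) := hy.inner tendsto_const_nhds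
    have h2 : Tendsto (fun n => ⟪s n, B f⟫_ℂ) atTop (𝓝 ⟪x, B f⟫_ℂ) := hs.inner tendsto_const_nhds
    have h3 : (fun n => ⟪L (s n), f⟫_ℂ) = fun n => ⟪s n, B f⟫_ℂ := funext fun n => h _ _
    rw [h3] at h1
    exact (tendsto_nhds_unique h1 h2).trans (h x f).symm
  exact ⟨⟨L, hL⟩, fun p => rfl⟩

/-- A boundary triple, encoded by the relation `𝒢` of all `(u, A u, Γ₀ u, Γ₁ u)` with `u` in the
domain of the maximal operator `A` and with boundary maps `Γ₀`, `Γ₁` that satisfy Green's identity;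
the restriction of `A` to the kernel of `Γ₀` is maximal symmetric, and `Γ₀` is onto. -/
structure IsBoundaryTriple (𝒢 : Submodule ℂ (K × K × H × H)) : Prop where
  green : ∀ x ∈ 𝒢, ∀ y ∈ 𝒢, ⟪x.1, y.2.1⟫_ℂ - ⟪x.2.1, y.1⟫_ℂ =
    ⟪x.2.2.1, y.2.2.2⟫_ℂ - ⟪x.2.2.2, y.2.2.1⟫_ℂ
  maximal : ∀ h g : K, (∀ x ∈ 𝒢, x.2.2.1 = 0 → ⟪h, x.2.1⟫_ℂ = ⟪g, x.1⟫_ℂ) →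
    ∃ q, (h, g, (0 : H), q) ∈ 𝒢
  surj : ∀ p : H, ∃ u v q, (u, v, p, q) ∈ 𝒢
  single : ∀ v p q, ((0 : K), v, p, q) ∈ 𝒢 → v = 0 ∧ p = 0 ∧ q = 0

/-- The graph of the restriction of the maximal operator to the kernel of the first boundary
map. -/
def kerGraph (𝒢 : Submodule ℂ (K × K × H × H)) : Submodule ℂ (K × K) where
  carrier := {p | ∃ q, (p.1, p.2, (0 : H), q) ∈ 𝒢}
  add_mem' := by
    rintro p q ⟨x, hx⟩ ⟨y, hy⟩
    exact ⟨x + y, by simpa using 𝒢.add_mem hx hy⟩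
  zero_mem' := ⟨0, 𝒢.zero_mem⟩
  smul_mem' := by
    rintro c p ⟨x, hx⟩
    exact ⟨c • x, by simpa using 𝒢.smul_mem c hx⟩

theorem mem_kerGraph {𝒢 : Submodule ℂ (K × K × H × H)} {u v : K} :
    (u, v) ∈ kerGraph 𝒢 ↔ ∃ q, (u, v, (0 : H), q) ∈ 𝒢 := Iff.rfl

namespace IsBoundaryTriple

variable {𝒢 : Submodule ℂ (K × K × H × H)}

/-- Green's identity makes the restriction to `Γ₀ u = 0` symmetric, and maximality makes it
self-adjoint. -/
theorem isSelfAdjointGraph (h𝒢 : IsBoundaryTriple 𝒢) : IsSelfAdjointGraph (kerGraph 𝒢) where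
  symm := by
    rintro p ⟨x, hx⟩ q ⟨y, hy⟩
    have h := h𝒢.green _ hx _ hy
    simpa [sub_eq_zero] using h
  maximal h g hhg := h𝒢.maximal h g fun x hx hx0 => by
    refine hhg (x.1, x.2.1) ⟨x.2.2.2, ?_⟩
    rw [← hx0]
    exact hx
  single := by
    rintro v ⟨q, hq⟩
    exact (h𝒢.single _ _ _ hq).1

theorem solution_unique (h𝒢 : IsBoundaryTriple 𝒢) {z : ℂ} (hz : z.im ≠ 0) {u u' : K} {p q q' : H}
    (h : (u, z • u, p, q) ∈ 𝒢) (h' : (u', z • u', p, q') ∈ 𝒢) : u = u' ∧ q = q' := by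
  have h1 := 𝒢.sub_mem h h'
  simp only [Prod.mk_sub_mk, sub_self, ← smul_sub] at h1
  have h2 : u - u' = 0 := h𝒢.isSelfAdjointGraph.eq_zero hz (mem_kerGraph.2 ⟨_, h1⟩)
  rw [h2] at h1
  exact ⟨sub_eq_zero.1 h2, sub_eq_zero.1 (h𝒢.single _ _ _ h1).2.2⟩

variable [CompleteSpace K]

/-- Solutions of `A u = z u` with prescribed first boundary value `p`: correct any `u` with `Γ₀ u =
p` by the resolvent of the self-adjoint restriction. -/
theorem exists_solution (h𝒢 : IsBoundaryTriple 𝒢) {z : ℂ} (hz : z.im ≠ 0) (p : H) :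
    ∃ u q, (u, z • u, p, q) ∈ 𝒢 := by
  obtain ⟨R, hR, -⟩ := h𝒢.isSelfAdjointGraph.exists_resolvent hz
  obtain ⟨u, v, q, h⟩ := h𝒢.surj p
  obtain ⟨q', h'⟩ := mem_kerGraph.1 (hR (v - z • u))
  refine ⟨u - R (v - z • u), q - q', ?_⟩
  have h1 := 𝒢.sub_mem h h'
  simp only [Prod.mk_sub_mk, sub_zero] at h1
  convert h1 using 2
  rw [Prod.mk.injEq]
  exact ⟨by module, rfl⟩

variable [CompleteSpace H]

/-- The `γ`-field and the Weyl function of a boundary triple are bounded: Green's identity provides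
formal adjoints. -/
theorem exists_weyl (h𝒢 : IsBoundaryTriple 𝒢) {z : ℂ} (hz : z.im ≠ 0) :
    ∃ (Γ : H →L[ℂ] K) (M : H →L[ℂ] H), ∀ p, (Γ p, z • Γ p, p, M p) ∈ 𝒢 := by
  have hz' : (starRingEnd ℂ z).im ≠ 0 := by simpa using hz
  choose u q huq using fun p => h𝒢.exists_solution hz p
  choose u' q' huq' using fun p => h𝒢.exists_solution hz' p
  obtain ⟨R, hR, -⟩ := h𝒢.isSelfAdjointGraph.exists_resolvent hz'
  choose X hX using fun f => mem_kerGraph.1 (hR f)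
  obtain ⟨Γ, hΓ⟩ := exists_clm_of_formal_adjoint u X fun p f => by
    have h := h𝒢.green _ (huq p) _ (hX f)
    simp only [inner_add_right, inner_smul_left, inner_smul_right, inner_zero_right, sub_zero] at h
    linear_combination h
  obtain ⟨M, hM⟩ := exists_clm_of_formal_adjoint q q' fun p f => by
    have h := h𝒢.green _ (huq p) _ (huq' f)
    simp only [inner_smul_left, inner_smul_right] at h
    linear_combination h
  exact ⟨Γ, M, fun p => by rw [hΓ, hM]; exact huq p⟩

end IsBoundaryTriple

open Classical in
/-- The operators `G(B) = ∫_B (λ - i) dE(λ) Γ` for bounded Borel sets `B`; elsewhere the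
conventional value is `0`. -/
def gammaInt [CompleteSpace K] (E : ProjectionMeasure K) (Γ : H →L[ℂ] K) (B : Set ℝ) :
    H →L[ℂ] K :=
  if h : MeasurableSet B ∧ ∃ C : ℝ, ∀ l ∈ B, |l| ≤ C then
    (ProjectionMeasure.exists_bounded (E := E) (C := max h.2.choose 0 + 1)
      (F := B.indicator fun l : ℝ => (l : ℂ) - Complex.I)
      ((Complex.measurable_ofReal.sub_const _).indicator h.1) (by positivity)
      (fun l => by
        by_cases hl : l ∈ B
        · rw [indicator_of_mem hl]
          refine (norm_sub_le _ _).trans ?_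
          rw [Complex.norm_real, Complex.norm_I]
          gcongr
          exact (h.2.choose_spec l hl).trans (le_max_left _ _)
        · rw [indicator_of_notMem hl, norm_zero]
          positivity)).choose.comp Γ
  else 0

theorem exists_abs_le_of_isBounded {B : Set ℝ} (hb : Bornology.IsBounded B) :
    ∃ C : ℝ, ∀ l ∈ B, |l| ≤ C := hb.exists_norm_le

section GammaInt

variable [CompleteSpace K] {E : ProjectionMeasure K} {Γ : H →L[ℂ] K}

theorem gammaInt_apply {B : Set ℝ} (hB : MeasurableSet B) (hb : Bornology.IsBounded B) (ξ : H) :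
    gammaInt E Γ B ξ = E.int (B.indicator fun l : ℝ => (l : ℂ) - Complex.I) (Γ ξ) := by
  have h : MeasurableSet B ∧ ∃ C : ℝ, ∀ l ∈ B, |l| ≤ C := ⟨hB, exists_abs_le_of_isBounded hb⟩
  rw [gammaInt, dif_pos h]
  generalize_proofs h1
  exact h1.choose_spec (Γ ξ)

theorem measurable_sub_I : Measurable fun l : ℝ => (l : ℂ) - Complex.I :=
  Complex.measurable_ofReal.sub_const _

theorem memLp_indicator_sub_I {B : Set ℝ} (hB : MeasurableSet B) (hb : Bornology.IsBounded B)
    (f : K) : MemLp (B.indicator fun l : ℝ => (l : ℂ) - Complex.I) 2 (E.scalarMeasure f) := by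
  obtain ⟨C, hC⟩ := exists_abs_le_of_isBounded hb
  refine ProjectionMeasure.memLp_indicator_of_bounded measurable_sub_I hB (C := C + 1)
    fun l hl => ?_
  refine (norm_sub_le _ _).trans ?_
  rw [Complex.norm_real, Complex.norm_I]
  gcongr
  exact hC l hl

theorem apply_gammaInt {A B : Set ℝ} (hA : MeasurableSet A) (hB : MeasurableSet B)
    (hb : Bornology.IsBounded B) (ξ : H) :
    E A (gammaInt E Γ B ξ) = gammaInt E Γ (A ∩ B) ξ := by
  rw [gammaInt_apply hB hb, gammaInt_apply (hA.inter hB) (hb.subset inter_subset_right),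
    ProjectionMeasure.apply_int (memLp_indicator_sub_I hB hb _) hA, indicator_indicator]

theorem apply_gammaInt_self {B : Set ℝ} (hB : MeasurableSet B)
    (hb : Bornology.IsBounded B) (ξ : H) : E B (gammaInt E Γ B ξ) = gammaInt E Γ B ξ := by
  rw [apply_gammaInt hB hB hb, inter_self]

/-- The vectors `G(B) ξ` are orthogonally scattered: `(G(A) ξ, G(B) η)` depends on `A ∩ B` only. -/
theorem inner_gammaInt {A B : Set ℝ} (hA : MeasurableSet A) (hB : MeasurableSet B)
    (ha : Bornology.IsBounded A) (hb : Bornology.IsBounded B) (ξ η : H) :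
    ⟪gammaInt E Γ A ξ, gammaInt E Γ B η⟫_ℂ =
      ⟪gammaInt E Γ (A ∩ B) ξ, gammaInt E Γ (A ∩ B) η⟫_ℂ := by
  have h1 : gammaInt E Γ (B ∩ A) ξ = E A (gammaInt E Γ (B ∩ A) ξ) := by
    rw [apply_gammaInt hA (hB.inter hA) (ha.subset inter_subset_right),
      inter_eq_right.2 inter_subset_right]
  rw [← apply_gammaInt_self hB hb, ← E.isSymm, apply_gammaInt hB hA ha, h1, E.isSymm,
    apply_gammaInt hA hB hb, inter_comm]

/-- `‖G(B) ξ‖² = ∫_B (1 + λ²) d(Γ ξ, E(λ) Γ ξ)`, as `|λ - i|² = 1 + λ²`. -/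
theorem enorm_gammaInt_sq {B : Set ℝ} (hB : MeasurableSet B) (hb : Bornology.IsBounded B) (ξ : H) :
    ‖gammaInt E Γ B ξ‖ₑ ^ 2 =
      ∫⁻ l in B, ENNReal.ofReal (1 + l ^ 2) ∂(E.scalarMeasure (Γ ξ)) := by
  rw [gammaInt_apply hB hb, ProjectionMeasure.enorm_int (memLp_indicator_sub_I hB hb _),
    sq_eLpNorm_two, ← lintegral_indicator hB]
  refine lintegral_congr fun l => ?_
  by_cases hl : l ∈ B
  · rw [indicator_of_mem hl, indicator_of_mem hl, ← ofReal_norm,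
      ← ENNReal.ofReal_pow (norm_nonneg _)]
    congr 1
    rw [← Complex.normSq_eq_norm_sq, Complex.normSq_apply]
    simp
    ring
  · rw [indicator_of_notMem hl, indicator_of_notMem hl]
    simp

variable [CompleteSpace H]

/-- The operator-valued measure `B ↦ G(B)* G(B)`. -/
def gammaMeasure (E : ProjectionMeasure K) (Γ : H →L[ℂ] K) : OperatorMeasure H where
  toFun B := (gammaInt E Γ B).adjoint.comp (gammaInt E Γ B)
  empty' := by
    have : gammaInt E Γ ∅ = 0 := by
      ext ξ
      rw [← apply_gammaInt_self MeasurableSet.empty Bornology.isBounded_empty, E.empty]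
      rfl
    rw [this]
    simp
  isPositive' B _ _ := ContinuousLinearMap.isPositive_adjoint_comp_self _
  hasSum' B hB hd hb x := by
    have h := (E.hasSum' B hB hd (gammaInt E Γ (⋃ i, B i) x)).mapL
      (gammaInt E Γ (⋃ i, B i)).adjoint
    have hU : MeasurableSet (⋃ i, B i) := MeasurableSet.iUnion hB
    have hbi : ∀ i, Bornology.IsBounded (B i) := fun i => hb.subset (subset_iUnion B i)
    have hE : E.toFun (⋃ i, B i) (gammaInt E Γ (⋃ i, B i) x) = gammaInt E Γ (⋃ i, B i) x :=
      apply_gammaInt_self hU hb x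
    rw [hE] at h
    convert h using 1
    swap
    · rfl
    funext i
    refine ext_inner_left ℂ fun y => ?_
    change ⟪y, (gammaInt E Γ (B i)).adjoint (gammaInt E Γ (B i) x)⟫_ℂ =
      ⟪y, (gammaInt E Γ (⋃ i, B i)).adjoint (E (B i) (gammaInt E Γ (⋃ i, B i) x))⟫_ℂ
    rw [ContinuousLinearMap.adjoint_inner_right, ContinuousLinearMap.adjoint_inner_right,
      apply_gammaInt (hB i) hU hb, inter_eq_left.2 (subset_iUnion B i),
      inner_gammaInt hU (hB i) hb (hbi i), inter_eq_right.2 (subset_iUnion B i)]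
  eq_zero' B hB := by
    have : gammaInt E Γ B = 0 := by
      rw [gammaInt, dif_neg]
      rintro ⟨h1, C, hC⟩
      exact hB ⟨h1, isBounded_iff_forall_norm_le.2 ⟨C, hC⟩⟩
    rw [this]
    simp

theorem inner_gammaMeasure (B : Set ℝ) (ξ η : H) :
    ⟪ξ, gammaMeasure E Γ B η⟫_ℂ = ⟪gammaInt E Γ B ξ, gammaInt E Γ B η⟫_ℂ := by
  change ⟪ξ, (gammaInt E Γ B).adjoint (gammaInt E Γ B η)⟫_ℂ = _
  rw [ContinuousLinearMap.adjoint_inner_right]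

end GammaInt

end Triple

/-! ### Nevanlinna representations -/

section Nevanlinna

variable {K H : Type u} [NormedAddCommGroup K] [InnerProductSpace ℂ K]
  [NormedAddCommGroup H] [InnerProductSpace ℂ H]

/-- Countable additivity over the intervals `(k, k + 1]`, through which the scalar measures are
defined on unbounded sets. -/
theorem OperatorMeasure.hasSum_inter_Ioc (ρ : OperatorMeasure H) {B : Set ℝ} (hB : MeasurableSet B)
    (hb : Bornology.IsBounded B) (x : H) :
    HasSum (fun k : ℤ => ρ (B ∩ Ioc (k : ℝ) (k + 1)) x) (ρ B x) := by
  let e : ℕ ≃ ℤ := (Denumerable.eqv ℤ).symm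
  have hU : (⋃ i : ℕ, B ∩ Ioc ((e i : ℤ) : ℝ) ((e i : ℤ) + 1)) = B := by
    have h1 : (⋃ i : ℕ, Ioc ((e i : ℤ) : ℝ) ((e i : ℤ) + 1)) = univ := by
      rw [e.surjective.iUnion_comp fun k : ℤ => Ioc (k : ℝ) (k + 1)]
      exact iUnion_Ioc_intCast ℝ
    rw [← inter_iUnion, h1, inter_univ]
  have h := ρ.hasSum' (fun i : ℕ => B ∩ Ioc ((e i : ℤ) : ℝ) ((e i : ℤ) + 1))
    (fun i => hB.inter measurableSet_Ioc)
    (fun i j hij => ((pairwise_disjoint_Ioc_intCast ℝ) (e.injective.ne hij)).mono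
      inter_subset_right inter_subset_right) (by rw [hU]; exact hb) x
  rw [hU] at h
  exact e.hasSum_iff.1 h

theorem OperatorMeasure.scalarMeasure_apply (ρ : OperatorMeasure H) (e : H) {B : Set ℝ}
    (hB : MeasurableSet B) : ρ.scalarMeasure e B =
      ∑' k : ℤ, ENNReal.ofReal (⟪e, ρ (B ∩ Ioc (k : ℝ) (k + 1)) e⟫_ℂ).re :=
  Measure.ofMeasurable_apply _ hB

theorem OperatorMeasure.scalarMeasure_apply_of_isBounded (ρ : OperatorMeasure H) (e : H)
    {B : Set ℝ} (hB : MeasurableSet B) (hb : Bornology.IsBounded B) :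
    ρ.scalarMeasure e B = ENNReal.ofReal (⟪e, ρ B e⟫_ℂ).re := by
  have h := Complex.hasSum_re ((ρ.hasSum_inter_Ioc hB hb e).mapL (innerSL ℂ e))
  simp only [innerSL_apply_apply] at h
  rw [ρ.scalarMeasure_apply e hB, ← h.tsum_eq, ENNReal.ofReal_tsum_of_nonneg _ h.summable]
  intro i
  exact (ρ.isPositive _).re_inner_nonneg_right e

theorem OperatorMeasure.inner_self_eq (ρ : OperatorMeasure H) (B : Set ℝ) (e : H) :
    ⟪e, ρ B e⟫_ℂ = ((⟪e, ρ B e⟫_ℂ).re : ℂ) := by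
  refine (Complex.conj_eq_iff_re.1 ?_).symm
  rw [inner_conj_symm]
  exact (ρ.isPositive B).isSymmetric.apply_clm e e

/-- An operator-valued measure is determined by its quadratic forms. -/
theorem OperatorMeasure.ext_of_scalarMeasure {ρ ρ' : OperatorMeasure H}
    (h : ∀ e, ρ.scalarMeasure e = ρ'.scalarMeasure e) : ρ = ρ' := by
  have h2 : ∀ B, ρ B = ρ' B := by
    intro B
    by_cases hB : MeasurableSet B ∧ Bornology.IsBounded B
    · refine ContinuousLinearMap.ext_inner_self fun e => ?_
      rw [ρ.inner_self_eq, ρ'.inner_self_eq]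
      have h4 : 0 ≤ (⟪e, ρ B e⟫_ℂ).re := (ρ.isPositive _).re_inner_nonneg_right e
      have h4' : 0 ≤ (⟪e, ρ' B e⟫_ℂ).re := (ρ'.isPositive _).re_inner_nonneg_right e
      have h3 := ρ.scalarMeasure_apply_of_isBounded e hB.1 hB.2
      rw [h, ρ'.scalarMeasure_apply_of_isBounded e hB.1 hB.2, ENNReal.ofReal_eq_ofReal_iff
        h4' h4] at h3
      rw [h3]
    · rw [ρ.eq_zero' B hB, ρ'.eq_zero' B hB]
  cases ρ
  cases ρ'
  congr
  exact funext h2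

theorem measurable_weight : Measurable fun l : ℝ => ENNReal.ofReal (1 + l ^ 2) := by fun_prop

theorem lintegral_inv_weight (μ : Measure ℝ) :
    ∫⁻ l, ENNReal.ofReal (1 / (1 + l ^ 2))
      ∂(μ.withDensity fun l => ENNReal.ofReal (1 + l ^ 2)) = μ univ := by
  rw [lintegral_withDensity_eq_lintegral_mul _ measurable_weight (by fun_prop)]
  rw [← lintegral_one]
  refine lintegral_congr fun l => ?_
  have h : (0 : ℝ) < 1 + l ^ 2 := by positivity
  rw [Pi.mul_apply, ← ENNReal.ofReal_mul h.le, mul_one_div_cancel h.ne', ENNReal.ofReal_one]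

/-- With `dσ = (1 + λ²) dμ` and finite `μ`, the Nevanlinna kernel integrates to
`z μ(ℝ) + (1 + z²) ∫ (λ - z)⁻¹ dμ`. -/
theorem integral_nevanlinna_kernel (μ : Measure ℝ) [IsFiniteMeasure μ] {z : ℂ} (hz : z.im ≠ 0) :
    ∫ l : ℝ, (1 / ((l : ℂ) - z) - (l : ℂ) / (1 + (l : ℂ) ^ 2))
      ∂(μ.withDensity fun l => ENNReal.ofReal (1 + l ^ 2)) =
    z * (μ.real univ : ℂ) + (1 + z ^ 2) * ∫ l : ℝ, 1 / ((l : ℂ) - z) ∂μ := by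
  rw [integral_withDensity_eq_integral_toReal_smul measurable_weight
    (Eventually.of_forall fun l => ENNReal.ofReal_lt_top)]
  have h1 : ∀ l : ℝ, (ENNReal.ofReal (1 + l ^ 2)).toReal •
      (1 / ((l : ℂ) - z) - (l : ℂ) / (1 + (l : ℂ) ^ 2)) = z + (1 + z ^ 2) * (1 / ((l : ℂ) - z)) := by
    intro l
    have h : (0 : ℝ) < 1 + l ^ 2 := by positivity
    have h2 : (1 + (l : ℂ) ^ 2) ≠ 0 := by exact_mod_cast h.ne'
    have h3 : (l : ℂ) - z ≠ 0 := fun h => hz (by rw [← sub_eq_zero.1 h]; simp)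
    rw [ENNReal.toReal_ofReal h.le, Complex.real_smul]
    push_cast
    field_simp
    ring
  simp_rw [h1]
  have h2 := integrable_inv_sub (μ := μ) hz
  rw [integral_add (integrable_const _) (h2.const_mul _), integral_const, integral_const_mul,
    Complex.real_smul, mul_comm z]

/-- The integrability condition of the Nevanlinna representation says that the measure is `(1 +
λ²)` times a finite measure. -/
theorem exists_eq_withDensity_weight {σ : Measure ℝ}
    (h : ∫⁻ l, ENNReal.ofReal (1 / (1 + l ^ 2)) ∂σ < ∞) :
    ∃ μ : Measure ℝ, IsFiniteMeasure μ ∧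
      σ = μ.withDensity fun l => ENNReal.ofReal (1 + l ^ 2) := by
  refine ⟨σ.withDensity fun l => ENNReal.ofReal (1 / (1 + l ^ 2)),
    isFiniteMeasure_withDensity h.ne, ?_⟩
  rw [← withDensity_mul _ (by fun_prop) measurable_weight]
  have : ((fun l : ℝ => ENNReal.ofReal (1 / (1 + l ^ 2))) * fun l => ENNReal.ofReal (1 + l ^ 2)) =
      1 := by
    funext l
    have h : (0 : ℝ) < 1 + l ^ 2 := by positivity
    rw [Pi.mul_apply, mul_comm, ← ENNReal.ofReal_mul h.le, mul_one_div_cancel h.ne',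
      ENNReal.ofReal_one]
    rfl
  rw [this, withDensity_one]

/-- The measure in a Nevanlinna representation is unique. -/
theorem IsNevanlinnaMeasure.unique [CompleteSpace H] {m : ℂ → H →L[ℂ] H} {ρ ρ' : OperatorMeasure H}
    (h : IsNevanlinnaMeasure m ρ) (h' : IsNevanlinnaMeasure m ρ') : ρ = ρ' := by
  obtain ⟨c, hc, h⟩ := h
  obtain ⟨c', hc', h'⟩ := h'
  refine OperatorMeasure.ext_of_scalarMeasure fun e => ?_
  obtain ⟨h1, h2⟩ := h e
  obtain ⟨h1', h2'⟩ := h' e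
  obtain ⟨μ, hμ, h3⟩ := exists_eq_withDensity_weight h1
  obtain ⟨μ', hμ', h3'⟩ := exists_eq_withDensity_weight h1'
  have hre : ∀ c : H →L[ℂ] H, IsSelfAdjoint c → (⟪e, c e⟫_ℂ).im = 0 := fun c hc => by
    refine Complex.conj_eq_iff_im.1 ?_
    rw [inner_conj_symm]
    exact hc.isSymmetric e e
  rw [h3] at h2
  rw [h3'] at h2'
  -- at `z = i` the imaginary part is the total mass and the real part is the constant term
  have hI : (Complex.I).im ≠ 0 := by simp
  have h4 := (h2 _ hI).symm.trans (h2' _ hI)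
  rw [integral_nevanlinna_kernel μ hI, integral_nevanlinna_kernel μ' hI, Complex.I_sq] at h4
  simp only [add_neg_cancel, zero_mul, add_zero] at h4
  have h5 : μ.real univ = μ'.real univ := by
    have := congrArg Complex.im h4
    simpa [hre c hc, hre c' hc'] using this
  rw [h5] at h4
  have h6 := add_right_cancel h4
  rw [h3, h3']
  congr 1
  refine eq_of_stieltjes_eq fun z hz hz1 => ?_
  have hz0 : z.im ≠ 0 := hz.ne'
  have h7 := (h2 _ hz0).symm.trans (h2' _ hz0)
  rw [integral_nevanlinna_kernel μ hz0, integral_nevanlinna_kernel μ' hz0, h5, h6] at h7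
  refine mul_left_cancel₀ ?_ (add_left_cancel (add_left_cancel h7))
  -- `1 + z² ≠ 0`, since `0 < Im z < 1`
  intro h8
  have h9 : (z - Complex.I) * (z + Complex.I) = 0 := by
    linear_combination h8 + (-1 : ℂ) * Complex.I_sq
  rcases mul_eq_zero.1 h9 with h | h
  · have := congrArg Complex.im h
    simp at this
    linarith
  · have := congrArg Complex.im h
    simp at this
    linarith

variable [CompleteSpace K] [CompleteSpace H] {E : ProjectionMeasure K} {Γ : H →L[ℂ] K}

/-- `d(e, ρ e) = (1 + λ²) d(Γ e, E Γ e)` for the measure `ρ(B) = G(B)* G(B)`. -/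
theorem scalarMeasure_gammaMeasure (e : H) : (gammaMeasure E Γ).scalarMeasure e =
    (E.scalarMeasure (Γ e)).withDensity fun l => ENNReal.ofReal (1 + l ^ 2) := by
  ext B hB
  rw [OperatorMeasure.scalarMeasure_apply _ e hB, withDensity_apply _ hB]
  have hU : B = ⋃ k : ℤ, B ∩ Ioc (k : ℝ) (k + 1) := by
    rw [← inter_iUnion, iUnion_Ioc_intCast ℝ, inter_univ]
  conv_rhs => rw [hU]
  rw [lintegral_iUnion (fun k => hB.inter measurableSet_Ioc) (fun i j hij =>
    ((pairwise_disjoint_Ioc_intCast ℝ) hij).mono inter_subset_right inter_subset_right)]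
  refine tsum_congr fun k => ?_
  have hm : MeasurableSet (B ∩ Ioc (k : ℝ) (k + 1)) := hB.inter measurableSet_Ioc
  have hb : Bornology.IsBounded (B ∩ Ioc (k : ℝ) (k + 1)) :=
    (Metric.isBounded_Ioc (k : ℝ) (k + 1)).subset inter_subset_right
  rw [inner_gammaMeasure, ← enorm_gammaInt_sq hm hb, ← ofReal_norm,
    ← ENNReal.ofReal_pow (norm_nonneg _)]
  congr 1
  exact inner_self_eq_norm_sq (𝕜 := ℂ) _

/-- The Weyl function `M` of a boundary triple has the Nevanlinna measure `G(B)* G(B)`. With `u`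
the solution of `A u = z u`, `Γ₀ u = p`, Green's identity for `Γ p` and `u` gives `(p, M(z) p) =
(M(i) p, p) + (z + i) (Γ p, u)`, where `u = Γ p + (z - i) ∫ (λ - z)⁻¹ dE(λ) Γ p`. -/
theorem IsBoundaryTriple.isNevanlinnaMeasure {𝒢 : Submodule ℂ (K × K × H × H)}
    (h𝒢 : IsBoundaryTriple 𝒢) (hE : kerGraph 𝒢 = E.idOp.graph)
    (hΓ : ∀ p, ∃ q, (Γ p, Complex.I • Γ p, p, q) ∈ 𝒢) (M : ℂ → H →L[ℂ] H)
    (hM : ∀ z : ℂ, z.im ≠ 0 → ∀ p, ∃ u, (u, z • u, p, M z p) ∈ 𝒢) :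
    IsNevanlinnaMeasure M (gammaMeasure E Γ) := by
  have hI : (Complex.I).im ≠ 0 := by simp
  have hMI : ∀ p, (Γ p, Complex.I • Γ p, p, M Complex.I p) ∈ 𝒢 := by
    intro p
    obtain ⟨q, hq⟩ := hΓ p
    obtain ⟨u, hu⟩ := hM _ hI p
    rwa [← (h𝒢.solution_unique hI hq hu).1] at hu
  have key : ∀ p, ∀ z : ℂ, z.im ≠ 0 → ⟪p, M z p⟫_ℂ = starRingEnd ℂ ⟪p, M Complex.I p⟫_ℂ +
      (z + Complex.I) * (((E.scalarMeasure (Γ p)).real univ : ℂ) + (z - Complex.I) *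
        ∫ l : ℝ, 1 / ((l : ℂ) - z) ∂(E.scalarMeasure (Γ p))) := by
    intro p z hz
    obtain ⟨u, hu⟩ := hM z hz p
    have h1 := h𝒢.green _ (hMI p) _ hu
    have h2 : u = Γ p + (z - Complex.I) • E.int (fun l : ℝ => 1 / ((l : ℂ) - z)) (Γ p) := by
      have h3 := 𝒢.sub_mem hu (hMI p)
      simp only [Prod.mk_sub_mk, sub_self] at h3
      have h4 : (u - Γ p, z • u - Complex.I • Γ p) ∈ kerGraph 𝒢 := mem_kerGraph.2 ⟨_, h3⟩
      have h5 := Submodule.smul_mem _ (z - Complex.I)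
        (ProjectionMeasure.inv_sub_mem_graph (E := E) hz (Γ p))
      rw [← hE] at h5
      have h6 := Submodule.sub_mem _ h4 h5
      rw [← sub_eq_zero, ← sub_sub]
      refine h𝒢.isSelfAdjointGraph.eq_zero hz ?_
      convert h6 using 1
      refine Prod.ext ?_ ?_
      · rfl
      · simp only [Prod.smul_mk, Prod.mk_sub_mk]
        module
    have h7 : ⟪Γ p, u⟫_ℂ = ((E.scalarMeasure (Γ p)).real univ : ℂ) + (z - Complex.I) *
        ∫ l : ℝ, 1 / ((l : ℂ) - z) ∂(E.scalarMeasure (Γ p)) := by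
      rw [h2, inner_add_right, inner_smul_right,
        ProjectionMeasure.inner_int (ProjectionMeasure.memLp_inv_sub hz _),
        E.real_scalarMeasure _ MeasurableSet.univ, E.univ']
      congr 1
      exact_mod_cast inner_self_eq_norm_sq_to_K (𝕜 := ℂ) (Γ p)
    simp only [inner_smul_left, inner_smul_right, Complex.conj_I] at h1
    rw [← h7, inner_conj_symm]
    linear_combination -h1
  -- the constant term of the Nevanlinna representation is the real part of `M(i)`
  refine ⟨(2⁻¹ : ℂ) • (M Complex.I + (M Complex.I).adjoint), ?_, fun e => ⟨?_, fun z hz => ?_⟩⟩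
  · rw [ContinuousLinearMap.isSelfAdjoint_iff', map_smulₛₗ, map_add,
      ContinuousLinearMap.adjoint_adjoint, add_comm, map_inv₀, map_ofNat]
  · rw [scalarMeasure_gammaMeasure, lintegral_inv_weight]
    exact measure_lt_top _ _
  · rw [scalarMeasure_gammaMeasure, integral_nevanlinna_kernel _ hz, key e z hz]
    have h1 := key e _ hI
    rw [sub_self, zero_mul, add_zero] at h1
    rw [smul_apply, inner_smul_right, add_apply, inner_add_right,
      ContinuousLinearMap.adjoint_inner_right, ← inner_conj_symm (M Complex.I e) e]
    linear_combination (-2⁻¹ : ℂ) * h1 -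
      (∫ l : ℝ, 1 / ((l : ℂ) - z) ∂(E.scalarMeasure (Γ e))) * Complex.I_sq

end Nevanlinna

/-! ### The space `L²(ℝ; dρ; H)` and the generalized Fourier transform -/

namespace OperatorMeasure

variable {H : Type u} [NormedAddCommGroup H] [InnerProductSpace ℂ H]

/-- The step function `χ_B ξ` for a bounded set `B`. -/
def indStep (ρ : OperatorMeasure H) (B : Set ℝ) (hB : MeasurableSet B)
    (hb : Bornology.IsBounded B) (ξ : H) : ρ.Step :=
  (⟨(SimpleFunc.const ℝ ξ).restrict B, by
    change Bornology.IsBounded (Function.support ((SimpleFunc.const ℝ ξ).restrict B))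
    rw [SimpleFunc.coe_restrict _ hB, Set.support_indicator]
    exact hb.subset inter_subset_left⟩ : boundedStep H)

theorem stepFun_eq_indStep (ρ : OperatorMeasure H) (l r : ℝ) (ξ : H) :
    ρ.stepFun l r ξ = ρ.indStep (Ioc l r) measurableSet_Ioc (Metric.isBounded_Ioc l r) ξ := rfl

/-- The inner product of `χ_A ξ` and `χ_B η` in `L²(ℝ; dρ; H)` is `(ξ, ρ(A ∩ B) η)`. -/
theorem inner_indStep (ρ : OperatorMeasure H) {A B : Set ℝ} (hA : MeasurableSet A)
    (hB : MeasurableSet B) (ha : Bornology.IsBounded A) (hb : Bornology.IsBounded B) (ξ η : H) :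
    ⟪ρ.indStep A hA ha ξ, ρ.indStep B hB hb η⟫_ℂ = ⟪ξ, ρ (A ∩ B) η⟫_ℂ := by
  classical
  let t : SimpleFunc ℝ (Bool × Bool) :=
    (SimpleFunc.piecewise A hA (SimpleFunc.const ℝ true) (SimpleFunc.const ℝ false)).pair
      (SimpleFunc.piecewise B hB (SimpleFunc.const ℝ true) (SimpleFunc.const ℝ false))
  have h1 : (SimpleFunc.const ℝ ξ).restrict A = t.map fun y => if y.1 then ξ else 0 := by
    ext x
    rw [SimpleFunc.restrict_apply _ hA]
    by_cases hx : x ∈ A <;> simp [t, hx]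
  have h2 : (SimpleFunc.const ℝ η).restrict B = t.map fun y => if y.2 then η else 0 := by
    ext x
    rw [SimpleFunc.restrict_apply _ hB]
    by_cases hx : x ∈ B <;> simp [t, hx]
  have ht : t ⁻¹' {(true, true)} = A ∩ B := by
    ext x
    by_cases hx : x ∈ A <;> by_cases hy : x ∈ B <;> simp [t, hx, hy]
  have e := ρ.form_map t (fun y => if y.1 then ξ else 0) (fun y => if y.2 then η else 0) (by
    rintro ⟨y1, y2⟩ hy1 hy2
    have h3 : y1 = true := by by_contra h; simp [h] at hy1
    have h4 : y2 = true := by by_contra h; simp [h] at hy2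
    subst h3 h4
    rw [ht]
    exact ha.subset inter_subset_left)
  change ρ.form ((SimpleFunc.const ℝ ξ).restrict A) ((SimpleFunc.const ℝ η).restrict B) = _
  rw [h1, h2, e, Finset.sum_eq_single (true, true)]
  · simp [ht]
  · rintro ⟨y1, y2⟩ - hy
    cases y1 <;> cases y2 <;> simp at hy ⊢
  · intro hn
    have h5 : t ⁻¹' {(true, true)} = ∅ := by
      rw [eq_empty_iff_forall_notMem]
      intro x hx
      exact hn (SimpleFunc.mem_range.2 ⟨x, hx⟩)
    rw [h5, ρ.empty']
    simp

theorem mem_span_indStep (ρ : OperatorMeasure H) (f : ρ.Step) :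
    f ∈ Submodule.span ℂ {g : ρ.Step | ∃ B hB hb ξ, g = ρ.indStep B hB hb ξ} := by
  obtain ⟨f, hf⟩ := f
  have key : ∀ f : SimpleFunc ℝ H, ∀ hf : Bornology.IsBounded (Function.support f),
      ((⟨f, hf⟩ : boundedStep H) : ρ.Step) ∈
        Submodule.span ℂ {g : ρ.Step | ∃ B hB hb ξ, g = ρ.indStep B hB hb ξ} := by
    intro f
    induction f using SimpleFunc.induction with
    | const c hs =>
      rename_i s
      intro hf
      by_cases hc : c = 0
      · have h0 : ((⟨_, hf⟩ : boundedStep H) : ρ.Step) = 0 := by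
          apply Subtype.ext
          ext x
          change SimpleFunc.piecewise s hs (SimpleFunc.const ℝ c) (SimpleFunc.const ℝ 0) x = 0
          simp [hc]
        rw [h0]
        exact Submodule.zero_mem _
      · have hb : Bornology.IsBounded s := by
          refine hf.subset fun x hx => ?_
          simp [hx, hc]
        refine Submodule.subset_span ⟨s, hs, hb, c, ?_⟩
        apply Subtype.ext
        ext x
        change _ = (SimpleFunc.const ℝ c).restrict s x
        rw [SimpleFunc.restrict_apply _ hs]
        by_cases hx : x ∈ s <;> simp [hx]
    | add hd h1 h2 =>
      rename_i f g
      intro hf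
      have hd' : ∀ x, f x = 0 ∨ g x = 0 := fun x => by
        by_contra h
        push Not at h
        exact disjoint_left.1 hd h.1 h.2
      have hf1 : Bornology.IsBounded (Function.support f) := by
        refine hf.subset fun x hx => ?_
        have h3 : g x = 0 := (hd' x).resolve_left hx
        rw [Function.mem_support, SimpleFunc.coe_add, Pi.add_apply, h3, add_zero]
        exact hx
      have hg1 : Bornology.IsBounded (Function.support g) := by
        refine hf.subset fun x hx => ?_
        have h3 : f x = 0 := (hd' x).resolve_right hx
        rw [Function.mem_support, SimpleFunc.coe_add, Pi.add_apply, h3, zero_add]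
        exact hx
      exact Submodule.add_mem _ (h1 hf1) (h2 hg1)
  exact key f hf

/-- The functions `χ_B ξ` span a dense subspace of `L²(ℝ; dρ; H)`. -/
theorem span_indStep (ρ : OperatorMeasure H) :
    (Submodule.span ℂ {g : ρ.L2 | ∃ B hB hb ξ, g = (ρ.indStep B hB hb ξ : ρ.Step)}
      ).topologicalClosure = ⊤ := by
  rw [eq_top_iff]
  intro x _
  have h : (x : ρ.L2) ∈ closure (range ((↑) : ρ.Step → ρ.L2)) :=
    UniformSpace.Completion.denseRange_coe x
  refine closure_mono ?_ h
  rintro _ ⟨f, rfl⟩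
  have h1 := Submodule.mem_map_of_mem
    (f := (UniformSpace.Completion.toComplL (𝕜 := ℂ) (E := ρ.Step)).toLinearMap)
    (ρ.mem_span_indStep f)
  rw [Submodule.map_span] at h1
  refine Submodule.span_mono ?_ h1
  rintro _ ⟨_, ⟨B, hB, hb, ξ, rfl⟩, rfl⟩
  exact ⟨B, hB, hb, ξ, rfl⟩

theorem indicator_indStep (ρ : OperatorMeasure H) {A B : Set ℝ} (hA : MeasurableSet A)
    (hB : MeasurableSet B) (hb : Bornology.IsBounded B) (ξ : H) :
    ρ.indicator A (ρ.indStep B hB hb ξ : ρ.Step) =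
      (ρ.indStep (A ∩ B) (hA.inter hB) (hb.subset inter_subset_right) ξ : ρ.Step) := by
  rw [indicator, ContinuousLinearMap.completion_apply_coe]
  congr 1
  apply Subtype.ext
  change ((SimpleFunc.const ℝ ξ).restrict B).restrict A = (SimpleFunc.const ℝ ξ).restrict (A ∩ B)
  ext x
  rw [SimpleFunc.restrict_apply _ hA, SimpleFunc.restrict_apply _ (hA.inter hB),
    SimpleFunc.coe_restrict _ hB, indicator_indicator]

end OperatorMeasure

section Transform

variable {K H : Type u} [NormedAddCommGroup K] [InnerProductSpace ℂ K] [CompleteSpace K]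
  [NormedAddCommGroup H] [InnerProductSpace ℂ H]
  {E : ProjectionMeasure K} {Γ : H →L[ℂ] K}

/-- The function `v : ℝ → H` is the transform of `h ∈ K` in the sense that, locally uniformly in
`λ`, `(y, h)` and `(Γ₁ y, v(λ))` differ by at most a multiple of `‖A y - λ y‖` for all `y` in the domain
with `Γ₀ y = 0`. -/
def IsTransform (𝒢 : Submodule ℂ (K × K × H × H)) (h : K) (v : ℝ → H) : Prop :=
  ∀ l r : ℝ, ∃ C : ℝ, 0 ≤ C ∧ ∀ t ∈ Icc l r, ∀ y w ξ, (y, w, (0 : H), ξ) ∈ 𝒢 →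
    ‖⟪y, h⟫_ℂ - ⟪ξ, v t⟫_ℂ‖ ≤ C * ‖w - (t : ℂ) • y‖

variable {𝒢 : Submodule ℂ (K × K × H × H)}

/-- Testing with the almost-eigenvectors `y = E(I) g` shows that `E(I) h` is close to `G(I) v(t)`
if all points of `I` are close to `t`. -/
theorem norm_apply_sub_gammaInt_le (h𝒢 : IsBoundaryTriple 𝒢) (hE : kerGraph 𝒢 = E.idOp.graph)
    (hΓ : ∀ p, ∃ q, (Γ p, Complex.I • Γ p, p, q) ∈ 𝒢) {h : K} {v : H} {t C d : ℝ} (hC0 : 0 ≤ C)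
    (hC : ∀ y w ξ, (y, w, (0 : H), ξ) ∈ 𝒢 → ‖⟪y, h⟫_ℂ - ⟪ξ, v⟫_ℂ‖ ≤ C * ‖w - (t : ℂ) • y‖)
    {I : Set ℝ} (hI : MeasurableSet I) (hb : Bornology.IsBounded I) (hd0 : 0 ≤ d)
    (hd : ∀ s ∈ I, |s - t| ≤ d) : ‖E I h - gammaInt E Γ I v‖ ≤ C * d := by
  obtain ⟨c, hc⟩ := exists_abs_le_of_isBounded hb
  have hmeas : ∀ z : ℂ, Measurable fun s : ℝ => (s : ℂ) - z :=
    fun z => Complex.measurable_ofReal.sub_const _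
  have hid : Measurable fun s : ℝ => (s : ℂ) := Complex.measurable_ofReal
  have hmem : ∀ g, MemLp (fun s : ℝ => (s : ℂ)) 2 (E.scalarMeasure (E I g)) := fun g =>
    (ProjectionMeasure.int_apply_eq hid hI
      (ProjectionMeasure.memLp_indicator_of_bounded hid hI (C := c) fun s hs => by
        rw [Complex.norm_real]; exact hc s hs)).1
  have hbd : ∀ (z : ℂ) (g : K), MemLp (I.indicator fun s : ℝ => (s : ℂ) - z) 2
      (E.scalarMeasure g) := fun z g =>
    ProjectionMeasure.memLp_indicator_of_bounded (hmeas z) hI (C := c + ‖z‖) fun s hs =>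
      (norm_sub_le _ _).trans (by
        rw [Complex.norm_real]
        gcongr
        exact hc s hs)
  have hint : ∀ (z : ℂ) (g : K), E.int (fun s : ℝ => (s : ℂ)) (E I g) - z • E I g =
      E.int (I.indicator fun s : ℝ => (s : ℂ) - z) g := fun z g => by
    rw [← ProjectionMeasure.int_sub_const (hmem g),
      (ProjectionMeasure.int_apply_eq (hmeas z) hI (hbd z g)).2]
  have key : ∀ g, ‖⟪g, E I h - gammaInt E Γ I v⟫_ℂ‖ ≤ C * d * ‖g‖ := by
    intro g
    have hg : (E I g, E.int (fun s : ℝ => (s : ℂ)) (E I g)) ∈ kerGraph 𝒢 := by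
      rw [hE]
      exact (ProjectionMeasure.mem_op_graph _).2 ⟨hmem g, rfl⟩
    obtain ⟨ξ, hξ⟩ := mem_kerGraph.1 hg
    -- Green's identity for `Γ v` and `E(I) g` gives `(Γ v, (A + i) E(I) g) = (v, ξ)`, and the
    -- left-hand side is `(G(I) v, g)`
    have h1 : ⟪gammaInt E Γ I v, g⟫_ℂ = ⟪v, ξ⟫_ℂ := by
      obtain ⟨q, hq⟩ := hΓ v
      have h2 := h𝒢.green _ hq _ hξ
      have h3 : ⟪Γ v, E.int (fun s : ℝ => (s : ℂ)) (E I g) - (-Complex.I) • E I g⟫_ℂ =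
          ⟪v, ξ⟫_ℂ := by
        simp only [inner_smul_left, inner_zero_right, sub_zero, Complex.conj_I] at h2
        rw [inner_sub_right, inner_smul_right]
        exact h2
      rw [← h3, hint, ProjectionMeasure.inner_int_right ((hmeas _).indicator hI) (hbd _ _)
        (hbd _ _), gammaInt_apply hI hb]
      congr 2
      funext s
      by_cases hs : s ∈ I <;> simp [hs, sub_eq_add_neg]
    have h4 : ⟪g, E I h - gammaInt E Γ I v⟫_ℂ = ⟪E I g, h⟫_ℂ - ⟪ξ, v⟫_ℂ := by
      rw [inner_sub_right, E.isSymm, ← inner_conj_symm g (gammaInt E Γ I v), h1, inner_conj_symm]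
    rw [h4, mul_assoc]
    refine (hC _ _ _ hξ).trans ?_
    gcongr
    rw [hint]
    refine (ProjectionMeasure.norm_int_indicator_le (hmeas _) g hI hd0 fun s hs => ?_).trans ?_
    · rw [← Complex.ofReal_sub, Complex.norm_real]
      exact hd s hs
    · gcongr
      exact E.norm_apply_le I g
  have h5 := key (E I h - gammaInt E Γ I v)
  rw [inner_self_eq_norm_sq_to_K] at h5
  have h6 : ‖E I h - gammaInt E Γ I v‖ * ‖E I h - gammaInt E Γ I v‖ ≤
      C * d * ‖E I h - gammaInt E Γ I v‖ := by
    rw [← sq]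
    simpa using h5
  rcases (norm_nonneg (E I h - gammaInt E Γ I v)).eq_or_lt with h7 | h7
  · rw [← h7]; positivity
  · exact le_of_mul_le_mul_right h6 h7

/-- The Riemann sums of `∫_{(l, r]} dG(λ) v(λ)` converge to `E((l, r]) h`: the errors on the
individual intervals are orthogonal and bounded by a multiple of the length. -/
theorem IsTransform.tendsto (h𝒢 : IsBoundaryTriple 𝒢) (hE : kerGraph 𝒢 = E.idOp.graph)
    (hΓ : ∀ p, ∃ q, (Γ p, Complex.I • Γ p, p, q) ∈ 𝒢) {h : K} {v : ℝ → H}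
    (hv : IsTransform 𝒢 h v) {l r : ℝ} (hlr : l < r) :
    Tendsto (fun P : TaggedPartition l r => ∑ j ∈ Finset.range P.n,
      gammaInt E Γ (Ioc (P.pt j) (P.pt (j + 1))) (v (P.tag j))) (meshToZero l r)
      (𝓝 (E (Ioc l r) h)) := by
  obtain ⟨C, hC0, hC⟩ := hv l r
  refine ProjectionMeasure.tendsto_sum_of_norm_le_length (C := C) hlr h _ (fun P j _ => ?_)
    fun P j hj => ?_
  · exact apply_gammaInt_self measurableSet_Ioc (Metric.isBounded_Ioc _ _) _
  · exact norm_apply_sub_gammaInt_le h𝒢 hE hΓ hC0 (hC _ (P.tag_mem_Icc hj)) measurableSet_Ioc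
      (Metric.isBounded_Ioc _ _) (sub_nonneg.2 (P.pt_lt j hj).le) fun s hs => P.abs_sub_tag_le hj hs

variable [CompleteSpace H]

/-- The isometry `W : L²(ℝ; dρ; H) → K` with `W (χ_B ξ) = G(B) ξ`. It intertwines multiplication by
indicator functions with the spectral projections. -/
theorem exists_gammaIsometry (E : ProjectionMeasure K) (Γ : H →L[ℂ] K) :
    ∃ W : (gammaMeasure E Γ).L2 →ₗᵢ[ℂ] K,
      (∀ B hB hb ξ, W ((gammaMeasure E Γ).indStep B hB hb ξ : (gammaMeasure E Γ).Step) =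
        gammaInt E Γ B ξ) ∧
      ∀ A, MeasurableSet A → ∀ k, W ((gammaMeasure E Γ).indicator A k) = E A (W k) := by
  let ι := {B : Set ℝ // MeasurableSet B ∧ Bornology.IsBounded B} × H
  let x : ι → (gammaMeasure E Γ).L2 := fun i =>
    ((gammaMeasure E Γ).indStep i.1.1 i.1.2.1 i.1.2.2 i.2 : (gammaMeasure E Γ).Step)
  have hx : {g : (gammaMeasure E Γ).L2 | ∃ B hB hb ξ, g =
      ((gammaMeasure E Γ).indStep B hB hb ξ : (gammaMeasure E Γ).Step)} = range x := by
    ext g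
    constructor
    · rintro ⟨B, hB, hb, ξ, rfl⟩
      exact ⟨(⟨B, hB, hb⟩, ξ), rfl⟩
    · rintro ⟨i, rfl⟩
      exact ⟨i.1.1, i.1.2.1, i.1.2.2, i.2, rfl⟩
  have hspan := (gammaMeasure E Γ).span_indStep
  rw [hx] at hspan
  obtain ⟨W, hW⟩ := exists_linearIsometry_of_inner_eq x (fun i => gammaInt E Γ i.1.1 i.2)
    (fun i j => by
      rw [UniformSpace.Completion.inner_coe, OperatorMeasure.inner_indStep, inner_gammaMeasure,
        inner_gammaInt i.1.2.1 j.1.2.1 i.1.2.2 j.1.2.2]) hspan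
  have hW' : ∀ B hB hb ξ, W ((gammaMeasure E Γ).indStep B hB hb ξ : (gammaMeasure E Γ).Step) =
      gammaInt E Γ B ξ := fun B hB hb ξ => hW (⟨B, hB, hb⟩, ξ)
  refine ⟨W, hW', fun A hA k => ?_⟩
  have h1 : W.toContinuousLinearMap.comp ((gammaMeasure E Γ).indicator A) =
      (E A).comp W.toContinuousLinearMap := by
    refine ContinuousLinearMap.ext_on (s := range x) ?_ ?_
    · exact Submodule.dense_iff_topologicalClosure_eq_top.2 hspan
    · rintro _ ⟨i, rfl⟩
      change W ((gammaMeasure E Γ).indicator A (x i)) = E A (W (x i))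
      rw [OperatorMeasure.indicator_indStep _ hA, hW', hW', apply_gammaInt hA i.1.2.1 i.1.2.2]
  exact DFunLike.congr_fun h1 k

/-- If sufficiently many vectors have a transform, then `W` is onto, and `W⁻¹ h` is the class of the
transform of `h`. -/
theorem exists_gammaUnitary (h𝒢 : IsBoundaryTriple 𝒢) (hE : kerGraph 𝒢 = E.idOp.graph)
    (hΓ : ∀ p, ∃ q, (Γ p, Complex.I • Γ p, p, q) ∈ 𝒢)
    (hdense : Dense {h : K | ∃ v, IsTransform 𝒢 h v}) :
    ∃ U : K ≃ₗᵢ[ℂ] (gammaMeasure E Γ).L2,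
      (∀ B hB hb ξ, U.symm ((gammaMeasure E Γ).indStep B hB hb ξ : (gammaMeasure E Γ).Step) =
        gammaInt E Γ B ξ) ∧
      (∀ A, MeasurableSet A → ∀ k, U.symm ((gammaMeasure E Γ).indicator A k) = E A (U.symm k)) ∧
      ∀ h v, IsTransform 𝒢 h v → (gammaMeasure E Γ).IsClassOf v (U h) := by
  obtain ⟨W, hW1, hW2⟩ := exists_gammaIsometry E Γ
  have hclosed : IsClosed (range W) := W.isometry.isClosedEmbedding.isClosed_range
  have hsum : ∀ (v : ℝ → H) (l r : ℝ) (P : TaggedPartition l r),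
      W (∑ j ∈ Finset.range P.n,
        (gammaMeasure E Γ).step (P.pt j) (P.pt (j + 1)) (v (P.tag j))) =
      ∑ j ∈ Finset.range P.n, gammaInt E Γ (Ioc (P.pt j) (P.pt (j + 1))) (v (P.tag j)) := by
    intro v l r P
    rw [map_sum]
    refine Finset.sum_congr rfl fun j _ => ?_
    rw [OperatorMeasure.step, OperatorMeasure.stepFun_eq_indStep, hW1]
  have hsurj : Function.Surjective W := by
    rw [← range_eq_univ]
    refine eq_univ_of_univ_subset ?_
    rw [← hdense.closure_eq]
    refine closure_minimal ?_ hclosed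
    rintro h ⟨v, hv⟩
    -- the closed range of `W` contains the Riemann sums, hence their limits `E((l, r]) h`, and
    -- thus `h`
    have h1 : ∀ l r : ℝ, l < r → E (Ioc l r) h ∈ range W := by
      intro l r hlr
      have := meshToZero_neBot hlr
      refine hclosed.mem_of_tendsto (hv.tendsto h𝒢 hE hΓ hlr) (Eventually.of_forall fun P => ?_)
      rw [← hsum]
      exact mem_range_self _
    have h2 : Tendsto (fun n : ℕ => E (Ioc (-((n : ℝ) + 1)) ((n : ℝ) + 1)) h) atTop (𝓝 h) := by
      refine ProjectionMeasure.tendsto_apply (fun n => measurableSet_Ioc) ?_ ?_ h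
      · intro m n hmn
        have : (m : ℝ) ≤ n := by exact_mod_cast hmn
        exact Ioc_subset_Ioc (by linarith) (by linarith)
      · rw [eq_univ_iff_forall]
        intro x
        obtain ⟨n, hn⟩ := exists_nat_ge |x|
        have := abs_le.1 hn
        exact mem_iUnion.2 ⟨n, by linarith, by linarith⟩
    exact hclosed.mem_of_tendsto h2 (Eventually.of_forall fun n => h1 _ _ (by
      have : (0 : ℝ) ≤ n := n.cast_nonneg
      linarith))
  let U := (LinearIsometryEquiv.ofSurjective W hsurj).symm
  have hU : ∀ k, U.symm k = W k := fun k => rfl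
  refine ⟨U, hW1, hW2, fun h v hv l r hlr => ?_⟩
  have h1 : W (U h) = h := U.symm_apply_apply h
  have h2 := hv.tendsto h𝒢 hE hΓ hlr
  rw [← h1, ← hW2 _ measurableSet_Ioc] at h2
  rw [W.isometry.isEmbedding.tendsto_nhds_iff]
  convert h2 using 2 with P
  exact hsum v l r P

end Transform

/-! ### Diagonalization, spectra and multiplicity -/

section Diagonal

variable {K H : Type u} [NormedAddCommGroup K] [InnerProductSpace ℂ K] [CompleteSpace K]
  [NormedAddCommGroup H] [InnerProductSpace ℂ H] [CompleteSpace H]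
  {E : ProjectionMeasure K} {Γ : H →L[ℂ] K}

/-- Both sides are described by Riemann sums of the projections, which the transform intertwines.
-/
theorem mem_op_graph_iff_mem_mulGraph (U : K ≃ₗᵢ[ℂ] (gammaMeasure E Γ).L2)
    (hU : ∀ A, MeasurableSet A → ∀ k,
      U.symm ((gammaMeasure E Γ).indicator A k) = E A (U.symm k))
    {F : ℝ → ℂ} (hF : Continuous F) (k g : (gammaMeasure E Γ).L2) :
    (U.symm k, U.symm g) ∈ (E.op F hF.measurable).graph ↔
      (k, g) ∈ (gammaMeasure E Γ).mulGraph F := by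
  rw [ProjectionMeasure.mem_op_graph_iff_riemann hF]
  refine forall_congr' fun l => forall_congr' fun r => imp_congr_right fun hlr => ?_
  rw [U.symm.isometry.isEmbedding.tendsto_nhds_iff, hU _ measurableSet_Ioc]
  refine tendsto_congr fun P => ?_
  simp only [Function.comp_apply, map_sum, map_smul]
  refine Finset.sum_congr rfl fun j _ => ?_
  rw [hU _ measurableSet_Ioc]

/-- The transform diagonalizes every function of the operator. -/
theorem mem_op_graph_iff_mem_mulOperator (U : K ≃ₗᵢ[ℂ] (gammaMeasure E Γ).L2)
    (hU : ∀ A, MeasurableSet A → ∀ k,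
      U.symm ((gammaMeasure E Γ).indicator A k) = E A (U.symm k))
    {F : ℝ → ℂ} (hF : Continuous F) (k g : (gammaMeasure E Γ).L2) :
    (U.symm k, U.symm g) ∈ (E.op F hF.measurable).graph ↔
      (k, g) ∈ ((gammaMeasure E Γ).mulOperator F).graph := by
  rw [OperatorMeasure.mulOperator, Submodule.toLinearPMap_graph_eq,
    mem_op_graph_iff_mem_mulGraph U hU hF]
  rintro ⟨k, g⟩ hx (rfl : k = 0)
  rw [← mem_op_graph_iff_mem_mulGraph U hU hF, map_zero] at hx
  have h := (E.op F hF.measurable).graph_fst_eq_zero_snd hx rfl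
  simpa using h


theorem gammaMeasure_eq_zero_iff_gammaInt {B : Set ℝ} :
    gammaMeasure E Γ B = 0 ↔ gammaInt E Γ B = 0 := by
  constructor
  · intro h
    ext ξ
    have h1 := inner_gammaMeasure (E := E) (Γ := Γ) B ξ ξ
    rw [h, zero_apply, inner_zero_right] at h1
    exact inner_self_eq_zero.1 h1.symm
  · intro h
    refine ContinuousLinearMap.ext_inner_self fun ξ => ?_
    rw [inner_gammaMeasure, h]
    simp

/-- The vectors `G(B) ξ` span a dense subspace. -/
theorem span_gammaInt (U : K ≃ₗᵢ[ℂ] (gammaMeasure E Γ).L2)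
    (hU : ∀ B hB hb ξ, U.symm ((gammaMeasure E Γ).indStep B hB hb ξ : (gammaMeasure E Γ).Step) =
      gammaInt E Γ B ξ) :
    (Submodule.span ℂ {g : K | ∃ B ξ, MeasurableSet B ∧ Bornology.IsBounded B ∧
      g = gammaInt E Γ B ξ}).topologicalClosure = ⊤ := by
  have h := (gammaMeasure E Γ).span_indStep
  rw [← Submodule.dense_iff_topologicalClosure_eq_top] at h ⊢
  have h1 := U.symm.surjective.denseRange.dense_image U.symm.continuous h
  refine h1.mono ?_
  have h2 : ⇑U.symm '' (Submodule.span ℂ {g : (gammaMeasure E Γ).L2 | ∃ B hB hb ξ,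
      g = ((gammaMeasure E Γ).indStep B hB hb ξ : (gammaMeasure E Γ).Step)} : Set _) =
      (Submodule.map (U.symm.toLinearEquiv : (gammaMeasure E Γ).L2 →ₗ[ℂ] K) (Submodule.span ℂ
        {g : (gammaMeasure E Γ).L2 | ∃ B hB hb ξ,
      g = ((gammaMeasure E Γ).indStep B hB hb ξ : (gammaMeasure E Γ).Step)}) : Set K) := rfl
  rw [h2, Submodule.map_span, SetLike.coe_subset_coe]
  refine Submodule.span_mono ?_
  rintro _ ⟨_, ⟨B, hB, hb, ξ, rfl⟩, rfl⟩
  exact ⟨B, ξ, hB, hb, hU B hB hb ξ⟩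

/-- The measures `ρ` and `E` have the same bounded null sets, because the vectors `G(A) ξ` are
total and `E(B) G(A) ξ = E(A) G(B) ξ`. -/
theorem gammaMeasure_eq_zero_iff (U : K ≃ₗᵢ[ℂ] (gammaMeasure E Γ).L2)
    (hU : ∀ B hB hb ξ, U.symm ((gammaMeasure E Γ).indStep B hB hb ξ : (gammaMeasure E Γ).Step) =
      gammaInt E Γ B ξ) {B : Set ℝ} (hB : MeasurableSet B) (hb : Bornology.IsBounded B) :
    gammaMeasure E Γ B = 0 ↔ E B = 0 := by
  rw [gammaMeasure_eq_zero_iff_gammaInt]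
  constructor
  · intro h
    refine ContinuousLinearMap.ext_on (s := {g : K | ∃ B ξ, MeasurableSet B ∧
      Bornology.IsBounded B ∧ g = gammaInt E Γ B ξ}) ?_ ?_
    · exact Submodule.dense_iff_topologicalClosure_eq_top.2 (span_gammaInt U hU)
    · rintro _ ⟨A, ξ, hA, ha, rfl⟩
      rw [apply_gammaInt hB hA ha, inter_comm, ← apply_gammaInt hA hB hb, h]
      simp
  · intro h
    ext ξ
    rw [← apply_gammaInt_self hB hb, h]
    rfl

/-- The sum of the measures `(e, ρ(·) e)` over a dense sequence of vectors `e` is a control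
measure. -/
theorem exists_isControlMeasure [TopologicalSpace.SeparableSpace H] :
    ∃ ν : Measure ℝ, (gammaMeasure E Γ).IsControlMeasure ν := by
  refine ⟨Measure.sum fun n : ℕ =>
    (gammaMeasure E Γ).scalarMeasure (TopologicalSpace.denseSeq H n), fun B hB hb => ?_⟩
  rw [Measure.sum_apply _ hB, ENNReal.tsum_eq_zero, gammaMeasure_eq_zero_iff_gammaInt]
  have h : ∀ n, (gammaMeasure E Γ).scalarMeasure (TopologicalSpace.denseSeq H n) B = 0 ↔
      gammaInt E Γ B (TopologicalSpace.denseSeq H n) = 0 := by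
    intro n
    have h1 : (⟪TopologicalSpace.denseSeq H n,
        gammaMeasure E Γ B (TopologicalSpace.denseSeq H n)⟫_ℂ).re =
        ‖gammaInt E Γ B (TopologicalSpace.denseSeq H n)‖ ^ 2 := by
      rw [inner_gammaMeasure]
      exact inner_self_eq_norm_sq (𝕜 := ℂ) _
    rw [OperatorMeasure.scalarMeasure_apply_of_isBounded _ _ hB hb, h1, ENNReal.ofReal_eq_zero]
    constructor
    · intro h
      exact norm_eq_zero.1 (pow_eq_zero_iff two_ne_zero |>.1 (le_antisymm h (sq_nonneg _)))
    · intro h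
      simp [h]
  simp_rw [h]
  constructor
  · intro h2
    refine ContinuousLinearMap.ext fun x => ?_
    have h3 : EqOn (gammaInt E Γ B) (0 : H →L[ℂ] K) (range (TopologicalSpace.denseSeq H)) := by
      rintro _ ⟨n, rfl⟩
      exact h2 n
    exact congrFun (Continuous.ext_on (TopologicalSpace.denseRange_denseSeq H)
      (gammaInt E Γ B).continuous (0 : H →L[ℂ] K).continuous h3) x
  · intro h2 n
    rw [h2]
    rfl

/-- A control measure is only required to detect the bounded null sets of `ρ`; by countable
additivity it has the same null sets as `E`. -/
theorem OperatorMeasure.IsControlMeasure.measure_eq_zero_iff {ν : Measure ℝ}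
    (hν : (gammaMeasure E Γ).IsControlMeasure ν) (U : K ≃ₗᵢ[ℂ] (gammaMeasure E Γ).L2)
    (hU : ∀ B hB hb ξ, U.symm ((gammaMeasure E Γ).indStep B hB hb ξ : (gammaMeasure E Γ).Step) =
      gammaInt E Γ B ξ) {A : Set ℝ} (hA : MeasurableSet A) : ν A = 0 ↔ E A = 0 := by
  let B : ℕ → Set ℝ := fun n => Icc (-(n : ℝ)) n
  have hB : ∀ n, MeasurableSet (B n) := fun n => measurableSet_Icc
  have hm : Monotone B := by
    intro m n hmn
    have : (m : ℝ) ≤ n := by exact_mod_cast hmn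
    exact Icc_subset_Icc (by linarith) this
  have hu : ⋃ n, B n = univ := by
    rw [eq_univ_iff_forall]
    intro x
    obtain ⟨n, hn⟩ := exists_nat_ge |x|
    exact mem_iUnion.2 ⟨n, abs_le.1 hn⟩
  have h1 : ∀ n, ν (B n ∩ A) = 0 ↔ E (B n ∩ A) = 0 := fun n => by
    have hb : Bornology.IsBounded (B n ∩ A) :=
      (Metric.isBounded_Icc _ _).subset inter_subset_left
    rw [hν _ ((hB n).inter hA) hb, gammaMeasure_eq_zero_iff U hU ((hB n).inter hA) hb]
  have h2 : A = ⋃ n, B n ∩ A := by rw [← iUnion_inter, hu, univ_inter]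
  constructor
  · intro h
    ext f
    refine tendsto_nhds_unique (ProjectionMeasure.tendsto_apply (E := E) hB hm hu (E A f)) ?_
    have h3 : ∀ n, E (B n) (E A f) = 0 := fun n => by
      rw [E.apply_apply (hB n) hA, (h1 n).1 (measure_mono_null inter_subset_right h)]
      rfl
    simp only [h3]
    exact tendsto_const_nhds
  · intro h
    rw [h2, measure_iUnion_null_iff]
    intro n
    rw [h1]
    ext f
    rw [← E.apply_apply (hB n) hA, h]
    simp

theorem operatorSpectrum_op_eq_essentialRange {ν : Measure ℝ}
    (hν : (gammaMeasure E Γ).IsControlMeasure ν) (U : K ≃ₗᵢ[ℂ] (gammaMeasure E Γ).L2)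
    (hU : ∀ B hB hb ξ, U.symm ((gammaMeasure E Γ).indStep B hB hb ξ : (gammaMeasure E Γ).Step) =
      gammaInt E Γ B ξ) {F : ℝ → ℂ} (hF : Measurable F) :
    operatorSpectrum (E.op F hF) = essentialRange ν F := by
  rw [ProjectionMeasure.operatorSpectrum_op]
  ext z
  refine forall_congr' fun ε => imp_congr_right fun _ => ?_
  rw [pos_iff_ne_zero, Ne, Ne, hν.measure_eq_zero_iff U hU]
  exact measurableSet_lt (hF.sub_const z).norm measurable_const

theorem operatorSpectrum_idOp (U : K ≃ₗᵢ[ℂ] (gammaMeasure E Γ).L2)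
    (hU : ∀ B hB hb ξ, U.symm ((gammaMeasure E Γ).indStep B hB hb ξ : (gammaMeasure E Γ).Step) =
      gammaInt E Γ B ξ) :
    operatorSpectrum E.idOp = (fun l : ℝ => (l : ℂ)) '' (gammaMeasure E Γ).support := by
  rw [ProjectionMeasure.operatorSpectrum_op]
  have hreal : ∀ x ε : ℝ, {l : ℝ | ‖(l : ℂ) - x‖ < ε} = Ioo (x - ε) (x + ε) := by
    intro x ε
    ext l
    rw [mem_ofPred_eq, ← Complex.ofReal_sub, Complex.norm_real, Real.norm_eq_abs, abs_sub_lt_iff,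
      mem_Ioo]
    constructor <;> rintro ⟨h1, h2⟩ <;> constructor <;> linarith
  have hiff : ∀ x ε : ℝ, E (Ioo (x - ε) (x + ε)) ≠ 0 ↔
      gammaMeasure E Γ (Ioo (x - ε) (x + ε)) ≠ 0 := fun x ε => by
    rw [Ne, Ne, gammaMeasure_eq_zero_iff U hU measurableSet_Ioo (Metric.isBounded_Ioo _ _)]
  ext z
  constructor
  · intro h
    have him : z.im = 0 := by
      by_contra h0
      refine h |z.im| (abs_pos.2 h0) ?_
      convert E.empty
      rw [eq_empty_iff_forall_notMem]
      intro l hl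
      have h1 : |z.im| ≤ ‖(l : ℂ) - z‖ := by
        simpa using Complex.abs_im_le_norm ((l : ℂ) - z)
      exact absurd hl (not_lt.2 h1)
    have hz : ((z.re : ℝ) : ℂ) = z := Complex.ext rfl (by simp [him])
    refine ⟨z.re, fun ε hε => ?_, hz⟩
    rw [← hiff, ← hreal, hz]
    exact h ε hε
  · rintro ⟨x, hx, rfl⟩ ε hε
    have := hx ε hε
    rw [← hiff, ← hreal] at this
    exact this

/-- The vector `(∫ F dE) f` lies in the cyclic subspace of `f`. -/
theorem ProjectionMeasure.int_mem_closure_span {F : ℝ → ℂ} {f : K}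
    (hF : MemLp F 2 (E.scalarMeasure f)) : E.int F f ∈
      (Submodule.span ℂ {g | ∃ B : Set ℝ, MeasurableSet B ∧ g = E B f}).topologicalClosure := by
  rw [ProjectionMeasure.int_def hF]
  obtain ⟨hV⟩ : Nonempty (∀ B, E.isom f (E.indLp f B) = E B f) :=
    ⟨(E.exists_isometry f).choose_spec⟩
  have h1 : hF.toLp F ∈ (Submodule.span ℂ (range (E.indLp f))).topologicalClosure := by
    rw [E.span_indLp]
    trivial
  have h2 := map_mem_closure (E.isom f).continuous h1
    (t := (Submodule.span ℂ {g | ∃ B : Set ℝ, MeasurableSet B ∧ g = E B f} : Set K)) ?_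
  · exact h2
  · intro x hx
    have h3 := Submodule.mem_map_of_mem (f := (E.isom f).toLinearMap) hx
    rw [Submodule.map_span] at h3
    refine Submodule.span_mono ?_ h3
    rintro _ ⟨_, ⟨B, rfl⟩, rfl⟩
    exact ⟨B.1, B.2, hV B⟩

/-- The images under `Γ` of a basis of `H` generate `K`, so that the multiplicity is at most
`dim H`. -/
theorem spectralMultiplicity_idOp_le (U : K ≃ₗᵢ[ℂ] (gammaMeasure E Γ).L2)
    (hU : ∀ B hB hb ξ, U.symm ((gammaMeasure E Γ).indStep B hB hb ξ : (gammaMeasure E Γ).Step) =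
      gammaInt E Γ B ξ) :
    spectralMultiplicity E.idOp ≤ Cardinal.toENat (Module.rank ℂ H) := by
  let b := Module.Basis.ofVectorSpace ℂ H
  let S : Set K := Γ '' (range b)
  have hS : (Submodule.span ℂ {g | ∃ B : Set ℝ, MeasurableSet B ∧ ∃ f ∈ S, g = E B f}
      ).topologicalClosure = ⊤ := by
    rw [eq_top_iff, ← span_gammaInt U hU]
    refine Submodule.topologicalClosure_minimal _ (Submodule.span_le.2 ?_)
      (Submodule.isClosed_topologicalClosure _)
    rintro _ ⟨B, ξ, hB, hb, rfl⟩
    have h1 : ξ ∈ Submodule.span ℂ (range b) := by rw [b.span_eq]; trivial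
    induction h1 using Submodule.span_induction with
    | mem x hx =>
      rw [gammaInt_apply hB hb]
      refine Submodule.topologicalClosure_mono (Submodule.span_mono ?_)
        (ProjectionMeasure.int_mem_closure_span (memLp_indicator_sub_I hB hb _))
      rintro _ ⟨A, hA, rfl⟩
      exact ⟨A, hA, Γ x, mem_image_of_mem _ hx, rfl⟩
    | zero => rw [map_zero]; exact Submodule.zero_mem _
    | add x y _ _ hx hy => rw [map_add]; exact Submodule.add_mem _ hx hy
    | smul c x _ hx => rw [map_smul]; exact Submodule.smul_mem _ c hx
  have h1 : S.encard ≤ Cardinal.toENat (Module.rank ℂ H) := by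
    refine (encard_image_le _ _).trans ?_
    rw [← b.mk_range_eq_rank]
    rfl
  refine le_trans ?_ h1
  exact iInf_le_of_le E (iInf_le_of_le (LinearPMap.isSpectralMeasureOf_iff.2 rfl)
    (iInf_le_of_le S (iInf_le _ hS)))

end Diagonal

/-! ### Absolutely continuous functions and measurability -/

section AbsolutelyContinuous

/-- Absolute continuity passes to functions with smaller increments. -/
theorem AbsolutelyContinuousOnInterval.of_dist_le {X Y : Type*} [PseudoMetricSpace X]
    [PseudoMetricSpace Y] {f : ℝ → X} {g : ℝ → Y} {a b : ℝ}
    (hf : AbsolutelyContinuousOnInterval f a b)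
    (h : ∀ x ∈ uIcc a b, ∀ y ∈ uIcc a b, dist (g x) (g y) ≤ dist (f x) (f y)) :
    AbsolutelyContinuousOnInterval g a b := by
  rw [absolutelyContinuousOnInterval_iff] at hf ⊢
  intro ε hε
  obtain ⟨δ, hδ, hδ'⟩ := hf ε hε
  refine ⟨δ, hδ, fun E hE hl => (Finset.sum_le_sum fun i hi => ?_).trans_lt (hδ' E hE hl)⟩
  exact h _ (hE.1 i hi).1 _ (hE.1 i hi).2

theorem AbsolutelyContinuousOnInterval.inner {H : Type*} [NormedAddCommGroup H]
    [InnerProductSpace ℂ H] {f g : ℝ → H} {a b : ℝ}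
    (hf : AbsolutelyContinuousOnInterval f a b) (hg : AbsolutelyContinuousOnInterval g a b) :
    AbsolutelyContinuousOnInterval (fun x => ⟪f x, g x⟫_ℂ) a b := by
  obtain ⟨C, hC⟩ := hf.exists_bound
  obtain ⟨D, hD⟩ := hg.exists_bound
  unfold AbsolutelyContinuousOnInterval at hf hg
  refine squeeze_zero' ?_ ?_ (by simpa using (hg.const_mul C).add (hf.const_mul D))
  · exact Eventually.of_forall fun _ => Finset.sum_nonneg fun i hi => dist_nonneg
  rw [eventually_inf_principal]
  filter_upwards with E hE
  simp only [Finset.mul_sum, ← Finset.sum_add_distrib]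
  refine Finset.sum_le_sum fun i hi => ?_
  obtain ⟨h1, h2⟩ := hE.1 i hi
  rw [dist_eq_norm, dist_eq_norm, dist_eq_norm]
  have : ⟪f (E.2 i).1, g (E.2 i).1⟫_ℂ - ⟪f (E.2 i).2, g (E.2 i).2⟫_ℂ =
      ⟪f (E.2 i).1, g (E.2 i).1 - g (E.2 i).2⟫_ℂ + ⟪f (E.2 i).1 - f (E.2 i).2, g (E.2 i).2⟫_ℂ := by
    rw [inner_sub_right, inner_sub_left]
    ring
  rw [this, mul_comm D]
  refine (norm_add_le _ _).trans (add_le_add ?_ ?_)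
  · refine (norm_inner_le_norm _ _).trans ?_
    gcongr
    exact hC _ h1
  · refine (norm_inner_le_norm _ _).trans ?_
    gcongr
    exact hD _ h2

variable {F : Type*} [NormedAddCommGroup F] [NormedSpace ℝ F]

theorem IntervalIntegrable.absolutelyContinuousOnInterval_primitive {f : ℝ → F}
    {a b c : ℝ} (h : IntervalIntegrable f volume a b) (hc : c ∈ uIcc a b) :
    AbsolutelyContinuousOnInterval (fun x => ∫ v in c..x, f v) a b := by
  refine (h.norm.absolutelyContinuousOnInterval_intervalIntegral hc).of_dist_le
    fun x hx y hy => ?_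
  have hs : ∀ x ∈ uIcc a b, IntervalIntegrable f volume c x := fun x hx =>
    h.mono_set (uIcc_subset_uIcc hc hx)
  rw [dist_eq_norm, dist_eq_norm, intervalIntegral.integral_interval_sub_left (hs x hx) (hs y hy),
    intervalIntegral.integral_interval_sub_left (hs x hx).norm (hs y hy).norm, Real.norm_eq_abs]
  exact intervalIntegral.norm_integral_le_abs_integral_norm

/-- The fundamental theorem of calculus for vector-valued absolutely continuous functions that are
differentiable almost everywhere. -/
theorem AbsolutelyContinuousOnInterval.integral_eq_sub [CompleteSpace F] {g g' : ℝ → F} {a b : ℝ}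
    (hg : AbsolutelyContinuousOnInterval g a b)
    (hd : ∀ᵐ x, x ∈ uIcc a b → HasDerivAt g (g' x) x) (hi : IntervalIntegrable g' volume a b) :
    ∫ x in a..b, g' x = g b - g a := by
  have h1 := hg.sub (hi.absolutelyContinuousOnInterval_primitive left_mem_uIcc)
  obtain ⟨C, hC⟩ := h1.const_of_ae_hasDerivAt_zero (by
    filter_upwards [hd, hi.ae_hasDerivAt_integral] with x hx1 hx2 hx
    simpa using (hx1 hx).sub (hx2 hx a left_mem_uIcc))
  have h2 := hC a left_mem_uIcc
  have h3 := hC b right_mem_uIcc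
  simp only [Pi.sub_apply, intervalIntegral.integral_same, sub_zero] at h2 h3
  rw [h2, ← h3]
  abel

/-- `exp` is Lipschitz on the bounded range of `s f`. -/
theorem AbsolutelyContinuousOnInterval.exp_mul {f : ℝ → ℝ} {a b : ℝ}
    (hf : AbsolutelyContinuousOnInterval f a b) (s : ℝ) :
    AbsolutelyContinuousOnInterval (fun x => Real.exp (s * f x)) a b := by
  have h1 := hf.const_mul s
  obtain ⟨C, hC⟩ := h1.exists_bound
  refine (h1.const_mul (Real.exp C)).of_dist_le fun x hx y hy => ?_
  have key : ∀ u v : ℝ, u ≤ v → v ≤ C → Real.exp v - Real.exp u ≤ Real.exp C * (v - u) := by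
    intro u v huv hv
    have h2 := Real.add_one_le_exp (u - v)
    have h3 : Real.exp u = Real.exp v * Real.exp (u - v) := by
      rw [← Real.exp_add, add_sub_cancel]
    have h4 : Real.exp v ≤ Real.exp C := Real.exp_le_exp.2 hv
    rw [h3]
    nlinarith [Real.exp_pos v]
  have hx' : s * f x ≤ C := (le_abs_self _).trans (hC x hx)
  have hy' : s * f y ≤ C := (le_abs_self _).trans (hC y hy)
  have e : dist (Real.exp C * (s * f x)) (Real.exp C * (s * f y)) =
      Real.exp C * |s * f x - s * f y| := by
    rw [Real.dist_eq, ← mul_sub, abs_mul, abs_of_pos (Real.exp_pos C)]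
  refine le_trans ?_ e.ge
  rw [Real.dist_eq]
  rcases le_total (s * f x) (s * f y) with h | h
  · rw [abs_sub_comm, abs_of_nonneg (sub_nonneg.2 (Real.exp_le_exp.2 h)), abs_sub_comm,
      abs_of_nonneg (sub_nonneg.2 h)]
    exact key _ _ h hy'
  · rw [abs_of_nonneg (sub_nonneg.2 (Real.exp_le_exp.2 h)), abs_of_nonneg (sub_nonneg.2 h)]
    exact key _ _ h hx'

/-- The integrand is the derivative of the absolutely continuous function `exp (s ∫ k)`. -/
theorem integral_mul_exp_primitive {k : ℝ → ℝ} {c x : ℝ} (hk : IntervalIntegrable k volume c x)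
    (s : ℝ) : ∫ t in c..x, s * k t * Real.exp (s * ∫ v in c..t, k v) =
      Real.exp (s * ∫ v in c..x, k v) - 1 := by
  have hK := hk.absolutelyContinuousOnInterval_primitive (left_mem_uIcc (a := c) (b := x))
  have h1 := (hK.exp_mul s).integral_eq_sub
    (g' := fun t => s * k t * Real.exp (s * ∫ v in c..t, k v)) ?_ ?_
  · simpa using h1
  · filter_upwards [hk.ae_hasDerivAt_integral] with t ht htm
    exact ((ht htm c left_mem_uIcc).const_mul s).exp.congr_deriv (mul_comm _ _)
  · exact (hk.const_mul s).mul_continuousOn ((hK.continuousOn.const_mul s).rexp)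

/-- The exponential weight that makes Volterra operators with kernel bounded by `k` contractions. -/
theorem abs_integral_mul_exp_le {k : ℝ → ℝ} {c x : ℝ} (hk : IntervalIntegrable k volume c x)
    (h0 : ∀ t, 0 ≤ k t) :
    |∫ t in c..x, k t * Real.exp (2 * |∫ v in c..t, k v|)| ≤
      2⁻¹ * Real.exp (2 * |∫ v in c..x, k v|) := by
  rcases le_total c x with hcx | hcx
  · have h1 : ∀ t ∈ uIcc c x, |∫ v in c..t, k v| = ∫ v in c..t, k v := fun t ht => by
      rw [uIcc_of_le hcx] at ht
      exact abs_of_nonneg (intervalIntegral.integral_nonneg ht.1 fun v _ => h0 v)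
    have h2 : ∫ t in c..x, k t * Real.exp (2 * |∫ v in c..t, k v|) =
        2⁻¹ * (Real.exp (2 * ∫ v in c..x, k v) - 1) := by
      rw [← integral_mul_exp_primitive hk 2, ← intervalIntegral.integral_const_mul]
      refine intervalIntegral.integral_congr fun t ht => ?_
      simp only [h1 t ht]
      ring
    have h3 : 1 ≤ Real.exp (2 * ∫ v in c..x, k v) := by
      refine Real.one_le_exp ?_
      rw [← h1 x right_mem_uIcc]
      positivity
    rw [h2, h1 x right_mem_uIcc, abs_of_nonneg (by linarith)]
    linarith
  · have h1 : ∀ t ∈ uIcc c x, |∫ v in c..t, k v| = -∫ v in c..t, k v := fun t ht => by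
      rw [uIcc_of_ge hcx] at ht
      refine abs_of_nonpos ?_
      rw [intervalIntegral.integral_symm]
      exact neg_nonpos.2 (intervalIntegral.integral_nonneg ht.2 fun v _ => h0 v)
    have h2 : ∫ t in c..x, k t * Real.exp (2 * |∫ v in c..t, k v|) =
        -(2⁻¹ * (Real.exp (-2 * ∫ v in c..x, k v) - 1)) := by
      rw [← integral_mul_exp_primitive hk (-2), ← intervalIntegral.integral_const_mul,
        ← intervalIntegral.integral_neg]
      refine intervalIntegral.integral_congr fun t ht => ?_
      have e : 2 * -(∫ v in c..t, k v) = -2 * ∫ v in c..t, k v := by ring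
      simp only [h1 t ht, e]
      ring
    have h4 : -2 * ∫ v in c..x, k v = 2 * |∫ v in c..x, k v| := by rw [h1 x right_mem_uIcc]; ring
    have h3 : 1 ≤ Real.exp (2 * |∫ v in c..x, k v|) := Real.one_le_exp (by positivity)
    rw [h2, h4, abs_neg, abs_of_nonneg (by linarith)]
    linarith

end AbsolutelyContinuous

section Measurability

variable {X : Type*} [MeasurableSpace X] {μ : Measure X} {H : Type*} [NormedAddCommGroup H]
  [InnerProductSpace ℂ H]

/-- Pettis: in a separable Hilbert space weakly measurable functions are strongly measurable. -/
theorem aestronglyMeasurable_of_inner [TopologicalSpace.SeparableSpace H] {f : X → H}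
    (hf : ∀ ξ, AEStronglyMeasurable (fun x => ⟪ξ, f x⟫_ℂ) μ) : AEStronglyMeasurable f μ := by
  let S : ℕ → Submodule ℂ H := fun n =>
    Submodule.span ℂ (TopologicalSpace.denseSeq H '' (Finset.range n : Set ℕ))
  have hfin : ∀ n, FiniteDimensional ℂ (S n) := fun n =>
    FiniteDimensional.span_of_finite ℂ ((Finset.finite_toSet _).image _)
  have hS : Monotone S := fun m n hmn => Submodule.span_mono (image_mono (by
    simpa using hmn))
  have hT : ⊤ ≤ (⨆ n, S n).topologicalClosure := by
    intro x _
    refine closure_mono ?_ (TopologicalSpace.denseRange_denseSeq H x)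
    rintro _ ⟨n, rfl⟩
    exact (le_iSup S (n + 1)) (Submodule.subset_span ⟨n, by simp, rfl⟩)
  refine aestronglyMeasurable_of_tendsto_ae atTop (f := fun n x => (S n).starProjection (f x))
    (fun n => ?_) (Eventually.of_forall fun x =>
      Submodule.starProjection_tendsto_self S hS (f x) hT)
  simp only [(stdOrthonormalBasis ℂ (S n)).starProjection_eq_sum_rankOne, _root_.sum_apply,
    InnerProductSpace.rankOne_apply]
  refine Finset.aestronglyMeasurable_fun_sum _ fun i _ => ?_
  exact (hf _).smul_const _

/-- Strongly measurable operators map measurable functions to measurable functions, by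
approximation with simple functions. -/
theorem aestronglyMeasurable_clm_apply {W : X → H →L[ℂ] H}
    (hW : ∀ ξ, AEStronglyMeasurable (fun x => W x ξ) μ) {u : X → H}
    (hu : AEStronglyMeasurable u μ) : AEStronglyMeasurable (fun x => W x (u x)) μ := by
  have key : ∀ s : SimpleFunc X H, AEStronglyMeasurable (fun x => W x (s x)) μ := by
    intro s
    induction s using SimpleFunc.induction with
    | const c hs =>
      rename_i s
      have : (fun x => W x (SimpleFunc.piecewise s hs (SimpleFunc.const X c)
          (SimpleFunc.const X 0) x)) = s.indicator fun x => W x c := by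
        funext x
        by_cases hx : x ∈ s <;> simp [hx]
      rw [this]
      exact (hW c).indicator hs
    | add hd h1 h2 =>
      have h3 := h1.add h2
      refine h3.congr (Eventually.of_forall fun x => ?_)
      simp only [SimpleFunc.coe_add, Pi.add_apply, map_add]
  have h1 : AEStronglyMeasurable (fun x => W x (hu.mk u x)) μ :=
    aestronglyMeasurable_of_tendsto_ae atTop
      (f := fun n x => W x (hu.stronglyMeasurable_mk.approx n x)) (fun n => key _)
      (Eventually.of_forall fun x =>
        ((W x).continuous.tendsto _).comp (hu.stronglyMeasurable_mk.tendsto_approx x))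
  refine h1.congr ?_
  filter_upwards [hu.ae_eq_mk] with x hx
  rw [hx]

end Measurability

/-! ### Initial value problems -/

section InitialValue

variable {H : Type u} [NormedAddCommGroup H] [InnerProductSpace ℂ H]

/-- Locally integrable operator-valued coefficients on the real line. -/
structure IsPotential (W : ℝ → H →L[ℂ] H) : Prop where
  measurable : ∀ ξ, AEStronglyMeasurable (fun x => W x ξ) volume
  integrable : LocallyIntegrable (fun x => ‖W x‖) volume

/-- `u` and `v = u'` solve `u'' = W u - f` on `S` with `u(c) = p` and `u'(c) = q`, in integrated
form. -/
structure IsSolution (W : ℝ → H →L[ℂ] H) (f : ℝ → H) (c : ℝ) (p q : H) (S : Set ℝ)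
    (u v : ℝ → H) : Prop where
  ordConnected : S.OrdConnected
  mem : c ∈ S
  continuousOn_fst : ContinuousOn u S
  continuousOn_snd : ContinuousOn v S
  eq_fst : ∀ x ∈ S, u x = p + ∫ t in c..x, v t
  eq_snd : ∀ x ∈ S, v x = q + ∫ t in c..x, (W t (u t) - f t)

theorem MeasureTheory.LocallyIntegrable.intervalIntegrable' {F : Type*} [NormedAddCommGroup F]
    {f : ℝ → F} (hf : LocallyIntegrable f volume) (x y : ℝ) : IntervalIntegrable f volume x y :=
  (hf.integrableOn_isCompact isCompact_uIcc).intervalIntegrable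

theorem IsPotential.intervalIntegrable {W : ℝ → H →L[ℂ] H} (hW : IsPotential W) {u : ℝ → H}
    {x y : ℝ} (hu : ContinuousOn u (uIcc x y)) :
    IntervalIntegrable (fun t => W t (u t)) volume x y := by
  obtain ⟨C, hC⟩ := isCompact_uIcc.exists_bound_of_continuousOn hu
  have h1 : IntervalIntegrable (fun t => ‖W t‖ * C) volume x y :=
    (hW.integrable.intervalIntegrable' x y).mul_const C
  rw [intervalIntegrable_iff] at h1 ⊢
  refine h1.mono' (aestronglyMeasurable_clm_apply (fun ξ => (hW.measurable ξ).restrict)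
    ((hu.mono uIoc_subset_uIcc).aestronglyMeasurable measurableSet_uIoc)) ?_
  filter_upwards [ae_restrict_mem measurableSet_uIoc] with t ht
  refine (ContinuousLinearMap.le_opNorm _ _).trans ?_
  gcongr
  exact hC t (uIoc_subset_uIcc ht)

/-- Integration from `c` halves the norm `sup ‖u‖ exp (-2 |∫ k|)` on functions dominated by `k u`.
-/
theorem norm_integral_le_of_le_weight {F : Type*} [NormedAddCommGroup F] [NormedSpace ℝ F]
    {k : ℝ → ℝ} {c x M : ℝ} (hk : IntervalIntegrable k volume c x) (h0 : ∀ t, 0 ≤ k t)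
    (hM : 0 ≤ M) {g : ℝ → F} (hg : ∀ t ∈ uIcc c x, ‖g t‖ ≤
      M * (k t * Real.exp (2 * |∫ v in c..t, k v|))) :
    ‖∫ t in c..x, g t‖ ≤ M * (2⁻¹ * Real.exp (2 * |∫ v in c..x, k v|)) := by
  have hK := hk.absolutelyContinuousOnInterval_primitive (left_mem_uIcc (a := c) (b := x))
  have hi : IntervalIntegrable (fun t => M * (k t * Real.exp (2 * |∫ v in c..t, k v|)))
      volume c x := (hk.mul_continuousOn (hK.continuousOn.abs.const_mul 2).rexp).const_mul M
  refine (intervalIntegral.norm_integral_le_abs_of_norm_le ?_ hi).trans ?_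
  · filter_upwards [ae_restrict_mem measurableSet_uIoc] with t ht
    exact hg t (uIoc_subset_uIcc ht)
  · rw [intervalIntegral.integral_const_mul, abs_mul, abs_of_nonneg hM]
    gcongr
    exact abs_integral_mul_exp_le hk h0

/-- A Gronwall inequality: the maximum `M` of `y exp (-2 |∫ k|)` is at most `C + M / 2`. -/
theorem le_exp_of_le_integral {k y : ℝ → ℝ} {c b C : ℝ} (hk : IntervalIntegrable k volume c b)
    (h0 : ∀ t, 0 ≤ k t) (hy : ContinuousOn y (uIcc c b)) (hy0 : ∀ t ∈ uIcc c b, 0 ≤ y t)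
    (h : ∀ x ∈ uIcc c b, y x ≤ C + |∫ t in c..x, k t * y t|) {x : ℝ} (hx : x ∈ uIcc c b) :
    y x ≤ 2 * C * Real.exp (2 * |∫ v in c..x, k v|) := by
  have hK := hk.absolutelyContinuousOnInterval_primitive (left_mem_uIcc (a := c) (b := b))
  set w : ℝ → ℝ := fun x => Real.exp (2 * |∫ v in c..x, k v|) with hw
  have hwc : ContinuousOn w (uIcc c b) := (hK.continuousOn.abs.const_mul 2).rexp
  have hw1 : ∀ x, 1 ≤ w x := fun x => Real.one_le_exp (by positivity)
  have hw0 : ∀ x, 0 < w x := fun x => Real.exp_pos _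
  obtain ⟨x0, hx0, hmax⟩ := isCompact_uIcc.exists_isMaxOn nonempty_uIcc
    (hy.div hwc fun x _ => (hw0 x).ne')
  set M := y x0 / w x0 with hM
  have hM0 : 0 ≤ M := div_nonneg (hy0 _ hx0) (hw0 _).le
  have hyM : ∀ t ∈ uIcc c b, y t ≤ M * w t := fun t ht => (div_le_iff₀ (hw0 t)).1 (hmax ht)
  have h1 := norm_integral_le_of_le_weight (hk.mono_set (uIcc_subset_uIcc left_mem_uIcc hx0)) h0 hM0
    (g := fun t => k t * y t) (fun t ht => by
      have ht' := uIcc_subset_uIcc left_mem_uIcc hx0 ht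
      rw [Real.norm_eq_abs, abs_of_nonneg (mul_nonneg (h0 t) (hy0 t ht'))]
      calc k t * y t ≤ k t * (M * w t) := mul_le_mul_of_nonneg_left (hyM t ht') (h0 t)
        _ = _ := by rw [hw]; ring)
  have h2 := h x0 hx0
  rw [Real.norm_eq_abs] at h1
  have h3 : y x0 = M * w x0 := by rw [hM, div_mul_cancel₀ _ (hw0 _).ne']
  have h4 : M * w x0 ≤ 2 * C := by
    have : M * (2⁻¹ * w x0) = 2⁻¹ * (M * w x0) := by ring
    change |∫ t in c..x0, k t * y t| ≤ M * (2⁻¹ * w x0) at h1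
    linarith
  have h5 : M ≤ 2 * C := by
    calc M = M * 1 := (mul_one M).symm
      _ ≤ M * w x0 := mul_le_mul_of_nonneg_left (hw1 _) hM0
      _ ≤ _ := h4
  exact (hyM x hx).trans (mul_le_mul_of_nonneg_right h5 (hw0 x).le)

namespace IsSolution

variable {W : ℝ → H →L[ℂ] H} {f f' : ℝ → H} {c : ℝ} {p q p' q' : H} {S : Set ℝ}
  {u v u' v' : ℝ → H}

theorem mono (h : IsSolution W f c p q S u v) {S' : Set ℝ} (hS : S' ⊆ S) (hc : c ∈ S')
    (ho : S'.OrdConnected) : IsSolution W f c p q S' u v :=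
  ⟨ho, hc, h.continuousOn_fst.mono hS, h.continuousOn_snd.mono hS, fun x hx => h.eq_fst x (hS hx),
    fun x hx => h.eq_snd x (hS hx)⟩

theorem uIcc_subset (h : IsSolution W f c p q S u v) {x : ℝ} (hx : x ∈ S) : uIcc c x ⊆ S :=
  h.ordConnected.uIcc_subset h.mem hx

theorem apply_fst (h : IsSolution W f c p q S u v) : u c = p := by
  rw [h.eq_fst c h.mem, intervalIntegral.integral_same, add_zero]

theorem apply_snd (h : IsSolution W f c p q S u v) : v c = q := by
  rw [h.eq_snd c h.mem, intervalIntegral.integral_same, add_zero]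

theorem intervalIntegrable (h : IsSolution W f c p q S u v) (hW : IsPotential W)
    (hf : LocallyIntegrable f volume) {x y : ℝ} (hx : x ∈ S) (hy : y ∈ S) :
    IntervalIntegrable (fun t => W t (u t) - f t) volume x y :=
  (hW.intervalIntegrable (h.continuousOn_fst.mono (h.ordConnected.uIcc_subset hx hy))).sub
    (hf.intervalIntegrable' x y)

/-- Superposition of solutions. -/
theorem add_smul (h : IsSolution W f c p q S u v) (h' : IsSolution W f' c p' q' S u' v')
    (hW : IsPotential W) (hf : LocallyIntegrable f volume) (hf' : LocallyIntegrable f' volume)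
    (s : ℂ) : IsSolution W (f + s • f') c (p + s • p') (q + s • q') S (u + s • u')
      (v + s • v') where
  ordConnected := h.ordConnected
  mem := h.mem
  continuousOn_fst := h.continuousOn_fst.add (h'.continuousOn_fst.const_smul s)
  continuousOn_snd := h.continuousOn_snd.add (h'.continuousOn_snd.const_smul s)
  eq_fst x hx := by
    have i1 := (h.continuousOn_snd.mono (h.uIcc_subset hx)).intervalIntegrable (μ := volume)
    have i2 := (h'.continuousOn_snd.mono (h.uIcc_subset hx)).intervalIntegrable (μ := volume)
    have i3 : IntervalIntegrable (fun t => s • v' t) volume c x := i2.smul s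
    simp only [Pi.add_apply, Pi.smul_apply]
    rw [h.eq_fst x hx, h'.eq_fst x hx, intervalIntegral.integral_add i1 i3,
      intervalIntegral.integral_smul, smul_add]
    abel
  eq_snd x hx := by
    have i1 := h.intervalIntegrable hW hf h.mem hx
    have i2 := h'.intervalIntegrable hW hf' h.mem hx
    have i3 : IntervalIntegrable (fun t => s • (W t (u' t) - f' t)) volume c x := i2.smul s
    simp only [Pi.add_apply, Pi.smul_apply]
    rw [h.eq_snd x hx, h'.eq_snd x hx, smul_add, ← intervalIntegral.integral_smul,
      add_add_add_comm, ← intervalIntegral.integral_add i1 i3]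
    congr 2
    funext t
    rw [map_add, map_smul, smul_sub]
    abel

theorem hasDerivAt (h : IsSolution W f c p q S u v) [CompleteSpace H] {x : ℝ} (hx : S ∈ 𝓝 x) :
    HasDerivAt u (v x) x := by
  have hxS : x ∈ S := mem_of_mem_nhds hx
  have h1 : HasDerivAt (fun x => p + ∫ t in c..x, v t) (v x) x := by
    refine HasDerivAt.const_add _ ?_
    refine intervalIntegral.integral_hasDerivAt_right
      ((h.continuousOn_snd.mono (h.uIcc_subset hxS)).intervalIntegrable) ?_
      (h.continuousOn_snd.continuousAt hx)
    exact ⟨S, hx, h.continuousOn_snd.aestronglyMeasurable h.ordConnected.measurableSet⟩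
  refine h1.congr_of_eventuallyEq ?_
  filter_upwards [hx] with y hy using h.eq_fst y hy

theorem snd_sub (h : IsSolution W f c p q S u v) (hW : IsPotential W)
    (hf : LocallyIntegrable f volume) {x y : ℝ} (hx : x ∈ S) (hy : y ∈ S) :
    v y - v x = ∫ t in x..y, (W t (u t) - f t) := by
  rw [h.eq_snd x hx, h.eq_snd y hy, add_sub_add_left_eq_sub,
    intervalIntegral.integral_interval_sub_left (h.intervalIntegrable hW hf h.mem hy)
      (h.intervalIntegrable hW hf h.mem hx)]

theorem fst_sub (h : IsSolution W f c p q S u v) {x y : ℝ} (hx : x ∈ S) (hy : y ∈ S) :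
    u y - u x = ∫ t in x..y, v t := by
  rw [h.eq_fst x hx, h.eq_fst y hy, add_sub_add_left_eq_sub,
    intervalIntegral.integral_interval_sub_left
      ((h.continuousOn_snd.mono (h.uIcc_subset hy)).intervalIntegrable)
      ((h.continuousOn_snd.mono (h.uIcc_subset hx)).intervalIntegrable)]

/-- The initial point of a solution can be moved. -/
theorem rebase (h : IsSolution W f c p q S u v) (hW : IsPotential W)
    (hf : LocallyIntegrable f volume) {d : ℝ} (hd : d ∈ S) :
    IsSolution W f d (u d) (v d) S u v where
  ordConnected := h.ordConnected
  mem := hd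
  continuousOn_fst := h.continuousOn_fst
  continuousOn_snd := h.continuousOn_snd
  eq_fst x hx := by rw [← h.fst_sub hd hx, add_sub_cancel]
  eq_snd x hx := by rw [← h.snd_sub hW hf hd hx, add_sub_cancel]

/-- Solutions are bounded by the data, with a constant that depends only on a bound `k` for the
coefficients. -/
theorem norm_le (h : IsSolution W f c p q S u v) (hW : IsPotential W)
    (hf : LocallyIntegrable f volume) {k : ℝ → ℝ} {b : ℝ} (hb : b ∈ S)
    (hk : IntervalIntegrable k volume c b) (hk0 : ∀ t, 1 + ‖W t‖ ≤ k t) {x : ℝ}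
    (hx : x ∈ uIcc c b) : ‖u x‖ + ‖v x‖ ≤ 2 * (‖p‖ + ‖q‖ + |∫ t in c..b, ‖f t‖|) *
      Real.exp (2 * |∫ t in c..x, k t|) := by
  have hS := h.uIcc_subset hb
  have h0 : ∀ t, 0 ≤ k t := fun t => le_trans (by positivity) (hk0 t)
  have hcont : ContinuousOn (fun t => ‖u t‖ + ‖v t‖) (uIcc c b) :=
    ((h.continuousOn_fst.mono hS).norm).add ((h.continuousOn_snd.mono hS).norm)
  refine le_exp_of_le_integral hk h0 hcont (fun t _ => by positivity)
    (fun y hy => ?_) hx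
  have hyS := hS hy
  have hsub : uIcc c y ⊆ uIcc c b := uIcc_subset_uIcc left_mem_uIcc hy
  have hi : IntervalIntegrable (fun t => k t * (‖u t‖ + ‖v t‖)) volume c y :=
    (hk.mono_set hsub).mul_continuousOn (hcont.mono hsub)
  have hi' : IntervalIntegrable (fun t => ‖f t‖) volume c y := (hf.intervalIntegrable' c y).norm
  have hiu : IntervalIntegrable (fun t => ‖v t‖) volume c y :=
    ((h.continuousOn_snd.mono (h.uIcc_subset hyS)).norm).intervalIntegrable
  have hiw : IntervalIntegrable (fun t => ‖W t‖ * ‖u t‖) volume c y :=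
    (hW.integrable.intervalIntegrable' c y).mul_continuousOn
      (h.continuousOn_fst.mono (h.uIcc_subset hyS)).norm
  have e1 : ‖u y‖ ≤ ‖p‖ + |∫ t in c..y, ‖v t‖| := by
    rw [h.eq_fst y hyS]
    exact (norm_add_le _ _).trans (add_le_add_right
      intervalIntegral.norm_integral_le_abs_integral_norm _)
  have e2 : ‖v y‖ ≤ ‖q‖ + |∫ t in c..y, (‖W t‖ * ‖u t‖ + ‖f t‖)| := by
    rw [h.eq_snd y hyS]
    refine (norm_add_le _ _).trans (add_le_add_right ?_ _)
    refine intervalIntegral.norm_integral_le_abs_of_norm_le (Eventually.of_forall fun t => ?_)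
      (hiw.add hi')
    exact (norm_sub_le _ _).trans (add_le_add_left (ContinuousLinearMap.le_opNorm _ _) _)
  have habs : ∀ g g' : ℝ → ℝ, (∀ t, 0 ≤ g t) → (∀ t, g t ≤ g' t) →
      IntervalIntegrable g volume c y → IntervalIntegrable g' volume c y →
      |∫ t in c..y, g t| ≤ |∫ t in c..y, g' t| := fun g g' hg hgg' _ hi => by
    rw [← Real.norm_eq_abs]
    exact intervalIntegral.norm_integral_le_abs_of_norm_le (Eventually.of_forall fun t => by
      rw [Real.norm_eq_abs, abs_of_nonneg (hg t)]
      exact hgg' t) hi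
  have hsum : ∀ g g' : ℝ → ℝ, (∀ t, 0 ≤ g t) → (∀ t, 0 ≤ g' t) →
      IntervalIntegrable g volume c y → IntervalIntegrable g' volume c y →
      |∫ t in c..y, g t| + |∫ t in c..y, g' t| = |∫ t in c..y, (g t + g' t)| := by
    intro g g' hg hg' ig ig'
    rw [intervalIntegral.integral_add ig ig']
    rcases le_total c y with hcy | hcy
    · rw [abs_of_nonneg (intervalIntegral.integral_nonneg hcy fun t _ => hg t),
        abs_of_nonneg (intervalIntegral.integral_nonneg hcy fun t _ => hg' t), abs_of_nonneg]
      exact add_nonneg (intervalIntegral.integral_nonneg hcy fun t _ => hg t)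
        (intervalIntegral.integral_nonneg hcy fun t _ => hg' t)
    · have n1 : ∫ t in c..y, g t ≤ 0 := by
        rw [intervalIntegral.integral_symm]
        exact neg_nonpos.2 (intervalIntegral.integral_nonneg hcy fun t _ => hg t)
      have n2 : ∫ t in c..y, g' t ≤ 0 := by
        rw [intervalIntegral.integral_symm]
        exact neg_nonpos.2 (intervalIntegral.integral_nonneg hcy fun t _ => hg' t)
      rw [abs_of_nonpos n1, abs_of_nonpos n2, abs_of_nonpos (add_nonpos n1 n2)]
      ring
  have e3 : |∫ t in c..y, ‖f t‖| ≤ |∫ t in c..b, ‖f t‖| :=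
    intervalIntegral.abs_integral_mono_interval (uIoc_subset_uIoc_of_uIcc_subset_uIcc hsub)
      (Eventually.of_forall fun t => norm_nonneg _) (hf.intervalIntegrable' c b).norm
  have e4 : |∫ t in c..y, ‖v t‖| + |∫ t in c..y, ‖W t‖ * ‖u t‖| ≤
      |∫ t in c..y, k t * (‖u t‖ + ‖v t‖)| := by
    rw [hsum _ _ (fun t => norm_nonneg _) (fun t => by positivity) hiu hiw]
    refine habs _ _ (fun t => by positivity) (fun t => ?_) (hiu.add hiw) hi
    have := hk0 t
    nlinarith [norm_nonneg (u t), norm_nonneg (v t), norm_nonneg (W t),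
      mul_nonneg (sub_nonneg.2 this) (add_nonneg (norm_nonneg (u t)) (norm_nonneg (v t))),
      mul_nonneg (norm_nonneg (W t)) (norm_nonneg (v t))]
  rw [← hsum _ _ (fun t => by positivity) (fun t => norm_nonneg _) hiw hi'] at e2
  linarith

theorem unique (h : IsSolution W f c p q S u v) (h' : IsSolution W f c p q S u' v')
    (hW : IsPotential W) (hf : LocallyIntegrable f volume) {x : ℝ} (hx : x ∈ S) :
    u x = u' x ∧ v x = v' x := by
  have h1 := h.add_smul h' hW hf hf (-1)
  have hz : f + (-1 : ℂ) • f = 0 := by simp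
  rw [hz] at h1
  have hk : IntervalIntegrable (fun t => 1 + ‖W t‖) volume c x :=
    intervalIntegrable_const.add (hW.integrable.intervalIntegrable' c x)
  have h2 := h1.norm_le hW locallyIntegrable_zero hx hk (fun t => le_rfl) right_mem_uIcc
  simp only [neg_smul, one_smul, add_neg_cancel, norm_zero, Pi.zero_apply,
    intervalIntegral.integral_zero, abs_zero, add_zero, mul_zero, zero_mul, Pi.add_apply,
    Pi.neg_apply] at h2
  have h3 := norm_nonneg (u x + -u' x)
  have h4 := norm_nonneg (v x + -v' x)
  have h5 : ‖u x + -u' x‖ = 0 := by linarith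
  have h6 : ‖v x + -v' x‖ = 0 := by linarith
  rw [norm_eq_zero, ← sub_eq_add_neg, sub_eq_zero] at h5 h6
  exact ⟨h5, h6⟩

end IsSolution

end InitialValue

section Existence

variable {H : Type u} [NormedAddCommGroup H] [InnerProductSpace ℂ H] [CompleteSpace H]

/-- Existence for the initial value problem: the weight `exp (2 |∫ k|)` turns the Volterra integral
operator into a contraction of the bounded continuous functions. -/
theorem IsPotential.exists_isSolution {W : ℝ → H →L[ℂ] H} (hW : IsPotential W) {f : ℝ → H}
    (hf : LocallyIntegrable f volume) (c : ℝ) (p q : H) :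
    ∃ u v, IsSolution W f c p q univ u v := by
  let k : ℝ → ℝ := fun t => 1 + ‖W t‖ + ‖f t‖
  have hk : LocallyIntegrable k volume :=
    ((locallyIntegrable_const (1 : ℝ)).add hW.integrable).add (hf.mono
      hf.aestronglyMeasurable.norm (Eventually.of_forall fun t => (norm_norm _).le))
  have hki : ∀ x y, IntervalIntegrable k volume x y := hk.intervalIntegrable'
  have hk0 : ∀ t, 0 ≤ k t := fun t => by positivity
  let w : ℝ → ℝ := fun x => Real.exp (2 * |∫ t in c..x, k t|)
  have hw0 : ∀ x, 0 < w x := fun x => Real.exp_pos _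
  have hw1 : ∀ x, 1 ≤ w x := fun x => Real.one_le_exp (by positivity)
  have hwc : Continuous w :=
    ((intervalIntegral.continuous_primitive hki c).abs.const_mul 2).rexp
  have hwi : Continuous fun x => (w x)⁻¹ := hwc.inv₀ fun x => (hw0 x).ne'
  let B := BoundedContinuousFunction ℝ (H × H)
  let I1 : B → ℝ → H := fun η x => ∫ t in c..x, w t • (η t).2
  let I2 : B → ℝ → H := fun η x => ∫ t in c..x, (W t (w t • (η t).1) - f t)
  have hc1 : ∀ η : B, Continuous fun t => w t • (η t).2 := fun η =>
    hwc.smul (continuous_snd.comp η.continuous)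
  have hc2 : ∀ η : B, Continuous fun t => w t • (η t).1 := fun η =>
    hwc.smul (continuous_fst.comp η.continuous)
  have hi1 : ∀ (η : B) x y, IntervalIntegrable (fun t => w t • (η t).2) volume x y :=
    fun η x y => (hc1 η).intervalIntegrable x y
  have hi2 : ∀ (η : B) x y, IntervalIntegrable (fun t => W t (w t • (η t).1) - f t) volume x y :=
    fun η x y => (hW.intervalIntegrable (hc2 η).continuousOn).sub (hf.intervalIntegrable' x y)
  have hI1 : ∀ η, Continuous (I1 η) := fun η => intervalIntegral.continuous_primitive (hi1 η) c
  have hI2 : ∀ η, Continuous (I2 η) := fun η => intervalIntegral.continuous_primitive (hi2 η) c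
  have hη1 : ∀ (η : B) t, ‖(η t).1‖ ≤ ‖η‖ := fun η t =>
    (norm_fst_le (η t)).trans (η.norm_coe_le_norm t)
  have hη2 : ∀ (η : B) t, ‖(η t).2‖ ≤ ‖η‖ := fun η t =>
    (norm_snd_le (η t)).trans (η.norm_coe_le_norm t)
  have hsc : ∀ (x : ℝ) (y : H) (M : ℝ), ‖y‖ ≤ M * w x → ‖(w x)⁻¹ • y‖ ≤ M := by
    intro x y M h
    rw [norm_smul, norm_inv, Real.norm_of_nonneg (hw0 x).le, inv_mul_le_iff₀ (hw0 x), mul_comm]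
    exact h
  have hb1 : ∀ (η : B) x, ‖I1 η x‖ ≤ ‖η‖ * (2⁻¹ * w x) := by
    intro η x
    refine norm_integral_le_of_le_weight (hki c x) hk0 (norm_nonneg _) fun t _ => ?_
    rw [norm_smul, Real.norm_of_nonneg (hw0 t).le]
    change w t * _ ≤ ‖η‖ * (k t * w t)
    have h1 : 1 ≤ k t := by simp only [k]; linarith [norm_nonneg (W t), norm_nonneg (f t)]
    calc w t * ‖(η t).2‖ ≤ w t * ‖η‖ := mul_le_mul_of_nonneg_left (hη2 η t) (hw0 t).le
      _ = ‖η‖ * (1 * w t) := by ring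
      _ ≤ ‖η‖ * (k t * w t) := by
        have := (hw0 t).le
        gcongr
  have hb2 : ∀ (η : B) x, ‖I2 η x‖ ≤ (‖η‖ + 1) * (2⁻¹ * w x) := by
    intro η x
    refine norm_integral_le_of_le_weight (hki c x) hk0 (by positivity) fun t _ => ?_
    change _ ≤ (‖η‖ + 1) * (k t * w t)
    have h1 : ‖W t (w t • (η t).1)‖ ≤ ‖W t‖ * (w t * ‖η‖) := by
      refine (ContinuousLinearMap.le_opNorm _ _).trans ?_
      rw [norm_smul, Real.norm_of_nonneg (hw0 t).le]
      have := (hw0 t).le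
      gcongr
      exact hη1 η t
    have h2 : ‖f t‖ ≤ ‖f t‖ * w t := le_mul_of_one_le_right (norm_nonneg _) (hw1 t)
    have h3 := norm_sub_le (W t (w t • (η t).1)) (f t)
    have h4 : (‖η‖ + 1) * (k t * w t) = ‖W t‖ * (w t * ‖η‖) + ‖f t‖ * w t +
        (‖η‖ * w t + ‖η‖ * ‖f t‖ * w t + w t + ‖W t‖ * w t) := by
      simp only [k]; ring
    have h5 : 0 ≤ ‖η‖ * w t + ‖η‖ * ‖f t‖ * w t + w t + ‖W t‖ * w t := by
      have := (hw0 t).le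
      positivity
    linarith
  -- the pair `(u, u') = w η` solves the problem if and only if `η` is a fixed point of `Φ`
  let Φ : B → B := fun η => BoundedContinuousFunction.ofNormedAddCommGroup
    (fun x => ((w x)⁻¹ • (p + I1 η x), (w x)⁻¹ • (q + I2 η x)))
    ((hwi.smul (continuous_const.add (hI1 η))).prodMk (hwi.smul (continuous_const.add (hI2 η))))
    (‖p‖ + ‖q‖ + ‖η‖ + 1) (fun x => by
      have hpw : ‖p‖ ≤ ‖p‖ * w x := le_mul_of_one_le_right (norm_nonneg _) (hw1 x)
      have hqw : ‖q‖ ≤ ‖q‖ * w x := le_mul_of_one_le_right (norm_nonneg _) (hw1 x)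
      have h1 := hb1 η x
      have h2 := hb2 η x
      have h3 : 0 ≤ ‖p‖ * w x := mul_nonneg (norm_nonneg _) (hw0 x).le
      have h4 : 0 ≤ ‖q‖ * w x := mul_nonneg (norm_nonneg _) (hw0 x).le
      have h5 : 0 ≤ ‖η‖ * w x := mul_nonneg (norm_nonneg _) (hw0 x).le
      refine max_le (hsc _ _ _ ((norm_add_le _ _).trans ?_)) (hsc _ _ _ ((norm_add_le _ _).trans ?_))
      · nlinarith [hw0 x]
      · nlinarith [hw0 x])
  have hΦ : ∀ η x, Φ η x = ((w x)⁻¹ • (p + I1 η x), (w x)⁻¹ • (q + I2 η x)) := fun η x => rfl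
  have hcontr : ContractingWith 2⁻¹ Φ := by
    refine ⟨by norm_num, LipschitzWith.of_dist_le_mul fun η ζ => ?_⟩
    rw [BoundedContinuousFunction.dist_le (by positivity)]
    intro x
    have hd1 : ∀ t, ‖(η t).1 - (ζ t).1‖ ≤ dist η ζ := fun t => by
      rw [dist_eq_norm]; exact hη1 (η - ζ) t
    have hd2 : ∀ t, ‖(η t).2 - (ζ t).2‖ ≤ dist η ζ := fun t => by
      rw [dist_eq_norm]; exact hη2 (η - ζ) t
    have e1 : ‖I1 η x - I1 ζ x‖ ≤ dist η ζ * (2⁻¹ * w x) := by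
      have : I1 η x - I1 ζ x = I1 (η - ζ) x := by
        simp only [I1]
        rw [← intervalIntegral.integral_sub (hi1 η c x) (hi1 ζ c x)]
        refine intervalIntegral.integral_congr fun t _ => ?_
        change w t • (η t).2 - w t • (ζ t).2 = w t • ((η t).2 - (ζ t).2)
        rw [smul_sub]
      rw [this, dist_eq_norm]
      exact hb1 _ x
    have e2 : ‖I2 η x - I2 ζ x‖ ≤ dist η ζ * (2⁻¹ * w x) := by
      simp only [I2]
      rw [← intervalIntegral.integral_sub (hi2 η c x) (hi2 ζ c x)]
      refine norm_integral_le_of_le_weight (hki c x) hk0 dist_nonneg fun t _ => ?_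
      change _ ≤ dist η ζ * (k t * w t)
      rw [sub_sub_sub_cancel_right, ← map_sub, ← smul_sub]
      refine (ContinuousLinearMap.le_opNorm _ _).trans ?_
      rw [norm_smul, Real.norm_of_nonneg (hw0 t).le]
      have hkW : ‖W t‖ ≤ k t := by simp only [k]; linarith [norm_nonneg (f t)]
      have := (hw0 t).le
      calc ‖W t‖ * (w t * ‖(η t).1 - (ζ t).1‖) ≤ k t * (w t * dist η ζ) := by
            have := hk0 t
            gcongr
            exact hd1 t
        _ = _ := by ring
    have e3 : ∀ r y y' : H, ‖y - y'‖ ≤ dist η ζ * (2⁻¹ * w x) →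
        dist ((w x)⁻¹ • (r + y)) ((w x)⁻¹ • (r + y')) ≤ 2⁻¹ * dist η ζ := fun r y y' hy => by
      rw [dist_eq_norm, ← smul_sub, add_sub_add_left_eq_sub]
      exact hsc x _ _ (by linarith)
    rw [hΦ, hΦ, Prod.dist_eq]
    exact max_le (e3 _ _ _ e1) (e3 _ _ _ e2)
  have hfix : Φ (hcontr.fixedPoint) = hcontr.fixedPoint := hcontr.fixedPoint_isFixedPt
  set η := hcontr.fixedPoint
  have hηx : ∀ x, η x = ((w x)⁻¹ • (p + I1 η x), (w x)⁻¹ • (q + I2 η x)) := fun x => by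
    rw [← hΦ, hfix]
  refine ⟨fun x => w x • (η x).1, fun x => w x • (η x).2, ordConnected_univ, mem_univ _,
    (hc2 η).continuousOn, (hc1 η).continuousOn, fun x _ => ?_, fun x _ => ?_⟩
  · have h1 := congrArg Prod.fst (hηx x)
    dsimp only at h1 ⊢
    rw [h1, smul_smul, mul_inv_cancel₀ (hw0 x).ne', one_smul]
  · have h1 := congrArg Prod.snd (hηx x)
    dsimp only at h1 ⊢
    rw [h1, smul_smul, mul_inv_cancel₀ (hw0 x).ne', one_smul]

/-- The solution operators of the homogeneous equation: the solution `Y x ξ` with initial data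
`P ξ`, `Q ξ` depends on `ξ` through a bounded operator. -/
theorem IsPotential.exists_clm_isSolution {W : ℝ → H →L[ℂ] H} (hW : IsPotential W) (c : ℝ)
    (P Q : H →L[ℂ] H) : ∃ Y Z : ℝ → H →L[ℂ] H,
      ∀ ξ, IsSolution W 0 c (P ξ) (Q ξ) univ (fun x => Y x ξ) (fun x => Z x ξ) := by
  have h0 : LocallyIntegrable (0 : ℝ → H) volume := locallyIntegrable_zero
  choose u v huv using fun ξ => hW.exists_isSolution h0 c (P ξ) (Q ξ)
  have hlin : ∀ ξ η (s : ℂ) x, u (ξ + s • η) x = u ξ x + s • u η x ∧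
      v (ξ + s • η) x = v ξ x + s • v η x := by
    intro ξ η s x
    have h1 := (huv ξ).add_smul (huv η) hW h0 h0 s
    rw [smul_zero, add_zero, ← map_smul, ← map_add, ← map_smul, ← map_add] at h1
    exact (huv (ξ + s • η)).unique h1 hW h0 (mem_univ x)
  have hzero : ∀ x, u 0 x = 0 ∧ v 0 x = 0 := fun x => by
    have := hlin 0 0 (-1) x
    simpa using this
  have hbd : ∀ x, ∃ C, ∀ ξ, ‖u ξ x‖ + ‖v ξ x‖ ≤ C * ‖ξ‖ := by
    intro x
    have hk : IntervalIntegrable (fun t => 1 + ‖W t‖) volume c x :=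
      intervalIntegrable_const.add (hW.integrable.intervalIntegrable' c x)
    refine ⟨2 * (‖P‖ + ‖Q‖) * Real.exp (2 * |∫ t in c..x, (1 + ‖W t‖)|), fun ξ => ?_⟩
    refine ((huv ξ).norm_le hW h0 (mem_univ x) hk (fun t => le_rfl) right_mem_uIcc).trans ?_
    have h1 := P.le_opNorm ξ
    have h2 := Q.le_opNorm ξ
    simp only [Pi.zero_apply, norm_zero, intervalIntegral.integral_zero, abs_zero, add_zero]
    calc 2 * (‖P ξ‖ + ‖Q ξ‖) * Real.exp (2 * |∫ t in c..x, (1 + ‖W t‖)|) ≤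
          2 * (‖P‖ * ‖ξ‖ + ‖Q‖ * ‖ξ‖) * Real.exp (2 * |∫ t in c..x, (1 + ‖W t‖)|) := by gcongr
      _ = _ := by ring
  choose C hC using hbd
  let mk : ∀ (g : H → ℝ → H), (∀ ξ η (s : ℂ) x, g (ξ + s • η) x = g ξ x + s • g η x) →
      (∀ x, g 0 x = 0) → (∀ x ξ, ‖g ξ x‖ ≤ C x * ‖ξ‖) → ℝ → H →L[ℂ] H := fun g hg hg0 hgC x =>
    LinearMap.mkContinuous
      { toFun := fun ξ => g ξ x
        map_add' := fun ξ η => by simpa using hg ξ η 1 x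
        map_smul' := fun s ξ => by simpa [hg0] using hg 0 ξ s x } (C x) (hgC x)
  exact ⟨mk u (fun ξ η s x => (hlin ξ η s x).1) (fun x => (hzero x).1)
      (fun x ξ => (le_add_of_nonneg_right (norm_nonneg _)).trans (hC x ξ)),
    mk v (fun ξ η s x => (hlin ξ η s x).2) (fun x => (hzero x).2)
      (fun x ξ => (le_add_of_nonneg_left (norm_nonneg _)).trans (hC x ξ)), huv⟩

/-- Lagrange's identity for self-adjoint coefficients. -/
theorem IsSolution.integral_lagrange {W : ℝ → H →L[ℂ] H} (hW : IsPotential W)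
    (hsa : ∀ᵐ x, IsSelfAdjoint (W x)) {f f' : ℝ → H} (hf : LocallyIntegrable f volume)
    (hf' : LocallyIntegrable f' volume) {c c' : ℝ} {p q p' q' : H} {S : Set ℝ}
    {u v u' v' : ℝ → H} (h : IsSolution W f c p q S u v) (h' : IsSolution W f' c' p' q' S u' v')
    {x y : ℝ} (hx : x ∈ S) (hy : y ∈ S) :
    IntervalIntegrable (fun t => ⟪u t, f' t⟫_ℂ - ⟪f t, u' t⟫_ℂ) volume x y ∧
    ∫ t in x..y, (⟪u t, f' t⟫_ℂ - ⟪f t, u' t⟫_ℂ) =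
      (⟪u x, v' x⟫_ℂ - ⟪v x, u' x⟫_ℂ) - (⟪u y, v' y⟫_ℂ - ⟪v y, u' y⟫_ℂ) := by
  have hS := h.ordConnected.uIcc_subset hx hy
  have g := h.rebase hW hf hx
  have g' := h'.rebase hW hf' hx
  have hAu : ∀ {f : ℝ → H} {p q} {u v : ℝ → H}, IsSolution W f x p q S u v →
      AbsolutelyContinuousOnInterval u x y := fun {f p q u v} h =>
    ((((h.continuousOn_snd.mono hS).intervalIntegrable (μ := volume)
      ).absolutelyContinuousOnInterval_primitive left_mem_uIcc)).of_dist_le fun s hs t ht => by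
        rw [h.eq_fst s (hS hs), h.eq_fst t (hS ht), dist_add_left]
  have hAv : ∀ {f : ℝ → H} {p q} {u v : ℝ → H}, LocallyIntegrable f volume →
      IsSolution W f x p q S u v →
      AbsolutelyContinuousOnInterval v x y := fun {f p q u v} hf h =>
    ((h.intervalIntegrable hW hf hx hy).absolutelyContinuousOnInterval_primitive
      left_mem_uIcc).of_dist_le fun s hs t ht => by
        rw [h.eq_snd s (hS hs), h.eq_snd t (hS ht), dist_add_left]
  have hint : IntervalIntegrable (fun t => ⟪u t, f' t⟫_ℂ - ⟪f t, u' t⟫_ℂ) volume x y := by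
    refine IntervalIntegrable.sub ?_ ?_
    · obtain ⟨C, hC⟩ := isCompact_uIcc.exists_bound_of_continuousOn (h.continuousOn_fst.mono hS)
      have h1 := (hf'.intervalIntegrable' x y).norm.const_mul C
      rw [intervalIntegrable_iff] at h1 ⊢
      refine h1.mono' (((h.continuousOn_fst.mono (uIoc_subset_uIcc.trans hS)).aestronglyMeasurable
        measurableSet_uIoc).inner hf'.aestronglyMeasurable.restrict) ?_
      filter_upwards [ae_restrict_mem measurableSet_uIoc] with t ht
      refine (norm_inner_le_norm _ _).trans ?_
      gcongr
      exact hC t (uIoc_subset_uIcc ht)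
    · obtain ⟨C, hC⟩ := isCompact_uIcc.exists_bound_of_continuousOn (h'.continuousOn_fst.mono hS)
      have h1 := (hf.intervalIntegrable' x y).norm.mul_const C
      rw [intervalIntegrable_iff] at h1 ⊢
      refine h1.mono' (hf.aestronglyMeasurable.restrict.inner
        ((h'.continuousOn_fst.mono (uIoc_subset_uIcc.trans hS)).aestronglyMeasurable
        measurableSet_uIoc)) ?_
      filter_upwards [ae_restrict_mem measurableSet_uIoc] with t ht
      refine (norm_inner_le_norm _ _).trans ?_
      gcongr
      exact hC t (uIoc_subset_uIcc ht)
  refine ⟨hint, ?_⟩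
  have hAC := ((hAu g).inner (hAv hf' g')).sub ((hAv hf g).inner (hAu g'))
  have hend : ∀ e : ℝ, ∀ᵐ t : ℝ, t ≠ e := fun e => by simp [ae_iff, measure_singleton]
  -- the Wronskian `(u, v') - (v, u')` is absolutely continuous, and the potential drops out of its
  -- derivative by self-adjointness
  have key := hAC.integral_eq_sub (g' := fun t => -(⟪u t, f' t⟫_ℂ - ⟪f t, u' t⟫_ℂ)) (by
    filter_upwards [hsa, hend x, hend y,
      (h.intervalIntegrable hW hf hx hy).ae_hasDerivAt_integral,
      (h'.intervalIntegrable hW hf' hx hy).ae_hasDerivAt_integral] with t ht h1 h2 h3 h4 htm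
    have hnhds : uIcc x y ∈ 𝓝 t := by
      have : t ∈ Ioo (min x y) (max x y) := by
        rcases htm with ⟨l1, l2⟩
        constructor
        · refine lt_of_le_of_ne l1 fun he => ?_
          rcases min_choice x y with h5 | h5 <;> rw [h5] at he
          exacts [h1 he.symm, h2 he.symm]
        · refine lt_of_le_of_ne l2 fun he => ?_
          rcases max_choice x y with h5 | h5 <;> rw [h5] at he
          exacts [h1 he, h2 he]
      exact mem_of_superset (Ioo_mem_nhds this.1 this.2) Ioo_subset_Icc_self
    have hSn : S ∈ 𝓝 t := mem_of_superset hnhds hS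
    have dv : ∀ {f : ℝ → H} {p q} {u v : ℝ → H}, IsSolution W f x p q S u v →
        HasDerivAt (fun s => ∫ r in x..s, (W r (u r) - f r)) (W t (u t) - f t) t →
        HasDerivAt v (W t (u t) - f t) t := fun {f p q u v} h hd => by
      refine (hd.const_add q).congr_of_eventuallyEq ?_
      filter_upwards [hSn] with s hs using h.eq_snd s hs
    have d1 := (g.hasDerivAt hSn).inner ℂ (dv g' (h4 htm x left_mem_uIcc))
    have d2 := (dv g (h3 htm x left_mem_uIcc)).inner ℂ (g'.hasDerivAt hSn)
    refine (d1.sub d2).congr_deriv ?_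
    have e : ⟪W t (u t), u' t⟫_ℂ = ⟪u t, W t (u' t)⟫_ℂ := ht.isSymmetric (u t) (u' t)
    simp only [inner_sub_left, inner_sub_right, e]
    ring) hint.neg
  rw [intervalIntegral.integral_neg] at key
  simp only [Pi.sub_apply] at key
  linear_combination -key

end Existence

/-! ### The Schrödinger equation on the half-line -/

section HalfLine

variable {H : Type u} [NormedAddCommGroup H] [InnerProductSpace ℂ H]

/-- Commuting self-adjoint operators with `C² + S² = 1`, such as `cos α` and `sin α`. -/
structure IsTrigPair [CompleteSpace H] (C S : H →L[ℂ] H) : Prop where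
  cos_symm : ∀ x y, ⟪C x, y⟫_ℂ = ⟪x, C y⟫_ℂ
  sin_symm : ∀ x y, ⟪S x, y⟫_ℂ = ⟪x, S y⟫_ℂ
  comm : ∀ x, C (S x) = S (C x)
  sq : ∀ x, C (C x) + S (S x) = x

theorem isTrigPair_opCos_opSin [CompleteSpace H] {α : H →L[ℂ] H} (hα : IsSelfAdjoint α) :
    IsTrigPair (opCos α) (opSin α) where
  cos_symm := (cfc_predicate Real.cos α : IsSelfAdjoint _).isSymmetric
  sin_symm := (cfc_predicate Real.sin α : IsSelfAdjoint _).isSymmetric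
  comm x := by
    have h : opCos α * opSin α = opSin α * opCos α := cfc_commute_cfc Real.cos Real.sin α
    exact DFunLike.congr_fun h x
  sq x := by
    have h : opCos α * opCos α + opSin α * opSin α = 1 := by
      rw [opCos, opSin, ← cfc_mul Real.cos Real.cos α, ← cfc_mul Real.sin Real.sin α,
        ← cfc_add (a := α) (fun x => Real.cos x * Real.cos x) (fun x => Real.sin x * Real.sin x)]
      have : (fun x => Real.cos x * Real.cos x + Real.sin x * Real.sin x) = fun _ => (1 : ℝ) := by
        funext x
        rw [← sq, ← sq, Real.cos_sq_add_sin_sq]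
      rw [this, cfc_const_one ℝ α]
    exact DFunLike.congr_fun h x

/-- The extension of the potential by zero to the left of `a`. -/
def extPotential (V : ℝ → H →L[ℂ] H) (a : ℝ) : ℝ → H →L[ℂ] H := (Ioi a).indicator V

theorem extPotential_of_mem {V : ℝ → H →L[ℂ] H} {a x : ℝ} (hx : x ∈ Ioi a) :
    extPotential V a x = V x := indicator_of_mem hx V

/-- Local integrability on the closed half-line, which expresses that `a` is a regular endpoint,
makes the extension by zero locally integrable on `ℝ`. -/
theorem isPotential_extPotential [TopologicalSpace.SeparableSpace H] {a : ℝ} {V : ℝ → H →L[ℂ] H}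
    (hV_meas : ∀ f g : H, AEStronglyMeasurable (fun x => ⟪f, V x g⟫_ℂ) (volume.restrict (Ioi a)))
    (hV_int : LocallyIntegrableOn (fun x => ‖V x‖) (Ici a)) :
    IsPotential (extPotential V a) where
  measurable ξ := by
    have h1 : AEStronglyMeasurable (fun x => V x ξ) (volume.restrict (Ioi a)) :=
      aestronglyMeasurable_of_inner fun f => hV_meas f ξ
    have h2 : (fun x => extPotential V a x ξ) = (Ioi a).indicator fun x => V x ξ := by
      funext x
      by_cases hx : x ∈ Ioi a
      · rw [extPotential_of_mem hx, indicator_of_mem hx]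
      · rw [extPotential, indicator_of_notMem hx, indicator_of_notMem hx]
        rfl
    rw [h2]
    exact (aestronglyMeasurable_indicator_iff measurableSet_Ioi).2 h1
  integrable := by
    have h2 : (fun x => ‖extPotential V a x‖) = (Ioi a).indicator fun x => ‖V x‖ := by
      funext x
      by_cases hx : x ∈ Ioi a
      · rw [extPotential_of_mem hx, indicator_of_mem hx]
      · rw [extPotential, indicator_of_notMem hx, indicator_of_notMem hx, norm_zero]
    rw [h2, locallyIntegrable_iff]
    intro k hk
    rw [IntegrableOn, integrable_indicator_iff measurableSet_Ioi, IntegrableOn,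
      Measure.restrict_restrict measurableSet_Ioi]
    refine (hV_int.integrableOn_compact_subset (t := k ∩ Ici a) inter_subset_right
      (hk.inter_right isClosed_Ici)).mono_set ?_
    rintro x ⟨hx1, hx2⟩
    exact ⟨hx2, mem_Ici_of_Ioi hx1⟩

theorem isSelfAdjoint_extPotential [CompleteSpace H] {a : ℝ} {V : ℝ → H →L[ℂ] H}
    (hV_sa : ∀ᵐ x ∂(volume.restrict (Ioi a)), IsSelfAdjoint (V x)) :
    ∀ᵐ x, IsSelfAdjoint (extPotential V a x) := by
  rw [ae_restrict_iff' measurableSet_Ioi] at hV_sa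
  filter_upwards [hV_sa] with x hx
  by_cases h : x ∈ Ioi a
  · rw [extPotential_of_mem h]
    exact hx h
  · rw [extPotential, indicator_of_notMem h]
    exact IsSelfAdjoint.zero _

/-- The operator norm of a strongly measurable family of operators is measurable. -/
theorem aemeasurable_enorm_of_apply [TopologicalSpace.SeparableSpace H] {W : ℝ → H →L[ℂ] H}
    {μ : Measure ℝ} (h : ∀ ξ, AEStronglyMeasurable (fun x => W x ξ) μ) :
    AEMeasurable (fun x => ‖W x‖ₑ) μ := by
  let d := TopologicalSpace.denseSeq H
  have e : ∀ T : H →L[ℂ] H, ‖T‖ₑ = ⨆ n, ‖T (d n)‖ₑ / ‖d n‖ₑ := by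
    intro T
    refine le_antisymm ?_ (iSup_le fun n => ENNReal.div_le_of_le_mul (T.le_opENorm _))
    by_cases hc : (⨆ n, ‖T (d n)‖ₑ / ‖d n‖ₑ) = ∞
    · rw [hc]
      exact le_top
    obtain ⟨c, hc⟩ : ∃ c : NNReal, (⨆ n, ‖T (d n)‖ₑ / ‖d n‖ₑ) = c :=
      ⟨_, (ENNReal.coe_toNNReal hc).symm⟩
    rw [hc]
    have h1 : ∀ n, ‖T (d n)‖ ≤ c * ‖d n‖ := by
      intro n
      rcases eq_or_ne (d n) 0 with h0 | h0
      · simp [h0]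
      have h2 : ‖T (d n)‖ₑ / ‖d n‖ₑ ≤ c := by
        rw [← hc]
        exact le_iSup (fun n => ‖T (d n)‖ₑ / ‖d n‖ₑ) n
      rw [ENNReal.div_le_iff (by simpa using h0) (by simp)] at h2
      have h3 : ‖T (d n)‖₊ ≤ c * ‖d n‖₊ := by
        rw [enorm_eq_nnnorm, enorm_eq_nnnorm] at h2
        exact_mod_cast h2
      exact_mod_cast h3
    have h2 : ‖T‖₊ ≤ c := by
      refine T.opNorm_le_bound c.2 fun x => ?_
      have hcl : IsClosed {x : H | ‖T x‖ ≤ c * ‖x‖} :=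
        isClosed_le T.continuous.norm (continuous_const.mul continuous_norm)
      exact hcl.closure_subset_iff.2 (range_subset_iff.2 h1)
        (TopologicalSpace.denseRange_denseSeq H x)
    rw [enorm_eq_nnnorm]
    exact_mod_cast h2
  simp only [e]
  exact AEMeasurable.iSup fun n => (h (d n)).enorm.div_const _

/-- The spectral parameter can be absorbed into the potential. Weak measurability of `W` does not
provide measurability of `W - z` in the operator norm; that of `‖W - z‖` uses separability. -/
theorem IsPotential.sub_const [TopologicalSpace.SeparableSpace H] {W : ℝ → H →L[ℂ] H}
    (hW : IsPotential W) (z : ℂ) : IsPotential fun x => W x - z • (1 : H →L[ℂ] H) := by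
  have hm : ∀ ξ, AEStronglyMeasurable (fun x => (W x - z • (1 : H →L[ℂ] H)) ξ) volume :=
    fun ξ => (hW.measurable ξ).sub aestronglyMeasurable_const
  have h1 : LocallyIntegrable (fun x => ‖W x‖ + ‖z • (1 : H →L[ℂ] H)‖) volume :=
    hW.integrable.add (locallyIntegrable_const _)
  refine ⟨hm, h1.mono ?_ (Eventually.of_forall fun x => ?_)⟩
  · exact (aemeasurable_enorm_of_apply hm).ennreal_toReal.aestronglyMeasurable.congr
      (Eventually.of_forall fun x => toReal_enorm _)
  · rw [norm_norm, Real.norm_of_nonneg (by positivity)]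
    exact norm_sub_le _ _

/-- The spectral parameter can be moved from the potential to the inhomogeneity. -/
theorem isSolution_sub_const_iff {W : ℝ → H →L[ℂ] H} {f : ℝ → H} {c : ℝ} {p q : H} {S : Set ℝ}
    {u v : ℝ → H} (z : ℂ) : IsSolution (fun x => W x - z • (1 : H →L[ℂ] H)) f c p q S u v ↔
      IsSolution W (f + z • u) c p q S u v := by
  have h : ∀ t, (W t - z • (1 : H →L[ℂ] H)) (u t) - f t = W t (u t) - (f + z • u) t := by
    intro t
    simp only [sub_apply, smul_apply, Pi.add_apply, Pi.smul_apply, one_apply_eq_self]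
    abel
  constructor
  · rintro ⟨h1, h2, h3, h4, h5, h6⟩
    simp only [h] at h6
    exact ⟨h1, h2, h3, h4, h5, h6⟩
  · rintro ⟨h1, h2, h3, h4, h5, h6⟩
    simp only [← h] at h6
    exact ⟨h1, h2, h3, h4, h5, h6⟩

namespace IsSolution

variable {W : ℝ → H →L[ℂ] H} {f f' : ℝ → H} {c : ℝ} {p q : H} {S : Set ℝ} {u v u' v' : ℝ → H}

theorem congr (h : IsSolution W f c p q S u v) (hu : EqOn u' u S) (hf : ∀ᵐ x, x ∈ S → f' x = f x) :
    IsSolution W f' c p q S u' v where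
  ordConnected := h.ordConnected
  mem := h.mem
  continuousOn_fst := h.continuousOn_fst.congr hu
  continuousOn_snd := h.continuousOn_snd
  eq_fst x hx := by rw [hu hx, h.eq_fst x hx]
  eq_snd x hx := by
    rw [h.eq_snd x hx]
    congr 1
    refine intervalIntegral.integral_congr_ae ?_
    filter_upwards [hf] with t ht htm
    have htS : t ∈ S := h.uIcc_subset hx (uIoc_subset_uIcc htm)
    rw [ht htS, hu htS]

variable {V : ℝ → H →L[ℂ] H} {a : ℝ}

theorem tendsto_fst (h : IsSolution W f a p q (Ici a) u v) : Tendsto u (𝓝[>] a) (𝓝 p) := by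
  have h1 := (h.continuousOn_fst a self_mem_Ici).mono_left (nhdsWithin_mono a Ioi_subset_Ici_self)
  rwa [h.apply_fst] at h1

theorem tendsto_snd (h : IsSolution W f a p q (Ici a) u v) : Tendsto v (𝓝[>] a) (𝓝 q) := by
  have h1 := (h.continuousOn_snd a self_mem_Ici).mono_left (nhdsWithin_mono a Ioi_subset_Ici_self)
  rwa [h.apply_snd] at h1

/-- Solutions on `[a, ∞)` are elements of `W^{2,1}_loc((a, ∞))`. -/
theorem isW21Loc [CompleteSpace H] (hW : IsPotential (extPotential V a))
    (hf : LocallyIntegrable f volume)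
    (h : IsSolution (extPotential V a) f a p q (Ici a) u v) :
    IsW21Loc a u v fun x => V x (u x) - f x where
  hasDerivAt x hx := h.hasDerivAt (Ici_mem_nhds hx)
  locallyIntegrable := by
    rw [locallyIntegrableOn_iff isOpen_Ioi.isLocallyClosed]
    intro k hk hkc
    rcases k.eq_empty_or_nonempty with rfl | hne
    · exact integrableOn_empty
    obtain ⟨b, hb⟩ := hkc.bddAbove
    obtain ⟨x0, hx0⟩ := hne
    have hab : a ≤ b := (le_of_lt (hk hx0)).trans (hb hx0)
    have h1 := h.intervalIntegrable hW hf self_mem_Ici (mem_Ici.2 hab)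
    rw [intervalIntegrable_iff_integrableOn_Ioc_of_le hab] at h1
    refine (h1.mono_set (fun x hx => ⟨hk hx, hb hx⟩ : k ⊆ Ioc a b)).congr_fun (fun x hx => ?_)
      hkc.measurableSet
    simp only [extPotential_of_mem (hk hx)]
  integral_eq x hx y hy := by
    rw [h.snd_sub hW hf (mem_Ici_of_Ioi hx) (mem_Ici_of_Ioi hy)]
    refine intervalIntegral.integral_congr fun t ht => ?_
    simp only [extPotential_of_mem ((ordConnected_Ioi (a := a)).uIcc_subset hx hy ht)]

end IsSolution

theorem tau_sub {V : ℝ → H →L[ℂ] H} (u f : ℝ → H) (x : ℝ) :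
    tau V u (fun x => V x (u x) - f x) x = f x := by
  simp [tau]

/-- Functions in `W^{2,1}_loc((a, ∞))` with boundary values at `a` solve the initial value
problem. -/
theorem IsW21Loc.exists_isSolution [CompleteSpace H] {W : ℝ → H →L[ℂ] H} {a : ℝ}
    (hW : IsPotential W) {u u' u'' f : ℝ → H} {u₀ u₁ : H}
    (hf : LocallyIntegrable f volume) (h : IsW21Loc a u u' u'')
    (hτ : ∀ᵐ x ∂(volume.restrict (Ioi a)), tau W u u'' x = f x)
    (h0 : Tendsto u (𝓝[>] a) (𝓝 u₀)) (h1 : Tendsto u' (𝓝[>] a) (𝓝 u₁)) :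
    ∃ U v, IsSolution W f a u₀ u₁ (Ici a) U v ∧
      (∀ x ∈ Ioi a, U x = u x) ∧ ∀ x ∈ Ioi a, v x = u' x := by
  let U : ℝ → H := fun x => if x ≤ a then u₀ else u x
  let v : ℝ → H := fun x => if x ≤ a then u₁ else u' x
  have hUu : ∀ x ∈ Ioi a, U x = u x := fun x hx => if_neg (not_le.2 hx)
  have hvu : ∀ x ∈ Ioi a, v x = u' x := fun x hx => if_neg (not_le.2 hx)
  have hU0 : U a = u₀ := if_pos le_rfl
  have hv0 : v a = u₁ := if_pos le_rfl
  have hcont : ∀ (g g' : ℝ → H), (∀ x ∈ Ioi a, g' x = g x) → Tendsto g (𝓝[>] a) (𝓝 (g' a)) →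
      ContinuousOn g (Ioi a) → ContinuousOn g' (Ici a) := by
    intro g g' hg ht hc x hx
    rcases (mem_Ici.1 hx).eq_or_lt with rfl | hlt
    · rw [← continuousWithinAt_Ioi_iff_Ici, ContinuousWithinAt]
      exact ht.congr' (eventually_mem_nhdsWithin.mono fun y hy => (hg y hy).symm)
    · refine ContinuousAt.continuousWithinAt ?_
      refine (hc.continuousAt (Ioi_mem_nhds hlt)).congr ?_
      filter_upwards [Ioi_mem_nhds hlt] with y hy using (hg y hy).symm
  have hu'c : ContinuousOn u' (Ioi a) := by
    intro x hx
    refine ContinuousAt.continuousWithinAt ?_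
    obtain ⟨y, hy1, hy2⟩ := exists_between (mem_Ioi.1 hx)
    have hi : IntervalIntegrable u'' volume y (x + 1) :=
      (h.locallyIntegrable.integrableOn_compact_subset (fun t ht => by
        rw [uIcc_of_le (by linarith)] at ht
        exact hy1.trans_le ht.1) isCompact_uIcc).intervalIntegrable
    have hc := intervalIntegral.continuousOn_primitive_interval' hi left_mem_uIcc
    have hn : uIcc y (x + 1) ∈ 𝓝 x := by
      rw [uIcc_of_le (by linarith)]
      exact Icc_mem_nhds hy2 (by linarith)
    have hc2 : ContinuousAt (fun t => u' y + ∫ s in y..t, u'' s) x :=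
      continuousAt_const.add (hc.continuousAt hn)
    refine hc2.congr ?_
    filter_upwards [Ioi_mem_nhds hx] with t ht
    rw [← h.integral_eq y hy1 t ht, add_sub_cancel]
  have hUc : ContinuousOn U (Ici a) := hcont u U hUu (by rwa [hU0])
    fun x hx => (h.hasDerivAt x hx).continuousAt.continuousWithinAt
  have hvc : ContinuousOn v (Ici a) := hcont u' v hvu (by rwa [hv0]) hu'c
  have hsub : ∀ {x}, x ∈ Ici a → uIcc a x ⊆ Ici a := fun hx => by
    rw [uIcc_of_le hx]
    exact Icc_subset_Ici_self
  refine ⟨U, v, ⟨ordConnected_Ici, self_mem_Ici, hUc, hvc, fun x hx => ?_, fun x hx => ?_⟩, hUu,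
    hvu⟩
  · have := intervalIntegral.integral_eq_sub_of_hasDeriv_right_of_le hx
      (hUc.mono (uIcc_of_le (mem_Ici.1 hx) ▸ hsub hx)) (f' := v) (fun y hy => ?_)
      ((hvc.mono (hsub hx)).intervalIntegrable)
    · rw [this, hU0, add_sub_cancel]
    · refine HasDerivAt.hasDerivWithinAt ?_
      have hy' : y ∈ Ioi a := hy.1
      rw [hvu y hy']
      refine (h.hasDerivAt y hy').congr_of_eventuallyEq ?_
      filter_upwards [Ioi_mem_nhds hy'] with t ht using hUu t ht
  · rcases (mem_Ici.1 hx).eq_or_lt with rfl | hlt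
    · rw [intervalIntegral.integral_same, add_zero, hv0]
    have hi : IntervalIntegrable (fun t => W t (U t) - f t) volume a x :=
      (hW.intervalIntegrable (hUc.mono (hsub hx))).sub (hf.intervalIntegrable' a x)
    have hc := intervalIntegral.continuousOn_primitive_interval_left (b := x) (a := a) (μ := volume)
      (f := fun t => W t (U t) - f t) (by
        rwa [uIcc_of_le hlt.le, integrableOn_Icc_iff_integrableOn_Ioc,
          ← intervalIntegrable_iff_integrableOn_Ioc_of_le hlt.le])
    have hc' := hc a left_mem_uIcc
    rw [uIcc_of_le hlt.le, ContinuousWithinAt] at hc'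
    have hle : 𝓝[>] a ≤ 𝓝[Icc a x] a := by
      rw [← nhdsWithin_Ioc_eq_nhdsGT hlt]
      exact nhdsWithin_mono a Ioc_subset_Icc_self
    have hl := hc'.mono_left hle
    -- the integrated equation on `[y, x]` passes to the limit as `y` decreases to `a`
    have hr : Tendsto (fun y => v x - v y) (𝓝[>] a) (𝓝 (v x - u₁)) := by
      have := ((hvc a self_mem_Ici).mono_left (nhdsWithin_mono a Ioi_subset_Ici_self))
      rw [hv0] at this
      exact this.const_sub (v x)
    have he : ∀ᶠ y in 𝓝[>] a, ∫ t in y..x, (W t (U t) - f t) = v x - v y := by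
      filter_upwards [self_mem_nhdsWithin] with y hy
      rw [hvu x hlt, hvu y hy, h.integral_eq y hy x hlt]
      rw [ae_restrict_iff' measurableSet_Ioi] at hτ
      refine intervalIntegral.integral_congr_ae ?_
      filter_upwards [hτ] with t ht htm
      have hta : t ∈ Ioi a :=
        (ordConnected_Ioi (a := a)).uIcc_subset hy hlt (uIoc_subset_uIcc htm)
      rw [← ht hta, hUu t hta, tau]
      abel
    rw [tendsto_nhds_unique (hl.congr' he) hr, add_sub_cancel]

end HalfLine

/-! ### The maximal operator with its boundary values -/

section ExtendByZero

variable {H : Type u} [NormedAddCommGroup H] {a : ℝ}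

/-- The extension by zero of a square integrable function on `(a, ∞)`. -/
def extLp (f : HalfLineL2 H a) : ℝ → H := (Ioi a).indicator f

theorem extLp_ae (f : HalfLineL2 H a) : extLp f =ᵐ[volume.restrict (Ioi a)] f :=
  indicator_ae_eq_restrict measurableSet_Ioi

theorem extLp_of_mem (f : HalfLineL2 H a) {x : ℝ} (hx : x ∈ Ioi a) : extLp f x = f x :=
  indicator_of_mem hx _

theorem extLp_of_notMem (f : HalfLineL2 H a) {x : ℝ} (hx : x ∉ Ioi a) : extLp f x = 0 :=
  indicator_of_notMem hx _

theorem memLp_extLp (f : HalfLineL2 H a) : MemLp (extLp f) 2 volume :=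
  (memLp_indicator_iff_restrict measurableSet_Ioi).2 (Lp.memLp f)

theorem locallyIntegrable_extLp (f : HalfLineL2 H a) : LocallyIntegrable (extLp f) volume :=
  (memLp_extLp f).locallyIntegrable (by norm_num)

theorem extLp_eq_ae_of_restrict {f : HalfLineL2 H a} {g : ℝ → H}
    (h : f =ᵐ[volume.restrict (Ioi a)] g) : ∀ᵐ x, x ∈ Ioi a → extLp f x = g x := by
  have h' : ∀ᵐ x ∂(volume.restrict (Ioi a)), f x = g x := h
  rw [ae_restrict_iff' measurableSet_Ioi] at h'
  filter_upwards [h'] with x hx hxa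
  rw [extLp_of_mem f hxa, hx hxa]

end ExtendByZero

section HalfLine

variable {H : Type u} [NormedAddCommGroup H] [InnerProductSpace ℂ H] {V : ℝ → H →L[ℂ] H} {a : ℝ}

/-- Sufficient condition for an operator-valued function to be the operator solution of
`τ Y = z Y`. -/
theorem isOperatorSolution_of_isSolution [CompleteSpace H] (hW : IsPotential (extPotential V a))
    {z : ℂ} {Y₀ Y₁ : H →L[ℂ] H} {Y Z : ℝ → H →L[ℂ] H}
    (h : ∀ ξ, IsSolution (fun x => extPotential V a x - z • (1 : H →L[ℂ] H)) 0 a (Y₀ ξ) (Y₁ ξ)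
      univ (fun x => Y x ξ) (fun x => Z x ξ)) : IsOperatorSolution V a z Y₀ Y₁ Y := by
  intro ξ
  have h1 := (isSolution_sub_const_iff z).1 (h ξ)
  have hc : Continuous fun x => Y x ξ := continuousOn_univ.1 h1.continuousOn_fst
  have hf : LocallyIntegrable ((0 : ℝ → H) + z • fun x => Y x ξ) volume :=
    Continuous.locallyIntegrable (by
      rw [zero_add]
      exact hc.const_smul z)
  have h2 := h1.mono (subset_univ (Ici a)) self_mem_Ici ordConnected_Ici
  refine ⟨_, _, h2.isW21Loc hW hf, Eventually.of_forall fun x => ?_, h2.apply_fst, h2.tendsto_fst,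
    h2.tendsto_snd⟩
  rw [tau_sub (V := V) (fun x => Y x ξ) ((0 : ℝ → H) + z • fun x => Y x ξ) x]
  simp

theorem isOperatorSolution_operatorSolution [CompleteSpace H] [TopologicalSpace.SeparableSpace H]
    (hW : IsPotential (extPotential V a)) (z : ℂ) (Y₀ Y₁ : H →L[ℂ] H) :
    IsOperatorSolution V a z Y₀ Y₁ (operatorSolution V a z Y₀ Y₁) := by
  obtain ⟨Y, Z, hYZ⟩ := (hW.sub_const z).exists_clm_isSolution a Y₀ Y₁
  have h : ∃ Y, IsOperatorSolution V a z Y₀ Y₁ Y :=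
    ⟨Y, isOperatorSolution_of_isSolution hW hYZ⟩
  rw [operatorSolution, dif_pos h]
  exact h.choose_spec

/-- The columns `Y ξ` of an operator solution solve the initial value problem. -/
theorem IsOperatorSolution.exists_isSolution [CompleteSpace H] [TopologicalSpace.SeparableSpace H]
    (hW : IsPotential (extPotential V a)) {z : ℂ} {Y₀ Y₁ : H →L[ℂ] H} {Y : ℝ → H →L[ℂ] H}
    (h : IsOperatorSolution V a z Y₀ Y₁ Y) (ξ : H) :
    ∃ v, IsSolution (fun x => extPotential V a x - z • (1 : H →L[ℂ] H)) 0 a (Y₀ ξ) (Y₁ ξ)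
      (Ici a) (fun x => Y x ξ) v := by
  obtain ⟨u', u'', h1, h2, h3, h4, h5⟩ := h ξ
  obtain ⟨U, v, h6, h7, -⟩ := h1.exists_isSolution (f := 0) (hW.sub_const z)
    locallyIntegrable_zero (by
      filter_upwards [h2, ae_restrict_mem measurableSet_Ioi] with x hx hxa
      rw [tau] at hx ⊢
      rw [sub_apply, extPotential_of_mem hxa, smul_apply, one_apply_eq_self, ← add_sub_assoc, hx,
        sub_self, Pi.zero_apply]) h4 h5
  refine ⟨v, h6.congr (fun x hx => ?_) (Eventually.of_forall fun x _ => rfl)⟩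
  rcases (mem_Ici.1 hx).eq_or_lt with rfl | hlt
  · rw [h6.apply_fst, h3]
  · exact (h7 x hlt).symm

theorem extLp_add_smul (f g : HalfLineL2 H a) (s : ℂ) :
    ∀ᵐ x, extLp (f + s • g) x = (extLp f + s • extLp g) x := by
  have h : (f + s • g : HalfLineL2 H a) =ᵐ[volume.restrict (Ioi a)] ⇑f + s • ⇑g :=
    (Lp.coeFn_add f (s • g)).trans (EventuallyEq.rfl.add (Lp.coeFn_smul s g))
  filter_upwards [extLp_eq_ae_of_restrict h] with x hx
  by_cases hxa : x ∈ Ioi a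
  · rw [hx hxa, Pi.add_apply, Pi.add_apply, Pi.smul_apply, Pi.smul_apply, extLp_of_mem f hxa,
      extLp_of_mem g hxa]
  · rw [Pi.add_apply, Pi.smul_apply, extLp_of_notMem _ hxa, extLp_of_notMem _ hxa,
      extLp_of_notMem _ hxa, smul_zero, add_zero]

/-- The graph of the maximal operator together with rotated boundary values: `(f, g, p, q)` with
`g = τ f`, `f(a) = C p - S q` and `f'(a) = S p + C q`, so that `p = C f(a) + S f'(a)` and
`q = C f'(a) - S f(a)`. -/
def boundaryGraph (hW : IsPotential (extPotential V a)) (C S : H →L[ℂ] H) :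
    Submodule ℂ (HalfLineL2 H a × HalfLineL2 H a × H × H) :=
  have key : ∀ (x y : HalfLineL2 H a × HalfLineL2 H a × H × H) (s : ℂ),
      (∃ u v, IsSolution (extPotential V a) (extLp x.2.1) a (C x.2.2.1 - S x.2.2.2)
        (S x.2.2.1 + C x.2.2.2) (Ici a) u v ∧ x.1 =ᵐ[volume.restrict (Ioi a)] u) →
      (∃ u v, IsSolution (extPotential V a) (extLp y.2.1) a (C y.2.2.1 - S y.2.2.2)
        (S y.2.2.1 + C y.2.2.2) (Ici a) u v ∧ y.1 =ᵐ[volume.restrict (Ioi a)] u) →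
      ∃ u v, IsSolution (extPotential V a) (extLp (x + s • y).2.1) a
        (C (x + s • y).2.2.1 - S (x + s • y).2.2.2) (S (x + s • y).2.2.1 + C (x + s • y).2.2.2)
        (Ici a) u v ∧ (x + s • y).1 =ᵐ[volume.restrict (Ioi a)] u := by
    rintro x y s ⟨u, v, h, hu⟩ ⟨u', v', h', hu'⟩
    have h1 := h.add_smul h' hW (locallyIntegrable_extLp _) (locallyIntegrable_extLp _) s
    refine ⟨u + s • u', v + s • v', ?_, ?_⟩
    · have e1 : C (x + s • y).2.2.1 - S (x + s • y).2.2.2 =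
          C x.2.2.1 - S x.2.2.2 + s • (C y.2.2.1 - S y.2.2.2) := by
        simp only [Prod.snd_add, Prod.fst_add, Prod.smul_snd, Prod.smul_fst, map_add, map_smul,
          smul_sub]
        abel
      have e2 : S (x + s • y).2.2.1 + C (x + s • y).2.2.2 =
          S x.2.2.1 + C x.2.2.2 + s • (S y.2.2.1 + C y.2.2.2) := by
        simp only [Prod.snd_add, Prod.fst_add, Prod.smul_snd, Prod.smul_fst, map_add, map_smul,
          smul_add]
        abel
      rw [e1, e2]
      refine h1.congr (fun _ _ => rfl) ?_
      filter_upwards [extLp_add_smul x.2.1 y.2.1 s] with t ht _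
      exact ht
    · exact (Lp.coeFn_add x.1 (s • y.1)).trans
        (hu.add ((Lp.coeFn_smul s y.1).trans (hu'.const_smul s)))
  have key0 : ∃ u v, IsSolution (extPotential V a)
      (extLp (0 : HalfLineL2 H a × HalfLineL2 H a × H × H).2.1) a
      (C (0 : HalfLineL2 H a × HalfLineL2 H a × H × H).2.2.1 -
        S (0 : HalfLineL2 H a × HalfLineL2 H a × H × H).2.2.2)
      (S (0 : HalfLineL2 H a × HalfLineL2 H a × H × H).2.2.1 +
        C (0 : HalfLineL2 H a × HalfLineL2 H a × H × H).2.2.2)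
      (Ici a) u v ∧ (0 : HalfLineL2 H a × HalfLineL2 H a × H × H).1
        =ᵐ[volume.restrict (Ioi a)] u := by
    refine ⟨0, 0, ?_, Lp.coeFn_zero _ _ _⟩
    have h0 : IsSolution (extPotential V a) (0 : ℝ → H) a 0 0 (Ici a) 0 0 :=
      ⟨ordConnected_Ici, self_mem_Ici, continuousOn_const, continuousOn_const, by simp, by simp⟩
    have e : C (0 : H) - S (0 : H) = 0 := by simp
    have e' : S (0 : H) + C (0 : H) = 0 := by simp
    simp only [Prod.snd_zero, Prod.fst_zero]
    rw [e, e']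
    refine h0.congr (fun _ _ => rfl) ?_
    filter_upwards [extLp_eq_ae_of_restrict (Lp.coeFn_zero H 2 (volume.restrict (Ioi a)))] with
      t ht hta
    by_cases hx : t ∈ Ioi a
    · exact ht hx
    · exact extLp_of_notMem _ hx
  { carrier := {x | ∃ u v, IsSolution (extPotential V a) (extLp x.2.1) a (C x.2.2.1 - S x.2.2.2)
      (S x.2.2.1 + C x.2.2.2) (Ici a) u v ∧ x.1 =ᵐ[volume.restrict (Ioi a)] u}
    add_mem' := fun {x y} hx hy => by
      have h := key x y 1 hx hy
      rwa [one_smul] at h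
    zero_mem' := key0
    smul_mem' := fun s y hy => by
      have h := key 0 y s key0 hy
      rwa [zero_add] at h }

theorem mem_boundaryGraph {hW : IsPotential (extPotential V a)} {C S : H →L[ℂ] H}
    {f g : HalfLineL2 H a} {p q : H} : (f, g, p, q) ∈ boundaryGraph hW C S ↔
      ∃ u v, IsSolution (extPotential V a) (extLp g) a (C p - S q) (S p + C q) (Ici a) u v ∧
        f =ᵐ[volume.restrict (Ioi a)] u := Iff.rfl

end HalfLine

/-! ### Cutoff functions and truncation -/

section Cutoff

variable {H : Type u} [NormedAddCommGroup H] [InnerProductSpace ℂ H]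

theorem AbsolutelyContinuousOnInterval.of_hasDerivAt {F : Type*} [NormedAddCommGroup F]
    [NormedSpace ℝ F] [CompleteSpace F] {g g' : ℝ → F} (h : ∀ x, HasDerivAt g (g' x) x)
    (hc : Continuous g') (a b : ℝ) : AbsolutelyContinuousOnInterval g a b := by
  refine ((hc.intervalIntegrable a b).absolutelyContinuousOnInterval_primitive
    left_mem_uIcc).of_dist_le fun x _ y _ => ?_
  rw [intervalIntegral.integral_eq_sub_of_hasDerivAt (fun t _ => h t) (hc.intervalIntegrable a x),
    intervalIntegral.integral_eq_sub_of_hasDerivAt (fun t _ => h t) (hc.intervalIntegrable a y),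
    dist_sub_right]

/-- The product of a solution with a twice continuously differentiable function. -/
theorem IsSolution.smul [CompleteSpace H] {W : ℝ → H →L[ℂ] H} (hW : IsPotential W) {f : ℝ → H}
    (hf : LocallyIntegrable f volume) {c : ℝ} {p q : H} {u v : ℝ → H}
    (h : IsSolution W f c p q univ u v) {χ χ' χ'' : ℝ → ℝ} (h1 : ∀ x, HasDerivAt χ (χ' x) x)
    (h2 : ∀ x, HasDerivAt χ' (χ'' x) x) (h3 : Continuous χ'') (hχ : χ c = 1) (hχ' : χ' c = 0) :
    IsSolution W (fun x => χ x • f x - (χ'' x • u x + (2 * χ' x) • v x)) c p q univ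
      (fun x => χ x • u x) (fun x => χ' x • u x + χ x • v x) := by
  have c1 : Continuous χ' := continuous_iff_continuousAt.2 fun x => (h2 x).continuousAt
  have c0 : Continuous χ := continuous_iff_continuousAt.2 fun x => (h1 x).continuousAt
  have cu : Continuous u := continuousOn_univ.1 h.continuousOn_fst
  have cv : Continuous v := continuousOn_univ.1 h.continuousOn_snd
  have du : ∀ x, HasDerivAt u (v x) x := fun x => h.hasDerivAt univ_mem
  refine ⟨ordConnected_univ, mem_univ c, (c0.smul cu).continuousOn,
    ((c1.smul cu).add (c0.smul cv)).continuousOn, fun x _ => ?_, fun x _ => ?_⟩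
  · have e := intervalIntegral.integral_eq_sub_of_hasDerivAt (a := c) (b := x)
      (f := fun x => χ x • u x) (f' := fun x => χ' x • u x + χ x • v x)
      (fun t _ => ((h1 t).smul (du t)).congr_deriv (add_comm _ _))
      (((c1.smul cu).add (c0.smul cv)).intervalIntegrable c x)
    rw [e, hχ, one_smul, h.apply_fst, add_sub_cancel]
  · have hi : ∀ y, IntervalIntegrable (fun t => W t (u t) - f t) volume c y := fun y =>
      h.intervalIntegrable hW hf (mem_univ _) (mem_univ _)
    have av : AbsolutelyContinuousOnInterval v c x :=
      ((hi x).absolutelyContinuousOnInterval_primitive left_mem_uIcc).of_dist_le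
        fun s _ t _ => by
          rw [h.eq_snd s (mem_univ _), h.eq_snd t (mem_univ _), dist_add_left]
    have au := AbsolutelyContinuousOnInterval.of_hasDerivAt du cv c x
    have aχ := AbsolutelyContinuousOnInterval.of_hasDerivAt h1 c1 c x
    have aχ' := AbsolutelyContinuousOnInterval.of_hasDerivAt h2 h3 c x
    have hW' : ∀ t, W t (χ t • u t) - (χ t • f t - (χ'' t • u t + (2 * χ' t) • v t)) =
        χ t • (W t (u t) - f t) + (χ'' t • u t + (2 * χ' t) • v t) := by
      intro t
      rw [(W t).map_smul_of_tower, smul_sub]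
      abel
    simp only [hW']
    have e := ((aχ'.smul au).add (aχ.smul av)).integral_eq_sub
      (g' := fun t => χ t • (W t (u t) - f t) + (χ'' t • u t + (2 * χ' t) • v t)) ?_ ?_
    · rw [e]
      simp only [Pi.add_apply, Pi.smul_apply']
      rw [hχ, hχ', h.apply_fst, h.apply_snd]
      simp
    · filter_upwards [(hi x).ae_hasDerivAt_integral] with t ht htm
      have dv : HasDerivAt v (W t (u t) - f t) t := by
        refine ((ht htm c left_mem_uIcc).const_add q).congr_of_eventuallyEq ?_
        exact Eventually.of_forall fun s => h.eq_snd s (mem_univ _)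
      refine (((h2 t).smul (du t)).add ((h1 t).smul dv)).congr_deriv ?_
      rw [two_mul, _root_.add_smul]
      abel
    · exact ((hi x).continuousOn_smul c0.continuousOn).add
        (((h3.smul cu).add ((continuous_const.mul c1).smul cv)).intervalIntegrable c x)

/-- A function that has the value `1` and slope `0` at `a`, and vanishes to second order at `a +
1`: `(1 - s)² (1 + 2 s)` with `s = x - a`. -/
theorem exists_cutoff (a : ℝ) : ∃ χ χ' χ'' : ℝ → ℝ, (∀ x, HasDerivAt χ (χ' x) x) ∧
    (∀ x, HasDerivAt χ' (χ'' x) x) ∧ Continuous χ'' ∧ χ a = 1 ∧ χ' a = 0 ∧ χ (a + 1) = 0 ∧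
    χ' (a + 1) = 0 := by
  refine ⟨fun x => 1 - 3 * (x - a) ^ 2 + 2 * (x - a) ^ 3, fun x => -6 * (x - a) + 6 * (x - a) ^ 2,
    fun x => -6 + 12 * (x - a), fun x => ?_, fun x => ?_, by fun_prop, by simp, by simp, by
      norm_num, by simp⟩
  · have hd : HasDerivAt (fun x : ℝ => x - a) 1 x := (hasDerivAt_id x).sub_const a
    refine ((((hd.pow 2).const_mul 3).const_sub 1).add ((hd.pow 3).const_mul 2)).congr_deriv ?_
    simp
    ring
  · have hd : HasDerivAt (fun x : ℝ => x - a) 1 x := (hasDerivAt_id x).sub_const a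
    refine ((hd.const_mul (-6)).add ((hd.pow 2).const_mul 6)).congr_deriv ?_
    simp
    ring

/-- A solution that vanishes together with its derivative at `b` vanishes to the right of `b` if
the inhomogeneity does. -/
theorem IsSolution.eq_zero_of_apply {W : ℝ → H →L[ℂ] H} (hW : IsPotential W) {f : ℝ → H}
    (hf : LocallyIntegrable f volume) {c : ℝ} {p q : H} {u v : ℝ → H}
    (h : IsSolution W f c p q (Ici c) u v) {b : ℝ} (hb : c ≤ b) (hu : u b = 0) (hv : v b = 0)
    (hf0 : ∀ᵐ x, b < x → f x = 0) : ∀ x ∈ Ici b, u x = 0 := by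
  intro x hx
  have h1 := (h.rebase hW hf (mem_Ici.2 hb)).mono (Ici_subset_Ici.2 hb) self_mem_Ici
    ordConnected_Ici
  rw [hu, hv] at h1
  have h0 : IsSolution W (0 : ℝ → H) b 0 0 (Ici b) 0 0 :=
    ⟨ordConnected_Ici, self_mem_Ici, continuousOn_const, continuousOn_const, by simp, by simp⟩
  have h2 : IsSolution W f b 0 0 (Ici b) 0 0 := by
    refine h0.congr (fun _ _ => rfl) ?_
    filter_upwards [hf0, (by simp [ae_iff, measure_singleton] : ∀ᵐ t : ℝ, t ≠ b)] with t h1 h2 h3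
    exact h1 (lt_of_le_of_ne h3 h2.symm)
  exact (h1.unique h2 hW hf hx).1

end Cutoff

section Truncation

variable {H : Type u} [NormedAddCommGroup H] {a : ℝ}

theorem memLp_indicator_Ioc_of_continuousOn {u : ℝ → H} {b : ℝ} (hu : ContinuousOn u (Icc a b)) :
    MemLp ((Ioc a b).indicator u) 2 (volume.restrict (Ioi a)) := by
  obtain ⟨C, hC⟩ := isCompact_Icc.exists_bound_of_continuousOn hu
  have h1 : AEStronglyMeasurable u (volume.restrict (Ioc a b)) :=
    (hu.mono Ioc_subset_Icc_self).aestronglyMeasurable measurableSet_Ioc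
  have h2 : MemLp u 2 (volume.restrict (Ioc a b)) := by
    refine MemLp.of_bound h1 C ?_
    filter_upwards [ae_restrict_mem measurableSet_Ioc] with x hx
    exact hC x (Ioc_subset_Icc_self hx)
  exact ((memLp_indicator_iff_restrict measurableSet_Ioc).2 h2).restrict _

/-- The restriction `χ_{(a, b]} f`. -/
def truncLp (b : ℝ) (f : HalfLineL2 H a) : HalfLineL2 H a :=
  (((Lp.memLp f).indicator (measurableSet_Ioc (a := a) (b := b)))).toLp _

theorem truncLp_ae (b : ℝ) (f : HalfLineL2 H a) :
    truncLp b f =ᵐ[volume.restrict (Ioi a)] (Ioc a b).indicator f := MemLp.coeFn_toLp _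

theorem extLp_truncLp_eq_zero (b : ℝ) (f : HalfLineL2 H a) :
    ∀ᵐ x, b < x → extLp (truncLp b f) x = 0 := by
  filter_upwards [extLp_eq_ae_of_restrict (truncLp_ae b f)] with x hx hbx
  by_cases hxa : x ∈ Ioi a
  · rw [hx hxa, indicator_of_notMem fun h => not_lt.2 h.2 hbx]
  · exact extLp_of_notMem _ hxa

theorem tendsto_truncLp (f : HalfLineL2 H a) : Tendsto (fun b => truncLp b f) atTop (𝓝 f) := by
  rw [Lp.tendsto_Lp_iff_tendsto_eLpNorm']
  have h0 : ∀ b, eLpNorm (⇑(truncLp b f) - ⇑f) 2 (volume.restrict (Ioi a)) =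
      (∫⁻ x in Ioi a, ‖(Ioc a b).indicator f x - f x‖ₑ ^ (2 : ℝ)) ^ (1 / (2 : ℝ)) := by
    intro b
    rw [eLpNorm_congr_ae ((truncLp_ae b f).sub (EventuallyEq.refl _ _)),
      eLpNorm_eq_lintegral_rpow_enorm_toReal (by norm_num) (by norm_num)]
    simp
  have hL := (eLpNorm_lt_top_iff_lintegral_rpow_enorm_lt_top (by norm_num) (by norm_num)).1
    (Lp.memLp f).2
  have h1 : Tendsto (fun b => ∫⁻ x in Ioi a, ‖(Ioc a b).indicator f x - f x‖ₑ ^ (2 : ℝ)) atTop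
      (𝓝 (∫⁻ _ in Ioi a, 0)) := by
    refine tendsto_lintegral_filter_of_dominated_convergence (fun x => ‖f x‖ₑ ^ (2 : ℝ))
      (Eventually.of_forall fun b => ?_) (Eventually.of_forall fun b => ?_) ?_ ?_
    · have hm := Lp.stronglyMeasurable f
      exact ((hm.indicator measurableSet_Ioc).sub hm).enorm.pow_const _
    · refine Eventually.of_forall fun x => ?_
      by_cases hx : x ∈ Ioc a b
      · rw [indicator_of_mem hx, sub_self, enorm_zero, ENNReal.zero_rpow_of_pos (by norm_num)]
        exact zero_le
      · rw [indicator_of_notMem hx, zero_sub, enorm_neg]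
    · simpa using hL.ne
    · filter_upwards [ae_restrict_mem measurableSet_Ioi] with x hx
      refine tendsto_const_nhds.congr' ?_
      filter_upwards [eventually_ge_atTop x] with b hb
      rw [indicator_of_mem (show x ∈ Ioc a b from ⟨hx, hb⟩), sub_self, enorm_zero, ENNReal.zero_rpow_of_pos (by norm_num)]
  simp only [lintegral_zero] at h1
  have h2 := ((ENNReal.continuous_rpow_const (y := 1 / (2 : ℝ))).tendsto 0).comp h1
  rw [ENNReal.zero_rpow_of_pos (by norm_num)] at h2
  refine h2.congr fun b => ?_
  rw [h0]
  rfl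

end Truncation

/-! ### The boundary triple of the half-line operator -/

section BoundaryTriple

variable {H : Type u} [NormedAddCommGroup H] [InnerProductSpace ℂ H] {V : ℝ → H →L[ℂ] H} {a : ℝ}

theorem integrableOn_inner_extLp (f g : HalfLineL2 H a) :
    IntegrableOn (fun x => ⟪extLp f x, extLp g x⟫_ℂ) (Ioi a) := by
  refine (L2.integrable_inner (𝕜 := ℂ) f g).congr ?_
  filter_upwards [extLp_ae f, extLp_ae g] with x hf hg
  rw [hf, hg]

theorem inner_eq_integral_extLp (f g : HalfLineL2 H a) :
    ⟪f, g⟫_ℂ = ∫ x in Ioi a, ⟪extLp f x, extLp g x⟫_ℂ := by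
  rw [L2.inner_def]
  refine integral_congr_ae ?_
  filter_upwards [extLp_ae f, extLp_ae g] with x hf hg
  rw [hf, hg]

/-- If `g` vanishes to the right of `b`, then `(f, g)` is an integral over `[a, b]`. -/
theorem inner_eq_intervalIntegral (f g : HalfLineL2 H a) {b : ℝ} (hab : a ≤ b)
    (hg : ∀ᵐ x, b < x → extLp g x = 0) :
    ⟪f, g⟫_ℂ = ∫ x in a..b, ⟪extLp f x, extLp g x⟫_ℂ := by
  rw [inner_eq_integral_extLp, intervalIntegral.integral_of_le hab]
  refine setIntegral_eq_of_subset_of_ae_sdiff_eq_zero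
    (measurableSet_Ioi (a := a)).nullMeasurableSet Ioc_subset_Ioi_self ?_
  filter_upwards [hg] with x hx hxm
  have hbx : b < x := not_le.1 fun h => hxm.2 (show x ∈ Ioc a b from ⟨hxm.1, h⟩)
  rw [hx hbx, inner_zero_right]

/-- A solution that coincides with a square integrable function lies in the maximal domain. -/
theorem IsSolution.isInMaxDomain [CompleteSpace H] (hW : IsPotential (extPotential V a))
    {f g : HalfLineL2 H a} {p q : H} {u v : ℝ → H}
    (h : IsSolution (extPotential V a) (extLp g) a p q (Ici a) u v)
    (hu : f =ᵐ[volume.restrict (Ioi a)] u) :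
    IsInMaxDomain V a u v fun x => V x (u x) - extLp g x := by
  refine ⟨h.isW21Loc hW (locallyIntegrable_extLp g), (Lp.memLp f).ae_eq hu, ?_⟩
  refine (Lp.memLp g).ae_eq ?_
  filter_upwards [extLp_ae g] with x hx
  rw [tau_sub, hx]

namespace IsTrigPair

variable [CompleteSpace H] {C S : H →L[ℂ] H}

theorem cos_sub_sin (hT : IsTrigPair C S) (p q : H) :
    C (C p + S q) - S (C q - S p) = p := by
  rw [map_add, map_sub, hT.comm, sub_sub_eq_add_sub, add_right_comm, hT.sq, add_sub_cancel_right]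

theorem sin_add_cos (hT : IsTrigPair C S) (p q : H) :
    S (C p + S q) + C (C q - S p) = q := by
  rw [map_add, map_sub, hT.comm]
  conv_rhs => rw [← hT.sq q]
  abel

/-- The rotation of the boundary values by `cos α`, `sin α` preserves the boundary form. -/
theorem wronskian (hT : IsTrigPair C S) (p q p' q' : H) :
    ⟪C p - S q, S p' + C q'⟫_ℂ - ⟪S p + C q, C p' - S q'⟫_ℂ = ⟪p, q'⟫_ℂ - ⟪q, p'⟫_ℂ := by
  have e1 : ⟪p, q'⟫_ℂ = ⟪p, C (C q')⟫_ℂ + ⟪p, S (S q')⟫_ℂ := by rw [← inner_add_right, hT.sq]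
  have e2 : ⟪q, p'⟫_ℂ = ⟪q, C (C p')⟫_ℂ + ⟪q, S (S p')⟫_ℂ := by rw [← inner_add_right, hT.sq]
  rw [e1, e2]
  simp only [inner_sub_left, inner_add_left, inner_sub_right, inner_add_right, hT.cos_symm,
    hT.sin_symm, hT.comm]
  ring

end IsTrigPair

variable [CompleteSpace H] {C S : H →L[ℂ] H}

/-- Green's formula: at `∞` the boundary term vanishes because of the limit point property. -/
theorem boundaryGraph_green (hW : IsPotential (extPotential V a))
    (hsa : ∀ᵐ x, IsSelfAdjoint (extPotential V a x)) (hlp : IsLimitPointAtTop V a)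
    (hT : IsTrigPair C S) {f g f' g' : HalfLineL2 H a} {p q p' q' : H}
    (h : (f, g, p, q) ∈ boundaryGraph hW C S) (h' : (f', g', p', q') ∈ boundaryGraph hW C S) :
    ⟪f, g'⟫_ℂ - ⟪g, f'⟫_ℂ = ⟪p, q'⟫_ℂ - ⟪q, p'⟫_ℂ := by
  obtain ⟨u, v, hs, hu⟩ := mem_boundaryGraph.1 h
  obtain ⟨u', v', hs', hu'⟩ := mem_boundaryGraph.1 h'
  have e1 : ∀ b ∈ Ici a, ∫ x in a..b, (⟪extLp f x, extLp g' x⟫_ℂ - ⟪extLp g x, extLp f' x⟫_ℂ) =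
      (⟪p, q'⟫_ℂ - ⟪q, p'⟫_ℂ) - (⟪u b, v' b⟫_ℂ - ⟪v b, u' b⟫_ℂ) := by
    intro b hb
    rw [← hT.wronskian, ← hs.apply_fst, ← hs.apply_snd, ← hs'.apply_fst, ← hs'.apply_snd,
      ← (hs.integral_lagrange hW hsa (locallyIntegrable_extLp g) (locallyIntegrable_extLp g') hs'
        self_mem_Ici hb).2]
    refine intervalIntegral.integral_congr_ae ?_
    filter_upwards [extLp_eq_ae_of_restrict hu, extLp_eq_ae_of_restrict hu'] with x hx hx' hxm
    rw [uIoc_of_le hb] at hxm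
    rw [hx hxm.1, hx' hxm.1]
  have l1 := intervalIntegral_tendsto_integral_Ioi a
    ((integrableOn_inner_extLp f g').sub (integrableOn_inner_extLp g f')) tendsto_id
  simp only [Pi.sub_apply] at l1
  rw [integral_sub (integrableOn_inner_extLp f g') (integrableOn_inner_extLp g f'),
    ← inner_eq_integral_extLp, ← inner_eq_integral_extLp] at l1
  have l2 := (hlp _ _ _ _ _ _ (hs.isInMaxDomain hW hu) (hs'.isInMaxDomain hW hu')).const_sub
    (⟪p, q'⟫_ℂ - ⟪q, p'⟫_ℂ)
  rw [sub_zero] at l2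
  refine tendsto_nhds_unique l1 (l2.congr' ?_)
  filter_upwards [eventually_ge_atTop a] with b hb
  exact (e1 b hb).symm

/-- A function `u = 0` has vanishing boundary values and `τ u = 0`. -/
theorem boundaryGraph_single (hW : IsPotential (extPotential V a)) (hT : IsTrigPair C S)
    {g : HalfLineL2 H a} {p q : H} (h : (0, g, p, q) ∈ boundaryGraph hW C S) :
    g = 0 ∧ p = 0 ∧ q = 0 := by
  obtain ⟨u, v, hs, hu⟩ := mem_boundaryGraph.1 h
  have hu0 : EqOn u 0 (Ioi a) := by
    refine Measure.eqOn_open_of_ae_eq (μ := volume) (hu.symm.trans (Lp.coeFn_zero _ _ _)) isOpen_Ioi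
      (hs.continuousOn_fst.mono Ioi_subset_Ici_self) continuousOn_const
  have hv0 : EqOn v 0 (Ioi a) := by
    intro x hx
    refine (hs.hasDerivAt (Ici_mem_nhds hx)).unique ?_
    refine (hasDerivAt_const x (0 : H)).congr_of_eventuallyEq ?_
    filter_upwards [Ioi_mem_nhds hx] with y hy using hu0 hy
  have hp := tendsto_nhds_unique hs.tendsto_fst (tendsto_const_nhds.congr'
    (eventually_mem_nhdsWithin.mono fun y hy => (hu0 hy).symm))
  have hq := tendsto_nhds_unique hs.tendsto_snd (tendsto_const_nhds.congr'
    (eventually_mem_nhdsWithin.mono fun y hy => (hv0 hy).symm))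
  have hp0 : p = 0 := by
    have := hT.cos_sub_sin p (-q)
    have e : C p + S (-q) = 0 := by
      rw [map_neg, ← sub_eq_add_neg]
      exact hp
    have e' : C (-q) - S p = 0 := by
      rw [map_neg, ← neg_add', add_comm, neg_eq_zero]
      exact hq
    rw [e, e', map_zero, map_zero, sub_zero] at this
    exact this.symm
  have hq0 : q = 0 := by
    have := hT.sq q
    rw [hp0, map_zero, zero_sub] at hp
    rw [hp0, map_zero, zero_add] at hq
    have e : S q = 0 := neg_eq_zero.1 hp
    have e' : C q = 0 := hq
    rw [e, e', map_zero, map_zero, add_zero] at this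
    exact this.symm
  refine ⟨?_, hp0, hq0⟩
  have hloc := locallyIntegrable_extLp g
  have hF : ∀ x ∈ Ioi a, ∫ t in a..x, extLp g t = 0 := by
    intro x hx
    have h1 := hs.eq_snd x (mem_Ici_of_Ioi hx)
    rw [hv0 hx, show S p + C q = 0 from hq, zero_add] at h1
    have h2 : ∫ t in a..x, (extPotential V a t (u t) - extLp g t) =
        ∫ t in a..x, -extLp g t := by
      refine intervalIntegral.integral_congr_ae (Eventually.of_forall fun t ht => ?_)
      rw [uIoc_of_le (le_of_lt hx)] at ht
      rw [hu0 ht.1, Pi.zero_apply, map_zero, zero_sub]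
    rw [h2, intervalIntegral.integral_neg] at h1
    exact neg_eq_zero.1 h1.symm
  rw [Lp.eq_zero_iff_ae_eq_zero]
  refine (extLp_ae g).symm.trans ?_
  filter_upwards [ae_restrict_of_ae (LocallyIntegrable.ae_hasDerivAt_integral hloc),
    ae_restrict_mem measurableSet_Ioi] with x hx hxa
  refine (hx a).unique ((hasDerivAt_const x (0 : H)).congr_of_eventuallyEq ?_)
  filter_upwards [Ioi_mem_nhds hxa] with y hy using hF y hy

end BoundaryTriple

section BoundaryTriple

variable {H : Type u} [NormedAddCommGroup H] [InnerProductSpace ℂ H] [CompleteSpace H]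
  {V : ℝ → H →L[ℂ] H} {a : ℝ} {C S : H →L[ℂ] H}

/-- A strongly continuous operator-valued function on `[a, b]` acts as a bounded operator from `H`
to `L²`, by the closed graph theorem. -/
theorem exists_clm_halfLine {B : ℝ → H →L[ℂ] H} {b : ℝ}
    (hB : ∀ ξ, ContinuousOn (fun x => B x ξ) (Icc a b)) :
    ∃ T : H →L[ℂ] HalfLineL2 H a,
      ∀ ξ, T ξ =ᵐ[volume.restrict (Ioi a)] (Ioc a b).indicator fun x => B x ξ := by
  have hm := fun ξ => memLp_indicator_Ioc_of_continuousOn (hB ξ)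
  let T : H →ₗ[ℂ] HalfLineL2 H a :=
    { toFun := fun ξ => (hm ξ).toLp _
      map_add' := fun ξ η => by
        rw [← MemLp.toLp_add]
        refine MemLp.toLp_congr _ _ (Eventually.of_forall fun x => ?_)
        by_cases hx : x ∈ Ioc a b <;> simp [hx]
      map_smul' := fun c ξ => by
        rw [RingHom.id_apply, ← MemLp.toLp_const_smul]
        refine MemLp.toLp_congr _ _ (Eventually.of_forall fun x => ?_)
        by_cases hx : x ∈ Ioc a b <;> simp [hx] }
  have hT : ∀ ξ, T ξ =ᵐ[volume.restrict (Ioi a)] (Ioc a b).indicator fun x => B x ξ :=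
    fun ξ => MemLp.coeFn_toLp (hm ξ)
  refine ⟨⟨T, T.continuous_of_seq_closed_graph fun s ξ g hs hg => ?_⟩, hT⟩
  obtain ⟨ns, hns, hlim⟩ := (tendstoInMeasure_of_tendsto_Lp hg).exists_seq_tendsto_ae
  refine Lp.ext ?_
  have hall : ∀ᵐ x ∂(volume.restrict (Ioi a)), ∀ n, T (s n) x =
      (Ioc a b).indicator (fun x => B x (s n)) x := ae_all_iff.2 fun n => hT (s n)
  filter_upwards [hlim, hall, hT ξ] with x h1 h2 h3
  rw [h3]
  refine tendsto_nhds_unique h1 ?_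
  simp only [Function.comp_apply, h2]
  by_cases hx : x ∈ Ioc a b
  · simp only [indicator_of_mem hx]
    exact ((B x).continuous.tendsto ξ).comp (hs.comp hns.tendsto_atTop)
  · simp only [indicator_of_notMem hx]
    exact tendsto_const_nhds

/-- Elements of the maximal domain of compact support with prescribed boundary value `p`, which
depend continuously on `p`: cut off the solutions of `τ u = 0`. -/
theorem exists_clm_boundaryGraph (hW : IsPotential (extPotential V a)) :
    ∃ A B : H →L[ℂ] HalfLineL2 H a, ∀ ξ, (A ξ, B ξ, ξ, 0) ∈ boundaryGraph hW C S := by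
  obtain ⟨χ, χ', χ'', h1, h2, h3, hχ, hχ', hb, hb'⟩ := exists_cutoff a
  have c1 : Continuous χ' := continuous_iff_continuousAt.2 fun x => (h2 x).continuousAt
  have c0 : Continuous χ := continuous_iff_continuousAt.2 fun x => (h1 x).continuousAt
  obtain ⟨Y, Z, hYZ⟩ := hW.exists_clm_isSolution a C S
  have cY : ∀ ξ, Continuous fun x => Y x ξ := fun ξ => continuousOn_univ.1 (hYZ ξ).continuousOn_fst
  have cZ : ∀ ξ, Continuous fun x => Z x ξ := fun ξ => continuousOn_univ.1 (hYZ ξ).continuousOn_snd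
  obtain ⟨A, hA⟩ := exists_clm_halfLine (a := a) (b := a + 1) (B := fun x => χ x • Y x)
    fun ξ => (c0.smul (cY ξ)).continuousOn
  obtain ⟨B, hB⟩ := exists_clm_halfLine (a := a) (b := a + 1)
    (B := fun x => -(χ'' x • Y x + (2 * χ' x) • Z x))
    fun ξ => ((h3.smul (cY ξ)).add ((continuous_const.mul c1).smul (cZ ξ))).neg.continuousOn
  refine ⟨A, B, fun ξ => ?_⟩
  have hab : a ≤ a + 1 := by linarith
  obtain ⟨u, v, hu⟩ := hW.exists_isSolution (locallyIntegrable_extLp (B ξ)) a (C ξ - S 0) (S ξ + C 0)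
  have hs := (hYZ ξ).smul hW locallyIntegrable_zero h1 h2 h3 hχ hχ'
  have hae : ∀ᵐ x : ℝ, x ≠ a := by simp [ae_iff, measure_singleton]
  have hs' : IsSolution (extPotential V a) (extLp (B ξ)) a (C ξ - S 0) (S ξ + C 0) (Icc a (a + 1))
      (fun x => χ x • Y x ξ) (fun x => χ' x • Y x ξ + χ x • Z x ξ) := by
    rw [map_zero, map_zero, sub_zero, add_zero]
    refine (hs.mono (subset_univ _) (left_mem_Icc.2 hab) ordConnected_Icc).congr
      (fun _ _ => rfl) ?_
    filter_upwards [extLp_eq_ae_of_restrict (hB ξ), hae] with x hx hxa hxm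
    have hxm' : x ∈ Ioc a (a + 1) := ⟨lt_of_le_of_ne hxm.1 hxa.symm, hxm.2⟩
    rw [hx hxm'.1, indicator_of_mem hxm']
    simp
  have hu' := hu.mono (subset_univ _) (left_mem_Icc.2 hab) ordConnected_Icc
  have huniq := fun x hx => hu'.unique hs' hW (locallyIntegrable_extLp (B ξ)) (x := x) hx
  obtain ⟨e1, e2⟩ := huniq (a + 1) (right_mem_Icc.2 hab)
  rw [hb, zero_smul] at e1
  rw [hb, hb', zero_smul, zero_smul, add_zero] at e2
  have hui := hu.mono (subset_univ (Ici a)) self_mem_Ici ordConnected_Ici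
  have hz := hui.eq_zero_of_apply hW (locallyIntegrable_extLp (B ξ)) hab e1 e2 (by
    filter_upwards [extLp_eq_ae_of_restrict (hB ξ)] with x hx hxb
    rw [hx (lt_of_le_of_lt hab hxb), indicator_of_notMem fun h => not_lt.2 h.2 hxb])
  refine mem_boundaryGraph.2 ⟨u, v, hui, (hA ξ).trans ?_⟩
  filter_upwards [ae_restrict_mem measurableSet_Ioi] with x hx
  by_cases hxb : x ≤ a + 1
  · rw [indicator_of_mem (show x ∈ Ioc a (a + 1) from ⟨hx, hxb⟩), (huniq x ⟨le_of_lt hx, hxb⟩).1]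
    rfl
  · rw [indicator_of_notMem fun h => hxb h.2, hz x (le_of_lt (not_le.1 hxb))]

/-- Every square integrable function that vanishes outside `(a, b]` is in the range of the maximal
operator, restricted to functions that vanish outside `(a, b]`. -/
theorem exists_mem_boundaryGraph_of_eq_zero (hW : IsPotential (extPotential V a))
    (hT : IsTrigPair C S) {b : ℝ} (hab : a ≤ b) (w : HalfLineL2 H a)
    (hw : ∀ᵐ x, b < x → extLp w x = 0) :
    ∃ (f : HalfLineL2 H a) (p q : H) (u v : ℝ → H),
      IsSolution (extPotential V a) (extLp w) a (C p - S q) (S p + C q) (Ici a) u v ∧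
      f =ᵐ[volume.restrict (Ioi a)] u ∧ u b = 0 ∧ v b = 0 ∧ ∀ x, b < x → u x = 0 := by
  have hloc := locallyIntegrable_extLp w
  obtain ⟨u, v, hu⟩ := hW.exists_isSolution hloc b 0 0
  have hua := (hu.rebase hW hloc (mem_univ a)).mono (subset_univ (Ici a)) self_mem_Ici
    ordConnected_Ici
  have hz := hua.eq_zero_of_apply hW hloc hab hu.apply_fst hu.apply_snd hw
  have hm := memLp_indicator_Ioc_of_continuousOn (a := a) (b := b)
    (hua.continuousOn_fst.mono Icc_subset_Ici_self)
  refine ⟨hm.toLp _, C (u a) + S (v a), C (v a) - S (u a), u, v, ?_, hm.coeFn_toLp.trans ?_,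
    hu.apply_fst, hu.apply_snd, fun x hx => hz x (le_of_lt hx)⟩
  · rwa [hT.cos_sub_sin, hT.sin_add_cos]
  · filter_upwards [ae_restrict_mem measurableSet_Ioi] with x hx
    by_cases hxb : x ≤ b
    · rw [indicator_of_mem (show x ∈ Ioc a b from ⟨hx, hxb⟩)]
    · rw [indicator_of_notMem fun h => hxb h.2, hz x (le_of_lt (not_le.1 hxb))]

/-- The restriction of the maximal operator to `p = 0` has no proper symmetric extension: a pair
`(h, g)` in the adjoint of its graph solves `τ h = g`, as testing with compactly supported
functions shows. -/
theorem boundaryGraph_maximal (hW : IsPotential (extPotential V a))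
    (hsa : ∀ᵐ x, IsSelfAdjoint (extPotential V a x)) (hT : IsTrigPair C S) {h g : HalfLineL2 H a}
    (hhg : ∀ x ∈ boundaryGraph hW C S, x.2.2.1 = 0 → ⟪h, x.2.1⟫_ℂ = ⟪g, x.1⟫_ℂ) :
    ∃ q, (h, g, 0, q) ∈ boundaryGraph hW C S := by
  obtain ⟨A, B, hAB⟩ := exists_clm_boundaryGraph (C := C) (S := S) hW
  set ζ := ContinuousLinearMap.adjoint B h - ContinuousLinearMap.adjoint A g with hζ
  -- the defect `⟪h, τ f⟫ - ⟪g, f⟫` depends on the boundary value `p` only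
  have h1 : ∀ f w p q, (f, w, p, q) ∈ boundaryGraph hW C S →
      ⟪h, w⟫_ℂ - ⟪g, f⟫_ℂ = ⟪ζ, p⟫_ℂ := by
    intro f w p q hf
    have h2 := hhg _ ((boundaryGraph hW C S).sub_mem hf (hAB p)) (sub_self p)
    simp only [Prod.mk_sub_mk, inner_sub_right] at h2
    rw [hζ, inner_sub_left, ContinuousLinearMap.adjoint_inner_left,
      ContinuousLinearMap.adjoint_inner_left]
    linear_combination h2
  have hg := locallyIntegrable_extLp g
  obtain ⟨u, v, hu⟩ := hW.exists_isSolution hg a (C 0 - S (-ζ)) (S 0 + C (-ζ))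
  have hua := hu.mono (subset_univ (Ici a)) self_mem_Ici ordConnected_Ici
  refine ⟨-ζ, mem_boundaryGraph.2 ⟨u, v, hua, ?_⟩⟩
  -- `u` solves `τ u = g` with the boundary values that the defect forces; it agrees with `h` on
  -- every `[a, b]`, as both have the same inner product with all `τ f`, `f` supported in `[a, b]`,
  -- and these exhaust `L²((a, b))`
  have key : ∀ b ∈ Ici a, ∀ᵐ x ∂(volume.restrict (Ioi a)), x ≤ b → h x = u x := by
    intro b hb
    have hm := memLp_indicator_Ioc_of_continuousOn (a := a) (b := b)
      (hua.continuousOn_fst.mono Icc_subset_Ici_self)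
    set U : HalfLineL2 H a := hm.toLp _ with hU
    have hUu : ∀ᵐ x, x ∈ Ioc a b → extLp U x = u x := by
      filter_upwards [extLp_eq_ae_of_restrict hm.coeFn_toLp] with x hx hxm
      rw [hx hxm.1, indicator_of_mem hxm]
    have hhu : ∀ w : HalfLineL2 H a, (∀ᵐ x, b < x → extLp w x = 0) →
        ⟪truncLp b h, w⟫_ℂ = ⟪U, w⟫_ℂ := by
      intro w hw
      obtain ⟨f, p, q, u', v', hs, hf, hub, hvb, hub'⟩ :=
        exists_mem_boundaryGraph_of_eq_zero hW hT hb w hw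
      have h2 := h1 f w p q (mem_boundaryGraph.2 ⟨u', v', hs, hf⟩)
      have h3 := hua.integral_lagrange hW hsa hg (locallyIntegrable_extLp w) hs self_mem_Ici hb
      rw [hub, hvb, hua.apply_fst, hua.apply_snd, hs.apply_fst, hs.apply_snd, hT.wronskian,
        inner_zero_right, inner_zero_right, inner_zero_left, inner_neg_left] at h3
      have hfz : ∀ᵐ x, b < x → extLp f x = 0 := by
        filter_upwards [extLp_eq_ae_of_restrict hf] with x hx hxb
        rw [hx (lt_of_le_of_lt hb hxb), hub' x hxb]
      have h4 : ⟪U, w⟫_ℂ - ⟪g, f⟫_ℂ = ⟪ζ, p⟫_ℂ := by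
        have e : ∫ t in a..b, (⟪u t, extLp w t⟫_ℂ - ⟪extLp g t, u' t⟫_ℂ) =
            ∫ t in a..b, (⟪extLp U t, extLp w t⟫_ℂ - ⟪extLp g t, extLp f t⟫_ℂ) := by
          refine intervalIntegral.integral_congr_ae ?_
          filter_upwards [hUu, extLp_eq_ae_of_restrict hf] with x hx hx' hxm
          rw [uIoc_of_le hb] at hxm
          rw [hx hxm, hx' hxm.1]
        have i1 : ∀ f g : HalfLineL2 H a, IntervalIntegrable (fun x => ⟪extLp f x, extLp g x⟫_ℂ)
            volume a b := fun f g => by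
          rw [intervalIntegrable_iff_integrableOn_Ioc_of_le hb]
          exact (integrableOn_inner_extLp f g).mono_set Ioc_subset_Ioi_self
        rw [e, intervalIntegral.integral_sub (i1 U w) (i1 g f), ← inner_eq_intervalIntegral U w hb hw,
          ← inner_eq_intervalIntegral g f hb hfz] at h3
        rw [h3.2]
        ring
      have h5 : ⟪truncLp b h, w⟫_ℂ = ⟪h, w⟫_ℂ := by
        rw [inner_eq_intervalIntegral _ w hb hw, inner_eq_intervalIntegral _ w hb hw]
        refine intervalIntegral.integral_congr_ae ?_
        filter_upwards [extLp_eq_ae_of_restrict (truncLp_ae b h)] with x hx hxm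
        rw [uIoc_of_le hb] at hxm
        rw [hx hxm.1, indicator_of_mem hxm, extLp_of_mem h hxm.1]
      rw [h5]
      linear_combination h2 - h4
    have hz : truncLp b h - U = 0 := by
      rw [← inner_self_eq_zero (𝕜 := ℂ), inner_sub_left, hhu, sub_self]
      filter_upwards [extLp_eq_ae_of_restrict ((Lp.coeFn_sub (truncLp b h) U).trans
        ((truncLp_ae b h).sub hm.coeFn_toLp))] with x hx hbx
      rw [hx (lt_of_le_of_lt hb hbx), Pi.sub_apply, indicator_of_notMem fun h => not_lt.2 h.2 hbx,
        indicator_of_notMem fun h => not_lt.2 h.2 hbx, sub_self]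
    have hae : (Ioc a b).indicator h =ᵐ[volume.restrict (Ioi a)] (Ioc a b).indicator u := by
      refine (truncLp_ae b h).symm.trans ?_
      rw [sub_eq_zero.1 hz]
      exact hm.coeFn_toLp
    filter_upwards [hae, ae_restrict_mem measurableSet_Ioi] with x hx hxa hxb
    have hxm : x ∈ Ioc a b := ⟨hxa, hxb⟩
    rwa [indicator_of_mem hxm, indicator_of_mem hxm] at hx
  have hall : ∀ᵐ x ∂(volume.restrict (Ioi a)), ∀ n : ℕ, x ≤ a + n → h x = u x :=
    ae_all_iff.2 fun n => key (a + n) (by simp)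
  filter_upwards [hall] with x hx
  obtain ⟨n, hn⟩ := exists_nat_ge (x - a)
  exact hx n (by linarith)

/-- The maximal operator, with the rotated boundary values `p` and `q`, is a boundary triple. -/
theorem isBoundaryTriple_boundaryGraph (hW : IsPotential (extPotential V a))
    (hsa : ∀ᵐ x, IsSelfAdjoint (extPotential V a x)) (hlp : IsLimitPointAtTop V a)
    (hT : IsTrigPair C S) : IsBoundaryTriple (boundaryGraph hW C S) where
  green _ hx _ hy := boundaryGraph_green hW hsa hlp hT hx hy
  maximal _ _ h := boundaryGraph_maximal hW hsa hT h
  surj p := by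
    obtain ⟨A, B, hAB⟩ := exists_clm_boundaryGraph (C := C) (S := S) hW
    exact ⟨A p, B p, 0, hAB p⟩
  single _ _ _ h := boundaryGraph_single hW hT h

end BoundaryTriple

/-! ### The Weyl–Titchmarsh operator and the transform -/

section Eigenvalue

variable {H : Type u} [NormedAddCommGroup H] [InnerProductSpace ℂ H] {V : ℝ → H →L[ℂ] H} {a : ℝ}
  {C S : H →L[ℂ] H}

/-- Square integrable solutions of `τ u = z u` with given boundary values. -/
theorem mem_boundaryGraph_smul_iff {hW : IsPotential (extPotential V a)} {f : HalfLineL2 H a}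
    {z : ℂ} {p q : H} : (f, z • f, p, q) ∈ boundaryGraph hW C S ↔
      ∃ u v, IsSolution (fun x => extPotential V a x - z • (1 : H →L[ℂ] H)) 0 a (C p - S q)
        (S p + C q) (Ici a) u v ∧ f =ᵐ[volume.restrict (Ioi a)] u := by
  rw [mem_boundaryGraph]
  refine exists_congr fun u => exists_congr fun v => and_congr_left fun hu => ?_
  rw [isSolution_sub_const_iff]
  have hae : ∀ᵐ x : ℝ, x ≠ a := by simp [ae_iff, measure_singleton]
  have hf : ∀ᵐ x, x ∈ Ici a → extLp (z • f) x = ((0 : ℝ → H) + z • u) x := by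
    filter_upwards [extLp_eq_ae_of_restrict ((Lp.coeFn_smul z f).trans (hu.const_smul z)), hae]
      with x hx hxa hxm
    rw [hx (lt_of_le_of_ne hxm hxa.symm), zero_add]
  constructor
  · intro h
    refine h.congr (fun _ _ => rfl) ?_
    filter_upwards [hf] with x hx hxm using (hx hxm).symm
  · exact fun h => h.congr (fun _ _ => rfl) hf

end Eigenvalue

section WeylFunction

variable {H : Type u} [NormedAddCommGroup H] [InnerProductSpace ℂ H] [CompleteSpace H]
  {V : ℝ → H →L[ℂ] H} {a : ℝ} {α : H →L[ℂ] H}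

/-- The restriction to `p = 0` is `H_{+,α}`, the boundary condition being `sin α u'(a) + cos α u(a)
= 0`. -/
theorem kerGraph_boundaryGraph (hW : IsPotential (extPotential V a)) (hα : IsSelfAdjoint α) :
    kerGraph (boundaryGraph hW (opCos α) (opSin α)) = halfLineGraph V a α := by
  have hT := isTrigPair_opCos_opSin hα
  ext ⟨f, g⟩
  rw [mem_kerGraph]
  constructor
  · rintro ⟨q, hq⟩
    obtain ⟨u, v, hs, hu⟩ := mem_boundaryGraph.1 hq
    refine ⟨u, v, _, _, _, hs.isW21Loc hW (locallyIntegrable_extLp g), hu, ?_, hs.tendsto_fst,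
      hs.tendsto_snd, ?_⟩
    · filter_upwards [extLp_ae g] with x hx
      rw [tau_sub, hx]
    · rw [map_zero, map_zero, zero_sub, zero_add, map_neg, hT.comm, add_neg_cancel]
  · rintro ⟨u, u', u'', u₀, u₁, h1, h2, h3, h4, h5, h6⟩
    obtain ⟨U, v, hU, hUu, -⟩ := h1.exists_isSolution hW (locallyIntegrable_extLp g) (by
      filter_upwards [h3, ae_restrict_mem measurableSet_Ioi] with x hx hxa
      rw [extLp_of_mem g hxa, hx, tau, tau, extPotential_of_mem hxa]) h4 h5
    have h6' : opCos α u₀ + opSin α u₁ = 0 := by rw [add_comm, h6]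
    refine ⟨opCos α u₁ - opSin α u₀, mem_boundaryGraph.2 ⟨U, v, ?_, ?_⟩⟩
    · rw [← h6', hT.cos_sub_sin, hT.sin_add_cos]
      exact hU
    · filter_upwards [h2, ae_restrict_mem measurableSet_Ioi] with x hx hxa
      rw [hx, hUu x hxa]

variable [TopologicalSpace.SeparableSpace H]

/-- The solution `θ_α(z, ·, a) f + φ_α(z, ·, a) g`. -/
theorem exists_isSolution_thetaSol_add_phiSol (hW : IsPotential (extPotential V a)) (z : ℂ)
    (f g : H) : ∃ v, IsSolution (fun x => extPotential V a x - z • (1 : H →L[ℂ] H)) 0 a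
      (opCos α f - opSin α g) (opSin α f + opCos α g) (Ici a)
      (fun x => thetaSol V a α z x f + phiSol V a α z x g) v := by
  obtain ⟨v, hv⟩ := (isOperatorSolution_operatorSolution hW z (opCos α) (opSin α)).exists_isSolution
    hW f
  obtain ⟨v', hv'⟩ := (isOperatorSolution_operatorSolution hW z (-opSin α)
    (opCos α)).exists_isSolution hW g
  have h := hv.add_smul hv' (hW.sub_const z) locallyIntegrable_zero locallyIntegrable_zero 1
  rw [one_smul, one_smul, one_smul, one_smul, one_smul, add_zero, neg_apply,
    ← sub_eq_add_neg] at h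
  exact ⟨_, h⟩

/-- The Weyl function of the boundary triple is the Weyl–Titchmarsh operator: `θ f + φ g` is the
solution of `τ u = z u` with rotated boundary values `(f, g)`, so it is square integrable if and
only if `g = M f`. -/
theorem isWeylValue_of_mem_boundaryGraph {hW : IsPotential (extPotential V a)}
    (h𝒢 : IsBoundaryTriple (boundaryGraph hW (opCos α) (opSin α))) {z : ℂ} (hz : z.im ≠ 0)
    {Γ : H →L[ℂ] HalfLineL2 H a} {M : H →L[ℂ] H}
    (h : ∀ p, (Γ p, z • Γ p, p, M p) ∈ boundaryGraph hW (opCos α) (opSin α)) :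
    IsWeylValue V a α z M := by
  intro f g
  obtain ⟨v, hv⟩ := exists_isSolution_thetaSol_add_phiSol (α := α) hW z f g
  constructor
  · intro hm
    exact (h𝒢.solution_unique hz (h f)
      (mem_boundaryGraph_smul_iff.2 ⟨_, v, hv, hm.coeFn_toLp⟩)).2
  · rintro rfl
    obtain ⟨u, v', hs, hu⟩ := mem_boundaryGraph_smul_iff.1 (h f)
    refine (Lp.memLp (Γ f)).ae_eq ?_
    filter_upwards [hu, ae_restrict_mem measurableSet_Ioi] with x hx hxa
    rw [hx, (hs.unique hv (hW.sub_const z) locallyIntegrable_zero (mem_Ici_of_Ioi hxa)).1]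

theorem isWeylValue_weylM {hW : IsPotential (extPotential V a)}
    (h𝒢 : IsBoundaryTriple (boundaryGraph hW (opCos α) (opSin α))) {z : ℂ} (hz : z.im ≠ 0) :
    IsWeylValue V a α z (weylM V a α z) := by
  obtain ⟨Γ, M, hΓ⟩ := h𝒢.exists_weyl hz
  have h : ∃ M, IsWeylValue V a α z M := ⟨M, isWeylValue_of_mem_boundaryGraph h𝒢 hz hΓ⟩
  rw [weylM, dif_pos h]
  exact h.choose_spec

theorem mem_boundaryGraph_weylM {hW : IsPotential (extPotential V a)}
    (h𝒢 : IsBoundaryTriple (boundaryGraph hW (opCos α) (opSin α))) {z : ℂ} (hz : z.im ≠ 0)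
    (p : H) : ∃ u, (u, z • u, p, weylM V a α z p) ∈ boundaryGraph hW (opCos α) (opSin α) := by
  obtain ⟨Γ, M, hΓ⟩ := h𝒢.exists_weyl hz
  have h1 := (isWeylValue_of_mem_boundaryGraph h𝒢 hz hΓ p (M p)).2 rfl
  rw [(isWeylValue_weylM h𝒢 hz p (M p)).1 h1]
  exact ⟨Γ p, hΓ p⟩

/-- The measure in the Nevanlinna representation of `m_{+,α}` is the one built from the spectral
measure `E` of `H_{+,α}`. -/
theorem spectralRho_eq_gammaMeasure {hW : IsPotential (extPotential V a)}
    (h𝒢 : IsBoundaryTriple (boundaryGraph hW (opCos α) (opSin α)))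
    {E : ProjectionMeasure (HalfLineL2 H a)} {Γ : H →L[ℂ] HalfLineL2 H a}
    (hE : kerGraph (boundaryGraph hW (opCos α) (opSin α)) = E.idOp.graph)
    (hΓ : ∀ p, ∃ q, (Γ p, Complex.I • Γ p, p, q) ∈ boundaryGraph hW (opCos α) (opSin α)) :
    IsNevanlinnaMeasure (weylM V a α) (spectralRho V a α) ∧
      spectralRho V a α = gammaMeasure E Γ := by
  have h1 : IsNevanlinnaMeasure (weylM V a α) (gammaMeasure E Γ) :=
    h𝒢.isNevanlinnaMeasure hE hΓ _ fun z hz => mem_boundaryGraph_weylM h𝒢 hz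
  have h2 : ∃ ρ, IsNevanlinnaMeasure (weylM V a α) ρ := ⟨_, h1⟩
  have h3 : IsNevanlinnaMeasure (weylM V a α) (spectralRho V a α) := by
    rw [spectralRho, dif_pos h2]
    exact h2.choose_spec
  exact ⟨h3, h3.unique h1⟩

end WeylFunction

section LocalNorm

variable {H : Type u} [NormedAddCommGroup H] {a : ℝ}

/-- Cauchy–Schwarz: on bounded intervals the `L¹` norm is bounded by a multiple of the `L²` norm.
-/
theorem integral_norm_extLp_le (f : HalfLineL2 H a) (b : ℝ) :
    ∫ x in Ioc a b, ‖extLp f x‖ ≤ (ENNReal.ofReal (b - a) ^ (1 / 2 : ℝ)).toReal * ‖f‖ := by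
  have hm := (memLp_extLp f).aestronglyMeasurable.restrict (s := Ioc a b)
  have h1 := eLpNorm_le_eLpNorm_mul_rpow_measure_univ (p := 1) (q := 2) (by norm_num) hm
  have h2 : eLpNorm (extLp f) 2 (volume.restrict (Ioc a b)) ≤
      eLpNorm f 2 (volume.restrict (Ioi a)) := by
    rw [← eLpNorm_congr_ae (extLp_ae f)]
    exact eLpNorm_mono_measure _ (Measure.restrict_mono Ioc_subset_Ioi_self le_rfl)
  have h3 : eLpNorm (extLp f) 1 (volume.restrict (Ioc a b)) ≤
      ENNReal.ofReal (b - a) ^ (1 / 2 : ℝ) * eLpNorm f 2 (volume.restrict (Ioi a)) := by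
    refine h1.trans ?_
    rw [mul_comm, Measure.restrict_apply_univ, Real.volume_Ioc]
    have : (1 / (1 : ℝ≥0∞).toReal - 1 / (2 : ℝ≥0∞).toReal) = (1 / 2 : ℝ) := by norm_num
    rw [this]
    gcongr
  rw [integral_norm_eq_lintegral_enorm hm, ← eLpNorm_one_eq_lintegral_enorm, Lp.norm_def,
    ← ENNReal.toReal_mul]
  exact ENNReal.toReal_mono (ENNReal.mul_ne_top
    (ENNReal.rpow_ne_top_of_nonneg (by norm_num) ENNReal.ofReal_ne_top) (Lp.eLpNorm_ne_top f)) h3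

end LocalNorm

section Transform

variable {H : Type u} [NormedAddCommGroup H] [InnerProductSpace ℂ H] [CompleteSpace H]
  [TopologicalSpace.SeparableSpace H] {V : ℝ → H →L[ℂ] H} {a : ℝ} {α : H →L[ℂ] H}

theorem exists_isSolution_phiSol (hW : IsPotential (extPotential V a)) (z : ℂ) (ξ : H) :
    ∃ v, IsSolution (fun x => extPotential V a x - z • (1 : H →L[ℂ] H)) 0 a
      (-opSin α ξ) (opCos α ξ) (Ici a) (fun x => phiSol V a α z x ξ) v :=
  (isOperatorSolution_operatorSolution hW z (-opSin α) (opCos α)).exists_isSolution hW ξ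

theorem continuousOn_phiSol (hW : IsPotential (extPotential V a)) (z : ℂ) (ξ : H) :
    ContinuousOn (fun x => phiSol V a α z x ξ) (Ici a) := by
  obtain ⟨v, hv⟩ := exists_isSolution_phiSol (α := α) hW z ξ
  exact hv.continuousOn_fst

/-- The integrand `φ_α(z, x, a)* h(x)` of the truncated transform is integrable over `(a, b]`. -/
theorem integrableOn_adjoint_phiSol (hW : IsPotential (extPotential V a)) (z : ℂ) (b : ℝ)
    {h : ℝ → H} (hh : IntegrableOn h (Ioc a b)) :
    IntegrableOn (fun x => ContinuousLinearMap.adjoint (phiSol V a α z x) (h x)) (Ioc a b) := by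
  have hc := fun ξ => (continuousOn_phiSol (α := α) hW z ξ).mono
    (Icc_subset_Ici_self : Icc a b ⊆ Ici a)
  -- the operators are uniformly bounded on `[a, b]` by the Banach-Steinhaus theorem
  obtain ⟨K, hK⟩ := banach_steinhaus (g := fun x : Icc a b => phiSol V a α z x) (by
    intro ξ
    obtain ⟨K, hK⟩ := isCompact_Icc.exists_bound_of_continuousOn (hc ξ)
    exact ⟨K, fun x => hK x x.2⟩)
  refine (hh.norm.const_mul K).mono' ?_ ?_
  · refine aestronglyMeasurable_of_inner fun ξ => ?_
    simp only [ContinuousLinearMap.adjoint_inner_right]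
    exact (((hc ξ).mono Ioc_subset_Icc_self).aestronglyMeasurable measurableSet_Ioc).inner
      hh.aestronglyMeasurable
  · filter_upwards [ae_restrict_mem measurableSet_Ioc] with x hx
    refine (ContinuousLinearMap.le_opNorm _ _).trans ?_
    rw [LinearIsometryEquiv.norm_map]
    exact mul_le_mul_of_nonneg_right (hK ⟨x, Ioc_subset_Icc_self hx⟩) (norm_nonneg _)

/-- The key estimate: for `y` in the domain, `y - φ_α(λ, ·, a) ξ` has zero data at `a` and solves
`τ d - λ d = τ y - λ y`, so it is small on `[a, b]`, uniformly for `λ` in bounded sets. -/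
theorem isTransform_truncTransform (hW : IsPotential (extPotential V a)) (h : HalfLineL2 H a)
    {b : ℝ} (hab : a < b) : IsTransform (boundaryGraph hW (opCos α) (opSin α)) (truncLp b h)
      (truncTransform V a α b h) := by
  intro l r
  set R := max |l| |r| with hR
  set k : ℝ → ℝ := fun t => 1 + ‖extPotential V a t‖ + R with hk
  have hR0 : 0 ≤ R := (abs_nonneg l).trans (le_max_left _ _)
  have hki : IntervalIntegrable k volume a b :=
    (intervalIntegrable_const.add (hW.integrable.intervalIntegrable' a b)).add
      intervalIntegrable_const
  have hk0 : ∀ t, 0 ≤ k t := fun t => by positivity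
  set L := (ENNReal.ofReal (b - a) ^ (1 / 2 : ℝ)).toReal with hL
  have hL0 : 0 ≤ L := ENNReal.toReal_nonneg
  set D := 2 * Real.exp (2 * |∫ t in a..b, k t|) * L with hD
  have hD0 : 0 ≤ D := by positivity
  refine ⟨D * ∫ x in Ioc a b, ‖h x‖, by positivity, fun t ht y w ξ hy => ?_⟩
  obtain ⟨u, v, hs, hu⟩ := mem_boundaryGraph.1 hy
  obtain ⟨v', hφ⟩ := exists_isSolution_phiSol (α := α) hW (t : ℂ) ξ
  have hae : ∀ᵐ x : ℝ, x ≠ a := by simp [ae_iff, measure_singleton]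
  have hWt := hW.sub_const (t : ℂ)
  have hf := locallyIntegrable_extLp (w - (t : ℂ) • y)
  have hs' := (isSolution_sub_const_iff (t : ℂ)).2 (hs.congr (f' := extLp (w - (t : ℂ) • y) +
    (t : ℂ) • u) (fun _ _ => rfl) (by
      filter_upwards [extLp_eq_ae_of_restrict ((Lp.coeFn_sub w ((t : ℂ) • y)).trans
        ((extLp_ae w).symm.sub ((Lp.coeFn_smul (t : ℂ) y).trans (hu.const_smul (t : ℂ))))), hae]
        with x hx hxa hxm
      rw [Pi.add_apply, hx (lt_of_le_of_ne hxm hxa.symm), Pi.sub_apply, sub_add_cancel]))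
  -- `u - φ ξ` has zero data at `a` and inhomogeneity `w - t y`; Gronwall's inequality bounds it
  have hd := hs'.add_smul hφ hWt hf locallyIntegrable_zero (-1)
  have hd' : ∀ x ∈ Ioc a b, ‖u x - phiSol V a α t x ξ‖ ≤ D * ‖w - (t : ℂ) • y‖ := by
    intro x hx
    have hxm : x ∈ uIcc a b := by
      rw [uIcc_of_le hab.le]
      exact Ioc_subset_Icc_self hx
    have h1 := hd.norm_le hWt (hf.add (locallyIntegrable_zero.smul (-1))) (mem_Ici.2 hab.le) hki
      (fun s => by
        have e1 := norm_sub_le (extPotential V a s) ((t : ℂ) • (1 : H →L[ℂ] H))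
        have e2 : ‖(t : ℂ) • (1 : H →L[ℂ] H)‖ ≤ R := by
          rw [norm_smul, Complex.norm_real, Real.norm_eq_abs]
          have e3 : ‖(1 : H →L[ℂ] H)‖ ≤ 1 := ContinuousLinearMap.norm_id_le
          have e4 : |t| ≤ R := abs_le_max_abs_abs ht.1 ht.2
          nlinarith [abs_nonneg t, norm_nonneg (1 : H →L[ℂ] H)]
        change _ ≤ 1 + ‖extPotential V a s‖ + R
        linarith) hxm
    have h2 : ∀ s, (extLp (w - (t : ℂ) • y) + (-1 : ℂ) • (0 : ℝ → H)) s =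
        extLp (w - (t : ℂ) • y) s := fun s => by simp
    simp only [h2, Pi.add_apply, Pi.smul_apply] at h1
    have h3 : |∫ s in a..b, ‖extLp (w - (t : ℂ) • y) s‖| ≤ L * ‖w - (t : ℂ) • y‖ := by
      rw [intervalIntegral.integral_of_le hab.le, abs_of_nonneg (by positivity)]
      exact integral_norm_extLp_le _ _
    have h4 : |∫ s in a..x, k s| ≤ |∫ s in a..b, k s| :=
      intervalIntegral.abs_integral_mono_interval
        (uIoc_subset_uIoc_of_uIcc_subset_uIcc (uIcc_subset_uIcc left_mem_uIcc hxm))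
        (Eventually.of_forall hk0) hki
    have h5 : ‖opCos α 0 - opSin α ξ + (-1 : ℂ) • -opSin α ξ‖ = 0 := by simp
    have h6 : ‖opSin α 0 + opCos α ξ + (-1 : ℂ) • opCos α ξ‖ = 0 := by simp
    rw [h5, h6, zero_add, zero_add, neg_smul, one_smul, ← sub_eq_add_neg] at h1
    refine (le_add_of_nonneg_right (norm_nonneg _)).trans (h1.trans ?_)
    calc 2 * |∫ s in a..b, ‖extLp (w - (t : ℂ) • y) s‖| * Real.exp (2 * |∫ s in a..x, k s|)
        ≤ 2 * (L * ‖w - (t : ℂ) • y‖) * Real.exp (2 * |∫ s in a..b, k s|) := by gcongr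
      _ = D * ‖w - (t : ℂ) • y‖ := by rw [hD]; ring
  have hh : IntegrableOn h (Ioc a b) := by
    refine ((locallyIntegrable_extLp h).intervalIntegrable' a b).1.congr_fun (fun x hx => ?_)
      measurableSet_Ioc
    exact extLp_of_mem h hx.1
  have hφi := integrableOn_adjoint_phiSol (α := α) hW (t : ℂ) b hh
  have e1 : ⟪ξ, truncTransform V a α b h t⟫_ℂ =
      ∫ x in Ioc a b, ⟪phiSol V a α t x ξ, h x⟫_ℂ := by
    rw [truncTransform, ← integral_inner hφi]
    simp only [ContinuousLinearMap.adjoint_inner_right]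
  have i1 : IntegrableOn (fun x => ⟪phiSol V a α t x ξ, h x⟫_ℂ) (Ioc a b) := by
    have := hφi.const_inner (𝕜 := ℂ) ξ
    rw [IntegrableOn]
    simpa only [ContinuousLinearMap.adjoint_inner_right] using this
  have hcongr : ∀ᵐ x, x ∈ Ioc a b → ⟪extLp y x, extLp (truncLp b h) x⟫_ℂ = ⟪u x, h x⟫_ℂ := by
    filter_upwards [extLp_eq_ae_of_restrict hu, extLp_eq_ae_of_restrict (truncLp_ae b h)]
      with x hx hx' hxm
    rw [hx hxm.1, hx' hxm.1, indicator_of_mem hxm]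
  have e2 : ⟪y, truncLp b h⟫_ℂ = ∫ x in Ioc a b, ⟪u x, h x⟫_ℂ := by
    rw [inner_eq_intervalIntegral _ _ hab.le (extLp_truncLp_eq_zero b h),
      intervalIntegral.integral_of_le hab.le]
    exact setIntegral_congr_ae measurableSet_Ioc hcongr
  have i2 : IntegrableOn (fun x => ⟪u x, h x⟫_ℂ) (Ioc a b) := by
    refine ((integrableOn_inner_extLp y (truncLp b h)).mono_set Ioc_subset_Ioi_self).congr ?_
    exact (ae_restrict_iff' measurableSet_Ioc).2 hcongr
  rw [e1, e2, ← integral_sub i2 i1, mul_right_comm, ← integral_const_mul]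
  refine norm_integral_le_of_norm_le (hh.norm.const_mul _) ?_
  filter_upwards [ae_restrict_mem measurableSet_Ioc] with x hx
  rw [← inner_sub_left]
  exact (norm_inner_le_norm _ _).trans
    (mul_le_mul_of_nonneg_right (hd' x hx) (norm_nonneg _))

/-- All functions that vanish near `∞` have a transform, and they are dense. -/
theorem dense_setOf_isTransform (hW : IsPotential (extPotential V a)) :
    Dense {h : HalfLineL2 H a |
      ∃ v, IsTransform (boundaryGraph hW (opCos α) (opSin α)) h v} := by
  intro h
  refine mem_closure_of_tendsto (tendsto_truncLp h) ?_
  filter_upwards [eventually_gt_atTop a] with b hb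
  exact ⟨_, isTransform_truncTransform hW h hb⟩

end Transform

end

/-! ### The spectral representation -/

theorem theoremt2p6 {H : Type u} [NormedAddCommGroup H] [InnerProductSpace ℂ H] [CompleteSpace H]
    [TopologicalSpace.SeparableSpace H] (a : ℝ) (V : ℝ → H →L[ℂ] H)
    (hV_meas : ∀ f g : H, AEStronglyMeasurable (fun x => ⟪f, V x g⟫_ℂ) (volume.restrict (Ioi a)))
    (hV_int : LocallyIntegrableOn (fun x => ‖V x‖) (Ici a))
    (hV_sa : ∀ᵐ x ∂(volume.restrict (Ioi a)), IsSelfAdjoint (V x))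
    (hV_lp : IsLimitPointAtTop V a)
    (α : H →L[ℂ] H) (hα : IsSelfAdjoint α) :
    -- existence of the solutions, of `m_{+,α}`, `dρ_{+,α}`, `F(H_{+,α})` and of a control measure
    (∀ z : ℂ, IsOperatorSolution V a z (opCos α) (opSin α) (thetaSol V a α z)) ∧
    (∀ z : ℂ, IsOperatorSolution V a z (-opSin α) (opCos α) (phiSol V a α z)) ∧
    (∀ z : ℂ, z.im ≠ 0 → IsWeylValue V a α z (weylM V a α z)) ∧
    IsNevanlinnaMeasure (weylM V a α) (spectralRho V a α) ∧
    IsSelfAdjoint (halfLineOperator V a α) ∧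
    (∀ F : ℝ → ℂ, Continuous F →
      IsFunctionOf (halfLineOperator V a α) F (functionOf (halfLineOperator V a α) F)) ∧
    (∃ ν : Measure ℝ, (spectralRho V a α).IsControlMeasure ν) ∧
    -- the generalized Fourier transform is unitary and diagonalizes all `F(H_{+,α})`
    (∃ U : HalfLineL2 H a ≃ₗᵢ[ℂ] (spectralRho V a α).L2,
      (∀ h : HalfLineL2 H a, ∃ k : ℝ → (spectralRho V a α).L2,
        (∀ b, a < b → (spectralRho V a α).IsClassOf (truncTransform V a α b h) (k b)) ∧
        Tendsto k atTop (𝓝 (U h))) ∧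
      ∀ F : ℝ → ℂ, Continuous F → ∀ k g : (spectralRho V a α).L2,
        (U.symm k, U.symm g) ∈ (functionOf (halfLineOperator V a α) F).graph ↔
          (k, g) ∈ ((spectralRho V a α).mulOperator F).graph) ∧
    -- spectra
    (∀ F : ℝ → ℂ, Continuous F → ∀ ν : Measure ℝ, (spectralRho V a α).IsControlMeasure ν →
      operatorSpectrum (functionOf (halfLineOperator V a α) F) = essentialRange ν F) ∧
    operatorSpectrum (halfLineOperator V a α) =
      (fun l : ℝ => (l : ℂ)) '' (spectralRho V a α).support ∧
    -- multiplicity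
    spectralMultiplicity (halfLineOperator V a α) ≤ Cardinal.toENat (Module.rank ℂ H) := by
  have hW := isPotential_extPotential hV_meas hV_int
  have h𝒢 := isBoundaryTriple_boundaryGraph hW (isSelfAdjoint_extPotential hV_sa) hV_lp
    (isTrigPair_opCos_opSin hα)
  obtain ⟨E, hE⟩ := h𝒢.isSelfAdjointGraph.exists_projectionMeasure
  obtain ⟨Γ, M, hΓ⟩ := h𝒢.exists_weyl (z := Complex.I) (by simp)
  have hΓ' : ∀ p, ∃ q, (Γ p, Complex.I • Γ p, p, q) ∈ boundaryGraph hW (opCos α) (opSin α) :=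
    fun p => ⟨_, hΓ p⟩
  have hgraph := kerGraph_boundaryGraph hW hα
  -- `halfLineOperator` is defined by its graph, which is single-valued
  have hop : halfLineOperator V a α = E.idOp := by
    refine LinearPMap.eq_of_eq_graph ?_
    rw [halfLineOperator, Submodule.toLinearPMap_graph_eq, ← hgraph, hE]
    rw [← hgraph]
    exact fun x hx hx0 => h𝒢.isSelfAdjointGraph.single _ (by rwa [← hx0])
  obtain ⟨hN, hρ⟩ := spectralRho_eq_gammaMeasure h𝒢 hE hΓ'
  refine ⟨fun z => isOperatorSolution_operatorSolution hW z _ _,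
    fun z => isOperatorSolution_operatorSolution hW z _ _,
    fun z hz => isWeylValue_weylM h𝒢 hz, hN, ?_⟩
  -- all remaining assertions concern `∫ λ dE(λ)` and the measure `G(B)* G(B)`
  rw [hρ, hop]
  obtain ⟨U, hU1, hU2, hU3⟩ := exists_gammaUnitary h𝒢 hE hΓ' (dense_setOf_isTransform hW)
  refine ⟨?_, fun F hF => ?_, exists_isControlMeasure, ⟨U, fun h => ?_, fun F hF k g => ?_⟩,
    fun F hF ν hν => ?_, operatorSpectrum_idOp U hU1, spectralMultiplicity_idOp_le U hU1⟩
  · refine IsSelfAdjointGraph.isSelfAdjoint ?_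
    rw [← hE]
    exact h𝒢.isSelfAdjointGraph
  · rw [functionOf_idOp E hF.measurable, isFunctionOf_idOp_iff E hF.measurable]
  -- the transform of the truncation of `h` to `(a, b]` is the integral over `(a, b]`
  · refine ⟨fun b => U (truncLp b h), fun b hb => hU3 _ _ (isTransform_truncTransform hW h hb), ?_⟩
    exact (U.continuous.tendsto h).comp (tendsto_truncLp h)
  · rw [functionOf_idOp E hF.measurable]
    exact mem_op_graph_iff_mem_mulOperator U hU2 hF k g
  · rw [functionOf_idOp E hF.measurable]
    exact operatorSpectrum_op_eq_essentialRange hν U hU1 hF.measurable
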